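/- Let $X$ be a smooth variety over $\mathbb C$ (an integral scheme of finite type, smooth of dimension $n$), let $F\to X$ be a line bundle with sheaf of sections $\mathscr F$, let $k\in\mathbb Z$, and let $\pi\colon L:=F^{\otimes k}\to X$, with dual bundle $\pi^\vee\colon L^\vee=F^{\otimes(-k)}\to X$. Let $j_L\colon L^*\hookrightarrow L$ and $j_{L^\vee}\colon L^{\vee,*}\hookrightarrow L^\vee$ be the complements of the zero sections. Let $\beta\in\mathbb C$ with $k\beta\in\mathbb Z$. Choose an open cover $X=\bigcup_i U_i$ and non-vanishing sections $s_i\in\Gamma(U_i,\mathscr F)$, and put $\alpha_{ij}:=s_i/s_j$. The quasi-coherent left $\mathscr D_{L^*}$-module $\mathcal O_{L^*}^\beta$ is obtained by gluing: via the trivialization $\mathbb C^*\times U_i\cong \pi^{-1}(U_i)\cap L^*$, $(\lambda,p)\mapsto\lambda s_i^k(p)$, it is $\mathscr D_{\mathbb C^*}/\mathscr D_{\mathbb C^*}(\partial_t t+\beta)\boxtimes\mathcal O_{U_i}$ with generator $u_i$ (the class of $1\boxtimes 1$), and over $U_i\cap U_j$ the generators are identified by $u_i=\alpha_{ij}^{m}u_j$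 with $m:=k(\beta+1)\in\mathbb Z$. The module $\mathcal O_{L^{\vee,*}}^{-\beta}$ on $L^{\vee,*}$ is defined in the same way from the same $s_i$, with $(k,\beta)$ replaced by $(-k,-\beta)$. These modules exist. For a $\mathscr D_L$-module $\mathscr M$ let $\mathrm{FL}_X^L(\mathscr M):=p_{2,+}\big(p_1^+\mathscr M\otimes^{\mathbb L}_{\mathcal O}\mathscr K\big)$ be its Fourier–Laplace transform, where $p_1,p_2$ are the projections of $L\times_XL^\vee$ to $L$ and $L^\vee$ and $\mathscr K$ is the inverse image of $\mathscr D_{\mathbb C}/\mathscr D_{\mathbb C}(\partial_t+1)$ under the natural pairing $L\times_XL^\vee\to\mathbb C$. Let $j_{L^\vee,\dagger}:=\mathbb D\circ j_{L^\vee,+}\circ\mathbb D$, where $\mathbb D\mathscr M=\omega^\vee\otimes_{\mathcal O}R\mathcal Hom_{\mathscr D}(\mathscr M,\mathscr D)[n+1]$ is the holonomic duality functor on $L^\vee$ and on $L^{\vee,*}$. Then $$\mathrm{FL}_X^{L}\big(j_{L,+}\mathcal O_{L^*}^{\beta}\big)\;\cong\; j_{L^\vee,\dagger}\,\mathcal O_{L^{\vee,*}}^{-\beta},$$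 and both sides are $\mathscr D_{L^\vee}$-modules, that is, complexes with cohomology in degree $0$ only. -/

import Mathlib

open CategoryTheory AlgebraicGeometry TopologicalSpace
open scoped Polynomial LaurentPolynomial

noncomputable section

/-! ## Differential operators and `𝒟`-modules on an affine chart -/

/-- The vector fields on `Spec A`: the `ℂ`-linear derivations of `A`. -/
abbrev VF (A : Type) [CommRing A] [Algebra ℂ A] : Type := Derivation ℂ A A

/-- The ring of differential operators on a smooth affine variety `Spec A`: the subalgebra of
`End_ℂ(A)` generated by the functions (acting by multiplication) and the vector fields. -/
def diffOpSubalgebra (A : Type) [CommRing A] [Algebra ℂ A] : Subalgebra ℂ (Module.End ℂ A) :=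
  Algebra.adjoin ℂ
    (Set.range (fun a : A => LinearMap.mulLeft ℂ a) ∪
      Set.range (fun θ : VF A => (θ : A →ₗ[ℂ] A)))

/-- The ring of differential operators, as a type. -/
def DiffOp (A : Type) [CommRing A] [Algebra ℂ A] : Type := diffOpSubalgebra A

instance (A : Type) [CommRing A] [Algebra ℂ A] : Ring (DiffOp A) :=
  inferInstanceAs (Ring (diffOpSubalgebra A))
instance (A : Type) [CommRing A] [Algebra ℂ A] : Algebra ℂ (DiffOp A) :=
  inferInstanceAs (Algebra ℂ (diffOpSubalgebra A))

/-- The operator on functions given by an element of the ring of differential operators. -/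
def DiffOp.toEnd {A : Type} [CommRing A] [Algebra ℂ A] : DiffOp A →ₐ[ℂ] Module.End ℂ A :=
  (diffOpSubalgebra A).val

/-- A function, as a differential operator of order zero. -/
def DiffOp.ofFun {A : Type} [CommRing A] [Algebra ℂ A] : A →ₐ[ℂ] DiffOp A :=
  (Algebra.lmul ℂ A).codRestrict (diffOpSubalgebra A)
    (fun a => Algebra.subset_adjoin (Or.inl ⟨a, rfl⟩))

/-- A vector field, as a differential operator. -/
def DiffOp.ofVF {A : Type} [CommRing A] [Algebra ℂ A] (θ : VF A) : DiffOp A :=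
  ⟨(θ : A →ₗ[ℂ] A), Algebra.subset_adjoin (Or.inr ⟨θ, rfl⟩)⟩

/-- The two module structures carried by a left `𝒟`-module on `Spec A` are compatible: functions
act as differential operators of order zero. -/
class DCompatible (A : Type) [CommRing A] [Algebra ℂ A] (M : Type) [AddCommGroup M]
    [Module A M] [Module (DiffOp A) M] : Prop where
  ofFun_smul : ∀ (a : A) (m : M), DiffOp.ofFun a • m = a • m

section Affine

variable {A B : Type} [CommRing A] [Algebra ℂ A] [CommRing B] [Algebra ℂ B]

/-- `N` (a `B`-module), with the `φ`-semilinear map `r : M → N`, is `B ⊗_A M`. -/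
def IsBaseChangeAlong (φ : A →ₐ[ℂ] B) {M N : Type} [AddCommGroup M] [Module A M]
    [AddCommGroup N] [Module B N] (r : M →+ N) (hr : ∀ (a : A) (m : M), r (a • m) = φ a • r m) :
    Prop :=
  letI : Algebra A B := φ.toRingHom.toAlgebra
  letI : Module A N := Module.compHom N φ.toRingHom
  haveI : IsScalarTower A B N :=
    ⟨fun a b n => by
      change (φ a * b) • n = φ a • (b • n)
      rw [mul_smul]⟩
  IsBaseChange B ({ toFun := r, map_add' := r.map_add, map_smul' := hr } : M →ₗ[A] N)

/-- For `f : Spec B → Spec A` given by `φ : A → B`, the left `𝒟_B`-module `N` is, through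
`r : M → N`, the inverse image `f⁺M = 𝒟_{B → A} ⊗_{𝒟_A} M`: as a `B`-module it is `B ⊗_A M`, and
the vector fields of `Spec B` act by the chain rule, `θ(1 ⊗ m) = ∑ b_l ⊗ η_l m` if
`θ ∘ φ = ∑ b_l (φ ∘ η_l)`. -/
structure IsDPullback (φ : A →ₐ[ℂ] B) {M N : Type}
    [AddCommGroup M] [Module A M] [Module (DiffOp A) M]
    [AddCommGroup N] [Module B N] [Module (DiffOp B) N] (r : M →+ N) : Prop where
  smul : ∀ (a : A) (m : M), r (a • m) = φ a • r m
  baseChange : IsBaseChangeAlong φ r smul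
  chain_rule : ∀ (θ : VF B) (p : ℕ) (b : Fin p → B) (η : Fin p → VF A),
    (∀ a : A, θ (φ a) = ∑ l, b l * φ (η l a)) →
      ∀ m : M, DiffOp.ofVF θ • r m = ∑ l, b l • r (DiffOp.ofVF (η l) • m)

theorem isDPullback_id {M : Type} [AddCommGroup M] [Module A M] [Module (DiffOp A) M]
    [DCompatible A M] : IsDPullback (AlgHom.id ℂ A) (AddMonoidHom.id M) where
  smul _ _ := rfl
  baseChange := IsBaseChange.ofEquiv (LinearEquiv.refl A M)
  chain_rule θ p b η h m := by
    have e : DiffOp.ofVF θ = ∑ l, DiffOp.ofFun (b l) * DiffOp.ofVF (η l) := by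
      have inj : Function.Injective (DiffOp.toEnd (A := A)) := Subtype.val_injective
      apply inj
      rw [map_sum]
      refine LinearMap.ext fun a => (h a).trans ?_
      rw [LinearMap.sum_apply]
      rfl
    change DiffOp.ofVF θ • m = ∑ l, b l • (DiffOp.ofVF (η l) • m)
    rw [e, Finset.sum_smul]
    refine Finset.sum_congr rfl fun l _ => ?_
    rw [mul_smul, DCompatible.ofFun_smul]

/-- The vector field `η` on `Spec A` and the vector field `θ` on `Spec B` correspond to each other
under `Spec B → Spec A`. -/
def VFRelated (φ : A →ₐ[ℂ] B) (η : VF A) (θ : VF B) : Prop :=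
  ∀ a : A, θ (φ a) = φ (η a)

/-- The vertical vector fields of `Spec B → Spec A`. -/
def relVF (φ : A →ₐ[ℂ] B) : Submodule B (VF B) where
  carrier := {θ | ∀ a : A, θ (φ a) = 0}
  add_mem' {x y} hx hy a := by
    have h1 := hx a
    have h2 := hy a
    simp [h1, h2]
  zero_mem' a := rfl
  smul_mem' b x hx a := by
    have h1 := hx a
    simp [h1]

/-- Differential forms of degree `n` on a smooth `Spec A`, as alternating forms on vector fields.
For `n = dim` this is the canonical module `ω`. -/
abbrev Form (A : Type) [CommRing A] [Algebra ℂ A] (n : ℕ) : Type := VF A [⋀^Fin n]→ₗ[A] A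

/-- `w'` is the Lie derivative of the form `w` along the vector field `θ`. The right action of
vector fields on the right `𝒟`-module `ω` is `w · θ = - Lie_θ w`. -/
def IsLieDerivative {n : ℕ} (θ : VF A) (w w' : Form A n) : Prop :=
  ∀ η : Fin n → VF A,
    w' η = θ (w η) - ∑ i, w (Function.update η i ⁅θ, η i⁆)

/-- The form `w'` on `Spec B` is the restriction of the form `w` on `Spec A`, for an étale
morphism `Spec B → Spec A`. -/
def FormRelated (φ : A →ₐ[ℂ] B) {n : ℕ} (w : Form A n) (w' : Form B n) : Prop :=
  ∀ (η : Fin n → VF A) (θ : Fin n → VF B), (∀ i, VFRelated φ (η i) (θ i)) → w' θ = φ (w η)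

end Affine

/-! ## `Ext` with values in the ring itself -/

section Ext

/-- `Ext^n_D(M, D)` for a left module `M` over a ring `D`. -/
abbrev DualExt (D : Type) [Ring D] (M : Type) [AddCommGroup M] [Module D M] (n : ℕ) : Type :=
  Abelian.Ext.{0} (ModuleCat.of D M) (ModuleCat.of D D) n

/-- The right `D`-module structure of `Ext^n_D(M, D)`, induced by right multiplication on `D`. -/
def DualExt.rmul {D : Type} [Ring D] {M : Type} [AddCommGroup M] [Module D M] {n : ℕ}
    (x : DualExt D M n) (P : D) : DualExt D M n :=
  x.comp (Abelian.Ext.mk₀ (ModuleCat.ofHom (LinearMap.toSpanSingleton D D P))) (add_zero n)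

/-- Restriction of scalars along a homomorphism of rings is exact. -/
theorem restrictScalars_exact {D D' : Type} [Ring D] [Ring D'] (σ : D →+* D') :
    Limits.PreservesFiniteLimits (ModuleCat.restrictScalars.{0} σ) ∧
      Limits.PreservesFiniteColimits (ModuleCat.restrictScalars.{0} σ) :=
  ((CategoryTheory.Functor.exact_tfae (ModuleCat.restrictScalars.{0} σ)).out 1 3).mp
    (fun S h => by
      rw [CategoryTheory.ShortComplex.ShortExact.moduleCat_exact_iff_function_exact] at h ⊢
      exact h)

/-- Let `σ : D → D'` be a ring homomorphism and `r : M → M'` a `σ`-semilinear map. The classes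
`x` in `Ext^n_D(M, D)` and `x'` in `Ext^n_{D'}(M', D')` are related if they have the same image in
`Ext^n_D(M, D')`. If `D'` is flat over `D` and `M' = D' ⊗_D M`, this says that `x'` is the image of
`x` under the base change map. -/
def DualExt.Related {D D' : Type} [Ring D] [Ring D'] (σ : D →+* D')
    {M M' : Type} [AddCommGroup M] [Module D M] [AddCommGroup M'] [Module D' M']
    (r : M →+ M') {n : ℕ} (x : DualExt D M n) (x' : DualExt D' M' n) : Prop :=
  haveI := (restrictScalars_exact σ).1
  haveI := (restrictScalars_exact σ).2
  ∃ (rr : ModuleCat.of D M ⟶ (ModuleCat.restrictScalars.{0} σ).obj (ModuleCat.of D' M'))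
    (ss : ModuleCat.of D D ⟶ (ModuleCat.restrictScalars.{0} σ).obj (ModuleCat.of D' D')),
    (∀ m : M, rr.hom m = r m) ∧ (∀ P : D, ss.hom P = σ P) ∧
    x.comp (Abelian.Ext.mk₀ ss) (add_zero n) =
      (Abelian.Ext.mk₀ rr).comp (x'.mapExactFunctor (ModuleCat.restrictScalars.{0} σ))
        (zero_add n)

end Ext

/-! ## Varieties glued from affine charts, and quasi-coherent `𝒟`-modules on them -/

/-- A scheme over `ℂ` presented by affine charts `Spec (A c)`, indexed by a preorder: for
`c ≤ c'` the chart `c` is contained in the chart `c'`, and `res` restricts functions. -/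
structure Charted (I : Type) [Preorder I] where
  A : I → Type
  [ring : ∀ c, CommRing (A c)]
  [alg : ∀ c, Algebra ℂ (A c)]
  res : ∀ {c c' : I}, c ≤ c' → A c' →ₐ[ℂ] A c
  res_self : ∀ (c : I) (a : A c), res (le_refl c) a = a
  res_res : ∀ {c c' c'' : I} (h : c ≤ c') (h' : c' ≤ c'') (a : A c''),
    res h (res h' a) = res (h.trans h') a

attribute [instance] Charted.ring Charted.alg

/-- A morphism `Y → Z` given chart by chart (`Y` and `Z` being indexed by the same preorder). -/
structure Charted.Hom {I : Type} [Preorder I] (Y Z : Charted I) where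
  app : ∀ c, Z.A c →ₐ[ℂ] Y.A c
  naturality : ∀ {c c' : I} (h : c ≤ c') (a : Z.A c'), app c (Z.res h a) = Y.res h (app c' a)

/-- The one-chart scheme `Spec A`, with the same chart for every index. -/
def Charted.const (I : Type) [Preorder I] (A : Type) [CommRing A] [Algebra ℂ A] : Charted I where
  A _ := A
  res _ := AlgHom.id ℂ A
  res_self _ _ := rfl
  res_res _ _ _ := rfl

/-- A quasi-coherent left `𝒟_Y`-module on `Y`, given by its sections over the charts: a left module
over the ring of differential operators of each chart, with restriction maps that make the sections
over a smaller chart the inverse image of the sections over the larger one. -/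
structure DMod {I : Type} [Preorder I] (Y : Charted I) where
  M : I → Type
  [grp : ∀ c, AddCommGroup (M c)]
  [omod : ∀ c, Module (Y.A c) (M c)]
  [dmod : ∀ c, Module (DiffOp (Y.A c)) (M c)]
  [compat : ∀ c, DCompatible (Y.A c) (M c)]
  res : ∀ {c c' : I}, c ≤ c' → M c' →+ M c
  res_self : ∀ (c : I) (m : M c), res (le_refl c) m = m
  res_res : ∀ {c c' c'' : I} (h : c ≤ c') (h' : c' ≤ c'') (m : M c''),
    res h (res h' m) = res (h.trans h') m
  isPullback : ∀ {c c' : I} (h : c ≤ c'), IsDPullback (Y.res h) (res h)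

attribute [instance] DMod.grp DMod.omod DMod.dmod DMod.compat

/-- A `𝒟`-module on the one-chart scheme `Spec A`. -/
def DMod.const (I : Type) [Preorder I] (A : Type) [CommRing A] [Algebra ℂ A] (M : Type)
    [grp : AddCommGroup M] [omod : Module A M] [dmod : Module (DiffOp A) M]
    [compat : DCompatible A M] : DMod (Charted.const I A) where
  M _ := M
  grp _ := grp
  omod _ := omod
  dmod _ := dmod
  compat _ := compat
  res _ := AddMonoidHom.id M
  res_self _ _ := rfl
  res_res _ _ _ := rfl
  isPullback _ := isDPullback_id (A := A) (M := M)

section Functors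

variable {I : Type} [Preorder I] {Y Z : Charted I}

/-- Isomorphisms of `𝒟`-modules. -/
structure DMod.Iso (M N : DMod Y) where
  app : ∀ c, M.M c ≃ₗ[DiffOp (Y.A c)] N.M c
  naturality : ∀ {c c' : I} (h : c ≤ c') (m : M.M c'), app c (M.res h m) = N.res h (app c' m)

/-- `N` is the inverse image `f⁺M` of `M` under `f : Y → Z`. -/
def IsInverseImage (f : Y.Hom Z) (M : DMod Z) (N : DMod Y) : Prop :=
  ∃ r : ∀ c, M.M c →+ N.M c,
    (∀ c, IsDPullback (f.app c) (r c)) ∧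
    ∀ {c c' : I} (h : c ≤ c') (m : M.M c'), r c (M.res h m) = N.res h (r c' m)

/-- `P` is the tensor product `M ⊗_𝒪 N`, on which vector fields act by the Leibniz rule. -/
def IsTensor (M N P : DMod Y) : Prop :=
  ∃ t : ∀ c, M.M c →ₗ[Y.A c] N.M c →ₗ[Y.A c] P.M c,
    (∀ c, IsTensorProduct (t c)) ∧
    (∀ c (θ : VF (Y.A c)) (m : M.M c) (n : N.M c),
      DiffOp.ofVF θ • t c m n = t c (DiffOp.ofVF θ • m) n + t c m (DiffOp.ofVF θ • n)) ∧
    ∀ {c c' : I} (h : c ≤ c') (m : M.M c') (n : N.M c'),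
      P.res h (t c' m n) = t c (M.res h m) (N.res h n)

/-- For an affine open embedding `j : Y → Z`, `N` is the direct image `j₊M = Rj_*M = j_*M` (here
`𝒟_{Z ← Y} = 𝒟_Y`, and `j_*` is exact since `j` is affine): it has the same sections as `M` over the charts, with functions and vector fields of `Z` acting through their
restriction to `Y`. -/
def IsOpenDirectImage (j : Y.Hom Z) (M : DMod Y) (N : DMod Z) : Prop :=
  ∃ e : ∀ c, N.M c ≃+ M.M c,
    (∀ c (a : Z.A c) (x : N.M c), e c (a • x) = j.app c a • e c x) ∧
    (∀ c (η : VF (Z.A c)) (θ : VF (Y.A c)), VFRelated (j.app c) η θ →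
      ∀ x : N.M c, e c (DiffOp.ofVF η • x) = DiffOp.ofVF θ • e c x) ∧
    ∀ {c c' : I} (h : c ≤ c') (x : N.M c'), e c (N.res h x) = M.res h (e c' x)

/-- For an affine smooth morphism `f : Y → Z` of relative dimension one, the direct image `f₊M` is
represented by the relative de Rham complex `M → Ω¹_{Y/Z} ⊗ M`, in degrees `-1` and `0`. Here
`Ω¹_{Y/Z} ⊗ M` is written as the module of `𝒪`-linear maps from vertical vector fields to `M`, and a
vector field `η` of `Z` acts on the cokernel by the Lie derivative along any lift `θ` of `η` to `Y`.
The predicate says that the cohomology in degree `-1` vanishes and that `N` is the cohomology in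
degree `0`; that is, `f₊M = N` in the derived category. -/
def IsDirectImageRelDimOne (f : Y.Hom Z) (M : DMod Y) (N : DMod Z) : Prop :=
  (∀ c (m : M.M c), (∀ v ∈ relVF (f.app c), DiffOp.ofVF v • m = 0) → m = 0) ∧
  ∃ q : ∀ c, (relVF (f.app c) →ₗ[Y.A c] M.M c) →+ N.M c,
    (∀ c, Function.Surjective (q c)) ∧
    (∀ c φ, q c φ = 0 ↔
      ∃ m : M.M c, ∀ v : relVF (f.app c), φ v = DiffOp.ofVF (v : VF (Y.A c)) • m) ∧
    (∀ c (a : Z.A c) φ, q c (f.app c a • φ) = a • q c φ) ∧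
    (∀ c (η : VF (Z.A c)) (θ : VF (Y.A c)), VFRelated (f.app c) η θ →
      ∀ φ φ' : relVF (f.app c) →ₗ[Y.A c] M.M c,
        (∀ v u : relVF (f.app c), (u : VF (Y.A c)) = ⁅θ, (v : VF (Y.A c))⁆ →
          φ' v = DiffOp.ofVF θ • φ v - φ u) →
        DiffOp.ofVF η • q c φ = q c φ') ∧
    ∀ {c c' : I} (h : c ≤ c') (φ : relVF (f.app c') →ₗ[Y.A c'] M.M c')
      (φ' : relVF (f.app c) →ₗ[Y.A c] M.M c),
      (∀ (v : relVF (f.app c')) (v' : relVF (f.app c)),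
        VFRelated (Y.res h) (v : VF (Y.A c')) (v' : VF (Y.A c)) → φ' v' = M.res h (φ v)) →
      N.res h (q c' φ) = q c φ'

/-- For a holonomic `𝒟`-module `M` on a smooth `Y` of dimension `n`, `N` is the holonomic dual
`𝔻M = ω^∨ ⊗_𝒪 RHom_𝒟(M, 𝒟)[n]`: all `Ext^i_𝒟(M, 𝒟)` with `i ≠ n` vanish, and `N` is
`ω^∨ ⊗_𝒪 Ext^n_𝒟(M, 𝒟) = Hom_𝒪(ω, Ext^n_𝒟(M, 𝒟))`, a left `𝒟`-module by
`(θ φ)(w) = φ(w · θ) - φ(w) · θ`. -/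
def IsHolonomicDual (n : ℕ) (M N : DMod Y) : Prop :=
  (∀ c (i : ℕ), i ≠ n → Subsingleton (DualExt (DiffOp (Y.A c)) (M.M c) i)) ∧
  ∃ e : ∀ c, N.M c →+ (Form (Y.A c) n →+ DualExt (DiffOp (Y.A c)) (M.M c) n),
    (∀ c x (a : Y.A c) w, e c x (a • w) = (e c x w).rmul (DiffOp.ofFun a)) ∧
    (∀ c, Function.Injective (e c)) ∧
    (∀ c (φ : Form (Y.A c) n →+ DualExt (DiffOp (Y.A c)) (M.M c) n),
      (∀ (a : Y.A c) w, φ (a • w) = (φ w).rmul (DiffOp.ofFun a)) → ∃ x, e c x = φ) ∧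
    (∀ c (a : Y.A c) x w, e c (a • x) w = (e c x w).rmul (DiffOp.ofFun a)) ∧
    (∀ c (θ : VF (Y.A c)) x w w', IsLieDerivative θ w w' →
      e c (DiffOp.ofVF θ • x) w = - e c x w' - (e c x w).rmul (DiffOp.ofVF θ)) ∧
    ∀ {c c' : I} (h : c ≤ c'),
      ∃ σ : DiffOp (Y.A c') →+* DiffOp (Y.A c),
        (∀ (P : DiffOp (Y.A c')) (a : Y.A c'),
          (σ P).toEnd (Y.res h a) = Y.res h (P.toEnd a)) ∧
        ∀ (x : N.M c') (w : Form (Y.A c') n) (w' : Form (Y.A c) n),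
          FormRelated (Y.res h) w w' →
            (e c' x w).Related σ (M.res h) (e c (N.res h x) w')

/-- For an affine open embedding `j : Y → Z` of smooth varieties of dimension `n`, `N` is
`j_†M = 𝔻 j₊ 𝔻 M`. -/
def IsOpenProperDirectImage (n : ℕ) (j : Y.Hom Z) (M : DMod Y) (N : DMod Z) : Prop :=
  ∃ (M' : DMod Y) (N' : DMod Z),
    IsHolonomicDual n M M' ∧ IsOpenDirectImage j M' N' ∧ IsHolonomicDual n N' N

end Functors

/-! ## `𝒟`-modules on the affine line and on the torus -/

/-- The left ideal `𝒟_ℂ (∂_t + 1)`. -/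
def expIdeal : Submodule (DiffOp ℂ[X]) (DiffOp ℂ[X]) :=
  Submodule.span _ {DiffOp.ofVF (Polynomial.derivative' (R := ℂ)) + 1}

/-- The `𝒟`-module `𝒟_ℂ / 𝒟_ℂ (∂_t + 1)` on the affine line. -/
def ExpModule : Type := DiffOp ℂ[X] ⧸ expIdeal

instance : AddCommGroup ExpModule := inferInstanceAs (AddCommGroup (DiffOp ℂ[X] ⧸ expIdeal))
instance : Module (DiffOp ℂ[X]) ExpModule :=
  inferInstanceAs (Module (DiffOp ℂ[X]) (DiffOp ℂ[X] ⧸ expIdeal))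
instance : Module ℂ[X] ExpModule :=
  Module.compHom ExpModule (DiffOp.ofFun (A := ℂ[X])).toRingHom
instance : DCompatible ℂ[X] ExpModule := ⟨fun _ _ => rfl⟩

/-- The left ideal `𝒟_{ℂ*} (∂_t t + β)`. The vector field `∂_t` of `ℂ*` is the unique one that maps
the coordinate `t` to `1`. -/
def torusIdeal (β : ℂ) : Submodule (DiffOp ℂ[T;T⁻¹]) (DiffOp ℂ[T;T⁻¹]) :=
  Submodule.span _ {P | ∃ d : VF ℂ[T;T⁻¹], d (LaurentPolynomial.T 1) = 1 ∧
    P = DiffOp.ofVF d * DiffOp.ofFun (LaurentPolynomial.T 1) + algebraMap ℂ _ β}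

/-- The `𝒟`-module `𝒪^β_{ℂ*} = 𝒟_{ℂ*} / 𝒟_{ℂ*} (∂_t t + β)`. -/
def TorusModule (β : ℂ) : Type := DiffOp ℂ[T;T⁻¹] ⧸ torusIdeal β

instance (β : ℂ) : AddCommGroup (TorusModule β) :=
  inferInstanceAs (AddCommGroup (DiffOp ℂ[T;T⁻¹] ⧸ torusIdeal β))
instance (β : ℂ) : Module (DiffOp ℂ[T;T⁻¹]) (TorusModule β) :=
  inferInstanceAs (Module (DiffOp ℂ[T;T⁻¹]) (DiffOp ℂ[T;T⁻¹] ⧸ torusIdeal β))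
instance (β : ℂ) : Module ℂ[T;T⁻¹] (TorusModule β) :=
  Module.compHom (TorusModule β) (DiffOp.ofFun (A := ℂ[T;T⁻¹])).toRingHom

/-- The cyclic generator of `𝒪^β_{ℂ*}`. -/
def TorusModule.gen (β : ℂ) : TorusModule β :=
  Submodule.Quotient.mk (p := torusIdeal β) (1 : DiffOp ℂ[T;T⁻¹])


/-! ## Homomorphisms out of (Laurent) polynomial rings -/

section PolyHoms

variable {R S : Type} [CommRing R] [Algebra ℂ R] [CommRing S] [Algebra ℂ S]

/-- Constants in a polynomial ring. -/
def polyConst : R →ₐ[ℂ] R[X] where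
  toRingHom := Polynomial.C
  commutes' _ := rfl

/-- The homomorphism given by `φ` on constants and by `X ↦ b`. -/
def polyLift (φ : R →ₐ[ℂ] S) (b : S) : R[X] →ₐ[ℂ] S where
  toRingHom := Polynomial.eval₂RingHom φ.toRingHom b
  commutes' z := by
    change Polynomial.eval₂ φ.toRingHom b (Polynomial.C (algebraMap ℂ R z)) = _
    rw [Polynomial.eval₂_C]
    exact φ.commutes z

theorem polyLift_const (φ : R →ₐ[ℂ] S) (b : S) (r : R) : polyLift φ b (polyConst r) = φ r :=
  Polynomial.eval₂_C _ _

theorem polyLift_X (φ : R →ₐ[ℂ] S) (b : S) : polyLift φ b Polynomial.X = b :=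
  Polynomial.eval₂_X _ _

theorem polyHom_ext {f g : R[X] →ₐ[ℂ] S} (h : ∀ r, f (polyConst r) = g (polyConst r))
    (hX : f Polynomial.X = g Polynomial.X) : f = g :=
  AlgHom.coe_ringHom_injective (Polynomial.ringHom_ext h hX)

/-- Constants in a Laurent polynomial ring. -/
def laurentConst : R →ₐ[ℂ] R[T;T⁻¹] where
  toRingHom := LaurentPolynomial.C
  commutes' z := (LaurentPolynomial.algebraMap_apply z).symm

/-- The variable of a Laurent polynomial ring, as a unit. -/
def laurentT : (R[T;T⁻¹])ˣ where
  val := LaurentPolynomial.T 1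
  inv := LaurentPolynomial.T (-1)
  val_inv := by rw [← LaurentPolynomial.T_add, add_neg_cancel, LaurentPolynomial.T_zero]
  inv_val := by rw [← LaurentPolynomial.T_add, neg_add_cancel, LaurentPolynomial.T_zero]

/-- The homomorphism given by `φ` on constants and by `T ↦ u`. -/
def laurentLift (φ : R →ₐ[ℂ] S) (u : Sˣ) : R[T;T⁻¹] →ₐ[ℂ] S where
  toRingHom := LaurentPolynomial.eval₂ φ.toRingHom u
  commutes' z := by
    change LaurentPolynomial.eval₂ φ.toRingHom u (algebraMap ℂ R[T;T⁻¹] z) = _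
    rw [LaurentPolynomial.algebraMap_apply, LaurentPolynomial.eval₂_C]
    exact φ.commutes z

theorem laurentLift_const (φ : R →ₐ[ℂ] S) (u : Sˣ) (r : R) :
    laurentLift φ u (laurentConst r) = φ r :=
  LaurentPolynomial.eval₂_C _ _ _

theorem laurentLift_T (φ : R →ₐ[ℂ] S) (u : Sˣ) : laurentLift φ u (laurentT : (R[T;T⁻¹])ˣ) = u :=
  (LaurentPolynomial.eval₂_T _ _ 1).trans (by simp)

theorem laurentHom_ext {f g : R[T;T⁻¹] →ₐ[ℂ] S}
    (h : ∀ r, f (laurentConst r) = g (laurentConst r))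
    (hT : f (laurentT : (R[T;T⁻¹])ˣ) = g (laurentT : (R[T;T⁻¹])ˣ)) : f = g := by
  have hu : Units.map (f : R[T;T⁻¹] →* S) laurentT = Units.map (g : R[T;T⁻¹] →* S) laurentT :=
    Units.ext hT
  have hz : ∀ m : ℤ, ((laurentT ^ m : (R[T;T⁻¹])ˣ) : R[T;T⁻¹]) = LaurentPolynomial.T m := by
    intro m
    induction m with
    | zero => simp
    | succ i ih =>
      rw [zpow_add_one, Units.val_mul, ih, LaurentPolynomial.T_add]
      rfl
    | pred i ih =>
      rw [zpow_sub_one, Units.val_mul, ih, sub_eq_add_neg, LaurentPolynomial.T_add]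
      rfl
  refine AlgHom.ext fun p => ?_
  induction p using LaurentPolynomial.induction_on' with
  | add p q hp hq => rw [map_add, map_add, hp, hq]
  | C_mul_T m a =>
    rw [map_mul, map_mul, ← hz m]
    congr 1
    · exact h a
    · have := congrArg (fun v : Sˣ => ((v ^ m : Sˣ) : S)) hu
      simp only [← map_zpow] at this
      exact this

end PolyHoms

/-! ## Line bundles and their total spaces -/

/-- An open cover of `X` with sections `s_i` of `ℱ` over the `U_i` such that multiplication by `s_i`
identifies `𝒪` and `ℱ` over `U_i`. An `𝒪_X`-module `ℱ` that has such a cover is (the sheaf of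
sections of) a line bundle, with non-vanishing local sections `s_i`. -/
structure LineBundleTrivialization {X : Scheme.{0}} (ℱ : X.Modules) where
  ι : Type
  U : ι → X.Opens
  cover : ∀ x : X, ∃ i, x ∈ U i
  sec : ∀ i, Γ(ℱ, U i)
  bijective : ∀ (i : ι) (V : X.Opens) (h : V ≤ U i),
    Function.Bijective (fun f : Γ(X, V) => f • ℱ.presheaf.map (homOfLE h).op (sec i))

namespace LineBundleTrivialization

variable {X : Scheme.{0}} {ℱ : X.Modules} (t : LineBundleTrivialization ℱ)

/-- The restriction of the section `s_i` to an open subset of `U_i`. -/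
def secOn (i : t.ι) {V : X.Opens} (h : V ≤ t.U i) : Γ(ℱ, V) :=
  ℱ.presheaf.map (homOfLE h).op (t.sec i)

/-- The function `s_i / s_j`. -/
def ratioFun {i j : t.ι} {V : X.Opens} (hi : V ≤ t.U i) (hj : V ≤ t.U j) : Γ(X, V) :=
  ((t.bijective j V hj).2 (t.secOn i hi)).choose

theorem ratioFun_smul {i j : t.ι} {V : X.Opens} (hi : V ≤ t.U i) (hj : V ≤ t.U j) :
    t.ratioFun hi hj • t.secOn j hj = t.secOn i hi :=
  ((t.bijective j V hj).2 (t.secOn i hi)).choose_spec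

theorem ratioFun_unique {i j : t.ι} {V : X.Opens} (hi : V ≤ t.U i) (hj : V ≤ t.U j)
    (f : Γ(X, V)) (hf : f • t.secOn j hj = t.secOn i hi) : f = t.ratioFun hi hj :=
  (t.bijective j V hj).1 (hf.trans (t.ratioFun_smul hi hj).symm)

theorem ratioFun_mul {i j l : t.ι} {V : X.Opens} (hi : V ≤ t.U i) (hj : V ≤ t.U j)
    (hl : V ≤ t.U l) : t.ratioFun hi hj * t.ratioFun hj hl = t.ratioFun hi hl :=
  t.ratioFun_unique _ _ _ (by rw [mul_smul, ratioFun_smul, ratioFun_smul])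

theorem ratioFun_self {i : t.ι} {V : X.Opens} (hi : V ≤ t.U i) : t.ratioFun hi hi = 1 :=
  (t.ratioFun_unique hi hi 1 (one_smul _ _)).symm

theorem secOn_map (i : t.ι) {V V' : X.Opens} (h : V' ≤ t.U i) (hV : V ≤ V') :
    ℱ.presheaf.map (homOfLE hV).op (t.secOn i h) = t.secOn i (hV.trans h) := by
  unfold secOn
  rw [← ConcreteCategory.comp_apply, ← ℱ.presheaf.map_comp]
  rfl

theorem ratioFun_map {i j : t.ι} {V V' : X.Opens} (hi : V' ≤ t.U i) (hj : V' ≤ t.U j)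
    (hV : V ≤ V') : X.presheaf.map (homOfLE hV).op (t.ratioFun hi hj) =
      t.ratioFun (hV.trans hi) (hV.trans hj) :=
  t.ratioFun_unique _ _ _ (by
    rw [← t.secOn_map j hj hV, ← Scheme.Modules.map_smul, ratioFun_smul, secOn_map])

/-- The unit `s_i / s_j`. -/
def ratio {i j : t.ι} {V : X.Opens} (hi : V ≤ t.U i) (hj : V ≤ t.U j) : Γ(X, V)ˣ where
  val := t.ratioFun hi hj
  inv := t.ratioFun hj hi
  val_inv := by rw [ratioFun_mul, ratioFun_self]
  inv_val := by rw [ratioFun_mul, ratioFun_self]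

theorem ratio_mul {i j l : t.ι} {V : X.Opens} (hi : V ≤ t.U i) (hj : V ≤ t.U j)
    (hl : V ≤ t.U l) : t.ratio hi hj * t.ratio hj hl = t.ratio hi hl :=
  Units.ext (t.ratioFun_mul hi hj hl)

theorem ratio_self {i : t.ι} {V : X.Opens} (hi : V ≤ t.U i) : t.ratio hi hi = 1 :=
  Units.ext (t.ratioFun_self hi)

end LineBundleTrivialization

/-- The `ℂ`-algebra structure on the functions over an open subset of a scheme over `ℂ`. -/
@[reducible]
def sectionsAlgebra {X : Scheme.{0}} (s : X ⟶ Spec (.of ℂ)) (V : X.Opens) : Algebra ℂ Γ(X, V) :=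
  ((Scheme.ΓSpecIso (.of ℂ)).inv ≫ s.appLE ⊤ V le_top).hom.toAlgebra

theorem sectionsAlgebra_map {X : Scheme.{0}} (s : X ⟶ Spec (.of ℂ)) {V V' : X.Opens} (h : V ≤ V')
    (z : ℂ) : (X.presheaf.map (homOfLE h).op).hom ((sectionsAlgebra s V').algebraMap z) =
      (sectionsAlgebra s V).algebraMap z := by
  have e : s.appLE ⊤ V' le_top ≫ X.presheaf.map (homOfLE h).op = s.appLE ⊤ V le_top :=
    Scheme.Hom.appLE_map s _ _
  change ((Scheme.ΓSpecIso (.of ℂ)).inv ≫ s.appLE ⊤ V' le_top ≫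
      X.presheaf.map (homOfLE h).op).hom z = _
  rw [e]
  rfl

/-- `V` admits a coordinate system: functions `x_1, …, x_n` and a basis `∂_1, …, ∂_n` of the vector
fields on `V` with `∂_i x_j = δ_ij`. -/
def HasCoordinates {X : Scheme.{0}} (s : X ⟶ Spec (.of ℂ)) (n : ℕ) (V : X.Opens) : Prop :=
  letI := sectionsAlgebra s V
  ∃ (x : Fin n → Γ(X, V)) (d : Module.Basis (Fin n) Γ(X, V) (VF Γ(X, V))),
    ∀ i j, d i (x j) = if i = j then 1 else 0

/-- The charts of `X` used for gluing: affine open subsets `W` with coordinates that are contained in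
some member `U_i` of the trivializing cover (`i` is part of the chart). On a smooth variety of
dimension `n` these `W` form a basis of the topology. -/
structure Chart {X : Scheme.{0}} (s : X ⟶ Spec (.of ℂ)) (n : ℕ) {ℱ : X.Modules}
    (t : LineBundleTrivialization ℱ) where
  i : t.ι
  W : X.Opens
  affine : IsAffineOpen W
  le : W ≤ t.U i
  coord : HasCoordinates s n W

section TotalSpaces

variable {X : Scheme.{0}} {s : X ⟶ Spec (.of ℂ)} {n : ℕ} {ℱ : X.Modules} {t : LineBundleTrivialization ℱ}

instance : Preorder (Chart s n t) where
  le c c' := c.W ≤ c'.W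
  le_refl c := le_refl c.W
  le_trans _ _ _ h h' := le_trans (α := X.Opens) h h'

/-- The functions on the open subset `W` of `X`. -/
def Chart.R (c : Chart s n t) : Type := Γ(X, c.W)

instance (c : Chart s n t) : CommRing c.R := inferInstanceAs (CommRing Γ(X, c.W))
instance (c : Chart s n t) : Algebra ℂ c.R := sectionsAlgebra s c.W

/-- Restriction of functions on `X`. -/
def Chart.res {c c' : Chart s n t} (h : c ≤ c') : c'.R →ₐ[ℂ] c.R where
  toRingHom := (X.presheaf.map (homOfLE (show c.W ≤ c'.W from h)).op).hom
  commutes' z := sectionsAlgebra_map s (show c.W ≤ c'.W from h) z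

theorem Chart.res_self (c : Chart s n t) (a : c.R) : Chart.res (le_refl c) a = a := by
  change X.presheaf.map (𝟙 _) a = a
  rw [X.presheaf.map_id]
  rfl

theorem Chart.res_res {c c' c'' : Chart s n t} (h : c ≤ c') (h' : c' ≤ c'') (a : c''.R) :
    Chart.res h (Chart.res h' a) = Chart.res (h.trans h') a := by
  have e : X.presheaf.map (homOfLE (show c'.W ≤ c''.W from h')).op ≫
      X.presheaf.map (homOfLE (show c.W ≤ c'.W from h)).op =
      X.presheaf.map (homOfLE (show c.W ≤ c''.W from h.trans h')).op := by
    rw [← X.presheaf.map_comp]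
    rfl
  exact congrArg (fun f => f.hom a) e

/-- The transition function `α = s_i / s_j` on the smaller of two charts `c ≤ c'` with indices `i`
and `j`. -/
def Chart.trans {c c' : Chart s n t} (h : c ≤ c') : c.Rˣ :=
  t.ratio c.le (le_trans (show c.W ≤ c'.W from h) c'.le)

theorem Chart.trans_self (c : Chart s n t) : Chart.trans (le_refl c) = 1 := t.ratio_self _

theorem Chart.trans_trans {c c' c'' : Chart s n t} (h : c ≤ c') (h' : c' ≤ c'') :
    Chart.trans h * Units.map (Chart.res h : c'.R →* c.R) (Chart.trans h') =
      Chart.trans (h.trans h') := by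
  have e : Units.map (Chart.res h : c'.R →* c.R) (Chart.trans h') =
      t.ratio (le_trans (show c.W ≤ c'.W from h) c'.le)
        (le_trans (show c.W ≤ c''.W from h.trans h') c''.le) :=
    Units.ext (t.ratioFun_map _ _ _)
  rw [e]
  exact t.ratio_mul _ _ _

theorem Chart.trans_zpow {c c' c'' : Chart s n t} (h : c ≤ c') (h' : c' ≤ c'') (k : ℤ) :
    Chart.res h ((Chart.trans h' ^ k : c'.Rˣ) : c'.R) * ((Chart.trans h ^ k : c.Rˣ) : c.R) =
      ((Chart.trans (h.trans h') ^ k : c.Rˣ) : c.R) := by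
  rw [← Chart.trans_trans h h', mul_zpow, ← map_zpow, Units.val_mul, mul_comm]
  rfl

/-- The embedding of polynomials into Laurent polynomials. -/
def toLaurentHom {R : Type} [CommRing R] [Algebra ℂ R] : R[X] →ₐ[ℂ] R[T;T⁻¹] :=
  polyLift laurentConst ((laurentT : (R[T;T⁻¹])ˣ) : R[T;T⁻¹])

/-- Restriction of functions on `L`. -/
def totRes (k : ℤ) {c c' : Chart s n t} (h : c ≤ c') : c'.R[X] →ₐ[ℂ] c.R[X] :=
  polyLift (polyConst.comp (Chart.res h))
    (polyConst ((Chart.trans h ^ k : c.Rˣ) : c.R) * Polynomial.X)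

/-- Restriction of functions on `L^*`. -/
def totStarRes (k : ℤ) {c c' : Chart s n t} (h : c ≤ c') : c'.R[T;T⁻¹] →ₐ[ℂ] c.R[T;T⁻¹] :=
  laurentLift (laurentConst.comp (Chart.res h))
    (Units.map ((laurentConst (R := c.R)) : c.R →* c.R[T;T⁻¹]) (Chart.trans h ^ k) * laurentT)

/-- Restriction of functions on `L ×_X L^∨`. -/
def totProdRes (k : ℤ) {c c' : Chart s n t} (h : c ≤ c') : c'.R[X][X] →ₐ[ℂ] c.R[X][X] :=
  polyLift (polyConst.comp (totRes (-k) h))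
    (polyConst (polyConst ((Chart.trans h ^ k : c.Rˣ) : c.R)) * Polynomial.X)

theorem totRes_self (k : ℤ) (c : Chart s n t) : totRes k (le_refl c) = AlgHom.id ℂ c.R[X] :=
  polyHom_ext (fun r => by simp [totRes, polyLift_const, Chart.res_self])
    (by simp [totRes, polyLift_X, Chart.trans_self])

theorem totRes_comp (k : ℤ) {c c' c'' : Chart s n t} (h : c ≤ c') (h' : c' ≤ c'') :
    (totRes k h).comp (totRes k h') = totRes k (h.trans h') :=
  polyHom_ext (fun r => by simp [totRes, polyLift_const, Chart.res_res])
    (by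
      simp only [AlgHom.comp_apply, totRes, polyLift_const, polyLift_X, map_mul,
        ← Chart.trans_zpow h h' k, mul_assoc])

theorem totStarRes_self (k : ℤ) (c : Chart s n t) :
    totStarRes k (le_refl c) = AlgHom.id ℂ c.R[T;T⁻¹] :=
  laurentHom_ext (fun r => by simp [totStarRes, laurentLift_const, Chart.res_self])
    (by simp [totStarRes, laurentLift_T, Chart.trans_self])

theorem totStarRes_comp (k : ℤ) {c c' c'' : Chart s n t} (h : c ≤ c') (h' : c' ≤ c'') :
    (totStarRes k h).comp (totStarRes k h') = totStarRes k (h.trans h') :=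
  laurentHom_ext (fun r => by simp [totStarRes, laurentLift_const, Chart.res_res])
    (by
      simp only [AlgHom.comp_apply, totStarRes, laurentLift_T, Units.val_mul, Units.coe_map,
        MonoidHom.coe_coe, map_mul, laurentLift_const, ← Chart.trans_zpow h h' k, mul_assoc])

theorem totProdRes_self (k : ℤ) (c : Chart s n t) :
    totProdRes k (le_refl c) = AlgHom.id ℂ c.R[X][X] :=
  polyHom_ext (fun r => by simp [totProdRes, polyLift_const, totRes_self])
    (by simp [totProdRes, polyLift_X, Chart.trans_self])

theorem totProdRes_comp (k : ℤ) {c c' c'' : Chart s n t} (h : c ≤ c') (h' : c' ≤ c'') :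
    (totProdRes k h).comp (totProdRes k h') = totProdRes k (h.trans h') :=
  polyHom_ext
    (fun r => by
      simp only [AlgHom.comp_apply, totProdRes, polyLift_const, ← totRes_comp (-k) h h'])
    (by
      simp only [AlgHom.comp_apply, totProdRes, totRes, polyLift_const, polyLift_X, map_mul,
        ← Chart.trans_zpow h h' k, mul_assoc])

variable (s n t) in
/-- The total space `L` of the `k`-th tensor power of the line bundle: over a chart `c` with index
`i` it is `Spec 𝒪(W)[t_c]`, where `t_c` is the fibre coordinate of the trivialization by `s_i^k`, so
that `t_{c'} = (s_i/s_j)^k t_c`. -/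
def Tot (k : ℤ) : Charted (Chart s n t) where
  A c := c.R[X]
  res h := totRes k h
  res_self c a := DFunLike.congr_fun (totRes_self k c) a
  res_res h h' a := DFunLike.congr_fun (totRes_comp k h h') a

variable (s n t) in
/-- The complement `L^*` of the zero section of the `k`-th tensor power: over a chart `c` it is
`Spec 𝒪(W)[t_c, t_c⁻¹]`. -/
def TotStar (k : ℤ) : Charted (Chart s n t) where
  A c := c.R[T;T⁻¹]
  res h := totStarRes k h
  res_self c a := DFunLike.congr_fun (totStarRes_self k c) a
  res_res h h' a := DFunLike.congr_fun (totStarRes_comp k h h') a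

variable (s n t) in
/-- The fibre product `L ×_X L^∨` of the total spaces of the `k`-th and the `(-k)`-th power: over a
chart `c` it is `Spec 𝒪(W)[y_c][t_c]`, with `t_c` the fibre coordinate of `L` (the outer variable)
and `y_c` the fibre coordinate of `L^∨` (the inner variable). -/
def TotProd (k : ℤ) : Charted (Chart s n t) where
  A c := c.R[X][X]
  res h := totProdRes k h
  res_self c a := DFunLike.congr_fun (totProdRes_self k c) a
  res_res h h' a := DFunLike.congr_fun (totProdRes_comp k h h') a

variable (s n t) in
/-- The open embedding `j : L^* → L`. -/
def jHom (k : ℤ) : (TotStar s n t k).Hom (Tot s n t k) where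
  app c := toLaurentHom (R := c.R)
  naturality {c c'} h a := by
    have e : (toLaurentHom (R := c.R)).comp (totRes k h) =
        (totStarRes k h).comp (toLaurentHom (R := c'.R)) := by
      refine polyHom_ext (fun r => ?_) ?_
      · simp only [AlgHom.comp_apply, totRes, totStarRes, toLaurentHom, polyLift_const,
          laurentLift_const]
      · simp only [AlgHom.comp_apply, totRes, totStarRes, toLaurentHom, polyLift_const,
          polyLift_X, laurentLift_T, map_mul]
        rfl
    exact DFunLike.congr_fun e a

variable (s n t) in
/-- The projection `p₁ : L ×_X L^∨ → L`. -/
def proj₁ (k : ℤ) : (TotProd s n t k).Hom (Tot s n t k) where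
  app c := polyLift (R := c.R) (polyConst.comp polyConst) (Polynomial.X : c.R[X][X])
  naturality {c c'} h a := by
    have e : (polyLift (R := c.R) (polyConst.comp polyConst) (Polynomial.X : c.R[X][X])).comp
        (totRes k h) = (totProdRes k h).comp
        (polyLift (R := c'.R) (polyConst.comp polyConst) (Polynomial.X : c'.R[X][X])) := by
      refine polyHom_ext (fun r => ?_) ?_
      · simp only [AlgHom.comp_apply, totRes, totProdRes, polyLift_const]
      · simp only [AlgHom.comp_apply, totRes, totProdRes, polyLift_const, polyLift_X, map_mul]
    exact DFunLike.congr_fun e a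

variable (s n t) in
/-- The projection `p₂ : L ×_X L^∨ → L^∨`. -/
def proj₂ (k : ℤ) : (TotProd s n t k).Hom (Tot s n t (-k)) where
  app c := polyConst (R := c.R[X])
  naturality {c _} h a :=
    (polyLift_const (polyConst.comp (totRes (-k) h))
      (polyConst (polyConst ((Chart.trans h ^ k : c.Rˣ) : c.R)) * Polynomial.X) a).symm

variable (s n t) in
/-- The natural pairing `L ×_X L^∨ → ℂ`, the function `t_c y_c`. -/
def pairing (k : ℤ) : (TotProd s n t k).Hom (Charted.const (Chart s n t) ℂ[X]) where
  app c := polyLift (Algebra.ofId ℂ c.R[X][X]) (Polynomial.X * polyConst Polynomial.X)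
  naturality {c c'} h a := by
    have hu : polyConst (polyConst ((Chart.trans h ^ k : c.Rˣ) : c.R)) *
        polyConst (polyConst ((Chart.trans h ^ (-k) : c.Rˣ) : c.R)) = (1 : c.R[X][X]) := by
      rw [← map_mul, ← map_mul, ← Units.val_mul, ← zpow_add]
      simp
    have e : polyLift (Algebra.ofId ℂ c.R[X][X]) (Polynomial.X * polyConst Polynomial.X) =
        (totProdRes k h).comp
          (polyLift (Algebra.ofId ℂ c'.R[X][X]) (Polynomial.X * polyConst Polynomial.X)) := by
      refine polyHom_ext (fun r => ?_) ?_
      · simp only [AlgHom.comp_apply, polyLift_const, Algebra.ofId_apply, AlgHom.commutes]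
      · simp only [AlgHom.comp_apply, totProdRes, totRes, polyLift_const, polyLift_X, map_mul]
        calc (Polynomial.X * polyConst Polynomial.X : c.R[X][X])
            = (polyConst (polyConst ((Chart.trans h ^ k : c.Rˣ) : c.R)) *
                polyConst (polyConst ((Chart.trans h ^ (-k) : c.Rˣ) : c.R))) *
                (Polynomial.X * polyConst Polynomial.X : c.R[X][X]) := by rw [hu, one_mul]
          _ = _ := by ring
    exact DFunLike.congr_fun e a

/-- The Fourier-Laplace transform over `X` of a `𝒟`-module on the line bundle `L` (the `k`-th power):
`N = p_{2,+}(p_1^+ M ⊗_𝒪 𝒦)` where `𝒦` is the inverse image of `𝒟_ℂ / 𝒟_ℂ (∂_t + 1)` under the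
pairing. As `p_1` is flat and `𝒦` is locally free over `𝒪`, the inverse image and the tensor
product need not be derived. -/
def IsFourierLaplace (k : ℤ) (M : DMod (Tot s n t k)) (N : DMod (Tot s n t (-k))) : Prop :=
  ∃ P K Q : DMod (TotProd s n t k),
    IsInverseImage (proj₁ s n t k) M P ∧
    IsInverseImage (pairing s n t k) (DMod.const (Chart s n t) ℂ[X] ExpModule) K ∧
    IsTensor P K Q ∧
    IsDirectImageRelDimOne (proj₂ s n t k) Q N

variable (s n t) in
/-- The projection `ℂ* × W → ℂ*` of a chart of `L^*`, in the trivialization by `s_i^k`. -/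
def torusProj (k : ℤ) (c : Chart s n t) : ℂ[T;T⁻¹] →ₐ[ℂ] (TotStar s n t k).A c :=
  laurentLift (S := c.R[T;T⁻¹]) (Algebra.ofId ℂ c.R[T;T⁻¹]) laurentT

variable (s n t) in
/-- A function on `W`, as a function on the chart `ℂ* × W` of `L^*`. -/
def baseFun (k : ℤ) (c : Chart s n t) : c.R →ₐ[ℂ] (TotStar s n t k).A c :=
  laurentConst (R := c.R)

/-- `M` is the `𝒟`-module `𝒪^β_{L^*}` on the complement of the zero section of the `k`-th power of
the line bundle, where `k β = ℓ` is an integer: over a chart `c` it is the inverse image of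
`𝒪^β_{ℂ*}` under the projection `ℂ* × W → ℂ*` (that is, `𝒪^β_{ℂ*} ⊠ 𝒪_W`), and these modules are
glued by identifying the generator over a chart with index `i` with `(s_i/s_j)^m` times the generator
over a chart with index `j`, for `m = k (β + 1) = ℓ + k`. -/
def IsOBeta (k : ℤ) (β : ℂ) (ℓ : ℤ) (M : DMod (TotStar s n t k)) : Prop :=
  ∃ r : ∀ c, TorusModule β →+ M.M c,
    (∀ c : Chart s n t, IsDPullback (torusProj s n t k c) (r c)) ∧
    ∀ {c c' : Chart s n t} (h : c ≤ c'),
      r c (TorusModule.gen β) =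
        baseFun s n t k c ((Chart.trans h ^ (ℓ + k) : c.Rˣ) : c.R) •
          M.res h (r c' (TorusModule.gen β))

end TotalSpaces

end

noncomputable section

/-! ## Coordinate systems -/

/-! Over a chart with ring `R`, the module 𝒪^β on `L^*` is the trivial line bundle `R[T;T⁻¹]` with
connection θ + γ θ(T)/T, where γ = -(β+1): the relation (∂_t t + β)u = 0 says t∂_t u = γu. If the
fibre coordinate changes by α^k, the factor α^m is compatible with the connections because m = kγ,
and this is where kβ ∈ ℤ enters. Every section is a function times the generator, so the gluing rule
determines the module up to isomorphism (`IsOBeta.exists_iso`), and both sides of the theorem can be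
computed on explicit models.

Fourier side. After pulling back to L ×_X L^∨ and twisting by e^{-ty}, the vertical derivative on
`R[X][T;T⁻¹]` sends T^j to (j-β-1)T^{j-1} - yT^j. It is injective (`fourierD_injective`), and its
cokernel is free over R on the classes e_j of T^j dt, with y e_j = (j-β-1)e_{j-1} and ∂_y e_j =
-e_{j+1}. This is `Ladder`. The factors coming from dt, T^j and the generator combine to the
transition function α^{kj-ℓ}.

Dual side. The modules to be dualized have, over a chart, the form 𝒟/𝒟(∂_1, …, ∂_n, y∂_y - a). These
operators commute and form a regular sequence, so the long exact sequences of Ext leave only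
Ext^{n+1}(M, 𝒟) = 𝒟/∑P_i𝒟 (`RegularSeq.ext_main`). The formal adjoint with respect to the volume
form of the coordinates turns this right module into 𝒟/𝒟(∂_1, …, ∂_n, y∂_y + a + 1). Hence 𝒪^{-β},
whose exponent is γ = β-1, has dual with exponent -β, and j₊ of that dual is `R[T;T⁻¹]` with y∂_y
acting on y^j by j-β. If m₀ > |β|, then y^{-m₀} generates this direct image, with a = -β-m₀; and
e_{1-m₀} generates the ladder module, with y∂_y acting on it by β+m₀-1 = -(a+1). So over each chart
the ladder module is the dual of j₊𝔻𝒪^{-β}.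

Gluing. The identification with the dual depends on the coordinates and generators of the chart. Two
such identifications differ by a 𝒟-linear endomorphism of the module, and this is a scalar: the
Euler operator has distinct eigenvalues on the graded pieces, and a function killed by all vector
fields on a smooth integral complex chart is constant (`exists_scalar_of_graded`,
`Coords.exists_eq_algebraMap`). Comparing a chart with a smaller one thus gives a multiplicative
cocycle. Since X is irreducible, any two nonempty charts contain a common nonempty one, so the
cocycle is a coboundary (`exists_coboundary`), and rescaling makes the identifications compatible
(`isHolonomicDual_of_frames`). -/

theorem vf_sum_apply {A : Type} [CommRing A] [Algebra ℂ A] {ι : Type} (s : Finset ι)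
    (f : ι → VF A) (a : A) : (∑ i ∈ s, f i) a = ∑ i ∈ s, f i a := by
  have := map_sum (Derivation.coeFnAddMonoidHom (R := ℂ) (A := A) (M := A)) f s
  exact (congrFun this a).trans (Finset.sum_apply _ _ _)

/-- A coordinate system on `Spec A`: functions `x_i` and vector fields `∂_i` with
`∂_i x_j = δ_ij`, such that a vector field is determined by its values on the `x_i`. -/
structure Coords (A : Type) [CommRing A] [Algebra ℂ A] (m : ℕ) where
  x : Fin m → A
  d : Fin m → VF A
  dual : ∀ i j, d i (x j) = if i = j then 1 else 0
  sep : ∀ θ : VF A, (∀ i, θ (x i) = 0) → θ = 0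

namespace Coords

variable {A : Type} [CommRing A] [Algebra ℂ A] {m : ℕ} (F : Coords A m)

theorem ext_vf {θ η : VF A} (h : ∀ i, θ (F.x i) = η (F.x i)) : θ = η :=
  sub_eq_zero.mp (F.sep _ fun i => by simp [h i])

theorem eq_sum (θ : VF A) : θ = ∑ i, θ (F.x i) • F.d i := by
  refine F.ext_vf fun j => ?_
  have : (∑ i, θ (F.x i) • F.d i) (F.x j) = ∑ i, θ (F.x i) * F.d i (F.x j) := by
    rw [vf_sum_apply]
    rfl
  rw [this]
  simp [F.dual]

theorem apply_eq_sum (θ : VF A) (a : A) : θ a = ∑ i, θ (F.x i) * F.d i a := by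
  conv_lhs => rw [F.eq_sum θ]
  rw [vf_sum_apply]
  rfl

theorem lie_d (i j : Fin m) : ⁅F.d i, F.d j⁆ = 0 := by
  refine F.sep _ fun l => ?_
  rw [Derivation.commutator_apply, F.dual, F.dual]
  split_ifs <;> simp

theorem d_comm (i j : Fin m) (a : A) : F.d i (F.d j a) = F.d j (F.d i a) := by
  have h := congrArg (fun θ : VF A => θ a) (F.lie_d i j)
  simp only [Derivation.commutator_apply, Derivation.coe_zero, Pi.zero_apply] at h
  exact sub_eq_zero.mp h

/-- The vector fields of a coordinate system form a basis. -/
def basis : Module.Basis (Fin m) A (VF A) :=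
  Module.Basis.mk (v := F.d)
    (by
      rw [Fintype.linearIndependent_iff]
      intro g hg j
      have h := congrArg (fun θ : VF A => θ (F.x j)) hg
      have e : (∑ i, g i • F.d i) (F.x j) = ∑ i, g i * F.d i (F.x j) := by
        rw [vf_sum_apply]
        rfl
      simp only [e, F.dual] at h
      simpa using h)
    (fun θ _ => by
      rw [F.eq_sum θ]
      exact Submodule.sum_mem _ fun i _ =>
        Submodule.smul_mem _ _ (Submodule.subset_span ⟨i, rfl⟩))

@[simp] theorem basis_apply (i : Fin m) : F.basis i = F.d i := by
  simp [basis]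

theorem basis_repr (θ : VF A) (i : Fin m) : F.basis.repr θ i = θ (F.x i) := by
  conv_lhs => rw [F.eq_sum θ]
  simp only [← F.basis_apply, map_sum, map_smul, Module.Basis.repr_self]
  simp [Finsupp.single_apply]

end Coords

theorem ofVF_smul_smul {A : Type} [CommRing A] [Algebra ℂ A] {M : Type} [AddCommGroup M]
    [Module A M] [Module (DiffOp A) M] [DCompatible A M] (θ : VF A) (a : A) (m : M) :
    DiffOp.ofVF θ • a • m = θ a • m + a • DiffOp.ofVF θ • m := by
  have e : DiffOp.ofVF θ * DiffOp.ofFun a =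
      DiffOp.ofFun (θ a) + DiffOp.ofFun a * DiffOp.ofVF θ := by
    apply Subtype.val_injective
    refine LinearMap.ext fun b => ?_
    change θ (a * b) = θ a * b + a * θ b
    rw [Derivation.leibniz]
    simp [mul_comm, add_comm]
  rw [← DCompatible.ofFun_smul, ← mul_smul, e, add_smul, mul_smul, DCompatible.ofFun_smul,
    DCompatible.ofFun_smul]

/-! ## Normally ordered differential operators -/

namespace DiffOp

variable {A : Type} [CommRing A] [Algebra ℂ A]

theorem toEnd_injective : Function.Injective (DiffOp.toEnd (A := A)) := Subtype.val_injective

theorem toEnd_ofFun (a b : A) : (ofFun a).toEnd b = a * b := rfl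

theorem toEnd_ofVF (θ : VF A) (b : A) : (ofVF θ).toEnd b = θ b := rfl

theorem ofVF_mul_ofFun (θ : VF A) (a : A) :
    ofVF θ * ofFun a = ofFun a * ofVF θ + ofFun (θ a) := by
  apply toEnd_injective
  refine LinearMap.ext fun b => ?_
  change θ (a * b) = a * θ b + θ a * b
  rw [Derivation.leibniz]
  simp [mul_comm]

theorem ofVF_smul (a : A) (θ : VF A) : ofVF (a • θ) = ofFun a * ofVF θ := rfl

theorem ofVF_add (θ η : VF A) : ofVF (θ + η) = ofVF θ + ofVF η := rfl

theorem ofVF_zero : ofVF (0 : VF A) = 0 := rfl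

theorem ofVF_sum {ι : Type} (s : Finset ι) (f : ι → VF A) :
    ofVF (∑ i ∈ s, f i) = ∑ i ∈ s, ofVF (f i) := by
  classical
  induction s using Finset.induction_on with
  | empty => rfl
  | insert i s hi ih => rw [Finset.sum_insert hi, Finset.sum_insert hi, ofVF_add, ih]

theorem ofVF_lie (θ η : VF A) : ofVF ⁅θ, η⁆ = ofVF θ * ofVF η - ofVF η * ofVF θ := rfl

theorem ofVF_eq_sum {m : ℕ} (F : Coords A m) (θ : VF A) :
    ofVF θ = ∑ i, ofFun (θ (F.x i)) * ofVF (F.d i) := by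
  conv_lhs => rw [F.eq_sum θ]
  rw [ofVF_sum]
  rfl

theorem ofVF_commute {m : ℕ} (F : Coords A m) (i j : Fin m) :
    Commute (ofVF (F.d i)) (ofVF (F.d j)) := by
  have h := ofVF_lie (F.d i) (F.d j)
  rw [F.lie_d, ofVF_zero] at h
  exact (sub_eq_zero.mp h.symm)

/-- Induction on differential operators. -/
theorem induction {p : DiffOp A → Prop} (hf : ∀ a, p (ofFun a)) (hv : ∀ θ, p (ofVF θ))
    (ha : ∀ P Q, p P → p Q → p (P + Q)) (hm : ∀ P Q, p P → p Q → p (P * Q)) (P : DiffOp A) :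
    p P := by
  obtain ⟨P, hP⟩ := P
  refine Algebra.adjoin_induction (p := fun Q hQ => p (⟨Q, hQ⟩ : diffOpSubalgebra A))
    ?_ ?_ ?_ ?_ hP
  · rintro _ (⟨a, rfl⟩ | ⟨θ, rfl⟩)
    · exact hf a
    · exact hv θ
  · intro r
    have := hf (algebraMap ℂ A r)
    rwa [AlgHom.commutes] at this
  · intro P Q hP hQ h h'
    exact ha _ _ h h'
  · intro P Q hP hQ h h'
    exact hm _ _ h h'

end DiffOp

/-- A representation of the functions and of the coordinate vector fields in a ring, satisfying the
relations of differential operators. -/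
structure WeylRep {A : Type} [CommRing A] [Algebra ℂ A] {m : ℕ} (F : Coords A m)
    (E : Type) [Ring E] where
  ρ : A →+* E
  δ : Fin m → E
  comm : ∀ i j, Commute (δ i) (δ j)
  leib : ∀ i a, δ i * ρ a = ρ a * δ i + ρ (F.d i a)

namespace WeylRep

variable {A : Type} [CommRing A] [Algebra ℂ A] {m : ℕ} {F : Coords A m}
  {E : Type} [Ring E] (W : WeylRep F E)

theorem closure_comm : ∀ x ∈ Set.range W.δ, ∀ y ∈ Set.range W.δ, x * y = y * x := by
  rintro _ ⟨i, rfl⟩ _ ⟨j, rfl⟩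
  exact W.comm i j

/-- Commutativity gives access to evaluation of `MvPolynomial`, which defines monomials in the `δ i`
without fixing an order of the factors. -/
instance : CommRing (Subring.closure (Set.range W.δ)) where
  __ := (inferInstance : Ring (Subring.closure (Set.range W.δ)))
  mul_comm a b :=
    (Subring.isMulCommutative_closure W.closure_comm).is_comm.comm a b

/-- The monomials in the `δ_i`. -/
def mon (α : Fin m →₀ ℕ) : E :=
  ((MvPolynomial.eval₂Hom (Int.castRingHom (Subring.closure (Set.range W.δ)))
    (fun i => (⟨W.δ i, Subring.subset_closure ⟨i, rfl⟩⟩ : Subring.closure (Set.range W.δ)))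
    (MvPolynomial.monomial α 1) : Subring.closure (Set.range W.δ)) : E)

theorem mon_zero : W.mon 0 = 1 := by
  unfold mon
  rw [show (MvPolynomial.monomial (0 : Fin m →₀ ℕ) (1 : ℤ)) = 1 from rfl, map_one]
  rfl

theorem mon_add_single (α : Fin m →₀ ℕ) (i : Fin m) :
    W.mon (α + Finsupp.single i 1) = W.mon α * W.δ i := by
  unfold mon
  have e : (MvPolynomial.monomial (α + Finsupp.single i 1) (1 : ℤ)) =
    MvPolynomial.monomial α 1 * MvPolynomial.X i := by
    rw [MvPolynomial.X, MvPolynomial.monomial_mul, one_mul]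
  rw [e, map_mul, MvPolynomial.eval₂Hom_X']
  rfl

theorem mon_commute (α : Fin m →₀ ℕ) (i : Fin m) : W.mon α * W.δ i = W.δ i * W.mon α := by
  have h := mul_comm (MvPolynomial.eval₂Hom (Int.castRingHom (Subring.closure (Set.range W.δ)))
    (fun i => (⟨W.δ i, Subring.subset_closure ⟨i, rfl⟩⟩ : Subring.closure (Set.range W.δ)))
    (MvPolynomial.monomial α 1)) ⟨W.δ i, Subring.subset_closure ⟨i, rfl⟩⟩
  exact congrArg Subtype.val h

/-- The normally ordered operator with a given symbol. -/
def op : MvPolynomial (Fin m) A →+ E :=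
  (Finsupp.liftAddHom fun α => (AddMonoidHom.mulRight (W.mon α)).comp
    (W.ρ : A →+ E)).comp (AddMonoidAlgebra.coeffAddEquiv
      (R := A) (M := Fin m →₀ ℕ)).toAddMonoidHom

theorem op_monomial (α : Fin m →₀ ℕ) (a : A) :
    W.op (MvPolynomial.monomial α a) = W.ρ a * W.mon α := by
  change Finsupp.liftAddHom _ (Finsupp.single α a) = _
  rw [Finsupp.liftAddHom_apply_single]
  rfl

theorem op_C (a : A) : W.op (MvPolynomial.C a) = W.ρ a := by
  rw [← MvPolynomial.monomial_zero', op_monomial, mon_zero, mul_one]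

theorem op_C_mul (a : A) (f : MvPolynomial (Fin m) A) :
    W.op (MvPolynomial.C a * f) = W.ρ a * W.op f := by
  induction f using MvPolynomial.induction_on' with
  | monomial α b =>
    rw [MvPolynomial.C_mul_monomial, op_monomial, op_monomial, map_mul, mul_assoc]
  | add p q hp hq => rw [mul_add, map_add, map_add, hp, hq, mul_add]

theorem op_mul_X (f : MvPolynomial (Fin m) A) (i : Fin m) :
    W.op (f * MvPolynomial.X i) = W.op f * W.δ i := by
  induction f using MvPolynomial.induction_on' with
  | monomial α b =>
    rw [MvPolynomial.X, MvPolynomial.monomial_mul, mul_one, op_monomial, op_monomial,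
      mon_add_single, mul_assoc]
  | add p q hp hq => rw [add_mul, map_add, map_add, hp, hq, add_mul]

theorem exists_δ_mul_op (f : MvPolynomial (Fin m) A) (i : Fin m) :
    ∃ g, W.δ i * W.op f = W.op g := by
  induction f using MvPolynomial.induction_on' with
  | monomial α b =>
    refine ⟨MvPolynomial.monomial α b * MvPolynomial.X i + MvPolynomial.monomial α (F.d i b), ?_⟩
    rw [map_add, op_mul_X, op_monomial, op_monomial, ← mul_assoc, W.leib, add_mul, mul_assoc,
      mul_assoc, mon_commute]
  | add p q hp hq =>
    obtain ⟨g, hg⟩ := hp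
    obtain ⟨h, hh⟩ := hq
    exact ⟨g + h, by rw [map_add, mul_add, hg, hh, map_add]⟩

theorem exists_op_mul_op (f g : MvPolynomial (Fin m) A) : ∃ h, W.op f * W.op g = W.op h := by
  induction f using MvPolynomial.induction_on generalizing g with
  | C a => exact ⟨MvPolynomial.C a * g, by rw [op_C, op_C_mul]⟩
  | add p q hp hq =>
    obtain ⟨h, hh⟩ := hp g
    obtain ⟨h', hh'⟩ := hq g
    exact ⟨h + h', by rw [map_add, add_mul, hh, hh', map_add]⟩
  | mul_X p i hp =>
    obtain ⟨g', hg'⟩ := W.exists_δ_mul_op g i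
    obtain ⟨h, hh⟩ := hp g'
    exact ⟨h, by rw [op_mul_X, mul_assoc, hg', hh]⟩

/-- The commutator with a coordinate acts on symbols as the derivative in the dual variable. This
lowers the order, and it is what makes symbols unique. -/
theorem op_mul_ρ_x (f : MvPolynomial (Fin m) A) (i : Fin m) :
    W.op f * W.ρ (F.x i) = W.ρ (F.x i) * W.op f + W.op (MvPolynomial.pderiv i f) := by
  induction f using MvPolynomial.induction_on with
  | C a =>
    rw [op_C, MvPolynomial.pderiv_C, map_zero, add_zero, ← map_mul, ← map_mul, mul_comm]
  | add p q hp hq => simp only [map_add, add_mul, mul_add, hp, hq]; abel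
  | mul_X p j hp =>
    rw [op_mul_X, mul_assoc, W.leib, mul_add, ← mul_assoc, hp, Derivation.leibniz, map_add,
      F.dual, MvPolynomial.pderiv_X, smul_eq_mul, smul_eq_mul,
      mul_comm (MvPolynomial.X j) (MvPolynomial.pderiv i p), op_mul_X, add_mul, mul_assoc]
    by_cases h : j = i
    · subst h
      simp
      abel
    · rw [if_neg h, Pi.single_eq_of_ne h]
      simp

end WeylRep

namespace Coords

variable {A : Type} [CommRing A] [Algebra ℂ A] {m : ℕ} (F : Coords A m)

/-- The tautological representation. -/
def rep : WeylRep F (DiffOp A) where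
  ρ := (DiffOp.ofFun : A →ₐ[ℂ] DiffOp A).toRingHom
  δ i := DiffOp.ofVF (F.d i)
  comm := DiffOp.ofVF_commute F
  leib _ _ := DiffOp.ofVF_mul_ofFun _ _

theorem rep_ρ (a : A) : F.rep.ρ a = DiffOp.ofFun a := rfl

/-- In normal order every term except the one of order zero ends in a vector field, which kills the
constant function 1. -/
theorem rep_op_toEnd_one (f : MvPolynomial (Fin m) A) :
    (F.rep.op f).toEnd 1 = MvPolynomial.coeff 0 f := by
  induction f using MvPolynomial.induction_on with
  | C a =>
    rw [WeylRep.op_C, MvPolynomial.coeff_zero_C]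
    exact mul_one a
  | add p q hp hq => rw [map_add, map_add, LinearMap.add_apply, hp, hq, MvPolynomial.coeff_add]
  | mul_X p j hp =>
    rw [WeylRep.op_mul_X, map_mul]
    change (F.rep.op p).toEnd ((F.d j) 1) = _
    rw [Derivation.map_one_eq_zero, map_zero]
    simp [MvPolynomial.coeff_mul_X']

/-- If the operator vanishes, so do its commutators with coordinates, whose symbols are the partial
derivatives of `f`. Repeated differentiation moves any coefficient to the constant term, up to a
positive integer, which is invertible because `A` is a ℂ-algebra. -/
theorem rep_op_injective : Function.Injective F.rep.op := by
  rw [injective_iff_map_eq_zero]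
  intro f hf
  have key : ∀ (N : ℕ) (α : Fin m →₀ ℕ), α.degree = N →
      ∀ f, F.rep.op f = 0 → MvPolynomial.coeff α f = 0 := by
    intro N
    induction N with
    | zero =>
      intro α hα f hf
      rw [Finsupp.degree_eq_zero_iff] at hα
      rw [hα, ← F.rep_op_toEnd_one, hf]
      rfl
    | succ N ih =>
      intro α hα f hf
      have : ∃ i, α i ≠ 0 := by
        by_contra! h
        have : α = 0 := Finsupp.ext h
        simp [this] at hα
      obtain ⟨i, hi⟩ := this
      have hd : F.rep.op (MvPolynomial.pderiv i f) = 0 := by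
        have := F.rep.op_mul_ρ_x f i
        rw [hf, zero_mul, mul_zero, zero_add] at this
        exact this.symm
      obtain ⟨γ, rfl⟩ : ∃ γ, α = γ + Finsupp.single i 1 :=
        ⟨α - Finsupp.single i 1, by
          rw [tsub_add_cancel_of_le]
          simpa [Nat.one_le_iff_ne_zero] using hi⟩
      have hγ : γ.degree = N := by
        simpa using hα
      have h0 := ih γ hγ _ hd
      rw [MvPolynomial.coeff_pderiv] at h0
      have hu : IsUnit ((γ i + 1 : ℕ) : A) := by
        have : ((γ i + 1 : ℕ) : A) = algebraMap ℂ A ((γ i + 1 : ℕ) : ℂ) := by simp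
        rw [this]
        exact (IsUnit.mk0 _ (Nat.cast_ne_zero.mpr (Nat.succ_ne_zero _))).map _
      push_cast at hu
      exact (hu.mul_left_eq_zero).mp h0
  exact MvPolynomial.ext _ _ fun α => by
    rw [key _ α rfl f hf, MvPolynomial.coeff_zero]

theorem rep_op_surjective : Function.Surjective F.rep.op := by
  intro P
  induction P using DiffOp.induction with
  | hf a => exact ⟨_, F.rep.op_C a⟩
  | hv θ =>
    refine ⟨∑ i, MvPolynomial.C (θ (F.x i)) * MvPolynomial.X i, ?_⟩
    rw [map_sum, DiffOp.ofVF_eq_sum F θ]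
    refine Finset.sum_congr rfl fun i _ => ?_
    rw [WeylRep.op_mul_X, WeylRep.op_C]
    rfl
  | ha P Q hP hQ =>
    obtain ⟨f, rfl⟩ := hP
    obtain ⟨g, rfl⟩ := hQ
    exact ⟨f + g, map_add _ _ _⟩
  | hm P Q hP hQ =>
    obtain ⟨f, rfl⟩ := hP
    obtain ⟨g, rfl⟩ := hQ
    obtain ⟨h, hh⟩ := F.rep.exists_op_mul_op f g
    exact ⟨h, hh.symm⟩

/-- The (full) symbol of a differential operator. -/
def symb : DiffOp A ≃+ MvPolynomial (Fin m) A :=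
  (AddEquiv.ofBijective F.rep.op ⟨F.rep_op_injective, F.rep_op_surjective⟩).symm

theorem symb_op (f : MvPolynomial (Fin m) A) : F.symb (F.rep.op f) = f :=
  (AddEquiv.ofBijective F.rep.op _).symm_apply_apply f

theorem op_symb (P : DiffOp A) : F.rep.op (F.symb P) = P :=
  (AddEquiv.ofBijective F.rep.op ⟨F.rep_op_injective, F.rep_op_surjective⟩).apply_symm_apply P

/-- Induction on normally ordered operators. -/
theorem op_induction {p : DiffOp A → Prop} (hf : ∀ a, p (DiffOp.ofFun a))
    (ha : ∀ P Q, p P → p Q → p (P + Q)) (hm : ∀ P i, p P → p (P * DiffOp.ofVF (F.d i)))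
    (P : DiffOp A) : p P := by
  rw [← F.op_symb P]
  induction F.symb P using MvPolynomial.induction_on with
  | C a => rw [WeylRep.op_C]; exact hf a
  | add f g hf hg => rw [map_add]; exact ha _ _ hf hg
  | mul_X f i h => rw [WeylRep.op_mul_X]; exact hm _ _ h

end Coords

namespace WeylRep

variable {A : Type} [CommRing A] [Algebra ℂ A] {m : ℕ} {F : Coords A m}
  {E : Type} [Ring E]

/-- The product of two representations. -/
def prod {E' : Type} [Ring E'] (W : WeylRep F E) (W' : WeylRep F E') : WeylRep F (E × E') where
  ρ := W.ρ.prod W'.ρ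
  δ i := (W.δ i, W'.δ i)
  comm i j := Prod.ext (W.comm i j) (W'.comm i j)
  leib i a := Prod.ext (W.leib i a) (W'.leib i a)

theorem prod_op {E' : Type} [Ring E'] (W : WeylRep F E) (W' : WeylRep F E')
    (f : MvPolynomial (Fin m) A) : (W.prod W').op f = (W.op f, W'.op f) := by
  induction f using MvPolynomial.induction_on with
  | C a => rw [op_C, op_C, op_C]; rfl
  | add p q hp hq => rw [map_add, map_add, map_add, hp, hq]; rfl
  | mul_X p i hp => rw [op_mul_X, op_mul_X, op_mul_X, hp]; rfl

/-- A representation of functions and coordinate vector fields extends to differential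
operators. -/
def lift (W : WeylRep F E) : DiffOp A →+* E where
  toFun P := W.op (F.symb P)
  map_zero' := by simp
  map_add' := by simp
  map_one' := by
    have : F.symb 1 = MvPolynomial.C 1 := by
      rw [← F.symb_op (MvPolynomial.C 1), op_C, map_one F.rep.ρ]
    rw [this, op_C, map_one]
  map_mul' P Q := by
    -- Working in the product of the tautological representation and `W` yields one symbol `h` that
    -- describes the product of operators in both rings at once; the first component identifies it
    -- with the symbol of `P * Q`.
    obtain ⟨h, hh⟩ := (F.rep.prod W).exists_op_mul_op (F.symb P) (F.symb Q)
    simp only [prod_op, F.op_symb, Prod.mk_mul_mk] at hh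
    have h1 := congrArg Prod.fst hh
    have h2 := congrArg Prod.snd hh
    simp only at h1 h2
    rw [h2, h1, F.symb_op]

@[simp] theorem lift_ofFun (W : WeylRep F E) (a : A) : W.lift (DiffOp.ofFun a) = W.ρ a := by
  change W.op (F.symb _) = _
  rw [← F.rep_ρ, ← op_C, F.symb_op, op_C]

@[simp] theorem lift_ofVF_d (W : WeylRep F E) (i : Fin m) :
    W.lift (DiffOp.ofVF (F.d i)) = W.δ i := by
  change W.op (F.symb _) = _
  have : DiffOp.ofVF (F.d i) = F.rep.op (MvPolynomial.C 1 * MvPolynomial.X i) := by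
    rw [op_mul_X, op_C, map_one, one_mul]
    rfl
  rw [this, F.symb_op, op_mul_X, op_C, map_one, one_mul]

theorem lift_ofVF (W : WeylRep F E) (θ : VF A) :
    W.lift (DiffOp.ofVF θ) = ∑ i, W.ρ (θ (F.x i)) * W.δ i := by
  rw [DiffOp.ofVF_eq_sum F θ, map_sum]
  refine Finset.sum_congr rfl fun i _ => ?_
  rw [map_mul, lift_ofFun, lift_ofVF_d]

end WeylRep

theorem DiffOp.hom_ext {A : Type} [CommRing A] [Algebra ℂ A] {m : ℕ} (F : Coords A m)
    {E : Type} [Ring E] {f g : DiffOp A →+* E} (h : ∀ a, f (ofFun a) = g (ofFun a))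
    (h' : ∀ i, f (ofVF (F.d i)) = g (ofVF (F.d i))) : f = g := by
  refine RingHom.ext fun P => ?_
  induction P using F.op_induction with
  | hf a => exact h a
  | ha P Q hP hQ => rw [map_add, map_add, hP, hQ]
  | hm P i hP => rw [map_mul, map_mul, hP, h']

end

noncomputable section

/-! ## Vector fields on polynomial and Laurent polynomial rings -/

section

variable {R : Type} [CommRing R] [Algebra ℂ R]

/-- The vector field on a monoid algebra that acts on the coefficients of degree `i` by `L i`. -/
def gradedVF {G : Type} [AddCommMonoid G] (L : G → R →ₗ[ℂ] R)
    (hL : ∀ i j r r', L (i + j) (r * r') = r * L j r' + r' * L i r) : VF (AddMonoidAlgebra R G) :=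
  Derivation.mk'
    ((Finsupp.lsum ℂ fun i => (AddMonoidAlgebra.lsingle (R := ℂ) i) ∘ₗ L i) ∘ₗ
      (AddMonoidAlgebra.coeffLinearEquiv ℂ).toLinearMap)
    (fun f g => by
      have hs : ∀ i r, ((Finsupp.lsum ℂ fun i => (AddMonoidAlgebra.lsingle (R := ℂ) i) ∘ₗ L i) ∘ₗ
          (AddMonoidAlgebra.coeffLinearEquiv ℂ).toLinearMap) (AddMonoidAlgebra.single i r) =
          AddMonoidAlgebra.single i (L i r) := by
        intro i r
        simp
      induction f using AddMonoidAlgebra.induction_linear with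
      | zero => simp
      | add p q hp hq =>
        rw [add_mul, map_add, hp, hq, map_add]
        simp only [smul_eq_mul]
        ring
      | single i r =>
        induction g using AddMonoidAlgebra.induction_linear with
        | zero => simp
        | add p q hp hq =>
          rw [mul_add, map_add, hp, hq, map_add]
          simp only [smul_eq_mul]
          ring
        | single j r' =>
          rw [AddMonoidAlgebra.single_mul_single, hs, hs, hs, hL, smul_eq_mul, smul_eq_mul,
            AddMonoidAlgebra.single_mul_single, AddMonoidAlgebra.single_mul_single,
            add_comm j i, ← AddMonoidAlgebra.single_add])

theorem gradedVF_single {G : Type} [AddCommMonoid G] (L : G → R →ₗ[ℂ] R)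
    (hL : ∀ i j r r', L (i + j) (r * r') = r * L j r' + r' * L i r) (i : G) (r : R) :
    gradedVF L hL (AddMonoidAlgebra.single i r) = AddMonoidAlgebra.single i (L i r) := by
  simp [gradedVF]

/-- The vector field `D` acting on the coefficients of Laurent polynomials. -/
def laurentCoeffVF (D : VF R) : VF R[T;T⁻¹] :=
  gradedVF (fun _ => (D : R →ₗ[ℂ] R)) (fun i j r r' => by simp)

/-- The Euler vector field `T ∂_T`. -/
def laurentEuler : VF R[T;T⁻¹] :=
  gradedVF (fun i => (i : ℂ) • LinearMap.id)
    (fun i j r r' => by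
      change ((i + j : ℤ) : ℂ) • (r * r') = r * ((j : ℂ) • r') + r' * ((i : ℂ) • r)
      simp only [Int.cast_add, Algebra.smul_def, map_add]
      ring)

/-- The vector field on `R[T;T⁻¹]` that extends `D` and maps `T` to `b`. -/
def laurentVF (D : VF R) (b : R[T;T⁻¹]) : VF R[T;T⁻¹] :=
  laurentCoeffVF D + (b * LaurentPolynomial.T (-1)) • laurentEuler

theorem laurentCoeffVF_C_mul_T (D : VF R) (r : R) (j : ℤ) :
    laurentCoeffVF D (LaurentPolynomial.C r * LaurentPolynomial.T j) =
      LaurentPolynomial.C (D r) * LaurentPolynomial.T j := by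
  rw [← LaurentPolynomial.single_eq_C_mul_T, ← LaurentPolynomial.single_eq_C_mul_T]
  exact gradedVF_single _ _ _ _

theorem laurentEuler_C_mul_T (r : R) (j : ℤ) :
    laurentEuler (LaurentPolynomial.C r * LaurentPolynomial.T j) =
      (j : ℂ) • (LaurentPolynomial.C r * LaurentPolynomial.T j) := by
  rw [← LaurentPolynomial.single_eq_C_mul_T]
  refine (gradedVF_single _ _ _ _).trans ?_
  rw [AddMonoidAlgebra.smul_single]
  rfl

theorem laurentVF_C_mul_T (D : VF R) (b : R[T;T⁻¹]) (r : R) (j : ℤ) :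
    laurentVF D b (LaurentPolynomial.C r * LaurentPolynomial.T j) =
      LaurentPolynomial.C (D r) * LaurentPolynomial.T j +
        (j : ℂ) • (b * (LaurentPolynomial.C r * LaurentPolynomial.T (j - 1))) := by
  rw [laurentVF, Derivation.add_apply, Derivation.smul_apply, laurentCoeffVF_C_mul_T,
    laurentEuler_C_mul_T, smul_eq_mul, mul_smul_comm, sub_eq_add_neg, LaurentPolynomial.T_add]
  congr 2
  ring

@[simp] theorem laurentVF_C (D : VF R) (b : R[T;T⁻¹]) (r : R) :
    laurentVF D b (LaurentPolynomial.C r) = LaurentPolynomial.C (D r) := by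
  have := laurentVF_C_mul_T D b r 0
  simpa using this

@[simp] theorem laurentVF_T (D : VF R) (b : R[T;T⁻¹]) :
    laurentVF D b (LaurentPolynomial.T 1) = b := by
  have := laurentVF_C_mul_T D b 1 1
  simpa using this

theorem vf_zpow {A : Type} [CommRing A] [Algebra ℂ A] (θ : VF A) (u : Aˣ) (j : ℤ) :
    θ ((u ^ j : Aˣ) : A) = (j : ℂ) • (((u ^ (j - 1) : Aˣ) : A) * θ u) := by
  induction j with
  | zero => simp
  | succ i ih =>
    rw [zpow_add_one, Units.val_mul, Derivation.leibniz, ih, add_sub_cancel_right,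
      smul_eq_mul, smul_eq_mul, mul_smul_comm, ← mul_assoc, ← Units.val_mul, zpow_sub_one,
      mul_comm u, inv_mul_cancel_right]
    push_cast
    rw [add_smul, one_smul, add_comm]
  | pred i ih =>
    -- Negative exponents: differentiate `u ^ (-i) = u ^ (-i-1) * u` and solve for the derivative of
    -- `u ^ (-i-1)`.
    have h : ((u ^ (-(i:ℤ)) : Aˣ) : A) = ((u ^ (-(i:ℤ) - 1) : Aˣ) : A) * u := by
      rw [← Units.val_mul, ← zpow_add_one, sub_add_cancel]
    have h2 : ((u ^ (-(i:ℤ) - 1) : Aˣ) : A) = ((u ^ (-(i:ℤ) - 1 - 1) : Aˣ) : A) * u := by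
      rw [← Units.val_mul, ← zpow_add_one, sub_add_cancel]
    have h3 := ih
    rw [h, Derivation.leibniz, smul_eq_mul, smul_eq_mul] at h3
    have h4 : (u : A) * θ ((u ^ (-(i:ℤ) - 1) : Aˣ) : A) =
        u * (((-(i : ℤ) - 1 : ℤ) : ℂ) • (((u ^ (-(i:ℤ) - 1 - 1) : Aˣ) : A) * θ u)) := by
      rw [mul_smul_comm, ← mul_assoc, mul_comm (u : A) ((u ^ (-(i:ℤ) - 1 - 1) : Aˣ) : A), ← h2]
      push_cast at h3 ⊢
      rw [sub_smul, one_smul]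
      exact eq_sub_of_add_eq' h3
    have := congrArg (fun z => ((u⁻¹ : Aˣ) : A) * z) h4
    simpa only [Units.inv_mul_cancel_left] using this

theorem laurentT_zpow {R : Type} [CommRing R] (j : ℤ) :
    ((laurentT ^ j : (R[T;T⁻¹])ˣ) : R[T;T⁻¹]) = LaurentPolynomial.T j := by
  induction j with
  | zero => simp
  | succ i ih =>
    rw [zpow_add_one, Units.val_mul, ih, LaurentPolynomial.T_add]
    rfl
  | pred i ih =>
    rw [zpow_sub_one, Units.val_mul, ih, sub_eq_add_neg, LaurentPolynomial.T_add]
    rfl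

theorem vf_T (θ : VF R[T;T⁻¹]) (j : ℤ) : θ (LaurentPolynomial.T j) =
    (j : ℂ) • (LaurentPolynomial.T (j - 1) * θ (LaurentPolynomial.T 1)) := by
  rw [← laurentT_zpow, vf_zpow, laurentT_zpow]
  rfl

theorem laurent_vf_ext {θ η : VF R[T;T⁻¹]}
    (h : ∀ r, θ (LaurentPolynomial.C r) = η (LaurentPolynomial.C r))
    (hT : θ (LaurentPolynomial.T 1) = η (LaurentPolynomial.T 1)) : θ = η := by
  refine Derivation.ext fun p => ?_
  induction p using LaurentPolynomial.induction_on' with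
  | add p q hp hq => rw [map_add, map_add, hp, hq]
  | C_mul_T j r => rw [Derivation.leibniz, Derivation.leibniz, h, vf_T θ j, vf_T η j, hT]

theorem poly_vf_ext {θ η : VF R[X]} (h : ∀ r, θ (Polynomial.C r) = η (Polynomial.C r))
    (hX : θ Polynomial.X = η Polynomial.X) : θ = η := by
  refine Derivation.ext fun p => ?_
  induction p using Polynomial.induction_on' with
  | add p q hp hq => rw [map_add, map_add, hp, hq]
  | monomial j r =>
    rw [← Polynomial.C_mul_X_pow_eq_monomial, Derivation.leibniz, Derivation.leibniz, h,
      Derivation.leibniz_pow, Derivation.leibniz_pow, hX]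

/-- The vector field `D` acting on the coefficients of polynomials. -/
def polyCoeffVF (D : VF R) : VF R[X] :=
  Derivation.mk'
    { toFun := fun p => p.sum fun i r => Polynomial.monomial i (D r)
      map_add' := fun p q => Polynomial.sum_add_index _ _ _ (by simp) (by simp)
      map_smul' := fun z p => by
        have := Polynomial.sum_smul_index p (algebraMap ℂ R z)
          (fun i r => Polynomial.monomial i (D r)) (by simp)
        rw [algebraMap_smul] at this
        rw [this]
        simp only [Polynomial.sum_def, RingHom.id_apply, Finset.smul_sum, Polynomial.smul_monomial]
        refine Finset.sum_congr rfl fun i _ => ?_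
        rw [← Algebra.smul_def, D.map_smul] }
    (fun p q => by
      have hs : ∀ i r, (Polynomial.monomial i r : R[X]).sum
          (fun i r => Polynomial.monomial i (D r)) = Polynomial.monomial i (D r) := fun i r =>
        Polynomial.sum_monomial_index _ _ (by simp)
      have ha : ∀ p q : R[X], (p + q).sum (fun i r => Polynomial.monomial i (D r)) =
          p.sum (fun i r => Polynomial.monomial i (D r)) +
            q.sum (fun i r => Polynomial.monomial i (D r)) := fun p q =>
        Polynomial.sum_add_index _ _ _ (by simp) (by simp)
      simp only [LinearMap.coe_mk, AddHom.coe_mk, smul_eq_mul]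
      induction p using Polynomial.induction_on' with
      | add p q hp hq => rw [add_mul, ha, hp, hq, ha]; ring
      | monomial i r =>
        induction q using Polynomial.induction_on' with
        | add p q hp hq => rw [mul_add, ha, hp, hq, ha]; ring
        | monomial j r' =>
          rw [Polynomial.monomial_mul_monomial, hs, hs, hs, Polynomial.monomial_mul_monomial,
            Polynomial.monomial_mul_monomial, Derivation.leibniz, add_comm j i, map_add]
          rfl)

/-- The vector field on `R[X]` that extends `D` and maps `X` to `b`. -/
def polyVF (D : VF R) (b : R[X]) : VF R[X] :=
  polyCoeffVF D + b • (Polynomial.derivative' (R := R)).restrictScalars ℂ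

@[simp] theorem polyVF_C (D : VF R) (b : R[X]) (r : R) :
    polyVF D b (Polynomial.C r) = Polynomial.C (D r) := by
  have : polyCoeffVF D (Polynomial.C r) = Polynomial.C (D r) := by
    change (Polynomial.C r).sum (fun i r => Polynomial.monomial i (D r)) = _
    rw [Polynomial.sum_C_index (by simp)]
    rfl
  rw [polyVF, Derivation.add_apply, this]
  simp [Polynomial.derivative']

@[simp] theorem polyVF_X (D : VF R) (b : R[X]) : polyVF D b Polynomial.X = b := by
  have : polyCoeffVF D Polynomial.X = 0 := by
    change (Polynomial.X : R[X]).sum (fun i r => Polynomial.monomial i (D r)) = _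
    rw [Polynomial.sum_X_index (by simp)]
    simp
  rw [polyVF, Derivation.add_apply, this]
  simp [Polynomial.derivative']

/-- The restriction to constants of a coefficient of a vector field on `R[X]`. -/
def polyVFCoeff (θ : VF R[X]) (i : ℕ) : VF R :=
  Derivation.mk'
    { toFun := fun r => (θ (Polynomial.C r)).coeff i
      map_add' := fun r r' => by simp
      map_smul' := fun z r => by
        rw [← Polynomial.smul_C, θ.map_smul, Polynomial.coeff_smul, RingHom.id_apply] }
    (fun r r' => by
      simp only [LinearMap.coe_mk, AddHom.coe_mk, map_mul, Derivation.leibniz,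
        Polynomial.coeff_add, smul_eq_mul, Polynomial.coeff_C_mul])

/-- The restriction to constants of a coefficient of a vector field on `R[T;T⁻¹]`. -/
def laurentVFCoeff (θ : VF R[T;T⁻¹]) (i : ℤ) : VF R :=
  Derivation.mk'
    { toFun := fun r => (θ (LaurentPolynomial.C r)).coeff i
      map_add' := fun r r' => by simp
      map_smul' := fun z r => by
        have : (LaurentPolynomial.C (z • r) : R[T;T⁻¹]) = z • LaurentPolynomial.C r := by
          rw [← LaurentPolynomial.single_eq_C, ← LaurentPolynomial.single_eq_C,
            AddMonoidAlgebra.smul_single]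
        rw [this, θ.map_smul, RingHom.id_apply]
        simp }
    (fun r r' => by
      change (θ (LaurentPolynomial.C (r * r'))).coeff i =
        r * (θ (LaurentPolynomial.C r')).coeff i + r' * (θ (LaurentPolynomial.C r)).coeff i
      rw [map_mul, Derivation.leibniz, smul_eq_mul, smul_eq_mul,
        ← LaurentPolynomial.smul_eq_C_mul, ← LaurentPolynomial.smul_eq_C_mul]
      simp)

namespace Coords

variable {n : ℕ} (F : Coords R n) (g : Rˣ)

/-- The coordinate system `(g y, x_1, …, x_n)` on `Spec R[y]`. -/
def poly : Coords R[X] (n + 1) where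
  x := Fin.cons (Polynomial.C (g : R) * Polynomial.X) fun i => Polynomial.C (F.x i)
  -- The unit `g` allows for the coordinate restricted from a larger chart, which is a unit times y.
  -- Fields on the base must kill gy, hence the correction term -g⁻¹ ∂_i(g) y in their value on y.
  d := Fin.cons (polyVF 0 (Polynomial.C ((g⁻¹ : Rˣ) : R))) fun i =>
    polyVF (F.d i) (-(Polynomial.C (((g⁻¹ : Rˣ) : R) * F.d i g) * Polynomial.X))
  dual i j := by
    have hg : (Polynomial.C (g : R) * Polynomial.C ((g⁻¹ : Rˣ) : R) : R[X]) = 1 := by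
      rw [← Polynomial.C_mul, Units.mul_inv, Polynomial.C_1]
    refine Fin.cases ?_ (fun i => ?_) i <;> refine Fin.cases ?_ (fun j => ?_) j
    · simp [Derivation.leibniz, hg]
    · simp [(Fin.succ_ne_zero j).symm]
    · simp only [Fin.cons_succ, Fin.cons_zero, Derivation.leibniz, polyVF_C, polyVF_X, smul_eq_mul,
        Fin.succ_ne_zero, if_false, map_mul]
      linear_combination (-Polynomial.C (F.d i g) * Polynomial.X) * hg
    · simp only [Fin.cons_succ, polyVF_C, F.dual, Fin.succ_inj]
      split_ifs <;> simp
  sep θ hθ := by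
    have h0 := hθ 0
    have hR : ∀ r, θ (Polynomial.C r) = 0 := by
      intro r
      ext i
      -- Coefficient by coefficient, θ restricted to constants is a vector field on the base, so it
      -- vanishes once it kills the base coordinates.
      have : polyVFCoeff θ i = 0 := F.sep _ fun j => by
        have := hθ j.succ
        rw [Fin.cons_succ] at this
        exact congrArg (fun p => Polynomial.coeff p i) this
      exact congrArg (fun η : VF R => η r) this
    rw [Fin.cons_zero, Derivation.leibniz, hR, smul_zero, add_zero, smul_eq_mul] at h0
    refine poly_vf_ext (fun r => by rw [hR]; rfl) ?_
    have := congrArg (fun z => Polynomial.C ((g⁻¹ : Rˣ) : R) * z) h0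
    rw [mul_zero, ← mul_assoc, ← Polynomial.C_mul, Units.inv_mul, Polynomial.C_1, one_mul] at this
    exact this

/-- The coordinate system `(g y, x_1, …, x_n)` on `Spec R[y, y⁻¹]`. -/
def laurent : Coords R[T;T⁻¹] (n + 1) where
  x := Fin.cons (LaurentPolynomial.C (g : R) * LaurentPolynomial.T 1)
    fun i => LaurentPolynomial.C (F.x i)
  d := Fin.cons (laurentVF 0 (LaurentPolynomial.C ((g⁻¹ : Rˣ) : R))) fun i =>
    laurentVF (F.d i) (-(LaurentPolynomial.C (((g⁻¹ : Rˣ) : R) * F.d i g) * LaurentPolynomial.T 1))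
  dual i j := by
    have hg : (LaurentPolynomial.C (g : R) * LaurentPolynomial.C ((g⁻¹ : Rˣ) : R) : R[T;T⁻¹]) = 1 := by
      rw [← map_mul, Units.mul_inv, map_one]
    refine Fin.cases ?_ (fun i => ?_) i <;> refine Fin.cases ?_ (fun j => ?_) j
    · simp [Derivation.leibniz, hg]
    · simp [(Fin.succ_ne_zero j).symm]
    · simp only [Fin.cons_succ, Fin.cons_zero, Derivation.leibniz, laurentVF_C, laurentVF_T,
        smul_eq_mul, Fin.succ_ne_zero, if_false, map_mul]
      linear_combination (-LaurentPolynomial.C (F.d i g) * LaurentPolynomial.T 1) * hg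
    · simp only [Fin.cons_succ, laurentVF_C, F.dual, Fin.succ_inj]
      split_ifs <;> simp
  sep θ hθ := by
    have h0 := hθ 0
    have hR : ∀ r, θ (LaurentPolynomial.C r) = 0 := by
      intro r
      apply LaurentPolynomial.ext
      intro i
      have : laurentVFCoeff θ i = 0 := F.sep _ fun j => by
        have := hθ j.succ
        rw [Fin.cons_succ] at this
        exact congrArg (fun p : R[T;T⁻¹] => p.coeff i) this
      exact congrArg (fun η : VF R => η r) this
    rw [Fin.cons_zero, Derivation.leibniz, hR, smul_zero, add_zero, smul_eq_mul] at h0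
    refine laurent_vf_ext (fun r => by rw [hR]; rfl) ?_
    have := congrArg (fun z => LaurentPolynomial.C ((g⁻¹ : Rˣ) : R) * z) h0
    rw [mul_zero, ← mul_assoc, ← map_mul, Units.inv_mul, map_one, one_mul] at this
    exact this

end Coords

end
end

noncomputable section

/-! ## Regular sequences of commuting elements and `Ext` -/

section Koszul

variable {D : Type} [Ring D]

/-- The left ideal generated by the first `k` members of a sequence. -/
def seqIdeal (P : ℕ → D) : ℕ → Submodule D D
  | 0 => ⊥
  | k + 1 => seqIdeal P k ⊔ Submodule.span D {P k}

theorem mem_seqIdeal_succ {P : ℕ → D} {k : ℕ} {Q : D} :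
    Q ∈ seqIdeal P (k + 1) ↔ ∃ Q', Q - Q' * P k ∈ seqIdeal P k := by
  rw [seqIdeal, Submodule.mem_sup]
  constructor
  · rintro ⟨y, hy, z, hz, rfl⟩
    obtain ⟨Q', rfl⟩ := Submodule.mem_span_singleton.mp hz
    exact ⟨Q', by simpa using hy⟩
  · rintro ⟨Q', h⟩
    exact ⟨_, h, _, Submodule.mem_span_singleton.mpr ⟨Q', rfl⟩, by simp⟩

theorem seqIdeal_mono (P : ℕ → D) {k l : ℕ} (h : k ≤ l) : seqIdeal P k ≤ seqIdeal P l := by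
  induction h with
  | refl => exact le_rfl
  | step _ ih => exact ih.trans le_sup_left

theorem mem_seqIdeal_of_lt (P : ℕ → D) {i k : ℕ} (h : i < k) : P i ∈ seqIdeal P k :=
  seqIdeal_mono P h (le_sup_right (a := seqIdeal P i) (Submodule.mem_span_singleton_self _))

theorem seqIdeal_le {P : ℕ → D} {k : ℕ} {I : Submodule D D} (h : ∀ i < k, P i ∈ I) :
    seqIdeal P k ≤ I := by
  induction k with
  | zero => exact bot_le
  | succ k ih =>
    refine sup_le (ih fun i hi => h i (hi.trans (Nat.lt_succ_self k))) ?_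
    rw [Submodule.span_singleton_le_iff_mem]
    exact h k (Nat.lt_succ_self k)

theorem mul_mem_seqIdeal {P : ℕ → D} {k : ℕ} {z : D} (hz : ∀ i < k, Commute (P i) z) {Q : D}
    (hQ : Q ∈ seqIdeal P k) : Q * z ∈ seqIdeal P k := by
  refine seqIdeal_le (I := (seqIdeal P k).comap (LinearMap.toSpanSingleton D D z)) ?_ hQ
  intro i hi
  change P i * z ∈ seqIdeal P k
  rw [hz i hi]
  exact Submodule.smul_mem _ z (mem_seqIdeal_of_lt P hi)

/-- The subgroup of a module generated by the images of the first `k` members of a sequence. -/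
def seqImage (P : ℕ → D) (M : Type) [AddCommGroup M] [Module D M] : ℕ → AddSubgroup M
  | 0 => ⊥
  | k + 1 => seqImage P M k ⊔ (DistribSMul.toAddMonoidHom M (P k)).range

theorem mem_seqImage_succ {P : ℕ → D} {M : Type} [AddCommGroup M] [Module D M] {k : ℕ} {m : M} :
    m ∈ seqImage P M (k + 1) ↔ ∃ m', m - P k • m' ∈ seqImage P M k := by
  rw [seqImage, AddSubgroup.mem_sup]
  constructor
  · rintro ⟨y, hy, _, ⟨z, rfl⟩, rfl⟩
    exact ⟨z, by simpa using hy⟩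
  · rintro ⟨z, h⟩
    exact ⟨_, h, _, ⟨z, rfl⟩, by simp⟩

/-- A sequence of commuting elements that is regular for right multiplication on the ring. -/
structure RegularSeq (D : Type) [Ring D] (N : ℕ) where
  P : ℕ → D
  comm : ∀ i j, Commute (P i) (P j)
  reg : ∀ k < N, ∀ Q, Q * P k ∈ seqIdeal P k → Q ∈ seqIdeal P k

/-- A sequence is regular on a left module. -/
def IsRegularOn (P : ℕ → D) (N : ℕ) (M : Type) [AddCommGroup M] [Module D M] : Prop :=
  ∀ k < N, ∀ m : M, P k • m ∈ seqImage P M k → m ∈ seqImage P M k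

/-- Right multiplication on the quotient of the ring by `seqIdeal P k`. -/
def quotMul (P : ℕ → D) (k : ℕ) (z : D) (hz : ∀ i < k, Commute (P i) z) :
    (D ⧸ seqIdeal P k) →ₗ[D] (D ⧸ seqIdeal P k) :=
  Submodule.mapQ _ _ (LinearMap.toSpanSingleton D D z) fun _ hQ => mul_mem_seqIdeal hz hQ

theorem quotMul_mk (P : ℕ → D) (k : ℕ) (z : D) (hz : ∀ i < k, Commute (P i) z) (Q : D) :
    quotMul P k z hz (Submodule.Quotient.mk Q) = Submodule.Quotient.mk (Q * z) := rfl

namespace RegularSeq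

variable {N : ℕ} (S : RegularSeq D N)

/-- The short exact sequence `D/I_k → D/I_k → D/I_{k+1}`. -/
abbrev ses (k : ℕ) : ShortComplex (ModuleCat.{0} D) where
  X₁ := ModuleCat.of D (D ⧸ seqIdeal S.P k)
  X₂ := ModuleCat.of D (D ⧸ seqIdeal S.P k)
  X₃ := ModuleCat.of D (D ⧸ seqIdeal S.P (k + 1))
  f := ModuleCat.ofHom (quotMul S.P k (S.P k) fun i _ => S.comm i k)
  g := ModuleCat.ofHom (Submodule.factor (seqIdeal_mono S.P (Nat.le_succ k)))
  zero := by
    refine ModuleCat.hom_ext (LinearMap.ext fun x => ?_)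
    obtain ⟨Q, rfl⟩ := Submodule.Quotient.mk_surjective _ x
    change Submodule.Quotient.mk (Q * S.P k) = 0
    rw [Submodule.Quotient.mk_eq_zero]
    exact Submodule.smul_mem _ Q (mem_seqIdeal_of_lt S.P (Nat.lt_succ_self k))

theorem ses_shortExact {k : ℕ} (hk : k < N) : (S.ses k).ShortExact where
  exact := by
    rw [ShortComplex.ShortExact.moduleCat_exact_iff_function_exact]
    intro x
    obtain ⟨Q, rfl⟩ := Submodule.Quotient.mk_surjective _ x
    change (Submodule.Quotient.mk Q : D ⧸ seqIdeal S.P (k + 1)) = 0 ↔ _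
    rw [Submodule.Quotient.mk_eq_zero, mem_seqIdeal_succ]
    constructor
    · rintro ⟨Q', h⟩
      refine ⟨Submodule.Quotient.mk Q', ?_⟩
      change Submodule.Quotient.mk (Q' * S.P k) = _
      exact ((Submodule.Quotient.eq _).mpr h).symm
    · rintro ⟨y, hy⟩
      obtain ⟨Q', rfl⟩ := Submodule.Quotient.mk_surjective _ y
      exact ⟨Q', (Submodule.Quotient.eq _).mp hy.symm⟩
  mono_f := by
    rw [ModuleCat.mono_iff_injective]
    change Function.Injective (quotMul S.P k (S.P k) fun i _ => S.comm i k)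
    rw [injective_iff_map_eq_zero]
    intro x hx
    obtain ⟨Q, rfl⟩ := Submodule.Quotient.mk_surjective _ x
    rw [quotMul_mk, Submodule.Quotient.mk_eq_zero] at hx
    rw [Submodule.Quotient.mk_eq_zero]
    exact S.reg k hk Q hx
  epi_g := by
    rw [ModuleCat.epi_iff_surjective]
    exact Submodule.factor_surjective (seqIdeal_mono S.P (Nat.le_succ k))

/-- The fundamental class in `Ext^k(D/I_k, D)`. -/
def fund : ∀ k : ℕ, k ≤ N →
    Abelian.Ext.{0} (ModuleCat.of D (D ⧸ seqIdeal S.P k)) (ModuleCat.of D D) k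
  | 0, _ => Abelian.Ext.mk₀ (ModuleCat.ofHom (Submodule.quotEquivOfEqBot (seqIdeal S.P 0) rfl))
  | k + 1, hk => (S.ses_shortExact hk).extClass.comp (fund k (Nat.le_of_succ_le hk)) (add_comm 1 k)

/-- The map `C → Ext^k(D/I_k, C)` given by the fundamental class. -/
def cls (k : ℕ) (hk : k ≤ N) {C : Type} [AddCommGroup C] [Module D C] (c : C) :
    Abelian.Ext.{0} (ModuleCat.of D (D ⧸ seqIdeal S.P k)) (ModuleCat.of D C) k :=
  (S.fund k hk).comp (Abelian.Ext.mk₀ (ModuleCat.ofHom (LinearMap.toSpanSingleton D C c)))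
    (add_zero k)

section

variable {C : Type} [AddCommGroup C] [Module D C]

theorem cls_add (k : ℕ) (hk : k ≤ N) (c c' : C) : S.cls k hk (c + c') =
    S.cls k hk c + S.cls k hk c' := by
  have : ModuleCat.ofHom (LinearMap.toSpanSingleton D C (c + c')) =
      ModuleCat.ofHom (LinearMap.toSpanSingleton D C c) +
        ModuleCat.ofHom (LinearMap.toSpanSingleton D C c') := by
    ext
    simp [LinearMap.toSpanSingleton]
  rw [cls, cls, cls, this, Abelian.Ext.mk₀_add, Abelian.Ext.comp_add]

/-- `cls` as an additive map. -/
def clsHom (k : ℕ) (hk : k ≤ N) (C : Type) [AddCommGroup C] [Module D C] : C →+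
    Abelian.Ext.{0} (ModuleCat.of D (D ⧸ seqIdeal S.P k)) (ModuleCat.of D C) k where
  toFun := S.cls k hk
  map_zero' := by
    have := S.cls_add k hk (0 : C) 0
    simpa using this
  map_add' := S.cls_add k hk

theorem cls_sub (k : ℕ) (hk : k ≤ N) (c c' : C) : S.cls k hk (c - c') =
    S.cls k hk c - S.cls k hk c' :=
  map_sub (S.clsHom k hk C) c c'

theorem cls_succ (k : ℕ) (hk : k + 1 ≤ N) (c : C) : S.cls (k + 1) hk c =
    (S.ses_shortExact hk).extClass.comp (S.cls k (Nat.le_of_succ_le hk) c) (add_comm 1 k) := by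
  rw [cls, cls, fund]
  exact Abelian.Ext.comp_assoc _ _ _ _ _ (by lia)

/-- Right multiplication by `z` acts on all terms of the short exact sequences, so naturality of the
extension classes carries it through the fundamental class, where it becomes the action of `z` on
the coefficients. For `z = P k` this computes the maps in the long exact sequence. -/
theorem mk₀_comp_cls (k : ℕ) (hk : k ≤ N) (z : D) (hz : ∀ i < k, Commute (S.P i) z) (c : C) :
    (Abelian.Ext.mk₀ (ModuleCat.ofHom (quotMul S.P k z hz))).comp (S.cls k hk c) (zero_add k) =
      S.cls k hk (z • c) := by
  induction k with
  | zero =>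
    rw [cls, cls, fund, Abelian.Ext.mk₀_comp_mk₀, Abelian.Ext.mk₀_comp_mk₀,
      Abelian.Ext.mk₀_comp_mk₀]
    congr 1
    refine ModuleCat.hom_ext (LinearMap.ext fun x => ?_)
    obtain ⟨Q, rfl⟩ := Submodule.Quotient.mk_surjective _ x
    change (Q * z) • c = Q • z • c
    rw [mul_smul]
  | succ k ih =>
    have hz' : ∀ i < k, Commute (S.P i) z := fun i hi => hz i (hi.trans (Nat.lt_succ_self k))
    rw [cls_succ, cls_succ, ← ih _ hz']
    let τ : S.ses k ⟶ S.ses k :=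
      { τ₁ := ModuleCat.ofHom (quotMul S.P k z hz')
        τ₂ := ModuleCat.ofHom (quotMul S.P k z hz')
        τ₃ := ModuleCat.ofHom (quotMul S.P (k + 1) z hz)
        comm₁₂ := by
          refine ModuleCat.hom_ext (LinearMap.ext fun x => ?_)
          obtain ⟨Q, rfl⟩ := Submodule.Quotient.mk_surjective _ x
          change Submodule.Quotient.mk (Q * z * S.P k) = Submodule.Quotient.mk (Q * S.P k * z)
          rw [mul_assoc, mul_assoc, hz k (Nat.lt_succ_self k)]
        comm₂₃ := by
          refine ModuleCat.hom_ext (LinearMap.ext fun x => ?_)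
          obtain ⟨Q, rfl⟩ := Submodule.Quotient.mk_surjective _ x
          rfl }
    have nat := (S.ses_shortExact hk).extClass_naturality (S.ses_shortExact hk) τ
    rw [← Abelian.Ext.comp_assoc (a₁₂ := 1) (a₂₃ := k) _ _ _ (add_zero 1) (zero_add k) (by lia),
      ← Abelian.Ext.comp_assoc (a₁₂ := 1) (a₂₃ := k + 1) _ _ _ (zero_add 1) (add_comm 1 k) (by lia)]
    exact congrArg (fun z => Abelian.Ext.comp z (S.cls k (Nat.le_of_succ_le hk) c) (add_comm 1 k))
      nat.symm

/-- By induction, only degree k of Ext(D/I_k, C) is nonzero, and there it is C modulo the images of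
the first k operators. Multiplication by `P k` is injective on this quotient by regularity, so the
long exact sequence gives the cokernel in degree k+1 and nothing else. -/
theorem ext_main (hC : IsRegularOn S.P N C) (k : ℕ) (hk : k ≤ N) :
    (∀ i ≠ k, Subsingleton
      (Abelian.Ext.{0} (ModuleCat.of D (D ⧸ seqIdeal S.P k)) (ModuleCat.of D C) i)) ∧
    (∀ x : Abelian.Ext.{0} (ModuleCat.of D (D ⧸ seqIdeal S.P k)) (ModuleCat.of D C) k,
      ∃ c, x = S.cls k hk c) ∧
    ∀ c : C, S.cls k hk c = 0 ↔ c ∈ seqImage S.P C k := by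
  induction k with
  | zero =>
    have hp : Projective (ModuleCat.of D (D ⧸ seqIdeal S.P 0)) := by
      have : Module.Projective D (D ⧸ seqIdeal S.P 0) :=
        Module.Projective.of_equiv (Submodule.quotEquivOfEqBot (seqIdeal S.P 0) rfl).symm
      exact (IsProjective.iff_projective _).mp this
    refine ⟨fun i hi => ?_, fun x => ?_, fun c => ?_⟩
    · obtain ⟨i, rfl⟩ := Nat.exists_eq_succ_of_ne_zero hi
      exact ⟨fun x y => by
        rw [Abelian.Ext.eq_zero_of_projective x, Abelian.Ext.eq_zero_of_projective y]⟩
    · obtain ⟨f, rfl⟩ := (Abelian.Ext.mk₀_bijective _ _).2 x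
      refine ⟨f.hom (Submodule.Quotient.mk 1), ?_⟩
      rw [cls, fund, Abelian.Ext.mk₀_comp_mk₀]
      congr 1
      refine ModuleCat.hom_ext (LinearMap.ext fun x => ?_)
      obtain ⟨Q, rfl⟩ := Submodule.Quotient.mk_surjective _ x
      change f.hom (Submodule.Quotient.mk Q) = Q • f.hom (Submodule.Quotient.mk 1)
      rw [← map_smul, ← Submodule.Quotient.mk_smul, smul_eq_mul, mul_one]
    · rw [cls, fund, Abelian.Ext.mk₀_comp_mk₀, Abelian.Ext.mk₀_eq_zero_iff]
      constructor
      · intro h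
        have h1 := congrArg (fun f => f.hom (Submodule.Quotient.mk 1)) h
        have h2 : (1 : D) • c = 0 := h1
        rw [one_smul] at h2
        exact h2
      · intro h
        have hc : c = 0 := h
        subst hc
        refine ModuleCat.hom_ext (LinearMap.ext fun x => ?_)
        exact smul_zero (Submodule.quotEquivOfEqBot (seqIdeal S.P 0) rfl x)
  | succ k ih =>
    have hk' : k ≤ N := Nat.le_of_succ_le hk
    obtain ⟨h1, h2, h3⟩ := ih hk'
    have hS := S.ses_shortExact hk
    have hf : ∀ c : C, (Abelian.Ext.mk₀ (S.ses k).f).comp (S.cls k hk' c) (zero_add k) =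
        S.cls k hk' (S.P k • c) := fun c => S.mk₀_comp_cls k hk' _ _ c
    -- Pullback along D/I_k → D/I_{k+1} is zero: in degree k its image is killed by the injective
    -- action of `P k`, in other degrees the target vanishes. Hence every class on D/I_{k+1} in
    -- positive degree comes from the connecting map.
    have hg : ∀ (i : ℕ) (x : Abelian.Ext.{0} (S.ses k).X₃ (ModuleCat.of D C) i),
        (Abelian.Ext.mk₀ (S.ses k).g).comp x (zero_add i) = 0 := by
      intro i x
      by_cases hi : i = k
      · subst hi
        obtain ⟨c, hc⟩ := h2 ((Abelian.Ext.mk₀ (S.ses i).g).comp x (zero_add i))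
        have h0 : (Abelian.Ext.mk₀ (S.ses i).f).comp
            ((Abelian.Ext.mk₀ (S.ses i).g).comp x (zero_add i)) (zero_add i) = 0 := by
          rw [← Abelian.Ext.comp_assoc (a₁₂ := 0) (a₂₃ := i) _ _ _ (zero_add 0) (zero_add i)
            (by lia), Abelian.Ext.mk₀_comp_mk₀, (S.ses i).zero, Abelian.Ext.mk₀_zero,
            Abelian.Ext.zero_comp]
        rw [hc, hf, h3] at h0
        rw [hc, h3]
        exact hC i hk c h0
      · exact @Subsingleton.elim _ (h1 i hi) _ _
    refine ⟨fun i hi => ?_, fun x => ?_, fun c => ?_⟩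
    · refine subsingleton_of_forall_eq 0 fun x => ?_
      -- Degree 0 is not reached by the connecting map; there pullback along an epimorphism is
      -- injective.
      rcases i with _ | i
      · have hepi := hS.epi_g
        exact Abelian.Ext.precomp_mk₀_injective_of_epi (ModuleCat.of D C) (S.ses k).g
          ((hg 0 x).trans (hg 0 0).symm)
      · obtain ⟨y, rfl⟩ := Abelian.Ext.contravariant_sequence_exact₃ hS _ x (hg _ x) (add_comm 1 i)
        have : y = 0 := @Subsingleton.elim _ (h1 i (by lia)) _ _
        rw [this, Abelian.Ext.comp_zero]
    · obtain ⟨y, rfl⟩ := Abelian.Ext.contravariant_sequence_exact₃ hS _ x (hg _ x) (add_comm 1 k)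
      obtain ⟨c, rfl⟩ := h2 y
      exact ⟨c, (S.cls_succ k hk c).symm⟩
    · rw [cls_succ, mem_seqImage_succ]
      constructor
      · intro h
        obtain ⟨y, hy⟩ := Abelian.Ext.contravariant_sequence_exact₁ hS _ _ _ h
        obtain ⟨c', rfl⟩ := h2 y
        refine ⟨c', ?_⟩
        rw [← h3, cls_sub, ← hf, sub_eq_zero]
        exact hy.symm
      · rintro ⟨c', h⟩
        rw [← h3, cls_sub, ← hf, sub_eq_zero] at h
        rw [h]
        exact hS.extClass_comp_assoc _

end

end RegularSeq

end Koszul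
end

/-! ### Koszul classes under a change of rings -/

noncomputable section

instance {D D' : Type} [Ring D] [Ring D'] (σ : D →+* D') :
    Limits.PreservesFiniteLimits (ModuleCat.restrictScalars.{0} σ) := (restrictScalars_exact σ).1

instance {D D' : Type} [Ring D] [Ring D'] (σ : D →+* D') :
    Limits.PreservesFiniteColimits (ModuleCat.restrictScalars.{0} σ) := (restrictScalars_exact σ).2

/-- A semilinear map, as a morphism to the restriction of scalars. -/
def semiHom {D D' : Type} [Ring D] [Ring D'] (σ : D →+* D') {M M' : Type} [AddCommGroup M]
    [Module D M] [AddCommGroup M'] [Module D' M'] (r : M →+ M')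
    (hr : ∀ (Q : D) (m : M), r (Q • m) = σ Q • r m) :
    ModuleCat.of D M ⟶ (ModuleCat.restrictScalars.{0} σ).obj (ModuleCat.of D' M') :=
  ModuleCat.ofHom (Y := (ModuleCat.restrictScalars.{0} σ).obj (ModuleCat.of D' M'))
    { toFun := r
      map_add' := r.map_add
      map_smul' := hr }

/-- A ring homomorphism, as a morphism to the restriction of scalars. -/
def ringSemiHom {D D' : Type} [Ring D] [Ring D'] (σ : D →+* D') :
    ModuleCat.of D D ⟶ (ModuleCat.restrictScalars.{0} σ).obj (ModuleCat.of D' D') :=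
  semiHom σ σ.toAddMonoidHom (fun Q m => σ.map_mul Q m)

section KoszulNaturality

variable {D D' : Type} [Ring D] [Ring D'] {σ : D →+* D'}

theorem map_mem_seqIdeal {P : ℕ → D} {P' : ℕ → D'} (hP : ∀ i, P' i = σ (P i)) {k : ℕ} {Q : D}
    (hQ : Q ∈ seqIdeal P k) : σ Q ∈ seqIdeal P' k := by
  induction k generalizing Q with
  | zero =>
    have : Q = 0 := hQ
    rw [this, map_zero]
    exact Submodule.zero_mem _
  | succ k ih =>
    rw [mem_seqIdeal_succ] at hQ ⊢
    obtain ⟨Q', h⟩ := hQ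
    exact ⟨σ Q', by rw [hP, ← map_mul, ← map_sub]; exact ih h⟩

/-- The map induced by a ring homomorphism on the quotients by `seqIdeal`. -/
def quotMap {P : ℕ → D} {P' : ℕ → D'} (hP : ∀ i, P' i = σ (P i)) (k : ℕ) :
    ModuleCat.of D (D ⧸ seqIdeal P k) ⟶
      (ModuleCat.restrictScalars.{0} σ).obj (ModuleCat.of D' (D' ⧸ seqIdeal P' k)) :=
  semiHom σ (QuotientAddGroup.map (seqIdeal P k).toAddSubgroup (seqIdeal P' k).toAddSubgroup
    σ.toAddMonoidHom (fun _ hQ => map_mem_seqIdeal hP hQ))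
    (fun Q m => by
      obtain ⟨Q', rfl⟩ := Submodule.Quotient.mk_surjective _ m
      change Submodule.Quotient.mk (σ (Q * Q')) = Submodule.Quotient.mk (σ Q * σ Q')
      rw [map_mul])

namespace RegularSeq

variable {N : ℕ} (S : RegularSeq D N) (S' : RegularSeq D' N)

/-- The ring homomorphism induces a morphism from each short exact sequence over `D` to the
restriction of scalars of the one over `D'`. Extension classes are natural and are preserved by
exact functors, so induction applies. -/
theorem fund_naturality (hP : ∀ i, S'.P i = σ (S.P i)) (k : ℕ) (hk : k ≤ N) :
    (S.fund k hk).comp (Abelian.Ext.mk₀ (ringSemiHom σ)) (add_zero k) =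
      (Abelian.Ext.mk₀ (quotMap hP k)).comp
        ((S'.fund k hk).mapExactFunctor (ModuleCat.restrictScalars.{0} σ)) (zero_add k) := by
  induction k with
  | zero =>
    rw [fund, fund, Abelian.Ext.mapExactFunctor_mk₀, Abelian.Ext.mk₀_comp_mk₀,
      Abelian.Ext.mk₀_comp_mk₀]
    congr 1
    refine ModuleCat.hom_ext (LinearMap.ext fun x => ?_)
    obtain ⟨Q, rfl⟩ := Submodule.Quotient.mk_surjective _ x
    rfl
  | succ k ih =>
    rw [fund, fund, Abelian.Ext.mapExactFunctor_comp, Abelian.Ext.mapExactFunctor_extClass,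
      Abelian.Ext.comp_assoc_of_third_deg_zero, ih (Nat.le_of_succ_le hk)]
    let τ : S.ses k ⟶ (S'.ses k).map (ModuleCat.restrictScalars.{0} σ) :=
      { τ₁ := quotMap hP k
        τ₂ := quotMap hP k
        τ₃ := quotMap hP (k + 1)
        comm₁₂ := by
          refine ModuleCat.hom_ext (LinearMap.ext fun x => ?_)
          obtain ⟨Q, rfl⟩ := Submodule.Quotient.mk_surjective _ x
          change Submodule.Quotient.mk (σ Q * S'.P k) = Submodule.Quotient.mk (σ (Q * S.P k))
          rw [map_mul, hP]
        comm₂₃ := by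
          refine ModuleCat.hom_ext (LinearMap.ext fun x => ?_)
          obtain ⟨Q, rfl⟩ := Submodule.Quotient.mk_surjective _ x
          rfl }
    have nat := (S.ses_shortExact hk).extClass_naturality
      ((S'.ses_shortExact hk).map_of_exact (ModuleCat.restrictScalars.{0} σ)) τ
    have hA := Abelian.Ext.comp_assoc (a₁₂ := 1) (a₂₃ := k) (a := k + 1)
      (S.ses_shortExact hk).extClass (Abelian.Ext.mk₀ τ.τ₁)
      ((S'.fund k (Nat.le_of_succ_le hk)).mapExactFunctor (ModuleCat.restrictScalars.{0} σ))
      (add_zero 1) (zero_add k) (by lia)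
    have hB := Abelian.Ext.comp_assoc (a₁₂ := 1) (a₂₃ := k + 1) (a := k + 1)
      (Abelian.Ext.mk₀ τ.τ₃)
      ((S'.ses_shortExact hk).map_of_exact (ModuleCat.restrictScalars.{0} σ)).extClass
      ((S'.fund k (Nat.le_of_succ_le hk)).mapExactFunctor (ModuleCat.restrictScalars.{0} σ))
      (zero_add 1) (add_comm 1 k) (by lia)
    exact hA.symm.trans ((congrArg (fun z => Abelian.Ext.comp z
      ((S'.fund k (Nat.le_of_succ_le hk)).mapExactFunctor
        (ModuleCat.restrictScalars.{0} σ)) (add_comm 1 k)) nat).trans hB)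

end RegularSeq

/-- `u` generates the module `M`, with annihilator the left ideal of the regular sequence. -/
structure RegularSeq.IsGen {N : ℕ} (S : RegularSeq D N) {M : Type} [AddCommGroup M] [Module D M]
    (u : M) : Prop where
  gen : ∀ m, ∃ Q : D, Q • u = m
  ann : ∀ Q : D, Q • u = 0 ↔ Q ∈ seqIdeal S.P N

namespace RegularSeq.IsGen

variable {N : ℕ} {S : RegularSeq D N} {M : Type} [AddCommGroup M] [Module D M] {u : M}
  (hu : S.IsGen u)

/-- The presentation of a cyclic module. -/
def equiv : (D ⧸ seqIdeal S.P N) ≃ₗ[D] M :=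
  LinearEquiv.ofBijective (Submodule.liftQ _ (LinearMap.toSpanSingleton D M u)
    fun Q hQ => (hu.ann Q).mpr hQ)
    ⟨by
      rw [injective_iff_map_eq_zero]
      intro x hx
      obtain ⟨Q, rfl⟩ := Submodule.Quotient.mk_surjective _ x
      rw [Submodule.Quotient.mk_eq_zero]
      exact (hu.ann Q).mp hx, fun m => by
      obtain ⟨Q, rfl⟩ := hu.gen m
      exact ⟨Submodule.Quotient.mk Q, rfl⟩⟩

theorem equiv_mk (Q : D) : hu.equiv (Submodule.Quotient.mk Q) = Q • u := rfl

theorem equiv_symm (Q : D) : hu.equiv.symm (Q • u) = Submodule.Quotient.mk Q := by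
  rw [LinearEquiv.symm_apply_eq, equiv_mk]

/-- The presentation of a cyclic module, as an isomorphism in the category of modules. -/
abbrev iso : ModuleCat.of D (D ⧸ seqIdeal S.P N) ≅ ModuleCat.of D M := hu.equiv.toModuleIso

/-- The map `C → Ext^N(M, C)` given by the fundamental class. -/
def cls {C : Type} [AddCommGroup C] [Module D C] (c : C) :
    Abelian.Ext.{0} (ModuleCat.of D M) (ModuleCat.of D C) N :=
  (Abelian.Ext.mk₀ hu.iso.inv).comp (S.cls N le_rfl c) (zero_add N)

theorem mk₀_inv_comp_hom {i : ℕ} {C : ModuleCat.{0} D}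
    (x : Abelian.Ext.{0} (ModuleCat.of D M) C i) :
    (Abelian.Ext.mk₀ hu.iso.inv).comp ((Abelian.Ext.mk₀ hu.iso.hom).comp x (zero_add i))
      (zero_add i) = x := by
  rw [← Abelian.Ext.comp_assoc (a₁₂ := 0) (a₂₃ := i) (a := i) _ _ _ (zero_add 0) (zero_add i)
    (by lia), Abelian.Ext.mk₀_comp_mk₀, Iso.inv_hom_id, Abelian.Ext.mk₀_id_comp]

theorem mk₀_hom_comp_inv {i : ℕ} {C : ModuleCat.{0} D}
    (x : Abelian.Ext.{0} (ModuleCat.of D (D ⧸ seqIdeal S.P N)) C i) :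
    (Abelian.Ext.mk₀ hu.iso.hom).comp ((Abelian.Ext.mk₀ hu.iso.inv).comp x (zero_add i))
      (zero_add i) = x := by
  rw [← Abelian.Ext.comp_assoc (a₁₂ := 0) (a₂₃ := i) (a := i) _ _ _ (zero_add 0) (zero_add i)
    (by lia), Abelian.Ext.mk₀_comp_mk₀, Iso.hom_inv_id, Abelian.Ext.mk₀_id_comp]

/-- `cls` as an additive map. -/
def clsHom (C : Type) [AddCommGroup C] [Module D C] :
    C →+ Abelian.Ext.{0} (ModuleCat.of D M) (ModuleCat.of D C) N where
  toFun := hu.cls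
  map_zero' := by
    rw [cls, show S.cls N le_rfl (0 : C) = 0 from map_zero (S.clsHom N le_rfl C),
      Abelian.Ext.comp_zero]
  map_add' c c' := by rw [cls, cls, cls, S.cls_add, Abelian.Ext.comp_add]

section

variable {C : Type} [AddCommGroup C] [Module D C] (hC : IsRegularOn S.P N C)
include hu hC

theorem subsingleton (i : ℕ) (hi : i ≠ N) :
    Subsingleton (Abelian.Ext.{0} (ModuleCat.of D M) (ModuleCat.of D C) i) := by
  have h := (S.ext_main hC N le_rfl).1 i hi
  exact ⟨fun x y => by
    rw [← hu.mk₀_inv_comp_hom x, ← hu.mk₀_inv_comp_hom y]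
    congr 1
    exact Subsingleton.elim _ _⟩

theorem exists_cls (x : Abelian.Ext.{0} (ModuleCat.of D M) (ModuleCat.of D C) N) :
    ∃ c, x = hu.cls c := by
  obtain ⟨c, hc⟩ := (S.ext_main hC N le_rfl).2.1
    ((Abelian.Ext.mk₀ hu.iso.hom).comp x (zero_add N))
  exact ⟨c, by rw [cls, ← hc, mk₀_inv_comp_hom]⟩

theorem cls_eq_zero_iff (c : C) : hu.cls c = 0 ↔ c ∈ seqImage S.P C N := by
  rw [← (S.ext_main hC N le_rfl).2.2 c]
  constructor
  · intro h
    rw [← hu.mk₀_hom_comp_inv (S.cls N le_rfl c)]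
    change (Abelian.Ext.mk₀ hu.iso.hom).comp (hu.cls c) _ = 0
    rw [h, Abelian.Ext.comp_zero]
  · intro h
    rw [cls, h, Abelian.Ext.comp_zero]

end

theorem cls_rmul (Q z : D) : DualExt.rmul (hu.cls Q) z = hu.cls (Q * z) := by
  rw [DualExt.rmul, cls, cls, RegularSeq.cls, RegularSeq.cls,
    Abelian.Ext.comp_assoc_of_third_deg_zero, Abelian.Ext.comp_assoc_of_third_deg_zero,
    Abelian.Ext.mk₀_comp_mk₀]
  congr 4
  refine ModuleCat.hom_ext (LinearMap.ext fun x => ?_)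
  exact (mul_assoc x Q z)

variable {S' : RegularSeq D' N} {M' : Type} [AddCommGroup M'] [Module D' M'] {u' : M'}
  (hu' : S'.IsGen u')

/-- This describes the image in Ext over `D` of an arbitrary class over `D'`, in terms of the same
representative. Both existence and uniqueness of related classes follow from it. -/
theorem cls_naturality (hP : ∀ i, S'.P i = σ (S.P i)) (r : M →+ M')
    (hr : ∀ (Q : D) (m : M), r (Q • m) = σ Q • r m) (hru : r u = u') (Q : D') :
    (Abelian.Ext.mk₀ (semiHom σ r hr)).comp
      ((hu'.cls Q).mapExactFunctor (ModuleCat.restrictScalars.{0} σ)) (zero_add N) =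
    hu.cls (C := (ModuleCat.restrictScalars.{0} σ).obj (ModuleCat.of D' D')) Q := by
  unfold cls RegularSeq.cls
  rw [Abelian.Ext.mapExactFunctor_comp,
    Abelian.Ext.mapExactFunctor_comp, Abelian.Ext.mapExactFunctor_mk₀,
    Abelian.Ext.mapExactFunctor_mk₀,
    ← Abelian.Ext.comp_assoc (a₁₂ := 0) (a₂₃ := N) (a := N) _ _ _ (zero_add 0) (zero_add N)
    (by lia), Abelian.Ext.mk₀_comp_mk₀]
  have e1 : semiHom σ r hr ≫ (ModuleCat.restrictScalars.{0} σ).map hu'.iso.inv =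
      hu.iso.inv ≫ quotMap hP N := by
    refine ModuleCat.hom_ext (LinearMap.ext fun x => ?_)
    obtain ⟨Q, rfl⟩ := hu.gen x
    change hu'.equiv.symm (r (Q • u)) = (quotMap hP N).hom (hu.equiv.symm (Q • u))
    rw [hr, hru, equiv_symm, equiv_symm]
    rfl
  rw [e1, ← Abelian.Ext.mk₀_comp_mk₀,
    Abelian.Ext.comp_assoc (a₁₂ := 0) (a₂₃ := N) (a := N) _ _ _ (zero_add 0) (zero_add N)
    (by lia)]
  congr 1
  rw [← Abelian.Ext.comp_assoc_of_third_deg_zero, ← S.fund_naturality S' hP,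
    Abelian.Ext.comp_assoc_of_third_deg_zero, Abelian.Ext.mk₀_comp_mk₀]
  congr 2

theorem cls_related (hP : ∀ i, S'.P i = σ (S.P i)) (r : M →+ M')
    (hr : ∀ (Q : D) (m : M), r (Q • m) = σ Q • r m) (hru : r u = u') (Q : D) :
    DualExt.Related σ r (hu.cls Q) (hu'.cls (σ Q)) := by
  refine ⟨semiHom σ r hr, ringSemiHom σ, fun _ => rfl, fun _ => rfl, ?_⟩
  rw [hu.cls_naturality hu' hP r hr hru]
  unfold cls RegularSeq.cls
  rw [    Abelian.Ext.comp_assoc_of_third_deg_zero, Abelian.Ext.comp_assoc_of_third_deg_zero,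
    Abelian.Ext.mk₀_comp_mk₀]
  congr 4
  refine ModuleCat.hom_ext (LinearMap.ext fun x => ?_)
  exact σ.map_mul x Q

theorem mem_seqImage_equiv {P : ℕ → D} {P' : ℕ → D'} {C C' : Type} [AddCommGroup C] [Module D C]
    [AddCommGroup C'] [Module D' C'] (e : C ≃+ C') (he : ∀ i c, e (P i • c) = P' i • e c) (k : ℕ)
    (c : C) : c ∈ seqImage P C k ↔ e c ∈ seqImage P' C' k := by
  induction k generalizing c with
  | zero => exact (map_eq_zero_iff e e.injective).symm
  | succ k ih =>
    rw [mem_seqImage_succ, mem_seqImage_succ]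
    constructor
    · rintro ⟨c', hc⟩
      exact ⟨e c', by rw [← he, ← map_sub]; exact (ih _).mp hc⟩
    · rintro ⟨c', hc⟩
      obtain ⟨c', rfl⟩ := e.surjective c'
      exact ⟨c', (ih _).mpr (by rw [map_sub, he]; exact hc)⟩

include hu hu' in
/-- A class over `D'` is determined by the class over `D` to which it is related. -/
theorem related_unique (hP : ∀ i, S'.P i = σ (S.P i)) (hreg : IsRegularOn S'.P N D') {r : M →+ M'}
    (hru : r u = u') {x : DualExt D M N} {y z : DualExt D' M' N} (hy : DualExt.Related σ r x y)
    (hz : DualExt.Related σ r x z) : y = z := by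
  obtain ⟨rr, ss, h1, h2, h3⟩ := hy
  obtain ⟨rr', ss', h1', h2', h3'⟩ := hz
  have hr : ∀ (Q : D) (m : M), r (Q • m) = σ Q • r m := fun Q m => by
    rw [← h1, ← h1, map_smul]
    rfl
  have e : rr = semiHom σ r hr := ModuleCat.hom_ext (LinearMap.ext fun x => h1 x)
  have e' : rr' = semiHom σ r hr := ModuleCat.hom_ext (LinearMap.ext fun x => h1' x)
  have es : ss = ss' := ModuleCat.hom_ext (LinearMap.ext fun x => (h2 x).trans (h2' x).symm)
  rw [es, h3', e, e'] at h3
  obtain ⟨Q, rfl⟩ := hu'.exists_cls hreg y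
  obtain ⟨Q', rfl⟩ := hu'.exists_cls hreg z
  rw [hu.cls_naturality hu' hP r hr hru, hu.cls_naturality hu' hP r hr hru] at h3
  -- Over either ring, the top Ext with values in `D'` is `D'` modulo the images of the same
  -- operators. So passing from Ext over `D'` to Ext over `D` with values in `D'` loses nothing, and
  -- a class there determines the class over `D'`.
  let e₀ : ((ModuleCat.restrictScalars.{0} σ).obj (ModuleCat.of D' D')) ≃+ D' := AddEquiv.refl D'
  have he₀ : ∀ i c, e₀ (S.P i • c) = S'.P i • e₀ c := fun i c => by
    rw [hP]
    rfl
  have hreg' : IsRegularOn S.P N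
      ((ModuleCat.restrictScalars.{0} σ).obj (ModuleCat.of D' D')) := by
    intro k hk m hm
    rw [mem_seqImage_equiv e₀ he₀] at hm ⊢
    rw [he₀] at hm
    exact hreg k hk _ hm
  have h0 : hu.clsHom ((ModuleCat.restrictScalars.{0} σ).obj (ModuleCat.of D' D')) (Q - Q') = 0 := by
    have := map_sub (hu.clsHom ((ModuleCat.restrictScalars.{0} σ).obj (ModuleCat.of D' D'))) Q Q'
    exact this.trans (sub_eq_zero.mpr h3.symm)
  have h0' := (hu.cls_eq_zero_iff hreg' _).mp h0
  have := (hu'.cls_eq_zero_iff hreg _).mpr ((mem_seqImage_equiv e₀ he₀ _ _).mp h0')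
  have h5 : hu'.clsHom D' Q - hu'.clsHom D' Q' = 0 := by
    rw [← map_sub]
    exact this
  exact sub_eq_zero.mp h5

end RegularSeq.IsGen

end KoszulNaturality

end

noncomputable section

/-! ## Formal adjoints and the regular sequence `∂_1, …, ∂_n, y ∂_y - a` -/

namespace Coords

variable {A : Type} [CommRing A] [Algebra ℂ A]

section Adjoint

variable {m : ℕ} (F : Coords A m)

/-- The representation of functions and vector fields by right multiplication operators. -/
def oppositeRep : WeylRep F (DiffOp A)ᵐᵒᵖ where
  ρ := (DiffOp.ofFun : A →ₐ[ℂ] DiffOp A).toRingHom.toOpposite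
    (fun a b => by
      change DiffOp.ofFun a * DiffOp.ofFun b = DiffOp.ofFun b * DiffOp.ofFun a
      rw [← map_mul, mul_comm, map_mul])
  δ i := MulOpposite.op (-DiffOp.ofVF (F.d i))
  comm i j := by
    change MulOpposite.op (-DiffOp.ofVF (F.d j) * -DiffOp.ofVF (F.d i)) =
      MulOpposite.op (-DiffOp.ofVF (F.d i) * -DiffOp.ofVF (F.d j))
    rw [neg_mul_neg, neg_mul_neg, (DiffOp.ofVF_commute F j i).eq]
  leib i a := by
    change MulOpposite.op (DiffOp.ofFun a * -DiffOp.ofVF (F.d i)) =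
      MulOpposite.op (-DiffOp.ofVF (F.d i) * DiffOp.ofFun a + DiffOp.ofFun (F.d i a))
    rw [neg_mul, DiffOp.ofVF_mul_ofFun, mul_neg, neg_add_rev, neg_add_cancel_comm]

/-- The formal adjoint of a differential operator, with respect to the volume form of a coordinate
system. -/
def adj : DiffOp A →+ DiffOp A :=
  (MulOpposite.opAddEquiv.symm : (DiffOp A)ᵐᵒᵖ ≃+ DiffOp A).toAddMonoidHom.comp
    F.oppositeRep.lift.toAddMonoidHom

theorem adj_mul (P Q : DiffOp A) : F.adj (P * Q) = F.adj Q * F.adj P :=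
  congrArg MulOpposite.unop (F.oppositeRep.lift.map_mul P Q)

@[simp] theorem adj_ofFun (a : A) : F.adj (DiffOp.ofFun a) = DiffOp.ofFun a :=
  congrArg MulOpposite.unop (F.oppositeRep.lift_ofFun a)

@[simp] theorem adj_d (i : Fin m) : F.adj (DiffOp.ofVF (F.d i)) = -DiffOp.ofVF (F.d i) :=
  congrArg MulOpposite.unop (F.oppositeRep.lift_ofVF_d i)

@[simp] theorem adj_adj (P : DiffOp A) : F.adj (F.adj P) = P := by
  induction P using F.op_induction with
  | hf a => simp
  | ha P Q hP hQ => rw [map_add, map_add, hP, hQ]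
  | hm P i hP => rw [adj_mul, adj_mul, hP, adj_d, map_neg, adj_d, neg_neg]

/-- The divergence of a vector field. -/
def div (θ : VF A) : A := ∑ i, F.d i (θ (F.x i))

/-- The divergence appears because the coefficients have to be moved back to the left of the
coordinate fields. The same term occurs in the Lie derivative of the volume form. -/
theorem adj_ofVF (θ : VF A) :
    F.adj (DiffOp.ofVF θ) = -DiffOp.ofVF θ - DiffOp.ofFun (F.div θ) := by
  rw [DiffOp.ofVF_eq_sum F θ, map_sum, div, map_sum, ← Finset.sum_neg_distrib,
    ← Finset.sum_sub_distrib]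
  refine Finset.sum_congr rfl fun i _ => ?_
  rw [adj_mul, adj_d, adj_ofFun, neg_mul, DiffOp.ofVF_mul_ofFun, neg_add, sub_eq_add_neg]

theorem symb_mul_d (P : DiffOp A) (i : Fin m) :
    F.symb (P * DiffOp.ofVF (F.d i)) = F.symb P * MvPolynomial.X i := by
  rw [← F.symb_op (F.symb P * MvPolynomial.X i), WeylRep.op_mul_X, F.op_symb]
  rfl

theorem symb_ofFun_mul (P : DiffOp A) (a : A) :
    F.symb (DiffOp.ofFun a * P) = MvPolynomial.C a * F.symb P := by
  rw [← F.symb_op (MvPolynomial.C a * F.symb P), WeylRep.op_C_mul, F.op_symb]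
  rfl

theorem symb_mul_x (P : DiffOp A) (i : Fin m) :
    F.symb (P * DiffOp.ofFun (F.x i)) =
      MvPolynomial.C (F.x i) * F.symb P + MvPolynomial.pderiv i (F.symb P) := by
  rw [← F.symb_op (_ + _), map_add, WeylRep.op_C_mul, F.op_symb]
  have := F.rep.op_mul_ρ_x (F.symb P) i
  rw [F.op_symb] at this
  rw [← this]
  rfl

end Adjoint

section Euler

variable {n : ℕ} (F : Coords A (n + 1))

/-- The operator `y ∂_y - a`, where `y` is the first coordinate. -/
def euler (a : ℂ) : DiffOp A :=
  DiffOp.ofFun (F.x 0) * DiffOp.ofVF (F.d 0) - algebraMap ℂ (DiffOp A) a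

/-- The sequence `∂_1, …, ∂_n, y ∂_y - a`. -/
def eulerP (a : ℂ) (k : ℕ) : DiffOp A :=
  -- Coordinate 0 of `F` is y, hence the shift by `Fin.succ`. The base fields come first so that
  -- regularity of the Euler operator is tested modulo them; values beyond index n do not matter.
  if h : k < n then DiffOp.ofVF (F.d (Fin.succ ⟨k, h⟩)) else if k = n then F.euler a else 0

theorem eulerP_of_lt (a : ℂ) {k : ℕ} (h : k < n) :
    F.eulerP a k = DiffOp.ofVF (F.d (Fin.succ ⟨k, h⟩)) := dif_pos h

theorem eulerP_self (a : ℂ) : F.eulerP a n = F.euler a := by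
  rw [eulerP, dif_neg (lt_irrefl n), if_pos rfl]

theorem eulerP_of_gt (a : ℂ) {k : ℕ} (h : n < k) : F.eulerP a k = 0 := by
  rw [eulerP, dif_neg (by lia), if_neg (by lia)]

theorem d_succ_commute_euler (a : ℂ) (i : Fin n) :
    Commute (DiffOp.ofVF (F.d i.succ)) (F.euler a) := by
  refine Commute.sub_right (Commute.mul_right ?_ (DiffOp.ofVF_commute F _ _))
    (Algebra.commutes a _).symm
  have := DiffOp.ofVF_mul_ofFun (F.d i.succ) (F.x 0)
  rw [F.dual, if_neg (Fin.succ_ne_zero i), map_zero, add_zero] at this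
  exact this

theorem eulerP_commute (a : ℂ) (i j : ℕ) : Commute (F.eulerP a i) (F.eulerP a j) := by
  rcases lt_trichotomy i n with hi | rfl | hi
  · rw [F.eulerP_of_lt a hi]
    rcases lt_trichotomy j n with hj | rfl | hj
    · rw [F.eulerP_of_lt a hj]
      exact DiffOp.ofVF_commute F _ _
    · rw [eulerP_self]
      exact F.d_succ_commute_euler a _
    · rw [F.eulerP_of_gt a hj]
      exact Commute.zero_right _
  · rw [eulerP_self]
    rcases lt_trichotomy j i with hj | rfl | hj
    · rw [F.eulerP_of_lt a hj]
      exact (F.d_succ_commute_euler a _).symm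
    · rw [eulerP_self]
    · rw [F.eulerP_of_gt a hj]
      exact Commute.zero_right _
  · rw [F.eulerP_of_gt a hi]
    exact Commute.zero_left _

/-- Right multiplication by a coordinate field multiplies the normally ordered symbol by a variable.
Left ideals generated by coordinate fields therefore become monomial ideals of a polynomial ring. -/
theorem mem_seqIdeal_eulerP (a : ℂ) {k : ℕ} (hk : k ≤ n) (Q : DiffOp A) :
    Q ∈ seqIdeal (F.eulerP a) k ↔
      F.symb Q ∈ Ideal.span (MvPolynomial.X '' {i : Fin (n + 1) | i ≠ 0 ∧ (i : ℕ) ≤ k}) := by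
  induction k generalizing Q with
  | zero =>
    have : {i : Fin (n + 1) | i ≠ 0 ∧ (i : ℕ) ≤ 0} = ∅ := by
      ext i
      simp only [Set.mem_ofPred_eq, Set.mem_empty_iff_false, iff_false, not_and]
      intro h h'
      exact h (Fin.ext (by simpa using h'))
    rw [this, Set.image_empty, Ideal.span_empty, Ideal.mem_bot,
      map_eq_zero_iff F.symb F.symb.injective]
    exact Iff.rfl
  | succ k ih =>
    have : {i : Fin (n + 1) | i ≠ 0 ∧ (i : ℕ) ≤ k + 1} =
        insert (Fin.succ ⟨k, hk⟩) {i : Fin (n + 1) | i ≠ 0 ∧ (i : ℕ) ≤ k} := by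
      ext i
      refine Fin.cases (by simp) (fun i => ?_) i
      simp only [Set.mem_ofPred_eq, Set.mem_insert_iff, Fin.ext_iff, Fin.val_succ]
      have : i.succ ≠ 0 := Fin.succ_ne_zero i
      simp only [ne_eq]
      lia
    rw [this, Set.image_insert_eq, Ideal.span_insert, mem_seqIdeal_succ, sup_comm,
      Submodule.mem_sup]
    constructor
    · rintro ⟨Q', h⟩
      rw [ih (Nat.le_of_succ_le hk), map_sub, F.eulerP_of_lt a hk, symb_mul_d] at h
      exact ⟨_, h, _, Ideal.mul_mem_left _ (F.symb Q') (Ideal.mem_span_singleton_self _), by simp⟩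
    · rintro ⟨f, hf, g, hg, e⟩
      obtain ⟨g, rfl⟩ := Ideal.mem_span_singleton'.mp hg
      refine ⟨F.rep.op g, ?_⟩
      rw [ih (Nat.le_of_succ_le hk), map_sub, F.eulerP_of_lt a hk, symb_mul_d, F.symb_op, ← e,
        add_sub_cancel_right]
      exact hf

/-- A polynomial lies in the ideal generated by all variables except X_0 exactly when it contains no
pure power of X_0. -/
theorem mem_seqIdeal_eulerP_top (a : ℂ) (Q : DiffOp A) :
    Q ∈ seqIdeal (F.eulerP a) n ↔
      ∀ j, MvPolynomial.coeff (Finsupp.single 0 j) (F.symb Q) = 0 := by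
  rw [F.mem_seqIdeal_eulerP a le_rfl, MvPolynomial.mem_ideal_span_X_image]
  constructor
  · intro h j
    by_contra hj
    obtain ⟨i, ⟨hi, -⟩, hi'⟩ := h _ (MvPolynomial.mem_support_iff.mpr hj)
    exact hi' (Finsupp.single_eq_of_ne hi)
  · intro h m hm
    by_contra! hc
    refine MvPolynomial.mem_support_iff.mp hm ?_
    have : m = Finsupp.single 0 (m 0) := by
      ext i
      by_cases hi : i = 0
      · subst hi
        simp
      · rw [Finsupp.single_eq_of_ne hi]
        exact hc i ⟨hi, Nat.lt_succ_iff.mp i.2⟩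
    rw [this]
    exact h _

/-- For the base fields this is regularity of variables in a polynomial ring. For the Euler
operator, only the coefficients c_j of the pure powers of X_0 matter modulo the previous ones, and
there the top coefficient is multiplied by y, a nonzerodivisor. -/
theorem eulerP_reg (a : ℂ) (hy : ∀ b, F.x 0 * b = 0 → b = 0) (k : ℕ) (hk : k < n + 1)
    (Q : DiffOp A) (hQ : Q * F.eulerP a k ∈ seqIdeal (F.eulerP a) k) :
    Q ∈ seqIdeal (F.eulerP a) k := by
  rcases Nat.lt_succ_iff_lt_or_eq.mp hk with h | rfl
  · rw [F.mem_seqIdeal_eulerP a h.le] at hQ ⊢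
    rw [F.eulerP_of_lt a h, symb_mul_d, MvPolynomial.mem_ideal_span_X_image] at hQ
    rw [MvPolynomial.mem_ideal_span_X_image]
    intro m hm
    obtain ⟨i, hi, hi'⟩ := hQ (m + Finsupp.single (Fin.succ ⟨k, h⟩) 1) (by
      rw [MvPolynomial.mem_support_iff, MvPolynomial.coeff_mul_X]
      exact MvPolynomial.mem_support_iff.mp hm)
    refine ⟨i, hi, ?_⟩
    have hne : i ≠ Fin.succ ⟨k, h⟩ := by
      rintro rfl
      have := hi.2
      simp at this
    rwa [Finsupp.add_apply, Finsupp.single_eq_of_ne hne, add_zero] at hi'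
  · rw [mem_seqIdeal_eulerP_top] at hQ ⊢
    set f := F.symb Q with hf
    -- The coefficient of X_0^{j+1} in the symbol of Q(y∂_y - a) is y c_j + (j+1-a) c_{j+1}. Once
    -- c_{j+1} vanishes, so does c_j; the descent starts above the total degree.
    have key : ∀ j, MvPolynomial.coeff (Finsupp.single 0 (j + 1)) f = 0 →
        MvPolynomial.coeff (Finsupp.single 0 j) f = 0 := by
      intro j hj
      have h := hQ (j + 1)
      rw [eulerP_self, euler, mul_sub, map_sub, ← mul_assoc, symb_mul_d, symb_mul_x,
        ← Algebra.commutes, ← AlgHom.commutes (DiffOp.ofFun (A := A)), symb_ofFun_mul,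
        MvPolynomial.coeff_sub, MvPolynomial.coeff_C_mul, ← hf, hj, mul_zero, sub_zero,
        Finsupp.single_add, MvPolynomial.coeff_mul_X, MvPolynomial.coeff_add,
        MvPolynomial.coeff_C_mul, MvPolynomial.coeff_pderiv, ← Finsupp.single_add, hj, zero_mul,
        add_zero] at h
      exact hy _ h
    have hfin : ∃ J, ∀ j ≥ J, MvPolynomial.coeff (Finsupp.single 0 j) f = 0 := by
      refine ⟨f.totalDegree + 1, fun j hj => ?_⟩
      by_contra hc
      have := MvPolynomial.le_totalDegree (MvPolynomial.mem_support_iff.mpr hc)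
      simp at this
      lia
    obtain ⟨J, hJ⟩ := hfin
    intro j
    by_cases h : J ≤ j
    · exact hJ j h
    · exact Nat.decreasingInduction (motive := fun j _ =>
        MvPolynomial.coeff (Finsupp.single 0 j) f = 0) (fun i _ h => key i h) (hJ J le_rfl)
        (not_le.mp h).le

/-- The regular sequence `∂_1, …, ∂_n, y ∂_y - a`. -/
def eulerSeq (a : ℂ) (hy : ∀ b, F.x 0 * b = 0 → b = 0) : RegularSeq (DiffOp A) (n + 1) where
  P := F.eulerP a
  comm := F.eulerP_commute a
  reg := F.eulerP_reg a hy

theorem adj_algebraMap {m : ℕ} (F : Coords A m) (a : ℂ) :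
    F.adj (algebraMap ℂ (DiffOp A) a) = algebraMap ℂ (DiffOp A) a := by
  rw [← AlgHom.commutes (DiffOp.ofFun (A := A)), adj_ofFun]

/-- The adjoint of y∂_y is -∂_y y = -(y∂_y + 1). This is the origin of the dual exponent -(a+1). -/
theorem adj_euler (a : ℂ) : F.adj (F.euler a) = -F.euler (-(a + 1)) := by
  rw [euler, euler, map_sub, adj_mul, adj_d, adj_ofFun, adj_algebraMap, neg_mul,
    DiffOp.ofVF_mul_ofFun, F.dual, if_pos rfl, map_one, map_neg, map_add, map_one]
  abel

theorem adj_eulerP (a : ℂ) (k : ℕ) : F.adj (F.eulerP a k) = -F.eulerP (-(a + 1)) k := by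
  rcases lt_trichotomy k n with h | rfl | h
  · rw [F.eulerP_of_lt _ h, F.eulerP_of_lt _ h, adj_d]
  · rw [eulerP_self, eulerP_self, adj_euler]
  · rw [F.eulerP_of_gt _ h, F.eulerP_of_gt _ h, map_zero, neg_zero]

/-- The adjoint reverses products, so it exchanges the right ideal generated by the sequence for `a`
with the left ideal generated by the sequence for -(a+1). The signs are harmless. Regularity on the
other side follows as well. -/
theorem mem_seqImage_eulerP (a : ℂ) (k : ℕ) (Q : DiffOp A) :
    Q ∈ seqImage (F.eulerP a) (DiffOp A) k ↔
      F.adj Q ∈ seqIdeal (F.eulerP (-(a + 1))) k := by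
  induction k generalizing Q with
  | zero =>
    change Q = 0 ↔ F.adj Q = 0
    constructor
    · rintro rfl
      exact map_zero _
    · intro h
      rw [← F.adj_adj Q, h, map_zero]
  | succ k ih =>
    rw [mem_seqImage_succ, mem_seqIdeal_succ]
    constructor
    · rintro ⟨Q', h⟩
      refine ⟨-F.adj Q', ?_⟩
      rw [ih, smul_eq_mul, map_sub, adj_mul, adj_eulerP] at h
      simpa using h
    · rintro ⟨Q', h⟩
      refine ⟨-F.adj Q', ?_⟩
      rw [ih, smul_eq_mul, map_sub, adj_mul, adj_eulerP, map_neg, adj_adj]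
      simpa using h

theorem isRegularOn_eulerP (a : ℂ) (hy : ∀ b, F.x 0 * b = 0 → b = 0) :
    IsRegularOn (F.eulerP a) (n + 1) (DiffOp A) := by
  intro k hk Q hQ
  rw [mem_seqImage_eulerP] at hQ ⊢
  rw [smul_eq_mul, adj_mul, adj_eulerP, mul_neg, neg_mem_iff] at hQ
  exact F.eulerP_reg _ hy k hk _ hQ

end Euler

end Coords
end

noncomputable section

/-! ## Volume forms and their Lie derivatives -/

theorem vf_prod {A : Type} [CommRing A] [Algebra ℂ A] {ι : Type} [DecidableEq ι] (θ : VF A)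
    (s : Finset ι) (f : ι → A) :
    θ (∏ i ∈ s, f i) = ∑ j ∈ s, ∏ i ∈ s, Function.update f j (θ (f j)) i := by
  induction s using Finset.induction_on with
  | empty => simp
  | insert a s ha ih =>
    rw [Finset.prod_insert ha, Derivation.leibniz, ih, Finset.sum_insert ha,
      Finset.prod_insert ha, Function.update_self, add_comm, smul_eq_mul, smul_eq_mul,
      Finset.mul_sum]
    congr 1
    · rw [mul_comm]
      congr 1
      refine Finset.prod_congr rfl fun i hi => ?_
      rw [Function.update_of_ne]
      rintro rfl
      exact ha hi
    · refine Finset.sum_congr rfl fun j hj => ?_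
      rw [Finset.prod_insert ha, Function.update_of_ne]
      rintro rfl
      exact ha hj

/-- The derivative of a determinant. -/
theorem vf_det {A : Type} [CommRing A] [Algebra ℂ A] {m : ℕ} (θ : VF A)
    (B : Matrix (Fin m) (Fin m) A) :
    θ B.det = ∑ j, (B.updateCol j fun i => θ (B i j)).det := by
  simp only [Matrix.det_apply, map_sum]
  rw [Finset.sum_comm]
  refine Finset.sum_congr rfl fun p _ => ?_
  rw [← Finset.smul_sum, Units.smul_def, Units.smul_def, map_zsmul, vf_prod]
  congr 1
  refine Finset.sum_congr rfl fun j _ => Finset.prod_congr rfl fun i _ => ?_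
  by_cases h : i = j
  · subst h
    rw [Function.update_self, Matrix.updateCol_self]
  · rw [Function.update_of_ne h, Matrix.updateCol_ne h]

namespace Coords

variable {A : Type} [CommRing A] [Algebra ℂ A] {m : ℕ} (F : Coords A m)

/-- The volume form of a coordinate system. -/
def vol : Form A m := F.basis.det

theorem vol_apply (η : Fin m → VF A) : F.vol η = Matrix.det (Matrix.of fun i j => η j (F.x i)) := by
  rw [vol, Module.Basis.det_apply]
  congr 1
  ext i j
  rw [Module.Basis.toMatrix_apply, basis_repr]
  rfl

theorem vol_d : F.vol F.d = 1 := by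
  have : F.d = F.basis := funext fun i => (F.basis_apply i).symm
  rw [this]
  exact F.basis.det_self

theorem form_eq (w : Form A m) : w = w F.d • F.vol := by
  have : F.d = F.basis := funext fun i => (F.basis_apply i).symm
  rw [this]
  exact w.eq_smul_basis_det F.basis

/-- Coordinate fields preserve the volume form: the bracket of ∂_i with η_j has the components
∂_i(η_j(x_l)), so the bracket terms are exactly the column-by-column derivative of the determinant.
Only the coefficient of the form is differentiated. -/
theorem isLieDerivative_d (i : Fin m) (w : Form A m) :
    IsLieDerivative (F.d i) w (F.d i (w F.d) • F.vol) := by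
  intro η
  have hvol : F.d i (F.vol η) = ∑ j, F.vol (Function.update η j ⁅F.d i, η j⁆) := by
    rw [vol_apply, vf_det]
    refine Finset.sum_congr rfl fun j _ => ?_
    rw [vol_apply]
    congr 1
    ext k l
    by_cases h : l = j
    · subst h
      rw [Matrix.updateCol_self, Matrix.of_apply, Matrix.of_apply, Function.update_self,
        Derivation.commutator_apply, F.dual]
      split_ifs <;> simp
    · rw [Matrix.updateCol_ne h, Matrix.of_apply, Matrix.of_apply, Function.update_of_ne h]
  generalize hf : w F.d = f
  have hw : w = f • F.vol := by rw [← hf]; exact F.form_eq w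
  rw [hw]
  simp only [AlternatingMap.smul_apply, smul_eq_mul, Derivation.leibniz, ← Finset.mul_sum, ← hvol]
  ring

/-- This is Lie_θ(f vol) = (θ(f) + div(θ) f) vol. In the bracket of θ with the i-th coordinate field
only the i-th component survives, because the form is alternating. -/
theorem isLieDerivative_apply_d {θ : VF A} {w w' : Form A m} (h : IsLieDerivative θ w w') :
    w' F.d = θ (w F.d) + F.div θ * w F.d := by
  rw [h F.d, sub_eq_add_neg, div, Finset.sum_mul, ← Finset.sum_neg_distrib]
  congr 1
  refine Finset.sum_congr rfl fun i _ => ?_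
  have e : ⁅θ, F.d i⁆ = ∑ j, (-F.d i (θ (F.x j))) • F.d j := by
    conv_lhs => rw [F.eq_sum ⁅θ, F.d i⁆]
    refine Finset.sum_congr rfl fun j _ => ?_
    rw [Derivation.commutator_apply, F.dual]
    split_ifs <;> simp
  rw [e, AlternatingMap.map_update_sum, Finset.sum_eq_single i]
  · rw [AlternatingMap.map_update_smul, Function.update_eq_self, smul_eq_mul]
    ring
  · intro j _ hj
    rw [AlternatingMap.map_update_smul, AlternatingMap.map_update_self w F.d hj.symm, smul_zero]
  · simp

end Coords

/-! ## Restriction of coordinate systems -/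

/-- The coordinate system `F` on `Spec A` is the restriction of `F'` on `Spec A'`. -/
structure Coords.Related {A' A : Type} [CommRing A'] [Algebra ℂ A'] [CommRing A] [Algebra ℂ A]
    (φ : A' →ₐ[ℂ] A) {m : ℕ} (F' : Coords A' m) (F : Coords A m) : Prop where
  x : ∀ i, φ (F'.x i) = F.x i
  d : ∀ i, VFRelated φ (F'.d i) (F.d i)

namespace Coords.Related

variable {A' A : Type} [CommRing A'] [Algebra ℂ A'] [CommRing A] [Algebra ℂ A]
  {φ : A' →ₐ[ℂ] A} {m : ℕ} {F' : Coords A' m} {F : Coords A m} (h : Coords.Related φ F' F)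

/-- The representation of the functions and vector fields of `Spec A'` on `Spec A`. -/
def rep : WeylRep F' (DiffOp A) where
  ρ := ((DiffOp.ofFun : A →ₐ[ℂ] DiffOp A).comp φ).toRingHom
  δ i := DiffOp.ofVF (F.d i)
  comm := DiffOp.ofVF_commute F
  leib i a := by
    change DiffOp.ofVF (F.d i) * DiffOp.ofFun (φ a) =
      DiffOp.ofFun (φ a) * DiffOp.ofVF (F.d i) + DiffOp.ofFun (φ (F'.d i a))
    rw [DiffOp.ofVF_mul_ofFun, h.d]

/-- Restriction of differential operators. -/
def map : DiffOp A' →+* DiffOp A := h.rep.lift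

@[simp] theorem map_ofFun (a : A') : h.map (DiffOp.ofFun a) = DiffOp.ofFun (φ a) :=
  h.rep.lift_ofFun a

@[simp] theorem map_d (i : Fin m) : h.map (DiffOp.ofVF (F'.d i)) = DiffOp.ofVF (F.d i) :=
  h.rep.lift_ofVF_d i

theorem map_algebraMap (a : ℂ) :
    h.map (algebraMap ℂ (DiffOp A') a) = algebraMap ℂ (DiffOp A) a := by
  rw [← AlgHom.commutes (DiffOp.ofFun (A := A')), map_ofFun, AlgHom.commutes, AlgHom.commutes]

theorem toEnd_map (P : DiffOp A') (a : A') : (h.map P).toEnd (φ a) = φ (P.toEnd a) := by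
  induction P using F'.op_induction generalizing a with
  | hf b =>
    rw [map_ofFun, DiffOp.toEnd_ofFun, DiffOp.toEnd_ofFun, map_mul]
  | ha P Q hP hQ => simp [hP, hQ]
  | hm P i hP =>
    rw [map_mul, map_mul, map_mul, map_d, Module.End.mul_apply, Module.End.mul_apply,
      DiffOp.toEnd_ofVF, DiffOp.toEnd_ofVF, h.d, hP]

theorem adj_map (P : DiffOp A') : F.adj (h.map P) = h.map (F'.adj P) := by
  induction P using F'.op_induction with
  | hf b => simp
  | ha P Q hP hQ => simp [hP, hQ]
  | hm P i hP => simp [adj_mul, hP]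

include h in
theorem exists_related (η : VF A') : ∃ θ : VF A, VFRelated φ η θ := by
  refine ⟨∑ i, φ (η (F'.x i)) • F.d i, fun a => ?_⟩
  rw [vf_sum_apply, F'.apply_eq_sum η a, map_sum]
  refine Finset.sum_congr rfl fun i _ => ?_
  rw [map_mul, ← h.d i a]
  rfl

include h in
-- Every vector field upstairs has a related one downstairs, and a vector field is determined by its
-- values on coordinates. Hence any two systems with matching coordinates have matching fields.
theorem of_x {F₂' : Coords A' m} {F₂ : Coords A m} (hx : ∀ i, φ (F₂'.x i) = F₂.x i) :
    Coords.Related φ F₂' F₂ where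
  x := hx
  d i := by
    obtain ⟨θ, hθ⟩ := h.exists_related (F₂'.d i)
    have : θ = F₂.d i := F₂.ext_vf fun j => by
      rw [← hx j, hθ, F₂'.dual, hx j, F₂.dual]
      split_ifs <;> simp
    exact this ▸ hθ

theorem map_ofVF {η : VF A'} {θ : VF A} (hθ : VFRelated φ η θ) :
    h.map (DiffOp.ofVF η) = DiffOp.ofVF θ := by
  rw [DiffOp.ofVF_eq_sum F' η, DiffOp.ofVF_eq_sum F θ, map_sum]
  refine Finset.sum_congr rfl fun i _ => ?_
  rw [map_mul, map_ofFun, map_d, ← hθ, h.x]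

/-- Restriction of operators does not depend on the coordinates used to construct it, so classes
compared through different frames are comparable. -/
theorem map_eq {F₂' : Coords A' m} {F₂ : Coords A m} (h₂ : Coords.Related φ F₂' F₂) :
    h.map = h₂.map :=
  DiffOp.hom_ext F' (fun a => by simp) fun i => by
    rw [map_d, h₂.map_ofVF (h.d i)]

include h in
theorem formRelated_vol : FormRelated φ F'.vol F.vol := by
  intro η θ hη
  rw [vol_apply, vol_apply, AlgHom.map_det]
  congr 1
  ext i j
  rw [Matrix.of_apply, ← h.x i, hη]
  rfl

/-- The chain rule with a single related field shows that restriction of sections is semilinear for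
each coordinate field; normal ordering extends this to all operators. -/
theorem map_smul {M' M : Type} [AddCommGroup M'] [Module A' M'] [Module (DiffOp A') M']
    [DCompatible A' M'] [AddCommGroup M] [Module A M] [Module (DiffOp A) M] [DCompatible A M]
    {r : M' →+ M} (hr : IsDPullback φ r) (P : DiffOp A') (m : M') :
    r (P • m) = h.map P • r m := by
  induction P using F'.op_induction generalizing m with
  | hf b => rw [map_ofFun, DCompatible.ofFun_smul, DCompatible.ofFun_smul, hr.smul]
  | ha P Q hP hQ => rw [add_smul, map_add, hP, hQ, map_add, add_smul]
  | hm P i hP =>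
    have := hr.chain_rule (F.d i) 1 (fun _ => 1) (fun _ => F'.d i) (fun a => by simp [h.d i a]) m
    simp only [Finset.univ_unique, Finset.sum_singleton, one_smul] at this
    rw [map_mul, map_d, mul_smul, mul_smul, hP, this]

theorem map_eulerP {n : ℕ} {F' : Coords A' (n + 1)} {F : Coords A (n + 1)}
    (h : Coords.Related φ F' F) (a : ℂ) (k : ℕ) : F.eulerP a k = h.map (F'.eulerP a k) := by
  rcases lt_trichotomy k n with hk | rfl | hk
  · rw [F.eulerP_of_lt _ hk, F'.eulerP_of_lt _ hk, map_d]
  · rw [eulerP_self, eulerP_self, euler, euler, map_sub, map_mul, map_ofFun, map_d,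
      map_algebraMap, h.x]
  · rw [F.eulerP_of_gt _ hk, F'.eulerP_of_gt _ hk, map_zero]

end Coords.Related

/-! ## Duality frames -/

/-- A presentation of two `𝒟`-modules by generators annihilated by the same operators up to formal
adjoints. -/
structure DualityFrame (A : Type) [CommRing A] [Algebra ℂ A] (n : ℕ) (M N : Type)
    [AddCommGroup M] [Module (DiffOp A) M] [AddCommGroup N] [Module (DiffOp A) N] where
  F : Coords A (n + 1)
  a : ℂ
  nzd : ∀ b, F.x 0 * b = 0 → b = 0
  u : M
  v : N
  hu : (F.eulerSeq a nzd).IsGen u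
  hv : (F.eulerSeq (-(a + 1)) nzd).IsGen v

theorem DualExt.zero_rmul {D : Type} [Ring D] {M : Type} [AddCommGroup M] [Module D M] {n : ℕ}
    (P : D) : (0 : DualExt D M n).rmul P = 0 :=
  Abelian.Ext.zero_comp _ _ _ _ _

namespace DualityFrame

variable {A : Type} [CommRing A] [Algebra ℂ A] {n : ℕ} {M N : Type}
    [AddCommGroup M] [Module (DiffOp A) M] [AddCommGroup N] [Module (DiffOp A) N]
    (G : DualityFrame A n M N)

theorem isRegularOn : IsRegularOn (G.F.eulerSeq G.a G.nzd).P (n + 1) (DiffOp A) :=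
  G.F.isRegularOn_eulerP G.a G.nzd

/-- The map of `toHom` on the level of operators. -/
def preHom : DiffOp A →+ (Form A (n + 1) →+ DualExt (DiffOp A) M (n + 1)) :=
  AddMonoidHom.mk' (fun Q => AddMonoidHom.mk'
      -- The value of `w` on the coordinate fields is the function f with w = f vol, and functions
      -- act on Ext through right multiplication.
      (fun w => G.hu.clsHom (DiffOp A) (G.F.adj Q * DiffOp.ofFun (w G.F.d)))
      (fun w w' => by rw [AlternatingMap.add_apply, map_add, mul_add, map_add]))
    (fun Q Q' => by
      ext w
      simp only [AddMonoidHom.mk'_apply, AddMonoidHom.add_apply, map_add, add_mul])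

theorem cls_adj_eq_zero_iff (Q : DiffOp A) :
    G.hu.cls (G.F.adj Q) = 0 ↔ Q ∈ seqIdeal (G.F.eulerP (-(G.a + 1))) (n + 1) := by
  rw [G.hu.cls_eq_zero_iff G.isRegularOn]
  refine (G.F.mem_seqImage_eulerP G.a _ _).trans ?_
  rw [Coords.adj_adj]

theorem preHom_eq_zero {Q : DiffOp A} (hQ : Q ∈ seqIdeal (G.F.eulerP (-(G.a + 1))) (n + 1)) :
    G.preHom Q = 0 := by
  ext w
  change G.hu.cls (G.F.adj Q * _) = 0
  rw [← G.hu.cls_rmul, (G.cls_adj_eq_zero_iff Q).mpr hQ, DualExt.zero_rmul]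

/-- The map from `N` to `Hom(ω, Ext(M, 𝒟))` given by a frame. -/
def toHom : N →+ (Form A (n + 1) →+ DualExt (DiffOp A) M (n + 1)) :=
  (QuotientAddGroup.lift (seqIdeal (G.F.eulerP (-(G.a + 1))) (n + 1)).toAddSubgroup G.preHom
    (fun _ hQ => G.preHom_eq_zero hQ)).comp G.hv.equiv.symm.toAddEquiv.toAddMonoidHom

theorem toHom_apply (Q : DiffOp A) (w : Form A (n + 1)) :
    G.toHom (Q • G.v) w = G.hu.cls (G.F.adj Q * DiffOp.ofFun (w G.F.d)) := by
  change QuotientAddGroup.lift (seqIdeal (G.F.eulerP (-(G.a + 1))) (n + 1)).toAddSubgroup G.preHom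
    (fun _ hQ => G.preHom_eq_zero hQ) (G.hv.equiv.symm (Q • G.v)) w = _
  rw [G.hv.equiv_symm]
  rfl

theorem toHom_form_smul (x : N) (a : A) (w : Form A (n + 1)) :
    G.toHom x (a • w) = (G.toHom x w).rmul (DiffOp.ofFun a) := by
  obtain ⟨Q, rfl⟩ := G.hv.gen x
  rw [toHom_apply, toHom_apply, G.hu.cls_rmul, AlternatingMap.smul_apply, smul_eq_mul, mul_comm,
    map_mul, mul_assoc]

theorem eq_zero_of_toHom_vol {x : N} (h : G.toHom x G.F.vol = 0) : x = 0 := by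
  obtain ⟨Q, rfl⟩ := G.hv.gen x
  rw [toHom_apply, Coords.vol_d, map_one, mul_one, cls_adj_eq_zero_iff] at h
  exact (G.hv.ann Q).mpr h

theorem toHom_injective : Function.Injective G.toHom := by
  rw [injective_iff_map_eq_zero]
  intro x hx
  exact G.eq_zero_of_toHom_vol (by rw [hx]; rfl)

/-- The volume form of any coordinate system generates ω, so one value on it suffices. The system
may differ from that of the frame, as is needed when frames of several charts are compared. -/
theorem eq_of_toHom_vol (F : Coords A (n + 1)) {x y : N}
    (h : G.toHom x F.vol = G.toHom y F.vol) : x = y := by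
  refine G.toHom_injective (AddMonoidHom.ext fun w => ?_)
  rw [F.form_eq w, toHom_form_smul, toHom_form_smul, h]

theorem exists_toHom_eq (f : Form A (n + 1) →+ DualExt (DiffOp A) M (n + 1))
    (hf : ∀ (a : A) w, f (a • w) = (f w).rmul (DiffOp.ofFun a)) : ∃ x, G.toHom x = f := by
  obtain ⟨c, hc⟩ := G.hu.exists_cls G.isRegularOn (f G.F.vol)
  refine ⟨G.F.adj c • G.v, AddMonoidHom.ext fun w => ?_⟩
  rw [toHom_apply, Coords.adj_adj, G.F.form_eq w, hf, hc, G.hu.cls_rmul, AlternatingMap.smul_apply,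
    Coords.vol_d, smul_eq_mul, mul_one]

theorem toHom_ofFun_smul (a : A) (x : N) (w : Form A (n + 1)) :
    G.toHom (DiffOp.ofFun a • x) w = (G.toHom x w).rmul (DiffOp.ofFun a) := by
  obtain ⟨Q, rfl⟩ := G.hv.gen x
  rw [← mul_smul, toHom_apply, toHom_apply, G.hu.cls_rmul, Coords.adj_mul, Coords.adj_ofFun,
    mul_assoc, mul_assoc, ← map_mul, ← map_mul, mul_comm a]

/-- The adjoint of θ and the Lie derivative of the form both produce the divergence of θ, and the
two contributions match. This is why the adjoint has to be taken with respect to the volume form. -/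
theorem toHom_ofVF_smul (θ : VF A) (x : N) {w w' : Form A (n + 1)} (hw : IsLieDerivative θ w w') :
    G.toHom (DiffOp.ofVF θ • x) w = -G.toHom x w' - (G.toHom x w).rmul (DiffOp.ofVF θ) := by
  obtain ⟨Q, rfl⟩ := G.hv.gen x
  rw [← mul_smul, toHom_apply, toHom_apply, toHom_apply, G.hu.cls_rmul, Coords.adj_mul,
    Coords.adj_ofVF, G.F.isLieDerivative_apply_d hw]
  change G.hu.clsHom (DiffOp A) _ = -G.hu.clsHom (DiffOp A) _ - G.hu.clsHom (DiffOp A) _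
  rw [← map_neg, ← map_sub]
  congr 1
  rw [mul_assoc, mul_assoc, sub_mul, neg_mul, DiffOp.ofVF_mul_ofFun, map_add, map_mul, ← mul_neg,
    ← mul_sub]
  congr 1
  abel

/-- If the endomorphisms of `N` are scalars, two frames differ by a scalar. -/
theorem exists_toHom_eq_smul (G' : DualityFrame A n M N)
    (hN : ∀ f : N →ₗ[DiffOp A] N, ∃ z : ℂ, ∀ x, f x = algebraMap ℂ (DiffOp A) z • x) :
    ∃ z : ℂ, ∀ x, G.toHom x = G'.toHom (algebraMap ℂ (DiffOp A) z • x) := by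
  -- The comparison of the two frames is an additive endomorphism of `N`. It commutes with functions
  -- and with coordinate fields, hence with all operators, and is therefore a scalar.
  choose f hf using fun x => G'.exists_toHom_eq (G.toHom x) (fun a w => G.toHom_form_smul x a w)
  have hadd : ∀ x y, f (x + y) = f x + f y := fun x y => G'.toHom_injective (by
    rw [map_add, hf, hf, hf, map_add])
  have hfun : ∀ (a : A) x, f (DiffOp.ofFun a • x) = DiffOp.ofFun a • f x := fun a x =>
    G'.toHom_injective (AddMonoidHom.ext fun w => by
      rw [hf, toHom_ofFun_smul, toHom_ofFun_smul, hf])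
  have hd : ∀ i x, f (DiffOp.ofVF (G.F.d i) • x) = DiffOp.ofVF (G.F.d i) • f x := fun i x =>
    G'.toHom_injective (AddMonoidHom.ext fun w => by
      rw [hf, G.toHom_ofVF_smul _ _ (G.F.isLieDerivative_d i w),
        G'.toHom_ofVF_smul _ _ (G.F.isLieDerivative_d i w), hf])
  have hsmul : ∀ (P : DiffOp A) x, f (P • x) = P • f x := by
    intro P
    induction P using G.F.op_induction with
    | hf a => exact hfun a
    | ha P Q hP hQ =>
      intro x
      rw [add_smul, hadd, hP, hQ, add_smul]
    | hm P i hP =>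
      intro x
      rw [mul_smul, hP, hd, mul_smul]
  obtain ⟨z, hz⟩ := hN { toFun := f, map_add' := hadd, map_smul' := hsmul }
  exact ⟨z, fun x => by rw [← hf]; exact congrArg G'.toHom (hz x)⟩

end DualityFrame

/-- The frame `G` on `Spec A` is the restriction of the frame `G'` on `Spec A'`. -/
structure DualityFrame.Related {A' A : Type} [CommRing A'] [Algebra ℂ A'] [CommRing A]
    [Algebra ℂ A] (φ : A' →ₐ[ℂ] A) {n : ℕ} {M' N' M N : Type}
    [AddCommGroup M'] [Module (DiffOp A') M'] [AddCommGroup N'] [Module (DiffOp A') N']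
    [AddCommGroup M] [Module (DiffOp A) M] [AddCommGroup N] [Module (DiffOp A) N]
    (rM : M' →+ M) (rN : N' →+ N)
    (G' : DualityFrame A' n M' N') (G : DualityFrame A n M N) : Prop where
  F : Coords.Related φ G'.F G.F
  a : G'.a = G.a
  u : rM G'.u = G.u
  v : rN G'.v = G.v

namespace DualityFrame.Related

variable {A' A : Type} [CommRing A'] [Algebra ℂ A'] [CommRing A]
    [Algebra ℂ A] {φ : A' →ₐ[ℂ] A} {n : ℕ} {M' N' M N : Type}
    [AddCommGroup M'] [Module (DiffOp A') M'] [AddCommGroup N'] [Module (DiffOp A') N']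
    [AddCommGroup M] [Module (DiffOp A) M] [AddCommGroup N] [Module (DiffOp A) N]
    {rM : M' →+ M} {rN : N' →+ N}
    {G' : DualityFrame A' n M' N'} {G : DualityFrame A n M N} (h : Related φ rM rN G' G)

theorem eulerSeq_P (i : ℕ) :
    (G.F.eulerSeq G.a G.nzd).P i = h.F.map ((G'.F.eulerSeq G'.a G'.nzd).P i) := by
  change G.F.eulerP _ _ = h.F.map (G'.F.eulerP _ _)
  rw [h.a, h.F.map_eulerP]

theorem toHom_related [Module A' M'] [DCompatible A' M'] [Module A' N'] [DCompatible A' N']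
    [Module A M] [DCompatible A M] [Module A N] [DCompatible A N] (hM : IsDPullback φ rM) (hN : IsDPullback φ rN) (x : N')
    {w : Form A' (n + 1)} {w' : Form A (n + 1)} (hw : FormRelated φ w w') :
    (G'.toHom x w).Related h.F.map rM (G.toHom (rN x) w') := by
  obtain ⟨Q, rfl⟩ := G'.hv.gen x
  have := G'.hu.cls_related G.hu h.eulerSeq_P rM (h.F.map_smul hM) h.u
    (G'.F.adj Q * DiffOp.ofFun (w G'.F.d))
  rw [map_mul, ← h.F.adj_map, Coords.Related.map_ofFun, ← hw _ _ h.F.d] at this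
  rw [toHom_apply, h.F.map_smul hN, h.v, toHom_apply]
  exact this

theorem toHom_eq_of_related {x : DualExt (DiffOp A') M' (n + 1)} {y z}
    (hy : x.Related h.F.map rM y) (hz : x.Related h.F.map rM z) : y = z :=
  RegularSeq.IsGen.related_unique G'.hu G.hu h.eulerSeq_P G.isRegularOn h.u hy hz

end DualityFrame.Related
end

noncomputable section

/-! ## Gluing duality frames -/

/-- A multiplicative cocycle on the good elements of a preorder is a coboundary if the good elements
are directed downward. -/
theorem exists_coboundary {I : Type} [Preorder I] (good : I → Prop)
    (hdir : ∀ c c', good c → good c' → ∃ d, d ≤ c ∧ d ≤ c' ∧ good d)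
    (z : ∀ {c c' : I}, c ≤ c' → ℂ) (hz : ∀ {c c' : I} (h : c ≤ c'), good c → z h ≠ 0)
    (hcoc : ∀ {c c' c'' : I} (h : c ≤ c') (h' : c' ≤ c''), good c →
      z (h.trans h') = z h * z h') (hup : ∀ {c c' : I}, c ≤ c' → good c → good c') :
    ∃ μ : I → ℂ, (∀ c, μ c ≠ 0) ∧ ∀ {c c' : I} (h : c ≤ c'), good c → μ c' = z h * μ c := by
  by_cases h0 : ∃ c₀, good c₀
  · obtain ⟨c₀, h₀⟩ := h0
    -- With a base element c₀ and a common lower bound d of c and c₀, put μ(c) = z(d ≤ c)/z(d ≤ c₀).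
    -- The choice of d does not matter: pass to a good lower bound of two choices and use the
    -- cocycle relation.
    have key : ∀ {c d e : I} (hdc : d ≤ c) (hd0 : d ≤ c₀) (hec : e ≤ c) (he0 : e ≤ c₀), good d →
        good e → z hdc / z hd0 = z hec / z he0 := by
      intro c d e hdc hd0 hec he0 hd he
      obtain ⟨f, hfd, hfe, hf⟩ := hdir d e hd he
      have h1 := hcoc hfd hdc hf
      have h2 := hcoc hfd hd0 hf
      have h3 := hcoc hfe hec hf
      have h4 := hcoc hfe he0 hf
      have e1 : z hfd * z hdc = z hfe * z hec := h1.symm.trans h3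
      have e2 : z hfd * z hd0 = z hfe * z he0 := h2.symm.trans h4
      rw [div_eq_div_iff (hz _ hd) (hz _ he)]
      refine mul_left_cancel₀ (mul_ne_zero (hz hfd hf) (hz hfe hf)) ?_
      linear_combination (z hfe * z he0) * e1 - (z hfe * z hec) * e2
    have ex : ∀ c, ∃ μ : ℂ, μ ≠ 0 ∧ ∀ (_ : good c) (d : I) (hdc : d ≤ c) (hd0 : d ≤ c₀), good d →
        μ = z hdc / z hd0 := by
      intro c
      by_cases hc : good c
      · obtain ⟨d, hdc, hd0, hd⟩ := hdir c c₀ hc h₀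
        exact ⟨z hdc / z hd0, div_ne_zero (hz _ hd) (hz _ hd), fun _ e hec he0 he =>
          key hdc hd0 hec he0 hd he⟩
      · exact ⟨1, one_ne_zero, fun h => absurd h hc⟩
    choose μ hμ0 hμ using ex
    refine ⟨μ, hμ0, fun {c c'} h hc => ?_⟩
    obtain ⟨d, hdc, hd0, hd⟩ := hdir c c₀ hc h₀
    rw [hμ c hc d hdc hd0 hd, hμ c' (hup h hc) d (hdc.trans h) hd0 hd, hcoc hdc h hd]
    ring
  · exact ⟨fun _ => 1, fun _ => one_ne_zero, fun {c _} _ hc => absurd ⟨c, hc⟩ h0⟩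

theorem algebraMap_smul_cancel {A : Type} [CommRing A] [Algebra ℂ A] {M : Type}
    [AddCommGroup M] [Module (DiffOp A) M] {z z' : ℂ} {x : M} (hx : x ≠ 0)
    (h : algebraMap ℂ (DiffOp A) z • x = algebraMap ℂ (DiffOp A) z' • x) : z = z' := by
  by_contra hne
  refine hx ?_
  have h1 : algebraMap ℂ (DiffOp A) (z - z') • x = 0 := by
    rw [map_sub, sub_smul, h, sub_self]
  have h2 : algebraMap ℂ (DiffOp A) (z - z')⁻¹ • algebraMap ℂ (DiffOp A) (z - z') • x = 0 := by
    rw [h1, smul_zero]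
  rwa [← mul_smul, ← map_mul, inv_mul_cancel₀ (sub_ne_zero.mpr hne), map_one, one_smul] at h2

section Glue

variable {A : Type} [CommRing A] [Algebra ℂ A] {M : Type} [AddCommGroup M] [Module A M]
    [Module (DiffOp A) M] [DCompatible A M]

theorem algebraMap_diffOp_smul (z : ℂ) (x : M) :
    algebraMap ℂ (DiffOp A) z • x = algebraMap ℂ A z • x := by
  rw [← AlgHom.commutes (DiffOp.ofFun (A := A)), DCompatible.ofFun_smul]

theorem map_algebraMap_smul {B N : Type} [CommRing B] [Algebra ℂ B] [AddCommGroup N] [Module B N]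
    [Module (DiffOp B) N] [DCompatible B N] {φ : A →ₐ[ℂ] B} {r : M →+ N} (hr : IsDPullback φ r)
    (z : ℂ) (x : M) : r (algebraMap ℂ (DiffOp A) z • x) = algebraMap ℂ (DiffOp B) z • r x := by
  rw [algebraMap_diffOp_smul, algebraMap_diffOp_smul, hr.smul, AlgHom.commutes]

end Glue

/-- Frames over all charts, with compatible restrictions to smaller charts, present `N` as the
holonomic dual of `M`, if the endomorphisms of `N` over a chart are scalars and the charts where `N`
is non-zero are directed downward. -/
theorem isHolonomicDual_of_frames {I : Type} [Preorder I] {Y : Charted I} {n : ℕ} (M N : DMod Y)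
    (G : ∀ c, DualityFrame (Y.A c) n (M.M c) (N.M c))
    (hG : ∀ {c c' : I} (h : c ≤ c'), ∃ G' : DualityFrame (Y.A c) n (M.M c) (N.M c),
      DualityFrame.Related (Y.res h) (M.res h) (N.res h) (G c') G')
    (hN : ∀ c, ∀ f : N.M c →ₗ[DiffOp (Y.A c)] N.M c, ∃ z : ℂ, ∀ x,
      f x = algebraMap ℂ (DiffOp (Y.A c)) z • x)
    (hdir : ∀ c c', Nontrivial (N.M c) → Nontrivial (N.M c') →
      ∃ d, d ≤ c ∧ d ≤ c' ∧ Nontrivial (N.M d)) :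
    IsHolonomicDual (n + 1) M N := by
  -- `Rs h` is the frame of the larger chart restricted to the smaller one, and `z h` is the scalar
  -- by which it differs from the frame that the smaller chart has itself.
  choose Rs hRs using @hG
  have ex : ∀ {c c' : I} (h : c ≤ c'), ∃ z : ℂ, ∀ x, (G c).toHom x =
      (Rs h).toHom (algebraMap ℂ (DiffOp (Y.A c)) z • x) :=
    fun {c c'} h => (G c).exists_toHom_eq_smul (Rs h) (hN c)
  choose z hz using @ex
  have hv : ∀ c, Nontrivial (N.M c) → (G c).v ≠ 0 := by
    intro c hc hv
    obtain ⟨x, hx⟩ := exists_ne (0 : N.M c)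
    obtain ⟨Q, rfl⟩ := (G c).hv.gen x
    exact hx (by rw [hv, smul_zero])
  have hup : ∀ {c c' : I}, c ≤ c' → Nontrivial (N.M c) → Nontrivial (N.M c') := by
    intro c c' h hc
    refine nontrivial_of_ne (G c').v 0 fun h0 => ?_
    have hv0 := (hRs h).v
    rw [h0, map_zero] at hv0
    obtain ⟨x, hx⟩ := exists_ne (0 : N.M c)
    obtain ⟨Q, rfl⟩ := (Rs h).hv.gen x
    exact hx (by rw [← hv0, smul_zero])
  have hz0 : ∀ {c c' : I} (h : c ≤ c'), Nontrivial (N.M c) → z h ≠ 0 := by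
    intro c c' h hc h0
    refine hv c hc ((G c).toHom_injective ?_)
    rw [hz h, h0, map_zero, zero_smul, map_zero, map_zero]
  have hcoc : ∀ {c c' c'' : I} (h : c ≤ c') (h' : c' ≤ c''), Nontrivial (N.M c) →
      z (h.trans h') = z h * z h' := by
    intro c c' c'' h h' hc
    -- The frame of c'' restricted to c directly is the restriction of its restriction to c'. Both
    -- ways of comparing on c are related to the same class on c', so uniqueness of related classes
    -- gives the cocycle relation.
    have hrel : DualityFrame.Related (Y.res h) (M.res h) (N.res h) (Rs h') (Rs (h.trans h')) :=
      { F := (hRs h).F.of_x fun i => by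
          rw [← (hRs h').F.x, Y.res_res, (hRs (h.trans h')).F.x]
        a := (hRs h').a.symm.trans (hRs (h.trans h')).a
        u := by rw [← (hRs h').u, M.res_res, (hRs (h.trans h')).u]
        v := by rw [← (hRs h').v, N.res_res, (hRs (h.trans h')).v] }
    have r1 := (hRs h).toHom_related (M.isPullback h) (N.isPullback h) (G c').v
      (hRs h).F.formRelated_vol
    have r2 := hrel.toHom_related (M.isPullback h) (N.isPullback h)
      (algebraMap ℂ (DiffOp (Y.A c')) (z h') • (G c').v) (hRs h).F.formRelated_vol
    rw [← hz h', hrel.F.map_eq (hRs h).F, map_algebraMap_smul (N.isPullback h)] at r2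
    have e := (hRs h).toHom_eq_of_related r1 r2
    have e2 : (G c).toHom (N.res h (G c').v) (Rs h).F.vol =
        (Rs (h.trans h')).toHom
          (algebraMap ℂ (DiffOp (Y.A c)) (z h * z h') • N.res h (G c').v) (Rs h).F.vol := by
      have hs : ∀ y, (Rs h).toHom (algebraMap ℂ (DiffOp (Y.A c)) (z h) • y) (Rs h).F.vol =
          ((Rs h).toHom y (Rs h).F.vol).rmul (DiffOp.ofFun (algebraMap ℂ (Y.A c) (z h))) := by
        intro y
        rw [← (Rs h).toHom_ofFun_smul, AlgHom.commutes]
      rw [hz h, hs, e, ← (Rs (h.trans h')).toHom_ofFun_smul, AlgHom.commutes, ← mul_smul,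
        ← map_mul]
    rw [hz (h.trans h')] at e2
    have e3 := (Rs (h.trans h')).eq_of_toHom_vol _ e2
    refine algebraMap_smul_cancel ?_ e3
    rw [(hRs h).v]
    intro h0
    obtain ⟨x, hx⟩ := exists_ne (0 : N.M c)
    obtain ⟨Q, rfl⟩ := (Rs h).hv.gen x
    exact hx (by rw [h0, smul_zero])
  obtain ⟨μ, hμ0, hμ⟩ := exists_coboundary (fun c => Nontrivial (N.M c)) hdir @z @hz0 @hcoc @hup
  have hcancel : ∀ c (x : N.M c), algebraMap ℂ (DiffOp (Y.A c)) (μ c) •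
      algebraMap ℂ (DiffOp (Y.A c)) (μ c)⁻¹ • x = x := by
    intro c x
    rw [← mul_smul, ← map_mul, mul_inv_cancel₀ (hμ0 c), map_one, one_smul]
  refine ⟨fun c i hi => (G c).hu.subsingleton (G c).isRegularOn i hi,
    fun c => (G c).toHom.comp (DistribSMul.toAddMonoidHom _ (algebraMap ℂ (DiffOp (Y.A c)) (μ c))),
    fun c x a w => (G c).toHom_form_smul _ a w, fun c => ?_, fun c f hf => ?_, fun c a x w => ?_,
    fun c θ x w w' hw => ?_, fun {c c'} h => ?_⟩
  · refine (G c).toHom_injective.comp fun x y hxy => ?_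
    have := congrArg (fun y => algebraMap ℂ (DiffOp (Y.A c)) (μ c)⁻¹ • y) hxy
    simp only [DistribSMul.toAddMonoidHom_apply] at this
    rwa [← mul_smul, ← mul_smul, ← map_mul, inv_mul_cancel₀ (hμ0 c), map_one, one_smul,
      one_smul] at this
  · obtain ⟨x, hx⟩ := (G c).exists_toHom_eq f hf
    refine ⟨algebraMap ℂ (DiffOp (Y.A c)) (μ c)⁻¹ • x, ?_⟩
    rw [AddMonoidHom.comp_apply, DistribSMul.toAddMonoidHom_apply, hcancel, hx]
  · simp only [AddMonoidHom.comp_apply, DistribSMul.toAddMonoidHom_apply]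
    rw [← (G c).toHom_ofFun_smul, ← DCompatible.ofFun_smul, ← mul_smul, ← mul_smul,
      Algebra.commutes]
  · simp only [AddMonoidHom.comp_apply, DistribSMul.toAddMonoidHom_apply]
    rw [← (G c).toHom_ofVF_smul θ _ hw, ← mul_smul, ← mul_smul, Algebra.commutes]
  · refine ⟨(hRs h).F.map, (hRs h).F.toEnd_map, fun x w w' hw => ?_⟩
    simp only [AddMonoidHom.comp_apply, DistribSMul.toAddMonoidHom_apply]
    have r := (hRs h).toHom_related (M.isPullback h) (N.isPullback h)
      (algebraMap ℂ (DiffOp (Y.A c')) (μ c') • x) hw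
    rw [map_algebraMap_smul (N.isPullback h)] at r
    -- Over a chart where `N` vanishes the scalars carry no information and the cocycle relation is
    -- not available, but both sides are zero.
    by_cases hc : Nontrivial (N.M c)
    · rw [hz h, ← mul_smul, ← map_mul, ← hμ h hc]
      exact r
    · rw [not_nontrivial_iff_subsingleton] at hc
      rw [Subsingleton.elim (algebraMap ℂ (DiffOp (Y.A c)) (μ c') • N.res h x) 0, map_zero] at r
      rw [Subsingleton.elim (algebraMap ℂ (DiffOp (Y.A c)) (μ c) • N.res h x) 0, map_zero]
      exact r
end

noncomputable section

/-! ## Criteria for inverse images -/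

/-- If `A` is spanned over `R` by the image of `A'`, and `M'` is spanned over `R'` by elements that
map to an `R`-basis of `M`, then `M` is the base change of `M'` from `A'` to `A`. -/
theorem isBaseChangeAlong_of_basis {R' R A' A : Type} [CommRing R'] [CommRing R] [CommRing A']
    [Algebra ℂ A'] [CommRing A] [Algebra ℂ A] [Algebra R' A'] [Algebra R A]
    (χ₀ : R' →+* R) (χ : A' →ₐ[ℂ] A) (hχ : ∀ r, χ (algebraMap R' A' r) = algebraMap R A (χ₀ r))
    (hA : Submodule.span R (Set.range χ) = ⊤)
    {M' M : Type} [AddCommGroup M'] [Module A' M'] [Module R' M'] [IsScalarTower R' A' M']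
    [AddCommGroup M] [Module A M] [Module R M] [IsScalarTower R A M]
    (r : M' →+ M) (hr : ∀ (a : A') (m : M'), r (a • m) = χ a • r m)
    {ι : Type} (b' : ι → M') (hb' : Submodule.span R' (Set.range b') = ⊤)
    (b : Module.Basis ι R M) (hb : ∀ i, b i = r (b' i)) : IsBaseChangeAlong χ r hr := by
  let : Algebra A' A := χ.toRingHom.toAlgebra
  let : Module A' M := Module.compHom M χ.toRingHom
  have : IsScalarTower A' A M := ⟨fun a c m => mul_smul (χ a) c m⟩
  change IsBaseChange A ({ toFun := r, map_add' := r.map_add, map_smul' := hr } : M' →ₗ[A'] M)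
  have hr₀ : ∀ (a : R') (m : M'), r (a • m) = χ₀ a • r m := fun a m => by
    rw [← algebraMap_smul A' a m, hr, hχ, algebraMap_smul]
  refine IsBaseChange.of_lift_unique _ fun Q _ _ _ _ g => ?_
  let : Module R Q := Module.compHom Q (algebraMap R A)
  have : IsScalarTower R A Q := ⟨fun a c m => by
    rw [Algebra.smul_def, mul_smul]
    rfl⟩
  -- The lift is forced on the `R`-basis. It is linear over `A` because the image of `A'` spans `A`
  -- over `R`, and on that image linearity is inherited from `g`.
  let g₁ : M →ₗ[R] Q := b.constr ℕ fun i => g (b' i)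
  have hg₁ : ∀ m, g₁ (r m) = g m := by
    intro m
    have hm : m ∈ Submodule.span R' (Set.range b') := hb' ▸ Submodule.mem_top
    induction hm using Submodule.span_induction with
    | mem m hm =>
      obtain ⟨i, rfl⟩ := hm
      rw [← hb, Module.Basis.constr_basis]
    | zero => rw [map_zero, map_zero, map_zero]
    | add m m' _ _ h h' => rw [map_add, map_add, map_add, h, h']
    | smul a m _ h =>
      rw [hr₀, map_smul, h, ← algebraMap_smul A' a m, map_smul]
      change algebraMap R A (χ₀ a) • g m = _
      rw [← hχ, ← algebraMap_smul A (algebraMap R' A' a) (g m)]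
      rfl
  have hlin : ∀ (a : A) (m : M), g₁ (a • m) = a • g₁ m := by
    intro a m
    have ha : a ∈ Submodule.span R (Set.range χ) := hA ▸ Submodule.mem_top
    induction ha using Submodule.span_induction with
    | mem a ha =>
      obtain ⟨a', rfl⟩ := ha
      have hm : m ∈ Submodule.span R (Set.range b) := b.span_eq ▸ Submodule.mem_top
      induction hm using Submodule.span_induction with
      | mem m hm =>
        obtain ⟨i, rfl⟩ := hm
        rw [hb, ← hr, hg₁, hg₁, map_smul, ← algebraMap_smul A a' (g (b' i))]
        rfl
      | zero => simp
      | add m m' _ _ h h' => rw [smul_add, map_add, map_add, h, h', smul_add]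
      | smul c m _ h => rw [smul_comm, map_smul, h, map_smul, smul_comm]
    | zero => simp
    | add a a' _ _ h h' => rw [add_smul, map_add, h, h', add_smul]
    | smul c a _ h => rw [smul_assoc, map_smul, h, smul_assoc]
  refine ⟨{ toFun := g₁, map_add' := g₁.map_add, map_smul' := hlin },
    LinearMap.ext hg₁, fun g₂ hg₂ => LinearMap.ext fun m => ?_⟩
  have hm : m ∈ Submodule.span R (Set.range b) := b.span_eq ▸ Submodule.mem_top
  change g₂ m = g₁ m
  induction hm using Submodule.span_induction with
  | mem m hm =>
    obtain ⟨i, rfl⟩ := hm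
    rw [hb, hg₁]
    exact LinearMap.congr_fun hg₂ (b' i)
  | zero => simp
  | add m m' _ _ h h' => rw [map_add, map_add, h, h']
  | smul c m _ h => rw [← algebraMap_smul A c m, map_smul, hlin, h]

/-- The chain rule has to be checked on generators only. -/
theorem chain_rule_of_span {A' A : Type} [CommRing A'] [Algebra ℂ A'] [CommRing A] [Algebra ℂ A]
    {χ : A' →ₐ[ℂ] A} {M' M : Type} [AddCommGroup M'] [Module A' M'] [Module (DiffOp A') M']
    [DCompatible A' M'] [AddCommGroup M] [Module A M] [Module (DiffOp A) M] [DCompatible A M]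
    {r : M' →+ M} (hr : ∀ (a : A') (m : M'), r (a • m) = χ a • r m) {s : Set M'}
    (hs : Submodule.span A' s = ⊤) {θ : VF A} {p : ℕ} {b : Fin p → A} {η : Fin p → VF A'}
    (hθ : ∀ a : A', θ (χ a) = ∑ l, b l * χ (η l a))
    (h : ∀ m ∈ s, DiffOp.ofVF θ • r m = ∑ l, b l • r (DiffOp.ofVF (η l) • m)) (m : M') :
    DiffOp.ofVF θ • r m = ∑ l, b l • r (DiffOp.ofVF (η l) • m) := by
  have hm : m ∈ Submodule.span A' s := hs ▸ Submodule.mem_top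
  induction hm using Submodule.span_induction with
  | mem m hm => exact h m hm
  | zero => simp
  | add m m' _ _ h h' => simp only [smul_add, map_add, h, h', Finset.sum_add_distrib]
  | smul a m _ h =>
    rw [hr, ofVF_smul_smul, h, hθ, Finset.sum_smul, Finset.smul_sum, ← Finset.sum_add_distrib]
    refine Finset.sum_congr rfl fun l _ => ?_
    rw [ofVF_smul_smul, map_add, hr, hr, smul_add, mul_smul, smul_comm (b l) (χ a)]

/-! ## Line bundles with a flat connection on an étale neighbourhood -/

/-- An étale morphism `Spec B → Spec A` of affine spaces with coordinates, and the data of the flat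
connection `∇_θ = θ + γ θ(g)/g + θ(f)` on the trivial line bundle on `Spec B`. -/
structure ConnData (A B : Type) [CommRing A] [Algebra ℂ A] [CommRing B] [Algebra ℂ B] where
  φ : A →ₐ[ℂ] B
  m : ℕ
  FA : Coords A m
  FB : Coords B m
  rel : Coords.Related φ FA FB
  g : Bˣ
  γ : ℂ
  f : B

namespace ConnData

variable {A B : Type} [CommRing A] [Algebra ℂ A] [CommRing B] [Algebra ℂ B] (W : ConnData A B)

/-- The connection form. -/
def form (θ : VF B) : B := W.γ • (θ W.g * ((W.g⁻¹ : Bˣ) : B)) + θ W.f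

/-- The form γ dg/g + df is closed, so the connection is flat and the coordinate fields act by
commuting operators. -/
theorem form_closed (i j : Fin W.m) :
    W.FB.d i (W.form (W.FB.d j)) = W.FB.d j (W.form (W.FB.d i)) := by
  have hinv : ∀ θ : VF B, θ ((W.g⁻¹ : Bˣ) : B) =
      -(((W.g⁻¹ : Bˣ) : B) * ((W.g⁻¹ : Bˣ) : B) * θ W.g) := fun θ => by
    have := vf_zpow θ W.g (-1)
    rw [zpow_neg_one] at this
    rw [this, show (-1 - 1 : ℤ) = -1 + -1 by rfl, zpow_add, zpow_neg_one, Units.val_mul]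
    simp
  simp only [form, map_add, Derivation.map_smul, Derivation.leibniz, hinv, smul_eq_mul,
    W.FB.d_comm i j]
  congr 2
  ring

/-- The representation of differential operators on the line bundle. -/
def rep : WeylRep W.FB (AddMonoid.End B) where
  ρ := Module.toAddMonoidEnd B B
  δ i := (W.FB.d i : B →ₗ[ℂ] B).toAddMonoidHom + AddMonoidHom.mulLeft (W.form (W.FB.d i))
  comm i j := by
    refine AddMonoidHom.ext fun b => ?_
    change W.FB.d i (W.FB.d j b + W.form (W.FB.d j) * b) +
      W.form (W.FB.d i) * (W.FB.d j b + W.form (W.FB.d j) * b) =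
      W.FB.d j (W.FB.d i b + W.form (W.FB.d i) * b) +
      W.form (W.FB.d j) * (W.FB.d i b + W.form (W.FB.d i) * b)
    simp only [map_add, Derivation.leibniz, smul_eq_mul, W.FB.d_comm i j, W.form_closed i j]
    ring
  leib i a := by
    refine AddMonoidHom.ext fun b => ?_
    change W.FB.d i (a * b) + W.form (W.FB.d i) * (a * b) =
      a * (W.FB.d i b + W.form (W.FB.d i) * b) + W.FB.d i a * b
    simp only [Derivation.leibniz, smul_eq_mul]
    ring

/-- The sections over `Spec B` of the line bundle with connection, as a `𝒟`-module on `Spec A`. -/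
def Mod (_ : ConnData A B) : Type := B

instance : AddCommGroup W.Mod := inferInstanceAs (AddCommGroup B)
instance : Module A W.Mod := Module.compHom B W.φ.toRingHom
instance : Module (DiffOp A) W.Mod := Module.compHom B (W.rep.lift.comp W.rel.map)

/-- The function that represents a section. -/
def val : W.Mod ≃+ B := AddEquiv.refl B

theorem val_smul (a : A) (b : W.Mod) : W.val (a • b) = W.φ a * W.val b := rfl

theorem val_diffOp_smul (P : DiffOp A) (b : W.Mod) :
    W.val (P • b) = W.rep.lift (W.rel.map P) (W.val b) := rfl

instance : DCompatible A W.Mod where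
  ofFun_smul a b := by
    apply W.val.injective
    rw [val_diffOp_smul, Coords.Related.map_ofFun, WeylRep.lift_ofFun]
    rfl

theorem val_ofVF_smul {η : VF A} {θ : VF B} (h : VFRelated W.φ η θ) (b : W.Mod) :
    W.val (DiffOp.ofVF η • b) = θ (W.val b) + W.form θ * W.val b := by
  rw [val_diffOp_smul, W.rel.map_ofVF h, WeylRep.lift_ofVF]
  have e : ∀ (c : Fin W.m → AddMonoid.End B), (∑ i, c i) (W.val b) = ∑ i, c i (W.val b) := fun c =>
    AddMonoidHom.finsetSum_apply c Finset.univ (W.val b)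
  have hform : W.form θ = ∑ i, θ (W.FB.x i) * W.form (W.FB.d i) := by
    simp only [form]
    rw [W.FB.apply_eq_sum θ W.g, W.FB.apply_eq_sum θ W.f, Finset.sum_mul, Finset.smul_sum,
      ← Finset.sum_add_distrib]
    refine Finset.sum_congr rfl fun i _ => ?_
    rw [mul_add, mul_smul_comm, mul_assoc]
  rw [e, hform, W.FB.apply_eq_sum θ (W.val b), Finset.sum_mul, ← Finset.sum_add_distrib]
  refine Finset.sum_congr rfl fun i _ => ?_
  change θ (W.FB.x i) * (W.FB.d i (W.val b) + W.form (W.FB.d i) * W.val b) = _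
  ring

variable {A' B' : Type} [CommRing A'] [Algebra ℂ A'] [CommRing B'] [Algebra ℂ B']
  (W' : ConnData A' B')

/-- The restriction map of sections, for a trivialization that changes by `w`. -/
def res (ψ : B' →ₐ[ℂ] B) (w : Bˣ) : W'.Mod →+ W.Mod :=
  W.val.symm.toAddMonoidHom.comp
    (((AddMonoidHom.mulRight (w : B)).comp (ψ : B' →+ B)).comp W'.val.toAddMonoidHom)

theorem val_res (ψ : B' →ₐ[ℂ] B) (w : Bˣ) (b : W'.Mod) :
    W.val (res W W' ψ w b) = ψ (W'.val b) * w := rfl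

/-- Derivations on `B'` over `B` are determined by their values on `A'`. -/
def Separates (φ : A' →ₐ[ℂ] B') (ψ : B' →ₐ[ℂ] B) : Prop :=
  ∀ D : B' →+ B, (∀ b c, D (b * c) = ψ b * D c + ψ c * D b) → (∀ a, D (φ a) = 0) → D = 0

variable {W W'}

/-- If g restricts to αg, the connection form changes by γ dα/α, and multiplication of sections by
`w` absorbs this when dw/w = γ dα/α, which is `hw`. The hypothesis `hsep` extends the chain rule
from the functions on `A'` to those on `B'`, where the connection lives. -/
theorem isDPullback {χ : A' →ₐ[ℂ] A} {ψ : B' →ₐ[ℂ] B} {w : Bˣ}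
    (hφ : ∀ a, ψ (W'.φ a) = W.φ (χ a)) (hsep : Separates W'.φ ψ) (hf : ψ W'.f = W.f)
    (α : Bˣ) (hg : ψ W'.g = α * W.g) (hγ : W'.γ = W.γ)
    (hw : ∀ θ : VF B, θ w * α = W.γ • (θ α * w))
    (hbc : ∀ hr : ∀ (a : A') (m : W'.Mod), res W W' ψ w (a • m) = χ a • res W W' ψ w m,
      IsBaseChangeAlong χ (res W W' ψ w) hr) : IsDPullback χ (res W W' ψ w) := by
  have hr : ∀ (a : A') (m : W'.Mod), res W W' ψ w (a • m) = χ a • res W W' ψ w m := fun a m => by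
    apply W.val.injective
    rw [val_res, val_smul, val_smul, val_res, map_mul, hφ, mul_assoc]
  refine ⟨hr, hbc hr, fun θ p b η hθ m => ?_⟩
  obtain ⟨θ₁, hθ₁⟩ := W.rel.exists_related θ
  choose η₁ hη₁ using fun l => W'.rel.exists_related (η l)
  -- The difference of the two sides is a derivation of `B'` over `B` that vanishes on the image of
  -- `A'`.
  have key : ∀ c : B', θ₁ (ψ c) = ∑ l, W.φ (b l) * ψ (η₁ l c) := by
    let D : B' →+ B := AddMonoidHom.mk' (fun c => θ₁ (ψ c) - ∑ l, W.φ (b l) * ψ (η₁ l c))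
      (fun c c' => by
        simp only [map_add, mul_add, Finset.sum_add_distrib]
        ring)
    have hD : D = 0 := by
      refine hsep D (fun c c' => ?_) fun a => ?_
      · change θ₁ (ψ (c * c')) - ∑ l, W.φ (b l) * ψ (η₁ l (c * c')) =
          ψ c * (θ₁ (ψ c') - ∑ l, W.φ (b l) * ψ (η₁ l c')) +
          ψ c' * (θ₁ (ψ c) - ∑ l, W.φ (b l) * ψ (η₁ l c))
        have : ∀ l, W.φ (b l) * ψ (η₁ l (c * c')) =
            ψ c * (W.φ (b l) * ψ (η₁ l c')) + ψ c' * (W.φ (b l) * ψ (η₁ l c)) := fun l => by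
          simp only [Derivation.leibniz, smul_eq_mul, map_add, map_mul]
          ring
        rw [Finset.sum_congr rfl fun l _ => this l, Finset.sum_add_distrib, ← Finset.mul_sum,
          ← Finset.mul_sum, map_mul, Derivation.leibniz, smul_eq_mul, smul_eq_mul]
        ring
      · change θ₁ (ψ (W'.φ a)) - ∑ l, W.φ (b l) * ψ (η₁ l (W'.φ a)) = 0
        rw [hφ, hθ₁, hθ, map_sum, sub_eq_zero]
        refine Finset.sum_congr rfl fun l _ => ?_
        rw [hη₁, map_mul, hφ]
    intro c
    exact sub_eq_zero.mp (DFunLike.congr_fun hD c)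
  have hL : ∀ l, W.val (b l • res W W' ψ w (DiffOp.ofVF (η l) • m)) =
      W.φ (b l) * ψ (η₁ l (W'.val m)) * w +
        W.φ (b l) * ψ (W'.form (η₁ l)) * (ψ (W'.val m) * w) := by
    intro l
    rw [val_smul, val_res, W'.val_ofVF_smul (hη₁ l), map_add, map_mul]
    ring
  have hform : ∑ l, W.φ (b l) * ψ (W'.form (η₁ l)) =
      W.γ • (θ₁ (ψ W'.g) * ψ ((W'.g⁻¹ : B'ˣ) : B')) + θ₁ W.f := by
    rw [key, ← hf, key, Finset.sum_mul, Finset.smul_sum, ← Finset.sum_add_distrib]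
    refine Finset.sum_congr rfl fun l _ => ?_
    rw [form, map_add, map_smul, map_mul, hγ, mul_add, mul_smul_comm, mul_assoc]
  apply W.val.injective
  rw [W.val_ofVF_smul hθ₁, map_sum, Finset.sum_congr rfl fun l _ => hL l,
    Finset.sum_add_distrib, ← Finset.sum_mul, ← Finset.sum_mul, hform, ← key, val_res,
    Derivation.leibniz, smul_eq_mul, smul_eq_mul]
  have hginv : ψ ((W'.g⁻¹ : B'ˣ) : B') = ((α⁻¹ : Bˣ) : B) * ((W.g⁻¹ : Bˣ) : B) := by
    have h1 : Units.map (ψ : B' →* B) W'.g = α * W.g := Units.ext hg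
    have h2 := congrArg (fun u : Bˣ => ((u⁻¹ : Bˣ) : B)) h1
    simp only [mul_inv, Units.val_mul, ← map_inv] at h2
    exact h2
  have hw' : θ₁ w = W.γ • (θ₁ α * w) * ((α⁻¹ : Bˣ) : B) := by
    rw [← hw, mul_assoc, Units.mul_inv, mul_one]
  rw [hginv, hg, Derivation.leibniz, hw', form]
  simp only [smul_eq_mul, Algebra.smul_def]
  have h1 : (α : B) * ((α⁻¹ : Bˣ) : B) = 1 := α.mul_inv
  have h2 : (W.g : B) * ((W.g⁻¹ : Bˣ) : B) = 1 := W.g.mul_inv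
  generalize ((α⁻¹ : Bˣ) : B) = α' at *
  generalize ((W.g⁻¹ : Bˣ) : B) = g' at *
  generalize algebraMap ℂ B W.γ = γ at *
  linear_combination (-(γ * θ₁ W.g * g' * ψ (W'.val m) * w)) * h1 -
    (γ * θ₁ α * α' * ψ (W'.val m) * w) * h2

end ConnData
end

noncomputable section

/-! ## Restriction maps between (Laurent) polynomial rings -/

section Restriction

variable {R' R : Type} [CommRing R'] [Algebra ℂ R'] [CommRing R] [Algebra ℂ R]
  (χ₀ : R' →ₐ[ℂ] R) (α : Rˣ)

/-- A unit of the base, as a Laurent polynomial. -/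
abbrev laurentUnit (α : Rˣ) : (R[T;T⁻¹])ˣ :=
  Units.map ((laurentConst (R := R)) : R →* R[T;T⁻¹]) α

/-- Restriction of polynomials, with a change of the coordinate by the unit `α`. -/
def polyRes : R'[X] →ₐ[ℂ] R[X] :=
  polyLift (polyConst.comp χ₀) (polyConst (α : R) * Polynomial.X)

/-- Restriction of Laurent polynomials, with a change of the coordinate by the unit `α`. -/
def laurentRes : R'[T;T⁻¹] →ₐ[ℂ] R[T;T⁻¹] :=
  laurentLift (laurentConst.comp χ₀) (laurentUnit α * laurentT)

@[simp] theorem polyRes_C (r : R') : polyRes χ₀ α (Polynomial.C r) = Polynomial.C (χ₀ r) :=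
  polyLift_const _ _ r

@[simp] theorem polyRes_X :
    polyRes χ₀ α Polynomial.X = Polynomial.C (α : R) * Polynomial.X :=
  polyLift_X _ _

@[simp] theorem laurentRes_C (r : R') :
    laurentRes χ₀ α (LaurentPolynomial.C r) = LaurentPolynomial.C (χ₀ r) :=
  laurentLift_const _ _ r

theorem laurentRes_T (j : ℤ) : laurentRes χ₀ α (LaurentPolynomial.T j) =
    LaurentPolynomial.C ((α ^ j : Rˣ) : R) * LaurentPolynomial.T j := by
  have h := LaurentPolynomial.eval₂_T (laurentConst.comp χ₀).toRingHom (laurentUnit α * laurentT) j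
  refine h.trans ?_
  rw [mul_zpow, ← map_zpow, Units.val_mul, laurentT_zpow]
  rfl

@[simp] theorem toLaurentHom_C (r : R) :
    toLaurentHom (Polynomial.C r) = (LaurentPolynomial.C r : R[T;T⁻¹]) :=
  polyLift_const _ _ r

@[simp] theorem toLaurentHom_X :
    toLaurentHom (Polynomial.X : R[X]) = (LaurentPolynomial.T 1 : R[T;T⁻¹]) :=
  polyLift_X _ _

theorem toLaurentHom_eq (p : R[X]) : toLaurentHom p = Polynomial.toLaurent p := by
  have : (toLaurentHom : R[X] →ₐ[ℂ] R[T;T⁻¹]).toRingHom = Polynomial.toLaurent :=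
    Polynomial.ringHom_ext (fun r => by
      rw [Polynomial.toLaurent_C]
      exact toLaurentHom_C r) (by
      rw [Polynomial.toLaurent_X]
      exact toLaurentHom_X)
  exact DFunLike.congr_fun this p

theorem laurentRes_toLaurentHom (p : R'[X]) :
    laurentRes χ₀ α (toLaurentHom p) = toLaurentHom (polyRes χ₀ α p) := by
  have : (laurentRes χ₀ α).comp toLaurentHom = toLaurentHom.comp (polyRes χ₀ α) :=
    polyHom_ext (fun r => by
      change laurentRes χ₀ α (toLaurentHom (Polynomial.C r)) =
        toLaurentHom (polyRes χ₀ α (Polynomial.C r))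
      simp) (by simp [laurentRes_T])
  exact DFunLike.congr_fun this p

theorem span_range_polyRes : Submodule.span R (Set.range (polyRes χ₀ α)) = ⊤ := by
  rw [eq_top_iff]
  intro p _
  induction p using Polynomial.induction_on' with
  | add p q hp hq => exact Submodule.add_mem _ (hp trivial) (hq trivial)
  | monomial i r =>
    have : Polynomial.monomial i r =
        (r * ((α⁻¹ ^ i : Rˣ) : R)) • polyRes χ₀ α (Polynomial.X ^ i) := by
      rw [map_pow, polyRes_X, mul_pow, ← Polynomial.C_pow, ← Polynomial.smul_eq_C_mul, smul_smul,
        mul_assoc, ← Units.val_pow_eq_pow_val, ← Units.val_mul, ← mul_pow, inv_mul_cancel, one_pow,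
        Units.val_one, mul_one, Polynomial.smul_eq_C_mul, Polynomial.C_mul_X_pow_eq_monomial]
    rw [this]
    exact Submodule.smul_mem _ _ (Submodule.subset_span ⟨_, rfl⟩)

theorem span_range_laurentRes : Submodule.span R (Set.range (laurentRes χ₀ α)) = ⊤ := by
  rw [eq_top_iff]
  intro p _
  induction p using LaurentPolynomial.induction_on' with
  | add p q hp hq => exact Submodule.add_mem _ (hp trivial) (hq trivial)
  | C_mul_T i r =>
    have : LaurentPolynomial.C r * LaurentPolynomial.T i =
        (r * ((α ^ (-i) : Rˣ) : R)) • laurentRes χ₀ α (LaurentPolynomial.T i) := by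
      rw [laurentRes_T, LaurentPolynomial.smul_eq_C_mul, ← mul_assoc, ← map_mul, mul_assoc,
        ← Units.val_mul, ← zpow_add, neg_add_cancel, zpow_zero, Units.val_one, mul_one]
    rw [this]
    exact Submodule.smul_mem _ _ (Submodule.subset_span ⟨_, rfl⟩)

end Restriction

/-- The powers of `T` form a basis of the Laurent polynomials. -/
def laurentBasis (R : Type) [CommRing R] : Module.Basis ℤ R R[T;T⁻¹] :=
  Module.Basis.ofRepr (AddMonoidAlgebra.coeffLinearEquiv R)

theorem laurentBasis_apply {R : Type} [CommRing R] (j : ℤ) : laurentBasis R j = LaurentPolynomial.T j := rfl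

section Restriction

variable {R : Type} [CommRing R] [Algebra ℂ R]

theorem separates_id {B : Type} [CommRing B] [Algebra ℂ B] (ψ : B →ₐ[ℂ] R) :
    ConnData.Separates (AlgHom.id ℂ B) ψ := fun _ _ h => AddMonoidHom.ext h

/-- Some T^N b is a polynomial, so D kills it together with T^N. The Leibniz rule then gives ψ(T^N)
D(b) = 0, and ψ(T^N) is a unit. -/
theorem separates_toLaurentHom {B : Type} [CommRing B] [Algebra ℂ B] (ψ : R[T;T⁻¹] →ₐ[ℂ] B) :
    ConnData.Separates (toLaurentHom (R := R)) ψ := by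
  intro D hD h0
  refine AddMonoidHom.ext fun b => ?_
  obtain ⟨N, p, hp⟩ := LaurentPolynomial.exists_T_pow b
  have h1 := h0 p
  rw [toLaurentHom_eq, hp, hD, ← Polynomial.toLaurent_X_pow, ← toLaurentHom_eq, h0, mul_zero,
    zero_add, toLaurentHom_eq, Polynomial.toLaurent_X_pow, ← laurentT_zpow] at h1
  have hu : IsUnit (ψ ((laurentT ^ (N : ℤ) : (R[T;T⁻¹])ˣ) : R[T;T⁻¹])) :=
    (Units.isUnit _).map ψ
  exact (hu.mul_right_eq_zero).mp h1

/-- This verifies dw/w = γ dα/α for w = u^m and α = u^k: both sides are multiples of du/u, by m and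
by kγ. -/
theorem vf_zpow_mul_zpow {B : Type} [CommRing B] [Algebra ℂ B] (u : Bˣ) {k m : ℤ} {γ : ℂ}
    (h : (m : ℂ) = k * γ) (θ : VF B) :
    θ ((u ^ m : Bˣ) : B) * ((u ^ k : Bˣ) : B) =
      γ • (θ ((u ^ k : Bˣ) : B) * ((u ^ m : Bˣ) : B)) := by
  rw [vf_zpow, vf_zpow, smul_mul_assoc, smul_mul_assoc, smul_smul, h, mul_comm γ]
  congr 1
  have e : u ^ (m - 1) * u ^ k = u ^ (k - 1) * u ^ m := by
    rw [← zpow_add, ← zpow_add]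
    congr 1
    ring
  have e' := congrArg Units.val e
  rw [Units.val_mul, Units.val_mul] at e'
  linear_combination θ u * e'

end Restriction

/-! ## Coordinates under restriction -/

theorem Coords.Related.refl {A : Type} [CommRing A] [Algebra ℂ A] {m : ℕ} (F : Coords A m) :
    Coords.Related (AlgHom.id ℂ A) F F := ⟨fun _ => rfl, fun _ _ => rfl⟩

section

variable {R B : Type} [CommRing R] [Algebra ℂ R] [CommRing B] [Algebra ℂ B]

theorem vfRelated_poly {φ : R[X] →ₐ[ℂ] B} {η : VF R[X]} {θ : VF B}
    (hC : ∀ r, θ (φ (Polynomial.C r)) = φ (η (Polynomial.C r)))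
    (hX : θ (φ Polynomial.X) = φ (η Polynomial.X)) : VFRelated φ η θ := by
  intro p
  have hmul : ∀ p q, θ (φ p) = φ (η p) → θ (φ q) = φ (η q) → θ (φ (p * q)) = φ (η (p * q)) := by
    intro p q hp hq
    simp only [map_mul, Derivation.leibniz, smul_eq_mul, map_add, hp, hq]
  induction p using Polynomial.induction_on with
  | C a => exact hC a
  | add p q hp hq => simp only [map_add, hp, hq]
  | monomial n a h =>
    rw [pow_succ, ← mul_assoc]
    exact hmul _ _ h hX

theorem vfRelated_laurent {φ : R[T;T⁻¹] →ₐ[ℂ] B} {η : VF R[T;T⁻¹]} {θ : VF B}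
    (hC : ∀ r, θ (φ (LaurentPolynomial.C r)) = φ (η (LaurentPolynomial.C r)))
    (hT : θ (φ (LaurentPolynomial.T 1)) = φ (η (LaurentPolynomial.T 1))) : VFRelated φ η θ := by
  intro p
  induction p using LaurentPolynomial.induction_on' with
  | add p q hp hq => simp only [map_add, hp, hq]
  | C_mul_T j r =>
    have h1 : θ (φ (LaurentPolynomial.T j)) = φ (η (LaurentPolynomial.T j)) := by
      have hu : φ (LaurentPolynomial.T j) =
          ((Units.map (φ : R[T;T⁻¹] →* B) laurentT ^ j : Bˣ) : B) := by
        rw [← map_zpow, Units.coe_map, laurentT_zpow]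
        rfl
      rw [hu, vf_zpow, vf_T, map_smul, map_mul, ← hT, ← map_zpow, Units.coe_map, laurentT_zpow]
      rfl
    simp only [map_mul, Derivation.leibniz, smul_eq_mul, map_add, hC, h1]

theorem Coords.related_toLaurentHom {m : ℕ} (F : Coords R m) (g : Rˣ) :
    Coords.Related toLaurentHom (F.poly g) (F.laurent g) where
  x i := by
    refine Fin.cases ?_ (fun i => ?_) i
    · simp [Coords.poly, Coords.laurent]
    · simp [Coords.poly, Coords.laurent]
  d i := by
    refine Fin.cases ?_ (fun i => ?_) i
    · refine vfRelated_poly (fun r => ?_) ?_ <;> simp [Coords.poly, Coords.laurent]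
    · refine vfRelated_poly (fun r => ?_) ?_ <;> simp [Coords.poly, Coords.laurent]

variable {R' : Type} [CommRing R'] [Algebra ℂ R']

/-- The fibre coordinate of the larger chart restricts to α times that of the smaller one. The
matching system is therefore the one twisted by α. -/
theorem Coords.Related.poly {m : ℕ} {F' : Coords R' m} {F : Coords R m} {χ₀ : R' →ₐ[ℂ] R}
    (h : Coords.Related χ₀ F' F) (α : Rˣ) :
    Coords.Related (polyRes χ₀ α) (F'.poly 1) (F.poly α) where
  x i := by
    refine Fin.cases ?_ (fun i => ?_) i
    · simp [Coords.poly]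
    · simp [Coords.poly, h.x]
  d i := by
    have hα : (Polynomial.C (α : R) * Polynomial.C ((α⁻¹ : Rˣ) : R) : R[X]) = 1 := by
      rw [← Polynomial.C_mul, Units.mul_inv, Polynomial.C_1]
    refine Fin.cases ?_ (fun i => ?_) i
    · refine vfRelated_poly (fun r => ?_) ?_ <;> simp [Coords.poly, Derivation.leibniz, hα]
    · refine vfRelated_poly (fun r => ?_) ?_
      · simp [Coords.poly, h.d i r]
      · simp only [Coords.poly, Fin.cons_succ, polyRes_X, Derivation.leibniz, polyVF_X, polyVF_C,
          smul_eq_mul, map_mul, Units.val_one, Derivation.map_one_eq_zero, mul_zero, map_zero,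
          zero_mul, neg_zero]
        linear_combination (-Polynomial.C (F.d i α) * Polynomial.X) * hα

theorem Coords.Related.laurent {m : ℕ} {F' : Coords R' m} {F : Coords R m} {χ₀ : R' →ₐ[ℂ] R}
    (h : Coords.Related χ₀ F' F) (α : Rˣ) :
    Coords.Related (laurentRes χ₀ α) (F'.laurent 1) (F.laurent α) where
  x i := by
    refine Fin.cases ?_ (fun i => ?_) i
    · simp [Coords.laurent, laurentRes_T]
    · simp [Coords.laurent, h.x]
  d i := by
    have hα : (LaurentPolynomial.C (α : R) * LaurentPolynomial.C ((α⁻¹ : Rˣ) : R) : R[T;T⁻¹]) =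
        1 := by
      rw [← map_mul, Units.mul_inv, map_one]
    refine Fin.cases ?_ (fun i => ?_) i
    · refine vfRelated_laurent (fun r => ?_) ?_ <;>
        simp [Coords.laurent, Derivation.leibniz, hα, laurentRes_T]
    · refine vfRelated_laurent (fun r => ?_) ?_
      · simp [Coords.laurent, h.d i r]
      · simp only [Coords.laurent, Fin.cons_succ, laurentRes_T, Derivation.leibniz, laurentVF_T,
          laurentVF_C, zpow_one, smul_eq_mul, map_mul, Units.val_one, Derivation.map_one_eq_zero,
          mul_zero, map_zero, zero_mul, neg_zero]
        linear_combination
          (-LaurentPolynomial.C (F.d i α) * LaurentPolynomial.T 1) * hα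

end

/-! ## Connections on punctured line bundles -/

namespace ConnData

section

variable {R' R A' A : Type} [CommRing R'] [Algebra ℂ R'] [CommRing R] [Algebra ℂ R]
  [CommRing A'] [Algebra ℂ A'] [CommRing A] [Algebra ℂ A] [Algebra R' A'] [Algebra R A]
  (W : ConnData A R[T;T⁻¹]) (W' : ConnData A' R'[T;T⁻¹])

/-- Each T^j is sent to a unit of `R` times T^j, so the monomial basis over `R'` maps to a basis
over `R`. The argument covers both the sheaf on the punctured bundle and its direct image. -/
theorem isBaseChangeAlong_laurent (hW : ∀ r, W.φ (algebraMap R A r) = LaurentPolynomial.C r)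
    (hW' : ∀ r, W'.φ (algebraMap R' A' r) = LaurentPolynomial.C r)
    (χ₀ : R' →ₐ[ℂ] R) (α w : Rˣ) (χ : A' →ₐ[ℂ] A)
    (hχ : ∀ r, χ (algebraMap R' A' r) = algebraMap R A (χ₀ r))
    (hA : Submodule.span R (Set.range χ) = ⊤)
    (hr : ∀ (a : A') (m : W'.Mod), res W W' (laurentRes χ₀ α) (laurentUnit w) (a • m) =
      χ a • res W W' (laurentRes χ₀ α) (laurentUnit w) m) :
    IsBaseChangeAlong χ (res W W' (laurentRes χ₀ α) (laurentUnit w)) hr := by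
  have hb : ∀ j, (laurentBasis R).unitsSMul (fun j => α ^ j * w) j =
      laurentRes χ₀ α (LaurentPolynomial.T j) * LaurentPolynomial.C (w : R) := fun j => by
    rw [Module.Basis.unitsSMul_apply, laurentRes_T, laurentBasis_apply, Units.smul_def,
      LaurentPolynomial.smul_eq_C_mul, Units.val_mul, map_mul]
    ring
  let : Module R W.Mod := (inferInstance : Module R R[T;T⁻¹])
  let : Module R' W'.Mod := (inferInstance : Module R' R'[T;T⁻¹])
  have : IsScalarTower R A W.Mod := ⟨fun r a m => by
    apply W.val.injective
    rw [Algebra.smul_def, val_smul, map_mul, hW, mul_assoc, ← LaurentPolynomial.smul_eq_C_mul,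
      ← val_smul]
    rfl⟩
  have : IsScalarTower R' A' W'.Mod := ⟨fun r a m => by
    apply W'.val.injective
    rw [Algebra.smul_def, val_smul, map_mul, hW', mul_assoc, ← LaurentPolynomial.smul_eq_C_mul,
      ← val_smul]
    rfl⟩
  let b' : Module.Basis ℤ R' W'.Mod := laurentBasis R'
  let b : Module.Basis ℤ R W.Mod := (laurentBasis R).unitsSMul fun j => α ^ j * w
  refine isBaseChangeAlong_of_basis χ₀.toRingHom χ hχ hA _ hr b' b'.span_eq b hb

end

section

variable {R : Type} [CommRing R] [Algebra ℂ R] {n : ℕ} (F : Coords R n) (γ : ℂ) (f : R[T;T⁻¹])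

/-- The connection `θ + γ θ(T)/T + θ(f)` on `Spec R[T, T⁻¹]`. -/
def star : ConnData R[T;T⁻¹] R[T;T⁻¹] where
  φ := AlgHom.id ℂ _
  m := n + 1
  FA := F.laurent 1
  FB := F.laurent 1
  rel := Coords.Related.refl _
  g := laurentT
  γ := γ
  f := f

/-- The direct image to `Spec R[T]` of the connection `θ + γ θ(T)/T + θ(f)` on
`Spec R[T, T⁻¹]`. -/
def direct : ConnData R[X] R[T;T⁻¹] where
  φ := toLaurentHom
  m := n + 1
  FA := F.poly 1
  FB := F.laurent 1
  rel := F.related_toLaurentHom 1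
  g := laurentT
  γ := γ
  f := f

/-- The connection `θ + θ(f)` on `Spec R`. -/
def exponential (f : R) : ConnData R R where
  φ := AlgHom.id ℂ _
  m := n
  FA := F
  FB := F
  rel := Coords.Related.refl _
  g := 1
  γ := 0
  f := f

end

section

variable {R' R : Type} [CommRing R'] [Algebra ℂ R'] [CommRing R] [Algebra ℂ R]
  {n' n : ℕ} (F' : Coords R' n') (F : Coords R n) (χ₀ : R' →ₐ[ℂ] R) (u : Rˣ) {k m : ℤ} {γ : ℂ}
  (h : (m : ℂ) = k * γ)
include h

theorem star_isDPullback : IsDPullback (laurentRes χ₀ (u ^ k))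
    (res (star F γ 0) (star F' γ 0) (laurentRes χ₀ (u ^ k)) (laurentUnit (u ^ m))) := by
  refine isDPullback (fun _ => rfl) (separates_id _) (map_zero _) (laurentUnit (u ^ k)) ?_ rfl
    (fun θ => ?_) fun hr => isBaseChangeAlong_laurent _ _ (fun _ => rfl) (fun _ => rfl) _ _ _ _
      (fun r => laurentRes_C _ _ r) (span_range_laurentRes _ _) hr
  · exact laurentLift_T _ _
  · rw [laurentUnit, laurentUnit, map_zpow, map_zpow]
    exact vf_zpow_mul_zpow _ h θ

theorem direct_isDPullback {f' : R'[T;T⁻¹]} {f : R[T;T⁻¹]} (hf : laurentRes χ₀ (u ^ k) f' = f) :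
    IsDPullback (polyRes χ₀ (u ^ k)) (res (direct F γ f) (direct F' γ f')
      (laurentRes χ₀ (u ^ k)) (laurentUnit (u ^ m))) := by
  refine isDPullback (fun a => laurentRes_toLaurentHom _ _ a) (separates_toLaurentHom _) hf
    (laurentUnit (u ^ k)) ?_ rfl (fun θ => ?_) fun hr => isBaseChangeAlong_laurent _ _
      (fun r => toLaurentHom_C r) (fun r => toLaurentHom_C r) _ _ _ _
      (fun r => polyRes_C _ _ r) (span_range_polyRes _ _) hr
  · exact laurentLift_T _ _
  · rw [laurentUnit, laurentUnit, map_zpow, map_zpow]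
    exact vf_zpow_mul_zpow _ h θ

end

end ConnData
end

noncomputable section

/-! ## Uniqueness of inverse images -/

section Unique

variable {A' A : Type} [CommRing A'] [Algebra ℂ A'] [CommRing A] [Algebra ℂ A] {φ : A' →ₐ[ℂ] A}
  {M' M N : Type} [AddCommGroup M'] [Module A' M']
  [AddCommGroup M] [Module A M] [AddCommGroup N] [Module A N]

theorem IsBaseChangeAlong.exists_equiv {r : M' →+ M} {hr : ∀ (a : A') (m : M'), r (a • m) = φ a • r m}
    {q : M' →+ N} {hq : ∀ (a : A') (m : M'), q (a • m) = φ a • q m}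
    (h : IsBaseChangeAlong φ r hr) (h' : IsBaseChangeAlong φ q hq) :
    ∃ e : M ≃ₗ[A] N, ∀ m, e (r m) = q m := by
  let : Algebra A' A := φ.toRingHom.toAlgebra
  let : Module A' M := Module.compHom M φ.toRingHom
  let : Module A' N := Module.compHom N φ.toRingHom
  have : IsScalarTower A' A M := ⟨fun a c m => mul_smul (φ a) c m⟩
  have : IsScalarTower A' A N := ⟨fun a c m => mul_smul (φ a) c m⟩
  have h1 : IsBaseChange A ({ toFun := r, map_add' := r.map_add, map_smul' := hr } : M' →ₗ[A'] M) :=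
    h
  have h2 : IsBaseChange A ({ toFun := q, map_add' := q.map_add, map_smul' := hq } : M' →ₗ[A'] N) :=
    h'
  refine ⟨h1.equiv.symm.trans h2.equiv, fun m => ?_⟩
  have e1 := h1.equiv_tmul 1 m
  have e2 := h2.equiv_tmul 1 m
  rw [one_smul] at e1 e2
  rw [LinearEquiv.trans_apply]
  have e3 : h1.equiv.symm (r m) = 1 ⊗ₜ[A'] m := by
    rw [LinearEquiv.symm_apply_eq, e1]
    rfl
  rw [e3, e2]
  rfl

theorem IsBaseChangeAlong.span {r : M' →+ M} {hr : ∀ (a : A') (m : M'), r (a • m) = φ a • r m}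
    (h : IsBaseChangeAlong φ r hr) : Submodule.span A (Set.range r) = ⊤ := by
  let : Algebra A' A := φ.toRingHom.toAlgebra
  let : Module A' M := Module.compHom M φ.toRingHom
  have : IsScalarTower A' A M := ⟨fun a c m => mul_smul (φ a) c m⟩
  have h1 : IsBaseChange A ({ toFun := r, map_add' := r.map_add, map_smul' := hr } : M' →ₗ[A'] M) :=
    h
  rw [eq_top_iff]
  intro m _
  induction m using h1.inductionOn with
  | zero => exact Submodule.zero_mem _
  | tmul m => exact Submodule.subset_span ⟨m, rfl⟩
  | smul a m hm => exact Submodule.smul_mem _ _ (hm trivial)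
  | add m m' hm hm' => exact Submodule.add_mem _ (hm trivial) (hm' trivial)

variable [Module (DiffOp A') M'] [Module (DiffOp A) M] [Module (DiffOp A) N]

/-- Two inverse images of the same `𝒟`-module are isomorphic, if all vector fields on the source can
be expressed by vector fields on the target. -/
theorem IsDPullback.exists_equiv [DCompatible A M] [DCompatible A N] {r : M' →+ M} {q : M' →+ N}
    (h : IsDPullback φ r) (h' : IsDPullback φ q)
    (hφ : ∀ θ : VF A, ∃ (p : ℕ) (b : Fin p → A) (η : Fin p → VF A'),
      ∀ a : A', θ (φ a) = ∑ l, b l * φ (η l a)) :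
    ∃ e : M ≃ₗ[DiffOp A] N, ∀ m, e (r m) = q m := by
  obtain ⟨e, he⟩ := h.baseChange.exists_equiv h'.baseChange
  have hθ : ∀ (θ : VF A) (m : M), e (DiffOp.ofVF θ • m) = DiffOp.ofVF θ • e m := by
    intro θ m
    have hm : m ∈ Submodule.span A (Set.range r) := h.baseChange.span ▸ Submodule.mem_top
    induction hm using Submodule.span_induction with
    | mem m hm =>
      obtain ⟨m, rfl⟩ := hm
      obtain ⟨p, b, η, hb⟩ := hφ θ
      rw [h.chain_rule θ p b η hb, he, h'.chain_rule θ p b η hb, map_sum]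
      refine Finset.sum_congr rfl fun l _ => ?_
      rw [map_smul, he]
    | zero => simp
    | add m m' _ _ h h' => rw [smul_add, map_add, map_add, smul_add, h, h']
    | smul a m _ h =>
      rw [ofVF_smul_smul, map_add, e.map_smul, e.map_smul, h, e.map_smul, ofVF_smul_smul]
  have hP : ∀ (P : DiffOp A) (m : M), e (P • m) = P • e m := by
    intro P
    induction P using DiffOp.induction with
    | hf a =>
      intro m
      rw [DCompatible.ofFun_smul, map_smul, DCompatible.ofFun_smul]
    | hv θ => exact hθ θ
    | ha P Q hP hQ =>
      intro m
      rw [add_smul, map_add, hP, hQ, add_smul]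
    | hm P Q hP hQ =>
      intro m
      rw [mul_smul, hP, hQ, mul_smul]
  exact ⟨{ e with map_smul' := hP }, he⟩

/-- Inverse images of isomorphic `𝒟`-modules. -/
theorem IsDPullback.comp_equiv {M'' : Type} [AddCommGroup M''] [Module A' M'']
    [Module (DiffOp A') M''] [DCompatible A' M'] [DCompatible A' M''] {r : M' →+ M}
    (h : IsDPullback φ r) (e : M'' ≃ₗ[DiffOp A'] M') :
    IsDPullback φ (r.comp e.toAddEquiv.toAddMonoidHom) := by
  have he : ∀ (a : A') m, e (a • m) = a • e m := fun a m => by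
    rw [← DCompatible.ofFun_smul, map_smul, DCompatible.ofFun_smul]
  refine ⟨fun a m => ?_, ?_, fun θ p b η hθ m => ?_⟩
  · change r (e (a • m)) = φ a • r (e m)
    rw [he, h.smul]
  · let : Algebra A' A := φ.toRingHom.toAlgebra
    let : Module A' M := Module.compHom M φ.toRingHom
    have : IsScalarTower A' A M := ⟨fun a c m => mul_smul (φ a) c m⟩
    have h1 : IsBaseChange A
        ({ toFun := r, map_add' := r.map_add, map_smul' := h.smul } : M' →ₗ[A'] M) := h.baseChange
    let e' : M'' ≃ₗ[A'] M' := { e with map_smul' := he }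
    refine IsBaseChange.of_lift_unique _ fun Q _ _ _ _ g => ?_
    refine ⟨h1.lift (g ∘ₗ e'.symm.toLinearMap), LinearMap.ext fun m => ?_, fun g₂ hg₂ => ?_⟩
    · have := LinearMap.congr_fun (h1.lift_comp (g ∘ₗ e'.symm.toLinearMap)) (e' m)
      refine this.trans ?_
      change g (e'.symm (e' m)) = g m
      rw [LinearEquiv.symm_apply_apply]
    · refine h1.algHom_ext' _ _ (LinearMap.ext fun m => ?_)
      rw [h1.lift_comp]
      have := LinearMap.congr_fun hg₂ (e'.symm m)
      refine Eq.trans ?_ this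
      change g₂ (r m) = g₂ (r (e' (e'.symm m)))
      rw [LinearEquiv.apply_symm_apply]
  · exact h.chain_rule θ p b η hθ (e m) |>.trans (Finset.sum_congr rfl fun l _ => by
      change b l • r (DiffOp.ofVF (η l) • e m) = b l • r (e (DiffOp.ofVF (η l) • m))
      rw [e.map_smul])

end Unique

/-! ## Cyclic modules of rank one -/

/-- If modulo a left ideal all coordinate vector fields are functions, all operators are. -/
theorem Coords.exists_sub_ofFun_mem {A : Type} [CommRing A] [Algebra ℂ A] {m : ℕ} (F : Coords A m)
    {J : Submodule (DiffOp A) (DiffOp A)}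
    (h : ∀ i, ∃ a, DiffOp.ofVF (F.d i) - DiffOp.ofFun a ∈ J) (P : DiffOp A) :
    ∃ a, P - DiffOp.ofFun a ∈ J := by
  -- The ideal absorbs multiplication on the left only, so replacing the last vector field by a
  -- function leaves functions to the right of P. The induction has to allow for them.
  suffices H : ∀ b, ∃ a, P * DiffOp.ofFun b - DiffOp.ofFun a ∈ J by
    obtain ⟨a, ha⟩ := H 1
    exact ⟨a, by rwa [map_one, mul_one] at ha⟩
  induction P using F.op_induction with
  | hf a => exact fun b => ⟨a * b, by rw [map_mul, sub_self]; exact J.zero_mem⟩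
  | ha P Q hP hQ =>
    intro b
    obtain ⟨a, ha⟩ := hP b
    obtain ⟨a', ha'⟩ := hQ b
    refine ⟨a + a', ?_⟩
    have := J.add_mem ha ha'
    rwa [sub_add_sub_comm, ← add_mul, ← map_add] at this
  | hm P i hP =>
    intro b
    obtain ⟨c, hc⟩ := h i
    obtain ⟨a, ha⟩ := hP (b * c + F.d i b)
    refine ⟨a, ?_⟩
    have h1 := J.smul_mem (P * DiffOp.ofFun b) hc
    have := J.add_mem h1 ha
    rw [map_add, map_mul, smul_eq_mul] at this
    rw [mul_assoc, DiffOp.ofVF_mul_ofFun]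
    convert this using 1
    noncomm_ring

/-- The coordinates on a point. -/
def coordsPoint : Coords ℂ 0 where
  x := Fin.elim0
  d := Fin.elim0
  dual i := i.elim0
  sep θ _ := Derivation.ext fun z => by
    have := θ.map_algebraMap z
    exact this

instance (β : ℂ) : DCompatible ℂ[T;T⁻¹] (TorusModule β) := ⟨fun _ _ => rfl⟩

/-- A cyclic module is the module of a connection. -/
theorem ConnData.exists_equiv_quotient {A : Type} [CommRing A] [Algebra ℂ A] (W : ConnData A A)
    (hW : W.φ = AlgHom.id ℂ A) (J : Submodule (DiffOp A) (DiffOp A))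
    (hJ : ∀ P ∈ J, P • W.val.symm 1 = 0)
    (h : ∀ i, ∃ a, DiffOp.ofVF (W.FA.d i) - DiffOp.ofFun a ∈ J) :
    ∃ e : (DiffOp A ⧸ J) ≃ₗ[DiffOp A] W.Mod, e (Submodule.Quotient.mk 1) = W.val.symm 1 := by
  have hval : ∀ a : A, W.val (DiffOp.ofFun a • W.val.symm 1) = a := fun a => by
    rw [DCompatible.ofFun_smul, val_smul, AddEquiv.apply_symm_apply, mul_one, hW]
    rfl
  refine ⟨LinearEquiv.ofBijective (J.liftQ (LinearMap.toSpanSingleton _ _ (W.val.symm 1)) hJ)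
    ⟨?_, ?_⟩, ?_⟩
  · rw [injective_iff_map_eq_zero]
    intro x hx
    obtain ⟨P, rfl⟩ := Submodule.Quotient.mk_surjective _ x
    obtain ⟨a, ha⟩ := W.FA.exists_sub_ofFun_mem h P
    have hx' : P • W.val.symm 1 = 0 := hx
    have h1 := hJ _ ha
    rw [sub_smul, hx', zero_sub, neg_eq_zero] at h1
    have h2 := hval a
    rw [h1, map_zero] at h2
    rw [← h2, map_zero, sub_zero] at ha
    exact (Submodule.Quotient.mk_eq_zero _).mpr ha
  · intro b
    refine ⟨Submodule.Quotient.mk (DiffOp.ofFun (W.val b)), W.val.injective ?_⟩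
    exact hval _
  · change (1 : DiffOp A) • W.val.symm 1 = _
    rw [one_smul]

/-- Since ∂_t t = t∂_t + 1, the relation reads t∂_t u = -(β+1)u. Modulo it ∂_t is a function times
u, so the quotient has rank one and is the connection with exponent -(β+1). -/
theorem exists_torusEquiv (β : ℂ) :
    ∃ e : TorusModule β ≃ₗ[DiffOp ℂ[T;T⁻¹]] (ConnData.star coordsPoint (-(β + 1)) 0).Mod,
      e (TorusModule.gen β) = (ConnData.star coordsPoint (-(β + 1)) 0).val.symm 1 := by
  refine ConnData.exists_equiv_quotient (ConnData.star coordsPoint (-(β + 1)) 0) rfl (torusIdeal β)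
    ?_ fun i => ?_
  · intro P hP
    induction hP using Submodule.span_induction with
    | mem P hP =>
      obtain ⟨d, hd, rfl⟩ := hP
      apply (ConnData.star coordsPoint (-(β + 1)) 0).val.injective
      rw [add_smul, mul_smul, DCompatible.ofFun_smul, algebraMap_diffOp_smul, map_add,
        ConnData.val_ofVF_smul _ (η := d) (θ := d) (fun _ => rfl), ConnData.val_smul,
        ConnData.val_smul, AddEquiv.apply_symm_apply, mul_one, mul_one, map_zero]
      change d (LaurentPolynomial.T 1) + ((-(β + 1)) • (d (LaurentPolynomial.T 1) *
        LaurentPolynomial.T (-1)) + d 0) * LaurentPolynomial.T 1 + algebraMap ℂ _ β = 0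
      rw [hd, map_zero, add_zero, one_mul, smul_mul_assoc, ← LaurentPolynomial.T_add,
        neg_add_cancel, LaurentPolynomial.T_zero, Algebra.smul_def, mul_one, ← map_one
        (algebraMap ℂ ℂ[T;T⁻¹]), ← map_add, ← map_add, ← map_zero (algebraMap ℂ ℂ[T;T⁻¹])]
      congr 1
      ring
    | zero => exact zero_smul _ _
    | add P Q _ _ hP hQ => rw [add_smul, hP, hQ, add_zero]
    | smul a P _ hP => rw [smul_eq_mul, mul_smul, hP, smul_zero]
  · set d : VF ℂ[T;T⁻¹] := (ConnData.star coordsPoint (-(β + 1)) 0).FA.d i with hd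
    have hd1 : d (LaurentPolynomial.T 1) = 1 := by
      have : ∀ i : Fin 1, (coordsPoint.laurent 1).d i (LaurentPolynomial.T 1) = 1 := fun i => by
        obtain rfl := Subsingleton.elim i 0
        simp [Coords.laurent]
      exact this i
    refine ⟨-(β + 1) • LaurentPolynomial.T (-1), ?_⟩
    have hmem : DiffOp.ofVF d * DiffOp.ofFun (LaurentPolynomial.T 1) + algebraMap ℂ _ β ∈
        torusIdeal β := Submodule.subset_span ⟨d, hd1, rfl⟩
    have := Submodule.smul_mem _ (DiffOp.ofFun (LaurentPolynomial.T (-1))) hmem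
    rw [DiffOp.ofVF_mul_ofFun, hd1, smul_eq_mul, mul_add, mul_add, ← mul_assoc, ← map_mul,
      ← LaurentPolynomial.T_add, neg_add_cancel, LaurentPolynomial.T_zero, map_one, one_mul,
      mul_one, ← Algebra.commutes, ← Algebra.smul_def] at this
    rw [map_smul]
    convert this using 1
    rw [neg_smul, add_smul, one_smul]
    abel

/-- The relation ∂_t u = -u is that of e^{-t}, which explains the potential -X. -/
theorem exists_expEquiv :
    ∃ e : ExpModule ≃ₗ[DiffOp ℂ[X]]
      (ConnData.exponential (coordsPoint.poly 1) (-Polynomial.X : ℂ[X])).Mod,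
      e (Submodule.Quotient.mk 1 : DiffOp ℂ[X] ⧸ expIdeal) =
        (ConnData.exponential (coordsPoint.poly 1) (-Polynomial.X : ℂ[X])).val.symm 1 := by
  have hd0 : Polynomial.derivative' (R := ℂ) = (coordsPoint.poly 1).d 0 := by
    refine poly_vf_ext (fun r => ?_) ?_
    · simp [Coords.poly]
    · simp [Coords.poly]
  refine ConnData.exists_equiv_quotient
    (ConnData.exponential (coordsPoint.poly 1) (-Polynomial.X : ℂ[X])) rfl expIdeal ?_ fun i => ?_
  · intro P hP
    induction hP using Submodule.span_induction with
    | mem P hP =>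
      rw [Set.mem_singleton_iff] at hP
      subst hP
      apply (ConnData.exponential (coordsPoint.poly 1) (-Polynomial.X : ℂ[X])).val.injective
      rw [add_smul, one_smul, map_add, ConnData.val_ofVF_smul _ (θ := Polynomial.derivative')
        (fun _ => rfl), AddEquiv.apply_symm_apply, map_zero]
      simp [ConnData.form, ConnData.exponential]
    | zero => exact zero_smul _ _
    | add P Q _ _ hP hQ => rw [add_smul, hP, hQ, add_zero]
    | smul a P _ hP => rw [smul_eq_mul, mul_smul, hP, smul_zero]
  · refine ⟨-1, ?_⟩
    have : ∀ i : Fin 1, (coordsPoint.poly 1).d i = Polynomial.derivative' := fun i => by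
      obtain rfl := Subsingleton.elim i 0
      exact hd0.symm
    rw [map_neg, map_one, sub_neg_eq_add]
    refine Submodule.subset_span ?_
    rw [← this i]
    rfl

/-! ## Base change of connections of rank one -/

theorem ConnData.isBaseChangeAlong_id {A' A : Type} [CommRing A'] [Algebra ℂ A'] [CommRing A]
    [Algebra ℂ A] (W : ConnData A A) (W' : ConnData A' A') (hW : W.φ = AlgHom.id ℂ A)
    (hW' : W'.φ = AlgHom.id ℂ A') (χ : A' →ₐ[ℂ] A) (w : Aˣ)
    (hr : ∀ (a : A') (m : W'.Mod), res W W' χ w (a • m) = χ a • res W W' χ w m) :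
    IsBaseChangeAlong χ (res W W' χ w) hr := by
  let e : W.Mod ≃ₗ[A] A :=
    { W.val with
      map_smul' := fun a m => by
        change W.val (a • m) = a * W.val m
        rw [val_smul, hW]
        rfl }
  let b : Module.Basis Unit A W.Mod :=
    ((Module.Basis.singleton Unit A).unitsSMul fun _ => w).map e.symm
  refine isBaseChangeAlong_of_basis χ.toRingHom χ (fun _ => rfl) ?_ _ hr
    (fun _ : Unit => W'.val.symm 1) ?_ b fun i => ?_
  · rw [Ideal.submodule_span_eq, Ideal.eq_top_iff_one]
    exact Ideal.subset_span ⟨1, map_one χ⟩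
  · rw [eq_top_iff]
    intro m _
    have : m = W'.val m • W'.val.symm 1 := by
      apply W'.val.injective
      rw [val_smul, hW', AddEquiv.apply_symm_apply, mul_one]
      rfl
    rw [this]
    exact Submodule.smul_mem _ _ (Submodule.subset_span ⟨(), rfl⟩)
  · apply W.val.injective
    rw [val_res, AddEquiv.apply_symm_apply, map_one χ, one_mul]
    change e (b i) = w
    rw [Module.Basis.map_apply, LinearEquiv.apply_symm_apply, Module.Basis.unitsSMul_apply,
      Module.Basis.singleton_apply, Units.smul_def, smul_eq_mul, mul_one]
end

/-! ### The models of 𝒪^β and its direct image, glued over the charts -/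

noncomputable section

/-- The `𝒟`-module of a family of connections with transition functions `w`. -/
def ConnData.dmod {I : Type} [Preorder I] {Y : Charted I} {B : I → Type} [∀ c, CommRing (B c)]
    [∀ c, Algebra ℂ (B c)] (W : ∀ c, ConnData (Y.A c) (B c))
    (ψ : ∀ {c c' : I}, c ≤ c' → B c' →ₐ[ℂ] B c) (w : ∀ {c c' : I}, c ≤ c' → (B c)ˣ)
    (ψ_self : ∀ c b, ψ (le_refl c) b = b)
    (ψ_comp : ∀ {c c' c'' : I} (h : c ≤ c') (h' : c' ≤ c'') b, ψ h (ψ h' b) = ψ (h.trans h') b)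
    (w_self : ∀ c, w (le_refl c) = 1)
    (w_comp : ∀ {c c' c'' : I} (h : c ≤ c') (h' : c' ≤ c''),
      ψ h (w h') * w h = (w (h.trans h') : B c))
    (pull : ∀ {c c' : I} (h : c ≤ c'), IsDPullback (Y.res h) (res (W c) (W c') (ψ h) (w h))) :
    DMod Y where
  M c := (W c).Mod
  res {c c'} h := res (W c) (W c') (ψ h) (w h)
  res_self c m := by
    apply (W c).val.injective
    rw [val_res, ψ_self, w_self, Units.val_one, mul_one]
  res_res {c c' c''} h h' m := by
    apply (W c).val.injective
    rw [val_res, val_res, val_res, map_mul, ψ_comp, mul_assoc, w_comp]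
  isPullback h := pull h

/-- The coordinate system given by a basis of vector fields. -/
def Coords.ofBasis {A : Type} [CommRing A] [Algebra ℂ A] {n : ℕ} (x : Fin n → A)
    (d : Module.Basis (Fin n) A (VF A)) (h : ∀ i j, d i (x j) = if i = j then 1 else 0) :
    Coords A n where
  x := x
  d := d
  dual := h
  sep θ hθ := by
    have e : ∀ j, d.repr θ j = 0 := by
      intro j
      have h1 := hθ j
      have h2 : θ = ∑ i, d.repr θ i • d i := (d.sum_repr θ).symm
      have h3 : θ (x j) = ∑ i, d.repr θ i * d i (x j) := by
        conv_lhs => rw [h2]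
        exact (vf_sum_apply _ _ _)
      rw [h1, Finset.sum_congr rfl (fun i _ => by rw [h i j]), Finset.sum_eq_single j] at h3
      · rw [if_pos rfl, mul_one] at h3
        exact h3.symm
      · intro i _ hij
        rw [if_neg hij, mul_zero]
      · simp
    exact d.repr.map_eq_zero_iff.mp (Finsupp.ext e)

theorem TorusModule.exists_smul_gen {β : ℂ} (x : TorusModule β) :
    ∃ f : ℂ[T;T⁻¹], x = f • TorusModule.gen β := by
  obtain ⟨e, he⟩ := exists_torusEquiv β
  refine ⟨(ConnData.star coordsPoint (-(β + 1)) 0).val (e x), e.injective ?_⟩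
  rw [← DCompatible.ofFun_smul, map_smul, he, DCompatible.ofFun_smul]
  apply (ConnData.star coordsPoint (-(β + 1)) 0).val.injective
  rw [ConnData.val_smul, AddEquiv.apply_symm_apply, mul_one]
  rfl

section Torus

variable {R : Type} [CommRing R] [Algebra ℂ R] {n : ℕ} (F : Coords R n) (γ : ℂ)

variable (R) in
/-- The projection `ℂ* × Spec R → ℂ*`. -/
def fibreTorus : ℂ[T;T⁻¹] →ₐ[ℂ] R[T;T⁻¹] := laurentLift (Algebra.ofId ℂ R[T;T⁻¹]) laurentT

theorem fibreTorus_isDPullback : IsDPullback (fibreTorus R)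
    (ConnData.res (ConnData.star F γ 0) (ConnData.star coordsPoint γ 0) (fibreTorus R) 1) :=
  ConnData.isDPullback (fun _ => rfl) (separates_id _) (map_zero _) 1
    (by
      rw [Units.val_one, one_mul]
      exact laurentLift_T _ _) rfl (fun θ => by simp)
    (fun hr => ConnData.isBaseChangeAlong_id _ _ rfl rfl _ _ hr)

/-- On functions of T alone, a vector field is its value on T times ∂_T. So the chain rule
determines the action of every vector field on the inverse image, as uniqueness requires. -/
theorem exists_fibreTorus_vf (θ : VF R[T;T⁻¹]) :
    ∃ (p : ℕ) (b : Fin p → R[T;T⁻¹]) (η : Fin p → VF ℂ[T;T⁻¹]),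
      ∀ a, θ (fibreTorus R a) = ∑ l, b l * fibreTorus R (η l a) := by
  refine ⟨1, fun _ => θ (LaurentPolynomial.T 1), fun _ => laurentVF 0 1, fun a => ?_⟩
  rw [Fin.sum_univ_one]
  have hC : ∀ z : ℂ, fibreTorus R (LaurentPolynomial.C z) = algebraMap ℂ _ z := fun z =>
    laurentLift_const _ _ z
  have hT : ∀ j : ℤ, fibreTorus R (LaurentPolynomial.T j) =
      (LaurentPolynomial.T j : R[T;T⁻¹]) := fun j => by
    have h := LaurentPolynomial.eval₂_T (Algebra.ofId ℂ R[T;T⁻¹]).toRingHom laurentT j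
    exact h.trans (laurentT_zpow j)
  induction a using LaurentPolynomial.induction_on' with
  | add p q hp hq => rw [map_add, map_add, hp, hq, map_add, map_add, mul_add]
  | C_mul_T j z =>
    rw [laurentVF_C_mul_T, map_mul, hC, hT, Derivation.leibniz, Derivation.map_algebraMap,
      smul_zero, add_zero, vf_T θ j, map_add, map_mul, map_smul, one_mul, map_mul, hC, hT, hT]
    simp only [Derivation.coe_zero, Pi.zero_apply, map_zero, zero_mul, zero_add, smul_eq_mul,
      Algebra.smul_def, hC]
    ring

theorem direct_ofVF_smul (f : R[T;T⁻¹]) {η : VF R[X]} {θ : VF R[T;T⁻¹]}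
    (h : VFRelated toLaurentHom η θ) (x : (ConnData.direct F γ f).Mod) :
    (ConnData.direct F γ f).val (DiffOp.ofVF η • x) = (ConnData.star F γ f).val
      (DiffOp.ofVF θ • (ConnData.star F γ f).val.symm ((ConnData.direct F γ f).val x)) := by
  rw [(ConnData.direct F γ f).val_ofVF_smul h, (ConnData.star F γ f).val_ofVF_smul (η := θ) (θ := θ)
    (fun _ => rfl), AddEquiv.apply_symm_apply]
  rfl

end Torus

section Charts

variable {X : Scheme.{0}} {s : X ⟶ Spec (.of ℂ)} {n : ℕ} {ℱ : X.Modules}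
  {t : LineBundleTrivialization ℱ}

theorem Chart.exists_coords (c : Chart s n t) : Nonempty (Coords c.R n) := by
  obtain ⟨x, d, h⟩ := c.coord
  let : Algebra ℂ Γ(X, c.W) := sectionsAlgebra s c.W
  exact ⟨Coords.ofBasis x d h⟩

/-- A coordinate system on a chart. -/
def Chart.coords (c : Chart s n t) : Coords c.R n := c.exists_coords.some

theorem laurentUnit_trans_self (m : ℤ) (c : Chart s n t) :
    laurentUnit (Chart.trans (le_refl c) ^ m) = 1 := by
  rw [Chart.trans_self, one_zpow]
  exact map_one _

theorem totStarRes_laurentUnit (k m : ℤ) {c c' c'' : Chart s n t} (h : c ≤ c') (h' : c' ≤ c'') :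
    totStarRes k h (laurentUnit (Chart.trans h' ^ m)) * laurentUnit (Chart.trans h ^ m) =
      (laurentUnit (Chart.trans (h.trans h') ^ m) : c.R[T;T⁻¹]) := by
  change laurentRes (Chart.res h) (Chart.trans h ^ k) (LaurentPolynomial.C _) *
    LaurentPolynomial.C _ = LaurentPolynomial.C _
  rw [laurentRes_C, ← map_mul, Chart.trans_zpow]

section

variable (s n t) (k : ℤ) {γ : ℂ} {m : ℤ} (hm : (m : ℂ) = k * γ)

/-- The line bundle on `L^*` with connection `θ + γ θ(T)/T` and transition functions
`(s_i/s_j)^m`. -/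
def starMod : DMod (TotStar s n t k) :=
  ConnData.dmod (B := fun c => c.R[T;T⁻¹]) (fun c => ConnData.star c.coords γ 0)
    (fun h => totStarRes k h) (fun h => laurentUnit (Chart.trans h ^ m))
    (TotStar s n t k).res_self (TotStar s n t k).res_res (laurentUnit_trans_self m)
    (totStarRes_laurentUnit k m)
    (fun {c c'} h => ConnData.star_isDPullback c'.coords c.coords (Chart.res h) (Chart.trans h) hm)

/-- The direct image of `starMod` on `L`. -/
def directMod : DMod (Tot s n t k) :=
  ConnData.dmod (B := fun c => c.R[T;T⁻¹]) (fun c => ConnData.direct c.coords γ 0)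
    (fun h => totStarRes k h) (fun h => laurentUnit (Chart.trans h ^ m))
    (TotStar s n t k).res_self (TotStar s n t k).res_res (laurentUnit_trans_self m)
    (totStarRes_laurentUnit k m)
    (fun {c c'} h => ConnData.direct_isDPullback c'.coords c.coords (Chart.res h) (Chart.trans h)
      hm (map_zero _))

theorem isOpenDirectImage_directMod :
    IsOpenDirectImage (jHom s n t k) (starMod s n t k hm) (directMod s n t k hm) :=
  ⟨fun c => (ConnData.direct c.coords γ 0).val.trans
    (ConnData.star c.coords γ 0).val.symm, fun _ _ _ => rfl, fun c _ _ hθ x =>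
      (ConnData.star c.coords γ 0).val.injective (direct_ofVF_smul c.coords γ 0 hθ x),
    fun _ _ => rfl⟩

end

/-- Sections are written as functions times the generator, so they transform by the inverse of the
factor prescribed for generators. The exponent is therefore -(ℓ+k), and it equals kγ for γ = -(β+1).
-/
theorem isOBeta_cast {k ℓ : ℤ} {β : ℂ} (hβ : (k : ℂ) * β = ℓ) :
    ((-(ℓ + k) : ℤ) : ℂ) = k * -(β + 1) := by
  push_cast
  linear_combination hβ

theorem trans_zpow_mul_neg {c c' : Chart s n t} (h : c ≤ c') (j : ℤ) :
    ((Chart.trans h ^ j : c.Rˣ) : c.R) * ((Chart.trans h ^ (-j) : c.Rˣ) : c.R) = 1 := by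
  rw [← Units.val_mul, ← zpow_add, add_neg_cancel, zpow_zero, Units.val_one]

/-- In every chart the generator is represented by the function 1. Restriction multiplies by
α^{-(ℓ+k)}, which the prescribed factor α^{ℓ+k} cancels. -/
theorem isOBeta_starMod {k ℓ : ℤ} {β : ℂ} (hβ : (k : ℂ) * β = ℓ) :
    IsOBeta k β ℓ (starMod s n t k (isOBeta_cast hβ)) := by
  obtain ⟨e, he⟩ := exists_torusEquiv β
  have hr : ∀ c : Chart s n t, (ConnData.star c.coords (-(β + 1)) 0).val
      ((ConnData.res (ConnData.star c.coords (-(β + 1)) 0)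
      (ConnData.star coordsPoint (-(β + 1)) 0) (fibreTorus c.R) 1).comp
        e.toAddEquiv.toAddMonoidHom (TorusModule.gen β)) = 1 := fun c => by
    change fibreTorus c.R ((ConnData.star coordsPoint (-(β + 1)) 0).val
      (e (TorusModule.gen β))) * ((1 : (c.R[T;T⁻¹])ˣ) : c.R[T;T⁻¹]) = 1
    rw [he, AddEquiv.apply_symm_apply, map_one, Units.val_one, mul_one]
  refine ⟨fun c => (ConnData.res (ConnData.star c.coords (-(β + 1)) 0)
      (ConnData.star coordsPoint (-(β + 1)) 0) (fibreTorus c.R) 1).comp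
        e.toAddEquiv.toAddMonoidHom,
    fun c => (fibreTorus_isDPullback c.coords _).comp_equiv e, fun {c c'} h => ?_⟩
  apply (ConnData.star c.coords (-(β + 1)) 0).val.injective
  refine (hr c).trans ?_
  have key : 1 = LaurentPolynomial.C ((Chart.trans h ^ (ℓ + k) : c.Rˣ) : c.R) *
      (totStarRes k h 1 * LaurentPolynomial.C ((Chart.trans h ^ (-(ℓ + k)) : c.Rˣ) : c.R)) := by
    rw [map_one, one_mul, ← map_mul, trans_zpow_mul_neg, map_one]
  exact key.trans (congrArg (fun z => LaurentPolynomial.C ((Chart.trans h ^ (ℓ + k) : c.Rˣ) : c.R) *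
      (totStarRes k h z * LaurentPolynomial.C ((Chart.trans h ^ (-(ℓ + k)) : c.Rˣ) : c.R)))
    (hr c').symm)

/-- The module `𝒪^β` is unique. -/
theorem IsOBeta.exists_iso {k ℓ : ℤ} {β : ℂ} (hβ : (k : ℂ) * β = ℓ) {M : DMod (TotStar s n t k)}
    (hM : IsOBeta k β ℓ M) : Nonempty ((starMod s n t k (isOBeta_cast hβ)).Iso M) := by
  obtain ⟨r, hr, hrr⟩ := isOBeta_starMod (s := s) (n := n) (t := t) hβ
  obtain ⟨q, hq, hqq⟩ := hM
  choose e he using fun c => (hr c).exists_equiv (hq c) exists_fibreTorus_vf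
  refine ⟨⟨e, fun {c c'} h m => ?_⟩⟩
  have hm : m ∈ Submodule.span ((TotStar s n t k).A c') (Set.range (r c')) :=
    (hr c').baseChange.span ▸ Submodule.mem_top
  have heA : ∀ c (a : (TotStar s n t k).A c) m, e c (a • m) = a • e c m := fun c a m => by
    rw [← DCompatible.ofFun_smul, map_smul, DCompatible.ofFun_smul]
  have hsmul : ∀ (a : (TotStar s n t k).A c') m,
      e c ((starMod s n t k (isOBeta_cast hβ)).res h m) = M.res h (e c' m) →
      e c ((starMod s n t k (isOBeta_cast hβ)).res h (a • m)) = M.res h (e c' (a • m)) := by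
    intro a m hm
    rw [((starMod s n t k (isOBeta_cast hβ)).isPullback h).smul, heA, heA,
      (M.isPullback h).smul, hm]
  induction hm using Submodule.span_induction with
  | mem m hm =>
    obtain ⟨x, rfl⟩ := hm
    obtain ⟨f, rfl⟩ := TorusModule.exists_smul_gen x
    rw [(hr c').smul]
    -- Compatibility with restriction is linear over functions, so only the generator is left; for
    -- it both modules satisfy the same gluing rule.
    refine hsmul _ _ ?_
    have h1 := congrArg (e c) (hrr h)
    rw [heA, he, hqq h] at h1
    have hu : baseFun s n t k c ((Chart.trans h ^ (-(ℓ + k)) : c.Rˣ) : c.R) *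
        baseFun s n t k c ((Chart.trans h ^ (ℓ + k) : c.Rˣ) : c.R) = 1 := by
      rw [← map_mul, mul_comm, trans_zpow_mul_neg, map_one]
    have h2 := congrArg (fun y => baseFun s n t k c
      ((Chart.trans h ^ (-(ℓ + k)) : c.Rˣ) : c.R) • y) h1
    simp only [smul_smul, hu, one_smul] at h2
    rw [he, h2]
  | zero => simp
  | add m m' _ _ h h' => simp only [map_add, h, h']
  | smul a m _ h => exact hsmul a m h

end Charts
end

noncomputable section

/-! ## The Fourier transform of `𝒪^β` -/

/-- The underlying module of the Fourier transform of `𝒪^β`: it has an `R`-basis `e_j`, `j ∈ ℤ`,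
with `y e_j = (j - β - 1) e_{j-1}` and `∂_y e_j = - e_{j+1}`. -/
def Ladder {R : Type} [CommRing R] [Algebra ℂ R] {n : ℕ} (_ : Coords R n) (_ : ℂ) : Type := ℤ →₀ R

namespace Ladder

variable {R : Type} [CommRing R] [Algebra ℂ R] {n : ℕ} (F : Coords R n) (β : ℂ)

instance : AddCommGroup (Ladder F β) := inferInstanceAs (AddCommGroup (ℤ →₀ R))
instance : Module R (Ladder F β) := inferInstanceAs (Module R (ℤ →₀ R))

/-- The element `r e_j`. -/
def elt (j : ℤ) : R →ₗ[R] Ladder F β := (Finsupp.lsingle j : R →ₗ[R] (ℤ →₀ R))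

/-- The basis `e_j`. -/
def basis : Module.Basis ℤ R (Ladder F β) := (Finsupp.basisSingleOne : Module.Basis ℤ R (ℤ →₀ R))

theorem basis_apply (j : ℤ) : basis F β j = elt F β j 1 := by
  change Finsupp.basisSingleOne j = Finsupp.single j 1
  simp

variable {F β} in
theorem induction_elt {p : Ladder F β → Prop} (h : ∀ j r, p (elt F β j r))
    (hadd : ∀ x y, p x → p y → p (x + y)) (x : Ladder F β) : p x := by
  refine Finsupp.induction_linear (motive := p) x ?_ hadd h
  have := h 0 0
  rwa [map_zero] at this

variable {F β} in
theorem hom_ext {N : Type} [AddCommGroup N] {f g : Ladder F β →+ N}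
    (h : ∀ j r, f (elt F β j r) = g (elt F β j r)) : f = g :=
  AddMonoidHom.ext fun x => induction_elt (p := fun x => f x = g x) h (fun x y hx hy => by rw [map_add, map_add, hx, hy]) x

/-- Multiplication by `y`. -/
def mulY : Module.End R (Ladder F β) :=
  (basis F β).constr R fun j => elt F β (j - 1) (algebraMap ℂ R (j - β - 1))

theorem elt_eq_smul (j : ℤ) (r : R) : elt F β j r = r • elt F β j 1 := by
  rw [← map_smul, smul_eq_mul, mul_one]

theorem mulY_elt (j : ℤ) (r : R) :
    mulY F β (elt F β j r) = elt F β (j - 1) (algebraMap ℂ R (j - β - 1) * r) := by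
  rw [elt_eq_smul, map_smul, ← basis_apply, mulY, Module.Basis.constr_basis, ← map_smul,
    smul_eq_mul, mul_comm]

instance : Module R[X] (Ladder F β) :=
  Module.compHom (Ladder F β) (Polynomial.aeval (mulY F β)).toRingHom

theorem smul_def (p : R[X]) (x : Ladder F β) : p • x = Polynomial.aeval (mulY F β) p x := rfl

theorem C_smul (r : R) (x : Ladder F β) : (Polynomial.C r : R[X]) • x = r • x := by
  rw [smul_def, Polynomial.aeval_C]
  rfl

theorem X_smul (x : Ladder F β) : (Polynomial.X : R[X]) • x = mulY F β x := by
  rw [smul_def, Polynomial.aeval_X]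

instance : IsScalarTower R R[X] (Ladder F β) :=
  ⟨fun r p x => by rw [Polynomial.smul_eq_C_mul, mul_smul, C_smul]⟩

theorem X_smul_elt (j : ℤ) (r : R) : (Polynomial.X : R[X]) • elt F β j r =
    elt F β (j - 1) (algebraMap ℂ R (j - β - 1) * r) := by
  rw [X_smul, mulY_elt]

theorem C_smul_elt (j : ℤ) (r r' : R) : (Polynomial.C r : R[X]) • elt F β j r' =
    elt F β j (r * r') := by
  rw [C_smul, ← map_smul, smul_eq_mul]

/-- The action of `∂_y`. -/
def dY : Ladder F β →+ Ladder F β :=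
  ((basis F β).constr R fun j => -elt F β (j + 1) (1 : R) :
    Ladder F β →ₗ[R] Ladder F β).toAddMonoidHom

theorem dY_elt (j : ℤ) (r : R) : dY F β (elt F β j r) = -elt F β (j + 1) r := by
  change ((basis F β).constr R fun j => -elt F β (j + 1) (1 : R)) (elt F β j r) = _
  rw [elt_eq_smul, map_smul, ← basis_apply, Module.Basis.constr_basis, smul_neg, ← map_smul,
    smul_eq_mul, mul_one]

/-- The action of a vector field on the base. -/
def dBase (θ : VF R) : Ladder F β →+ Ladder F β :=
  (Finsupp.mapRange.addMonoidHom (θ : R →ₗ[ℂ] R).toAddMonoidHom : (ℤ →₀ R) →+ (ℤ →₀ R))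

theorem dBase_elt (θ : VF R) (j : ℤ) (r : R) : dBase F β θ (elt F β j r) = elt F β j (θ r) :=
  Finsupp.mapRange_single (hf := map_zero _)

theorem leibniz_of_generators {δ : Ladder F β →+ Ladder F β} {d : VF R[X]}
    (hC : ∀ r x, δ ((Polynomial.C r : R[X]) • x) = (Polynomial.C r : R[X]) • δ x + d (Polynomial.C r) • x)
    (hX : ∀ x, δ ((Polynomial.X : R[X]) • x) = (Polynomial.X : R[X]) • δ x + d Polynomial.X • x)
    (p : R[X]) (x : Ladder F β) : δ (p • x) = p • δ x + d p • x := by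
  have hmul : ∀ p q : R[X], (∀ x, δ (p • x) = p • δ x + d p • x) →
      (∀ x, δ (q • x) = q • δ x + d q • x) → ∀ x, δ ((p * q) • x) = (p * q) • δ x + d (p * q) • x := by
    intro p q hp hq x
    rw [mul_smul, hp, hq, Derivation.leibniz, smul_add, add_smul, smul_eq_mul, smul_eq_mul,
      ← mul_smul, ← mul_smul, ← mul_smul, mul_comm (d p) q, add_assoc]
  revert x
  induction p using Polynomial.induction_on with
  | C a => exact hC a
  | add p q hp hq =>
    intro x
    rw [add_smul, map_add, hp, hq, map_add, add_smul, add_smul]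
    abel
  | monomial m a h =>
    rw [pow_succ, ← mul_assoc]
    exact hmul _ _ h hX

/-- The representation of the differential operators on `Spec R[y]`. -/
def rep : WeylRep (F.poly 1) (AddMonoid.End (Ladder F β)) where
  ρ := Module.toAddMonoidEnd R[X] (Ladder F β)
  δ := Fin.cons (dY F β) fun i => dBase F β (F.d i)
  comm i j := by
    have h0 : ∀ i, (dY F β).comp (dBase F β (F.d i)) = (dBase F β (F.d i)).comp (dY F β) := fun i =>
      hom_ext fun j r => by
        change dY F β (dBase F β (F.d i) _) = dBase F β (F.d i) (dY F β _)
        rw [dBase_elt, dY_elt, dY_elt, map_neg, dBase_elt]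
    refine Fin.cases ?_ (fun i => ?_) i <;> refine Fin.cases ?_ (fun j => ?_) j
    · exact Commute.refl _
    · exact h0 j
    · exact (h0 i).symm
    · refine hom_ext fun l r => ?_
      change dBase F β (F.d i) (dBase F β (F.d j) _) = dBase F β (F.d j) (dBase F β (F.d i) _)
      rw [dBase_elt, dBase_elt, dBase_elt, dBase_elt, F.d_comm]
  leib i p := by
    refine AddMonoidHom.ext fun x => ?_
    refine Fin.cases ?_ (fun i => ?_) i
    · refine leibniz_of_generators F β (δ := dY F β) (d := (F.poly 1).d 0) (fun r x => ?_)
        (fun x => ?_) p x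
      · have : (F.poly 1).d 0 (Polynomial.C r) = 0 := by simp [Coords.poly]
        rw [this, zero_smul, add_zero]
        induction x using induction_elt with
        | h j r' => rw [C_smul_elt, dY_elt, dY_elt, smul_neg, C_smul_elt]
        | hadd x y hx hy => rw [smul_add, map_add, hx, hy, map_add, smul_add]
      · have : (F.poly 1).d 0 Polynomial.X = 1 := by simp [Coords.poly]
        rw [this, one_smul]
        induction x using induction_elt with
        | h j r =>
          rw [X_smul_elt, dY_elt, dY_elt, smul_neg, X_smul_elt, sub_add_cancel, add_sub_cancel_right,
            ← map_neg, ← map_neg, ← map_add]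
          congr 1
          simp only [map_sub, Int.cast_add, Int.cast_one, map_add, map_one]
          ring
        | hadd x y hx hy =>
          rw [smul_add, map_add, hx, hy, map_add, smul_add]
          abel
    · refine leibniz_of_generators F β (δ := dBase F β (F.d i)) (d := (F.poly 1).d i.succ)
        (fun r x => ?_) (fun x => ?_) p x
      · have : (F.poly 1).d i.succ (Polynomial.C r) = Polynomial.C (F.d i r) := by
          simp [Coords.poly]
        rw [this]
        induction x using induction_elt with
        | h j r' =>
          rw [C_smul_elt, dBase_elt, dBase_elt, C_smul_elt, C_smul_elt, ← map_add,
            Derivation.leibniz, smul_eq_mul, smul_eq_mul, mul_comm r']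
        | hadd x y hx hy =>
          rw [smul_add, map_add, hx, hy, map_add, smul_add, smul_add]
          abel
      · have : (F.poly 1).d i.succ Polynomial.X = 0 := by simp [Coords.poly]
        rw [this, zero_smul, add_zero]
        induction x using induction_elt with
        | h j r =>
          rw [X_smul_elt, dBase_elt, dBase_elt, X_smul_elt, Derivation.leibniz,
            Derivation.map_algebraMap, smul_zero, add_zero, smul_eq_mul]
        | hadd x y hx hy => rw [smul_add, map_add, hx, hy, map_add, smul_add]

instance : Module (DiffOp R[X]) (Ladder F β) := Module.compHom (Ladder F β) (rep F β).lift

theorem diffOp_smul_def (P : DiffOp R[X]) (x : Ladder F β) : P • x = (rep F β).lift P x := rfl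

instance : DCompatible R[X] (Ladder F β) where
  ofFun_smul a x := by
    rw [diffOp_smul_def, WeylRep.lift_ofFun]
    rfl

theorem ofVF_smul_elt_one (η : VF R[X]) (j : ℤ) :
    DiffOp.ofVF η • elt F β j 1 = -(η Polynomial.X • elt F β (j + 1) 1) := by
  have e : ∀ (c : Fin (n + 1) → AddMonoid.End (Ladder F β)) x, (∑ i, c i) x = ∑ i, c i x :=
    fun c x => AddMonoidHom.finsetSum_apply c Finset.univ x
  rw [diffOp_smul_def, WeylRep.lift_ofVF, e, Fin.sum_univ_succ, Finset.sum_eq_zero, add_zero]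
  · change η (Polynomial.C ((1 : Rˣ) : R) * Polynomial.X) • dY F β (elt F β j 1) = _
    rw [dY_elt, smul_neg, Units.val_one, Polynomial.C_1, one_mul]
  · intro i _
    change η (Polynomial.C (F.x i)) • dBase F β (F.d i) (elt F β j 1) = 0
    rw [dBase_elt, Derivation.map_one_eq_zero, map_zero, smul_zero]

theorem ofVF_smul_elt (η : VF R[X]) (j : ℤ) (r : R) :
    DiffOp.ofVF η • elt F β j r =
      η (Polynomial.C r) • elt F β j 1 - η Polynomial.X • elt F β (j + 1) r := by
  rw [elt_eq_smul F β j r, ← C_smul, ofVF_smul_smul, ofVF_smul_elt_one, smul_neg, sub_eq_add_neg,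
    smul_comm, C_smul_elt, mul_one]

/-! ### Restriction -/

section Res

variable {F β}
variable {R' : Type} [CommRing R'] [Algebra ℂ R'] {n' : ℕ} {F' : Coords R' n'}
  (χ₀ : R' →ₐ[ℂ] R) (u : Rˣ) (k ℓ : ℤ)

/-- The restriction map `e_j ↦ u^{k j - ℓ} e_j`. -/
def res : Ladder F' β →+ Ladder F β :=
  -- The exponent collects kj from T^j, -(ℓ+k) from the generator, and k from the form dt.
  (Finsupp.liftAddHom fun j => (elt F β j).toAddMonoidHom.comp
    ((AddMonoidHom.mulRight ((u ^ (k * j - ℓ) : Rˣ) : R)).comp (χ₀ : R' →+ R)) :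
      (ℤ →₀ R') →+ Ladder F β)

theorem res_elt (j : ℤ) (r : R') : res (F := F) (F' := F') (β := β) χ₀ u k ℓ (elt F' β j r) =
    elt F β j (χ₀ r * ((u ^ (k * j - ℓ) : Rˣ) : R)) :=
  Finsupp.liftAddHom_apply_single _ _ _

theorem res_smul (p : R'[X]) (x : Ladder F' β) :
    res (F := F) χ₀ u k ℓ (p • x) = polyRes χ₀ (u ^ (-k)) p • res (F := F) χ₀ u k ℓ x := by
  revert x
  have hC : ∀ r (x : Ladder F' β), res (F := F) χ₀ u k ℓ ((Polynomial.C r : R'[X]) • x) =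
      polyRes χ₀ (u ^ (-k)) (Polynomial.C r) • res (F := F) χ₀ u k ℓ x := by
    intro r x
    rw [polyRes_C]
    induction x using induction_elt with
    | h j r' => rw [C_smul_elt, res_elt, res_elt, C_smul_elt, map_mul χ₀, mul_assoc]
    | hadd x y hx hy => rw [smul_add, map_add, hx, hy, map_add, smul_add]
  have hX : ∀ x : Ladder F' β, res (F := F) χ₀ u k ℓ ((Polynomial.X : R'[X]) • x) =
      polyRes χ₀ (u ^ (-k)) Polynomial.X • res (F := F) χ₀ u k ℓ x := by
    intro x
    rw [polyRes_X]
    induction x using induction_elt with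
    | h j r' =>
      rw [X_smul_elt, res_elt, res_elt, mul_smul, X_smul_elt, C_smul_elt, map_mul χ₀,
        AlgHom.commutes, show k * (j - 1) - ℓ = -k + (k * j - ℓ) by ring, zpow_add, Units.val_mul]
      congr 1
      ring
    | hadd x y hx hy => rw [smul_add, map_add, hx, hy, map_add, smul_add]
  induction p using Polynomial.induction_on with
  | C a => exact hC a
  | add p q hp hq =>
    intro x
    rw [add_smul, map_add, hp, hq, map_add, add_smul]
  | monomial m a h =>
    intro x
    rw [pow_succ, ← mul_assoc, mul_smul, h, hX, map_mul (polyRes χ₀ (u ^ (-k))) _ Polynomial.X,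
      mul_smul]

/-- The basis is rescaled by units, which settles the base change. The chain rule is needed only on
the e_j, where the derivative of u^{kj-ℓ} must cancel the contribution of the change of coordinate y
↦ u^{-k}y. -/
theorem res_isDPullback (hβ : (k : ℂ) * β = ℓ) :
    IsDPullback (polyRes χ₀ (u ^ (-k))) (res (F := F) (F' := F') (β := β) χ₀ u k ℓ) := by
  refine ⟨res_smul χ₀ u k ℓ, ?_, fun θ p b η hθ m => ?_⟩
  · refine isBaseChangeAlong_of_basis χ₀.toRingHom _ (fun r => polyRes_C χ₀ _ r)
      (span_range_polyRes _ _) _ _ (basis F' β) (basis F' β).span_eq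
      ((basis F β).unitsSMul fun j => u ^ (k * j - ℓ)) fun j => ?_
    rw [Module.Basis.unitsSMul_apply, basis_apply, basis_apply, res_elt, Units.smul_def, ← map_smul,
      map_one, smul_eq_mul, one_mul, mul_one]
  · refine chain_rule_of_span (s := Set.range fun j => elt F' β j 1) (res_smul χ₀ u k ℓ) ?_ hθ ?_ m
    · rw [eq_top_iff]
      intro x _
      induction x using induction_elt with
      | h j r =>
        rw [elt_eq_smul, ← C_smul]
        exact Submodule.smul_mem _ _ (Submodule.subset_span ⟨j, rfl⟩)
      | hadd x y hx hy => exact Submodule.add_mem _ (hx trivial) (hy trivial)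
    · rintro _ ⟨j, rfl⟩
      have hR : ∀ l, b l • res (F := F) χ₀ u k ℓ (DiffOp.ofVF (η l) • elt F' β j 1) =
          -((b l * polyRes χ₀ (u ^ (-k)) (η l Polynomial.X)) •
            elt F β (j + 1) ((u ^ (k * (j + 1) - ℓ) : Rˣ) : R)) := fun l => by
        rw [ofVF_smul_elt_one, map_neg, res_smul, res_elt, map_one, one_mul, smul_neg, mul_smul]
      rw [Finset.sum_congr rfl fun l _ => hR l, Finset.sum_neg_distrib, ← Finset.sum_smul, ← hθ,
        res_elt, map_one, one_mul, ofVF_smul_elt, polyRes_X, Derivation.leibniz, smul_eq_mul,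
        smul_eq_mul, add_smul, mul_comm Polynomial.X, mul_smul, mul_smul, X_smul_elt,
        add_sub_cancel_right, smul_comm (Polynomial.C _), C_smul_elt, neg_add_rev, sub_eq_add_neg]
      have hu : ∀ i : ℤ, Polynomial.C ((u ^ i : Rˣ) : R) =
          ((Units.map ((polyConst (R := R)) : R →* R[X]) u ^ i : (R[X])ˣ) : R[X]) := fun i => by
        rw [← map_zpow]
        rfl
      have hsplit : u ^ (-k) * u ^ (k * (j + 1) - ℓ) = u ^ (k * j - ℓ) := by
        rw [← zpow_add]
        congr 1
        ring
      rw [← Units.val_mul, hsplit]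
      congr 1
      rw [elt_eq_smul F β j (_ * _), ← C_smul F β (_ * _), ← mul_smul, ← neg_smul]
      congr 1
      rw [Polynomial.C_mul, hu, hu, hu, vf_zpow, vf_zpow]
      have hs : Units.map ((polyConst (R := R)) : R →* R[X]) u ^ (k * j - ℓ - 1) =
          Units.map ((polyConst (R := R)) : R →* R[X]) u ^ (-k - 1) *
            Units.map ((polyConst (R := R)) : R →* R[X]) u ^ (k * (j + 1) - ℓ) := by
        rw [← zpow_add]
        congr 1
        ring
      rw [hs, Units.val_mul, show Polynomial.C (algebraMap ℂ R (((j + 1 : ℤ) : ℂ) - β - 1)) =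
        algebraMap ℂ R[X] (((j + 1 : ℤ) : ℂ) - β - 1) from rfl]
      -- This is kj - ℓ = k(j - β). The factor j-β is the coefficient in y e_{j+1} = (j-β)e_j.
      have hc : (((k * j - ℓ : ℤ)) : ℂ) = -(((-k : ℤ) : ℂ) * (((j + 1 : ℤ) : ℂ) - β - 1)) := by
        push_cast
        linear_combination hβ
      rw [hc, Algebra.smul_def, Algebra.smul_def, map_neg, map_mul]
      ring

end Res

end Ladder
end

noncomputable section

/-! ## The relative de Rham complex of the twisted module -/

theorem polyVF_mem_relVF {S : Type} [CommRing S] [Algebra ℂ S] (b : S[X]) :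
    polyVF 0 b ∈ relVF (polyConst : S →ₐ[ℂ] S[X]) := fun a => by
  change polyVF 0 b (Polynomial.C a) = 0
  simp

/-- The vector field `∂_t`, as a vertical vector field. -/
def verticalVF (S : Type) [CommRing S] [Algebra ℂ S] : relVF (polyConst : S →ₐ[ℂ] S[X]) :=
  ⟨polyVF 0 1, polyVF_mem_relVF 1⟩

theorem relVF_eq_smul {S : Type} [CommRing S] [Algebra ℂ S]
    (v : relVF (polyConst : S →ₐ[ℂ] S[X])) :
    v = (v : VF S[X]) Polynomial.X • verticalVF S := by
  refine Subtype.ext (poly_vf_ext (fun r => ?_) ?_)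
  · refine (v.2 r).trans ?_
    change (0 : S[X]) = (v : VF S[X]) Polynomial.X * polyVF 0 1 (Polynomial.C r)
    simp
  · change _ = (v : VF S[X]) Polynomial.X * polyVF 0 1 Polynomial.X
    simp

section Fourier

variable {R : Type} [CommRing R] [Algebra ℂ R] {n : ℕ} (F : Coords R n) (β : ℂ)

/-- The tensor product of the inverse image of `j₊𝒪^β` with the exponential module, over a chart. -/
abbrev fourierConn : ConnData R[X][X] R[X][T;T⁻¹] :=
  ConnData.direct (F.poly 1) (-(β + 1)) (-(LaurentPolynomial.T 1 * LaurentPolynomial.C Polynomial.X))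

variable (R) in
/-- The connection along the fibres. -/
def fourierD : R[X][T;T⁻¹] →ₗ[R[X]] R[X][T;T⁻¹] :=
  (laurentBasis R[X]).constr ℕ fun j => algebraMap ℂ R[X] (j - β - 1) • LaurentPolynomial.T (j - 1) -
    (Polynomial.X : R[X]) • LaurentPolynomial.T j

theorem fourierD_T (j : ℤ) : fourierD R β (LaurentPolynomial.T j) =
    algebraMap ℂ R[X] (j - β - 1) • LaurentPolynomial.T (j - 1) -
      (Polynomial.X : R[X]) • LaurentPolynomial.T j :=
  (laurentBasis R[X]).constr_basis ℕ _ j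

/-- The map to the cokernel of `fourierD`. -/
def fourierProj : R[X][T;T⁻¹] →ₗ[R[X]] Ladder F β :=
  (laurentBasis R[X]).constr ℕ fun j => Ladder.elt F β j 1

theorem fourierProj_T (j : ℤ) : fourierProj F β (LaurentPolynomial.T j) = Ladder.elt F β j 1 :=
  (laurentBasis R[X]).constr_basis ℕ _ j

theorem laurent_linear_induction {S : Type} [CommRing S] {p : S[T;T⁻¹] → Prop}
    (h : ∀ (a : S) j, p (a • LaurentPolynomial.T j)) (hadd : ∀ x y, p x → p y → p (x + y))
    (x : S[T;T⁻¹]) : p x := by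
  induction x using LaurentPolynomial.induction_on' with
  | add x y hx hy => exact hadd x y hx hy
  | C_mul_T j a =>
    rw [← LaurentPolynomial.smul_eq_C_mul]
    exact h a j

theorem fourierProj_fourierD (x : R[X][T;T⁻¹]) : fourierProj F β (fourierD R β x) = 0 := by
  induction x using laurent_linear_induction with
  | h a j =>
    rw [map_smul, map_smul, fourierD_T, map_sub, map_smul, map_smul, fourierProj_T, fourierProj_T,
      Ladder.X_smul_elt, mul_one]
    have : algebraMap ℂ R[X] (j - β - 1) • Ladder.elt F β (j - 1) 1 =
        Ladder.elt F β (j - 1) (algebraMap ℂ R (j - β - 1)) :=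
      (Ladder.C_smul_elt F β _ _ _).trans (by rw [mul_one])
    rw [this, sub_self, smul_zero]
  | hadd x y hx hy => rw [map_add, map_add, hx, hy, add_zero]

/-- A section of `fourierProj`. -/
def fourierSection : Ladder F β →+ R[X][T;T⁻¹] :=
  (Finsupp.liftAddHom fun j => ((AddMonoidHom.mulRight (LaurentPolynomial.T j)).comp
    ((LaurentPolynomial.C : R[X] →+* R[X][T;T⁻¹]).comp Polynomial.C).toAddMonoidHom) :
    (ℤ →₀ R) →+ R[X][T;T⁻¹])

theorem fourierSection_elt (j : ℤ) (r : R) : fourierSection F β (Ladder.elt F β j r) =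
    (Polynomial.C r : R[X]) • LaurentPolynomial.T j :=
  (Finsupp.liftAddHom_apply_single _ _ _).trans (LaurentPolynomial.smul_eq_C_mul _ _).symm

theorem fourierProj_fourierSection (x : Ladder F β) :
    fourierProj F β (fourierSection F β x) = x := by
  induction x using Ladder.induction_elt with
  | h j r => rw [fourierSection_elt, map_smul, fourierProj_T, Ladder.C_smul_elt, mul_one]
  | hadd x y hx hy => rw [map_add, map_add, hx, hy]

/-- Modulo the image of the vertical derivative, yT^j equals (j-β-1)T^{j-1}. Induction on the degree
in y removes y altogether and leaves a combination of the T^j over `R`. -/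
theorem sub_fourierSection_mem (x : R[X][T;T⁻¹]) :
    x - fourierSection F β (fourierProj F β x) ∈ LinearMap.range (fourierD R β) := by
  have hadd : ∀ x y, x - fourierSection F β (fourierProj F β x) ∈ LinearMap.range (fourierD R β) →
      y - fourierSection F β (fourierProj F β y) ∈ LinearMap.range (fourierD R β) →
      x + y - fourierSection F β (fourierProj F β (x + y)) ∈ LinearMap.range (fourierD R β) := by
    intro x y hx hy
    rw [map_add, map_add, add_sub_add_comm]
    exact Submodule.add_mem _ hx hy
  induction x using laurent_linear_induction with
  | h a j =>
    induction a using Polynomial.induction_on generalizing j with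
    | C a =>
      rw [map_smul, fourierProj_T, Ladder.C_smul_elt, mul_one, fourierSection_elt, sub_self]
      exact Submodule.zero_mem _
    | add p q hp hq =>
      rw [add_smul]
      exact hadd _ _ (hp j) (hq j)
    | monomial m a h =>
      set p := Polynomial.C a * Polynomial.X ^ m
      have e : (Polynomial.C a * Polynomial.X ^ (m + 1)) • (LaurentPolynomial.T j : R[X][T;T⁻¹]) =
          algebraMap ℂ R[X] (j - β - 1) • p • LaurentPolynomial.T (j - 1) -
            fourierD R β (p • LaurentPolynomial.T j) := by
        rw [map_smul, fourierD_T, smul_sub, pow_succ, ← mul_assoc, mul_smul,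
          smul_comm p (algebraMap ℂ R[X] _), sub_sub_cancel]
      have hD : fourierD R β (p • LaurentPolynomial.T j) - fourierSection F β (fourierProj F β
          (fourierD R β (p • LaurentPolynomial.T j))) ∈ LinearMap.range (fourierD R β) := by
        rw [fourierProj_fourierD, map_zero, sub_zero]
        exact ⟨_, rfl⟩
      have hσ : ∀ (z : ℂ) x, fourierSection F β (algebraMap ℂ R[X] z • x) =
          algebraMap ℂ R[X] z • fourierSection F β x := by
        intro z x
        induction x using Ladder.induction_elt with
        | h j r =>
          change fourierSection F β (Polynomial.C (algebraMap ℂ R z) • _) =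
            (Polynomial.C (algebraMap ℂ R z) : R[X]) • _
          rw [Ladder.C_smul_elt, fourierSection_elt, fourierSection_elt, smul_smul,
            Polynomial.C_mul]
        | hadd x y hx hy => rw [smul_add, map_add, hx, hy, map_add, smul_add]
      rw [e, map_sub (fourierProj F β), map_sub (fourierSection F β), sub_sub_sub_comm,
        map_smul, hσ, ← smul_sub]
      exact Submodule.sub_mem _ (Submodule.smul_mem _ _ (h (j - 1))) hD
  | hadd x y hx hy => exact hadd x y hx hy

theorem fourierProj_eq_zero_iff (x : R[X][T;T⁻¹]) :
    fourierProj F β x = 0 ↔ ∃ y, x = fourierD R β y := by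
  constructor
  · intro h
    have := sub_fourierSection_mem F β x
    rw [h, map_zero, sub_zero] at this
    obtain ⟨y, hy⟩ := this
    exact ⟨y, hy.symm⟩
  · rintro ⟨y, rfl⟩
    exact fourierProj_fourierD F β y

theorem coeff_fourierD (x : R[X][T;T⁻¹]) (i : ℤ) : (fourierD R β x).coeff i =
    algebraMap ℂ R[X] (i - β) * x.coeff (i + 1) - Polynomial.X * x.coeff i := by
  induction x using laurent_linear_induction with
  | h a j =>
    have hT : ∀ j : ℤ, ((LaurentPolynomial.T j : R[X][T;T⁻¹])).coeff =
        Finsupp.single j (1 : R[X]) := fun j => rfl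
    rw [map_smul, fourierD_T]
    simp only [AddMonoidAlgebra.coeff_smul, AddMonoidAlgebra.coeff_sub, Finsupp.coe_smul,
      Finsupp.coe_sub, Pi.smul_apply, Pi.sub_apply, hT, Finsupp.single_apply, smul_eq_mul]
    by_cases h1 : j = i + 1
    · subst h1
      simp
      ring
    · have h2 : j - 1 ≠ i := fun h => h1 (by omega)
      by_cases h3 : j = i
      · subst h3
        simp
        ring
      · simp [h1, h2, h3]
  | hadd x y hx hy =>
    rw [map_add, AddMonoidAlgebra.coeff_add, AddMonoidAlgebra.coeff_add, Finsupp.add_apply, hx, hy,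
      Finsupp.add_apply, Finsupp.add_apply]
    ring

/-- For an element of the kernel, y c_i = (i-β)c_{i+1}. The coefficients vanish for large i and y is
a nonzerodivisor, so descending induction makes all of them vanish; β plays no role. -/
theorem fourierD_injective : Function.Injective (fourierD R β) := by
  rw [injective_iff_map_eq_zero]
  intro x hx
  have hc : ∀ i, Polynomial.X * x.coeff i = algebraMap ℂ R[X] (i - β) * x.coeff (i + 1) := by
    intro i
    have := coeff_fourierD β x i
    rw [hx] at this
    exact (sub_eq_zero.mp this.symm).symm
  obtain ⟨N, hN⟩ := x.coeff.support.bddAbove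
  have hbig : ∀ i, N < i → x.coeff i = 0 := fun i hi =>
    Finsupp.notMem_support_iff.mp fun h => absurd (hN h) (not_le.mpr hi)
  have hall : ∀ m : ℕ, x.coeff (N + 1 - m) = 0 := by
    intro m
    induction m with
    | zero => exact hbig _ (by simp)
    | succ m ih =>
      have := hc (N + 1 - (m + 1 : ℕ))
      rw [show N + 1 - ((m + 1 : ℕ) : ℤ) + 1 = N + 1 - m by push_cast; ring, ih, mul_zero] at this
      refine Polynomial.ext fun i => ?_
      have h := congrArg (fun p => Polynomial.coeff p (i + 1)) this
      rwa [Polynomial.coeff_X_mul, Polynomial.coeff_zero] at h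
  refine AddMonoidAlgebra.coeff_injective (Finsupp.ext fun i => ?_)
  by_cases hi : N < i
  · exact hbig i hi
  · have := hall (N + 1 - i).toNat
    rwa [Int.toNat_of_nonneg (by omega), sub_sub_cancel] at this

/-- This identifies the explicit operator with ∂_t + γ/t - y, the action of the vertical field on
the twisted module. -/
theorem fourierD_eq (x : R[X][T;T⁻¹]) : fourierD R β x =
    laurentVF 0 1 x + (fourierConn F β).form (laurentVF 0 1) * x := by
  have hform : (fourierConn F β).form (laurentVF 0 1) =
      -(β + 1) • LaurentPolynomial.T (-1) - LaurentPolynomial.C Polynomial.X := by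
    change -(β + 1) • (laurentVF 0 1 (LaurentPolynomial.T 1) * LaurentPolynomial.T (-1)) +
      laurentVF 0 1 (-(LaurentPolynomial.T 1 * LaurentPolynomial.C Polynomial.X)) = _
    rw [map_neg, Derivation.leibniz, laurentVF_T, laurentVF_C]
    simp [sub_eq_add_neg]
  rw [hform]
  induction x using laurent_linear_induction with
  | h a j =>
    rw [map_smul, fourierD_T, LaurentPolynomial.smul_eq_C_mul a (LaurentPolynomial.T j),
      laurentVF_C_mul_T]
    simp only [LaurentPolynomial.T_sub, Algebra.smul_def, Algebra.algebraMap_self, RingHom.id_apply,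
      LaurentPolynomial.algebraMap_apply, Derivation.coe_zero, Pi.zero_apply, map_zero, map_sub,
      map_add, map_neg, map_one, zero_mul]
    ring
  | hadd x y hx hy =>
    rw [map_add, hx, hy, map_add]
    ring

theorem vfRelated_vertical :
    VFRelated toLaurentHom (polyVF (0 : VF R[X]) 1) (laurentVF (0 : VF R[X]) 1) :=
  vfRelated_poly (fun r => by simp) (by simp)

theorem val_vertical_smul (m : (fourierConn F β).Mod) :
    (fourierConn F β).val (DiffOp.ofVF (verticalVF R[X] : VF R[X][X]) • m) =
      fourierD R β ((fourierConn F β).val m) := by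
  rw [fourierD_eq F]
  exact (fourierConn F β).val_ofVF_smul vfRelated_vertical m

theorem val_polyConst_smul (a : R[X]) (m : (fourierConn F β).Mod) :
    (fourierConn F β).val ((polyConst a : R[X][X]) • m) = a • (fourierConn F β).val m := by
  rw [ConnData.val_smul, LaurentPolynomial.smul_eq_C_mul]
  congr 1
  exact toLaurentHom_C a

theorem fourierConn_eq_zero (m : (fourierConn F β).Mod)
    (h : ∀ v ∈ relVF (polyConst : R[X] →ₐ[ℂ] R[X][X]), DiffOp.ofVF v • m = 0) : m = 0 := by
  apply (fourierConn F β).val.injective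
  apply fourierD_injective β
  rw [← val_vertical_smul, h _ (verticalVF R[X]).2, map_zero, map_zero]

/-- The map from relative differential forms to the Fourier transform. -/
def fourierMap : (relVF (polyConst : R[X] →ₐ[ℂ] R[X][X]) →ₗ[R[X][X]] (fourierConn F β).Mod) →+
    Ladder F β where
  toFun φ := fourierProj F β ((fourierConn F β).val (φ (verticalVF R[X])))
  map_zero' := by simp
  map_add' φ φ' := by simp

theorem fourierMap_surjective : Function.Surjective (fourierMap F β) := by
  intro x
  let m : (fourierConn F β).Mod := (fourierConn F β).val.symm (fourierSection F β x)
  let φ : relVF (polyConst : R[X] →ₐ[ℂ] R[X][X]) →ₗ[R[X][X]] (fourierConn F β).Mod :=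
    { toFun := fun v => (v : VF R[X][X]) Polynomial.X • m
      map_add' := fun v v' => by
        change ((v : VF R[X][X]) + (v' : VF R[X][X])) Polynomial.X • m = _
        rw [Derivation.add_apply, add_smul]
      map_smul' := fun a v => by
        change (a • (v : VF R[X][X])) Polynomial.X • m = _
        rw [Derivation.smul_apply, smul_eq_mul, mul_smul]
        rfl }
  refine ⟨φ, ?_⟩
  change fourierProj F β ((fourierConn F β).val
    ((verticalVF R[X] : VF R[X][X]) Polynomial.X • m)) = x
  have : (verticalVF R[X] : VF R[X][X]) Polynomial.X = 1 := polyVF_X _ _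
  rw [this, one_smul, AddEquiv.apply_symm_apply, fourierProj_fourierSection]

theorem fourierMap_eq_zero_iff
    (φ : relVF (polyConst : R[X] →ₐ[ℂ] R[X][X]) →ₗ[R[X][X]] (fourierConn F β).Mod) :
    fourierMap F β φ = 0 ↔ ∃ m : (fourierConn F β).Mod,
      ∀ v : relVF (polyConst : R[X] →ₐ[ℂ] R[X][X]), φ v = DiffOp.ofVF (v : VF R[X][X]) • m := by
  refine (fourierProj_eq_zero_iff F β _).trans ⟨?_, ?_⟩
  · rintro ⟨y, hy⟩
    refine ⟨(fourierConn F β).val.symm y, fun v => ?_⟩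
    have h : φ (verticalVF R[X]) =
        DiffOp.ofVF (verticalVF R[X] : VF R[X][X]) • (fourierConn F β).val.symm y := by
      apply (fourierConn F β).val.injective
      rw [hy, val_vertical_smul, AddEquiv.apply_symm_apply]
    conv_lhs => rw [relVF_eq_smul v]
    conv_rhs => rw [relVF_eq_smul v]
    rw [map_smul, h]
    change _ = DiffOp.ofVF ((v : VF R[X][X]) Polynomial.X • (verticalVF R[X] : VF R[X][X])) • _
    rw [DiffOp.ofVF_smul, mul_smul, DCompatible.ofFun_smul]
  · rintro ⟨m, hm⟩
    exact ⟨(fourierConn F β).val m, by rw [hm, val_vertical_smul]⟩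

theorem fourierMap_smul (a : R[X])
    (φ : relVF (polyConst : R[X] →ₐ[ℂ] R[X][X]) →ₗ[R[X][X]] (fourierConn F β).Mod) :
    fourierMap F β ((polyConst a : R[X][X]) • φ) = a • fourierMap F β φ := by
  change fourierProj F β ((fourierConn F β).val ((polyConst a : R[X][X]) • φ (verticalVF R[X]))) = _
  rw [val_polyConst_smul, map_smul]
  rfl

/-- The lift of η that kills T acts on the coefficients and adds -Tη(y), which comes from the twist
e^{-ty}. On classes this is ∂_y e_j = -e_{j+1}. -/
theorem fourierProj_vf (η : VF R[X]) (x : R[X][T;T⁻¹]) :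
    fourierProj F β (laurentVF η 0 x -
      LaurentPolynomial.T 1 * LaurentPolynomial.C (η Polynomial.X) * x) =
      DiffOp.ofVF η • fourierProj F β x := by
  induction x using laurent_linear_induction with
  | h a j =>
    have e : laurentVF η 0 (a • LaurentPolynomial.T j) -
        LaurentPolynomial.T 1 * LaurentPolynomial.C (η Polynomial.X) * (a • LaurentPolynomial.T j) =
        η a • LaurentPolynomial.T j - (a * η Polynomial.X) • LaurentPolynomial.T (j + 1) := by
      simp only [LaurentPolynomial.smul_eq_C_mul, laurentVF_C_mul_T, LaurentPolynomial.T_add,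
        map_mul, zero_mul, smul_zero, add_zero]
      ring
    rw [e, map_sub, map_smul, map_smul, map_smul, fourierProj_T, fourierProj_T, ofVF_smul_smul,
      Ladder.ofVF_smul_elt_one, smul_neg, mul_smul]
    abel
  | hadd x y hx hy =>
    rw [map_add, mul_add, add_sub_add_comm, map_add, hx, hy, map_add, smul_add]

/-- An arbitrary lift is the standard one plus a vertical field b∂_t. By Cartan's formula the Lie
derivative along the vertical part is exact, so it disappears in the cokernel. -/
theorem ofVF_smul_fourierMap {η : VF R[X]} {θ : VF R[X][X]} (h : VFRelated polyConst η θ)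
    {φ φ' : relVF (polyConst : R[X] →ₐ[ℂ] R[X][X]) →ₗ[R[X][X]] (fourierConn F β).Mod}
    (hφ : ∀ v u : relVF (polyConst : R[X] →ₐ[ℂ] R[X][X]), (u : VF R[X][X]) = ⁅θ, (v : VF R[X][X])⁆ →
      φ' v = DiffOp.ofVF θ • φ v - φ u) :
    DiffOp.ofVF η • fourierMap F β φ = fourierMap F β φ' := by
  have hC : ∀ s, θ (Polynomial.C s) = Polynomial.C (η s) := h
  -- The bracket of θ with ∂_t is -∂_t(θ(t)) ∂_t.
  have hu := hφ (verticalVF R[X]) (-(polyVF 0 1 (θ Polynomial.X)) • verticalVF R[X])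
    (poly_vf_ext (fun r => by
      change -(polyVF 0 1 (θ Polynomial.X)) * polyVF 0 1 (Polynomial.C r) =
        θ (polyVF 0 1 (Polynomial.C r)) - polyVF 0 1 (θ (Polynomial.C r))
      simp [hC]) (by
      change -(polyVF 0 1 (θ Polynomial.X)) * polyVF 0 1 Polynomial.X =
        θ (polyVF 0 1 Polynomial.X) - polyVF 0 1 (θ Polynomial.X)
      simp))
  obtain ⟨θ₁, hθ₁⟩ := (fourierConn F β).rel.exists_related θ
  have hT : θ₁ (LaurentPolynomial.T 1) = toLaurentHom (θ Polynomial.X) := by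
    have := hθ₁ Polynomial.X
    rwa [show (fourierConn F β).φ Polynomial.X = LaurentPolynomial.T 1 from toLaurentHom_X] at this
  have hθC : ∀ s, θ₁ (LaurentPolynomial.C s) = LaurentPolynomial.C (η s) := fun s => by
    have := hθ₁ (Polynomial.C s)
    rw [show (fourierConn F β).φ (Polynomial.C s) = LaurentPolynomial.C s from toLaurentHom_C s,
      hC] at this
    exact this.trans (toLaurentHom_C _)
  set b := toLaurentHom (θ Polynomial.X) with hb
  have hsplit : θ₁ = laurentVF η 0 + b • laurentVF 0 1 :=
    laurent_vf_ext (fun s => by simp [hθC]) (by simp [hT])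
  have hdb : toLaurentHom (polyVF 0 1 (θ Polynomial.X)) = laurentVF (0 : VF R[X]) 1 b :=
    (vfRelated_vertical (θ Polynomial.X)).symm
  set x := (fourierConn F β).val (φ (verticalVF R[X]))
  have hform : (fourierConn F β).form θ₁ = b * (fourierConn F β).form (laurentVF 0 1) -
      LaurentPolynomial.T 1 * LaurentPolynomial.C (η Polynomial.X) := by
    simp only [ConnData.form]
    change _ • (θ₁ (LaurentPolynomial.T 1) * LaurentPolynomial.T (-1)) +
      θ₁ (-(LaurentPolynomial.T 1 * LaurentPolynomial.C Polynomial.X)) =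
      b * (_ • (laurentVF 0 1 (LaurentPolynomial.T 1) * LaurentPolynomial.T (-1)) +
      laurentVF 0 1 (-(LaurentPolynomial.T 1 * LaurentPolynomial.C Polynomial.X))) - _
    simp only [map_neg, Derivation.leibniz, hT, hθC, laurentVF_T, laurentVF_C, smul_eq_mul,
      Algebra.smul_def, Derivation.coe_zero, Pi.zero_apply, map_zero]
    ring
  -- The terms containing b, including the one from the bracket, combine to the exact term `fourierD
  -- R β (b * x)`.
  have hval : (fourierConn F β).val (φ' (verticalVF R[X])) =
      (laurentVF η 0 x - LaurentPolynomial.T 1 * LaurentPolynomial.C (η Polynomial.X) * x) +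
        fourierD R β (b * x) := by
    rw [hu, map_smul, map_sub, (fourierConn F β).val_ofVF_smul hθ₁, ConnData.val_smul, map_neg,
      show (fourierConn F β).φ (polyVF 0 1 (θ Polynomial.X)) = laurentVF (0 : VF R[X]) 1 b from hdb,
      hform, fourierD_eq F, Derivation.leibniz, hsplit]
    simp only [Derivation.add_apply, Derivation.smul_apply, smul_eq_mul]
    ring
  change _ = fourierProj F β ((fourierConn F β).val (φ' (verticalVF R[X])))
  rw [hval, map_add, fourierProj_fourierD, add_zero, fourierProj_vf]
  rfl

end Fourier

section FourierRes

variable {R' R : Type} [CommRing R'] [Algebra ℂ R'] [CommRing R] [Algebra ℂ R]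
  {n' n : ℕ} (F' : Coords R' n') (F : Coords R n) (β : ℂ) (χ₀ : R' →ₐ[ℂ] R) (u : Rˣ) (k ℓ : ℤ)

/-- A unit of the base, as a polynomial. -/
abbrev polyUnit (α : Rˣ) : (R[X])ˣ := Units.map ((polyConst (R := R)) : R →* R[X]) α

/-- On T^j the factors u^k from dt, u^{kj} from T^j and u^{-(ℓ+k)} from the generator multiply to
u^{kj-ℓ}. -/
theorem ladderRes_fourierProj (x : R'[X][T;T⁻¹]) :
    Ladder.res (F := F) χ₀ u k ℓ (fourierProj F' β x) =
      fourierProj F β ((polyUnit u ^ k : (R[X])ˣ) •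
        (laurentRes (polyRes χ₀ (u ^ (-k))) (polyUnit u ^ k) x *
          LaurentPolynomial.C ((polyUnit u ^ (-(ℓ + k)) : (R[X])ˣ) : R[X]))) := by
  induction x using laurent_linear_induction with
  | h a j =>
    have hu : ∀ i : ℤ, ((polyUnit u ^ i : (R[X])ˣ) : R[X]) = Polynomial.C ((u ^ i : Rˣ) : R) :=
      fun i => by
        rw [← map_zpow]
        rfl
    have e : (polyUnit u ^ k : (R[X])ˣ) •
        (laurentRes (polyRes χ₀ (u ^ (-k))) (polyUnit u ^ k) (a • LaurentPolynomial.T j) *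
          LaurentPolynomial.C ((polyUnit u ^ (-(ℓ + k)) : (R[X])ˣ) : R[X])) =
        polyRes χ₀ (u ^ (-k)) a • Polynomial.C ((u ^ (k * j - ℓ) : Rˣ) : R) •
          LaurentPolynomial.T j := by
      rw [LaurentPolynomial.smul_eq_C_mul a, map_mul, laurentRes_C, laurentRes_T, Units.smul_def,
        ← hu, show k * j - ℓ = k + k * j + -(ℓ + k) by ring, zpow_add, zpow_add, zpow_mul,
        Units.val_mul, Units.val_mul]
      simp only [LaurentPolynomial.smul_eq_C_mul, map_mul]
      ring
    rw [e, map_smul (fourierProj F' β), map_smul (fourierProj F β), map_smul (fourierProj F β),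
      fourierProj_T, fourierProj_T, Ladder.res_smul,
      Ladder.res_elt, Ladder.C_smul_elt, map_one, one_mul, mul_one]
  | hadd x y hx hy => rw [map_add, map_add, hx, hy, map_add, add_mul, smul_add, map_add]

theorem ladderRes_fourierMap {χ : R'[X][X] →ₐ[ℂ] R[X][X]}
    (hχ : χ = polyRes (polyRes χ₀ (u ^ (-k))) (polyUnit u ^ k))
    {φ' : relVF (polyConst : R'[X] →ₐ[ℂ] R'[X][X]) →ₗ[R'[X][X]] (fourierConn F' β).Mod}
    {φ : relVF (polyConst : R[X] →ₐ[ℂ] R[X][X]) →ₗ[R[X][X]] (fourierConn F β).Mod}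
    (h : ∀ (v' : relVF (polyConst : R'[X] →ₐ[ℂ] R'[X][X]))
      (v : relVF (polyConst : R[X] →ₐ[ℂ] R[X][X])),
      VFRelated χ (v' : VF R'[X][X]) (v : VF R[X][X]) → φ v = ConnData.res (fourierConn F β)
        (fourierConn F' β) (laurentRes (polyRes χ₀ (u ^ (-k))) (polyUnit u ^ k))
        (laurentUnit (polyUnit u ^ (-(ℓ + k)))) (φ' v')) :
    Ladder.res (F := F) χ₀ u k ℓ (fourierMap F' β φ') = fourierMap F β φ := by
  subst hχ
  have hinv : ((polyUnit u ^ k : (R[X])ˣ) : R[X]) * (((polyUnit u ^ k)⁻¹ : (R[X])ˣ) : R[X]) = 1 :=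
    Units.mul_inv _
  -- Since t' = u^k t, the field ∂_{t'} restricts to u^{-k}∂_t. Evaluating the form on ∂_t instead
  -- of on ∂_{t'} produces the extra factor u^k.
  have h1 := h (verticalVF R'[X])
    (Polynomial.C (((polyUnit u ^ k)⁻¹ : (R[X])ˣ) : R[X]) • verticalVF R[X])
    (vfRelated_poly (fun r => by
      change Polynomial.C _ * polyVF 0 1 (polyRes _ _ (Polynomial.C r)) =
        polyRes _ _ (polyVF 0 1 (Polynomial.C r))
      simp) (by
      change Polynomial.C _ * polyVF 0 1 (polyRes _ _ Polynomial.X) =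
        polyRes _ _ (polyVF 0 1 Polynomial.X)
      rw [polyRes_X, Derivation.leibniz, polyVF_X, polyVF_X, polyVF_C]
      simp only [smul_eq_mul, Derivation.coe_zero, Pi.zero_apply, map_zero, mul_zero, add_zero,
        mul_one, map_one]
      rw [← map_mul, mul_comm, hinv, map_one]))
  have h2 : (fourierConn F β).val (φ (verticalVF R[X])) = (polyUnit u ^ k : (R[X])ˣ) •
      (laurentRes (polyRes χ₀ (u ^ (-k))) (polyUnit u ^ k)
        ((fourierConn F' β).val (φ' (verticalVF R'[X]))) *
          LaurentPolynomial.C ((polyUnit u ^ (-(ℓ + k)) : (R[X])ˣ) : R[X])) := by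
    have h3 := congrArg (fun y => (polyUnit u ^ k : (R[X])ˣ) • (fourierConn F β).val y) h1
    have h4 : (fourierConn F β).val (φ (Polynomial.C (((polyUnit u ^ k)⁻¹ : (R[X])ˣ) : R[X]) •
        verticalVF R[X])) = (((polyUnit u ^ k)⁻¹ : (R[X])ˣ) : R[X]) •
          (fourierConn F β).val (φ (verticalVF R[X])) := by
      rw [map_smul]
      exact val_polyConst_smul F β _ _
    simp only [h4, Units.smul_def, smul_smul, hinv, one_smul] at h3
    exact h3
  change Ladder.res (F := F) χ₀ u k ℓ (fourierProj F' β _) = fourierProj F β _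
  rw [h2, ladderRes_fourierProj]

end FourierRes
end

/-! ### Inverse images and tensor products on L ×_X L^∨ -/

noncomputable section

theorem IsDPullback.congr {A B : Type} [CommRing A] [Algebra ℂ A] [CommRing B] [Algebra ℂ B]
    {φ φ' : A →ₐ[ℂ] B} {M N : Type} [AddCommGroup M] [Module A M] [Module (DiffOp A) M]
    [AddCommGroup N] [Module B N] [Module (DiffOp B) N] {r : M →+ N} (h : IsDPullback φ r)
    (e : φ = φ') : IsDPullback φ' r := e ▸ h

theorem isTensorProduct_of_equiv {A P K Q : Type} [CommRing A] [AddCommGroup P] [Module A P]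
    [AddCommGroup K] [Module A K] [AddCommGroup Q] [Module A Q] (t : P →ₗ[A] K →ₗ[A] Q)
    (e : K ≃ₗ[A] A) (g : P ≃ₗ[A] Q) (h : ∀ p x, t p x = e x • g p) : IsTensorProduct t := by
  have : TensorProduct.lift t =
      ((LinearEquiv.lTensor P e).trans ((TensorProduct.rid A P).trans g)).toLinearMap :=
    TensorProduct.ext' fun p x => by simp [h]
  change Function.Bijective (TensorProduct.lift t)
  rw [this]
  exact ((LinearEquiv.lTensor P e).trans ((TensorProduct.rid A P).trans g)).bijective

theorem ConnData.exponential_isDPullback {R' R : Type} [CommRing R'] [Algebra ℂ R'] [CommRing R]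
    [Algebra ℂ R] {n' n : ℕ} (F' : Coords R' n') (F : Coords R n) (χ : R' →ₐ[ℂ] R) {f' : R'} {f : R}
    (hf : χ f' = f) : IsDPullback χ (res (exponential F f) (exponential F' f') χ 1) :=
  isDPullback (fun _ => rfl) (separates_id _) hf 1
    (by
      rw [Units.val_one, one_mul]
      exact map_one _) rfl (fun θ => by simp)
    (fun hr => isBaseChangeAlong_id _ _ rfl rfl _ _ hr)

section

variable {R R' R'' : Type} [CommRing R] [Algebra ℂ R] [CommRing R'] [Algebra ℂ R'] [CommRing R'']
  [Algebra ℂ R'']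

theorem laurentRes_id (b : R[T;T⁻¹]) : laurentRes (AlgHom.id ℂ R) 1 b = b := by
  have : laurentRes (AlgHom.id ℂ R) 1 = AlgHom.id ℂ R[T;T⁻¹] :=
    laurentHom_ext (fun r => laurentLift_const _ _ r) ((laurentLift_T _ _).trans (by simp))
  rw [this]
  rfl

theorem laurentRes_laurentRes (χ : R' →ₐ[ℂ] R) (χ' : R'' →ₐ[ℂ] R') (α : Rˣ) (α' : R'ˣ)
    (b : R''[T;T⁻¹]) : laurentRes χ α (laurentRes χ' α' b) =
      laurentRes (χ.comp χ') (Units.map (χ : R' →* R) α' * α) b := by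
  have : (laurentRes χ α).comp (laurentRes χ' α') =
      laurentRes (χ.comp χ') (Units.map (χ : R' →* R) α' * α) := by
    refine laurentHom_ext (fun r => ?_) ?_
    · change laurentRes χ α (laurentRes χ' α' (LaurentPolynomial.C r)) =
        laurentRes _ _ (LaurentPolynomial.C r)
      rw [laurentRes_C, laurentRes_C, laurentRes_C]
      rfl
    · change laurentRes χ α (laurentRes χ' α' (LaurentPolynomial.T 1)) =
        laurentRes _ _ (LaurentPolynomial.T 1)
      rw [laurentRes_T, laurentRes_T, map_mul, laurentRes_C, laurentRes_T, zpow_one, zpow_one,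
        zpow_one, Units.val_mul, map_mul, mul_assoc]
      rfl
  exact DFunLike.congr_fun this b

end

section Charts

variable {X : Scheme.{0}} {s : X ⟶ Spec (.of ℂ)} {n : ℕ} {ℱ : X.Modules}
  {t : LineBundleTrivialization ℱ}

variable (s n t) in
/-- The Fourier transform of `j₊𝒪^β`. -/
def fourierMod {k ℓ : ℤ} {β : ℂ} (hβ : (k : ℂ) * β = ℓ) : DMod (Tot s n t (-k)) where
  M c := Ladder c.coords β
  grp c := inferInstanceAs (AddCommGroup (Ladder c.coords β))
  omod c := inferInstanceAs (Module c.R[X] (Ladder c.coords β))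
  dmod c := inferInstanceAs (Module (DiffOp c.R[X]) (Ladder c.coords β))
  compat c := inferInstanceAs (DCompatible c.R[X] (Ladder c.coords β))
  res {c c'} h := Ladder.res (Chart.res h) (Chart.trans h) k ℓ
  res_self c m := by
    have : Ladder.res (F := c.coords) (F' := c.coords) (β := β) (Chart.res (le_refl c))
        (Chart.trans (le_refl c)) k ℓ = AddMonoidHom.id _ := Ladder.hom_ext fun j r => by
      rw [Ladder.res_elt, Chart.res_self, Chart.trans_self, one_zpow, Units.val_one, mul_one]
      rfl
    exact DFunLike.congr_fun this m
  res_res {c c' c''} h h' m := by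
    have : (Ladder.res (F := c.coords) (F' := c'.coords) (β := β) (Chart.res h)
        (Chart.trans h) k ℓ).comp (Ladder.res (F' := c''.coords) (Chart.res h')
        (Chart.trans h') k ℓ) = Ladder.res (Chart.res (h.trans h')) (Chart.trans (h.trans h')) k ℓ :=
      Ladder.hom_ext fun j r => by
        rw [AddMonoidHom.comp_apply, Ladder.res_elt, Ladder.res_elt, Ladder.res_elt,
          map_mul (Chart.res h), Chart.res_res, mul_assoc, Chart.trans_zpow]
    exact DFunLike.congr_fun this m
  isPullback h := Ladder.res_isDPullback _ _ k ℓ hβ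

theorem polyUnit_trans_self (m : ℤ) (c : Chart s n t) :
    polyUnit (Chart.trans (le_refl c)) ^ m = 1 := by
  rw [Chart.trans_self, polyUnit, map_one, one_zpow]

theorem totRes_polyUnit_trans (k m : ℤ) {c c' c'' : Chart s n t} (h : c ≤ c') (h' : c' ≤ c'') :
    Units.map (totRes k h : c'.R[X] →* c.R[X]) (polyUnit (Chart.trans h') ^ m) *
      polyUnit (Chart.trans h) ^ m = polyUnit (Chart.trans (h.trans h')) ^ m := by
  rw [map_zpow, ← mul_zpow]
  congr 1
  refine Units.ext ?_
  change polyRes (Chart.res h) (Chart.trans h ^ k) (Polynomial.C _) * Polynomial.C _ =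
    Polynomial.C _
  rw [polyRes_C, ← map_mul, mul_comm, ← Chart.trans_trans h h']
  rfl

theorem totProdRes_eq (k : ℤ) {c c' : Chart s n t} (h : c ≤ c') :
    totProdRes k h = polyRes (totRes (-k) h) (polyUnit (Chart.trans h) ^ k) := by
  have : polyUnit (Chart.trans h) ^ k = polyUnit (Chart.trans h ^ k) := (map_zpow _ _ _).symm
  rw [this]
  rfl

/-- Restriction of functions on `L^* ×_X L^∨`. -/
def totProdStarRes (k : ℤ) {c c' : Chart s n t} (h : c ≤ c') :
    c'.R[X][T;T⁻¹] →ₐ[ℂ] c.R[X][T;T⁻¹] :=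
  laurentRes (totRes (-k) h) (polyUnit (Chart.trans h) ^ k)

theorem totProdStarRes_self (k : ℤ) (c : Chart s n t) (b : c.R[X][T;T⁻¹]) :
    totProdStarRes k (le_refl c) b = b := by
  rw [totProdStarRes, totRes_self, polyUnit_trans_self]
  exact laurentRes_id b

theorem totProdStarRes_comp (k : ℤ) {c c' c'' : Chart s n t} (h : c ≤ c') (h' : c' ≤ c'')
    (b : c''.R[X][T;T⁻¹]) :
    totProdStarRes k h (totProdStarRes k h' b) = totProdStarRes k (h.trans h') b := by
  refine (laurentRes_laurentRes _ _ _ _ b).trans ?_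
  rw [totRes_comp, totRes_polyUnit_trans]
  rfl

theorem totProdStarRes_laurentUnit (k m : ℤ) {c c' c'' : Chart s n t} (h : c ≤ c')
    (h' : c' ≤ c'') : totProdStarRes k h (laurentUnit (polyUnit (Chart.trans h') ^ m)) *
      laurentUnit (polyUnit (Chart.trans h) ^ m) =
      (laurentUnit (polyUnit (Chart.trans (h.trans h')) ^ m) : c.R[X][T;T⁻¹]) := by
  change laurentRes (totRes (-k) h) _ (LaurentPolynomial.C _) * LaurentPolynomial.C _ =
    LaurentPolynomial.C _
  rw [laurentRes_C, ← map_mul]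
  exact congrArg (fun u : (c.R[X])ˣ => LaurentPolynomial.C (u : c.R[X]))
    (totRes_polyUnit_trans (-k) m h h')

theorem totProdStarRes_toLaurentHom (k : ℤ) {c c' : Chart s n t} (h : c ≤ c') (a : c'.R[X][X]) :
    totProdStarRes k h (toLaurentHom a) = toLaurentHom (totProdRes k h a) := by
  rw [totProdRes_eq]
  exact laurentRes_toLaurentHom _ _ a

theorem totProdRes_pairing (k : ℤ) {c c' : Chart s n t} (h : c ≤ c') :
    totProdRes k h (-(Polynomial.X * Polynomial.C Polynomial.X)) =
      -(Polynomial.X * Polynomial.C Polynomial.X) := by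
  have e := (pairing s n t k).naturality h Polynomial.X
  have e' : ∀ c : Chart s n t, (pairing s n t k).app c Polynomial.X =
      (Polynomial.X * Polynomial.C Polynomial.X : c.R[X][X]) := fun c => polyLift_X _ _
  have e'' : (Polynomial.X * Polynomial.C Polynomial.X : c.R[X][X]) =
      totProdRes k h (Polynomial.X * Polynomial.C Polynomial.X) :=
    (e' c).symm.trans (e.trans (congrArg (totProdRes k h) (e' c')))
  rw [map_neg, ← e'']

section

variable (s n t) (k : ℤ) {γ : ℂ} {m : ℤ} (hm : (m : ℂ) = k * γ)

/-- The direct image from `L^* ×_X L^∨` to `L ×_X L^∨` of the line bundle with connection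
`θ + γ θ(T)/T + θ(f)`. -/
def prodMod (f : ∀ c : Chart s n t, c.R[X][T;T⁻¹])
    (hf : ∀ {c c' : Chart s n t} (h : c ≤ c'), totProdStarRes k h (f c') = f c) :
    DMod (TotProd s n t k) :=
  ConnData.dmod (B := fun c => c.R[X][T;T⁻¹])
    (fun c => ConnData.direct (c.coords.poly 1) γ (f c))
    (fun h => totProdStarRes k h) (fun h => laurentUnit (polyUnit (Chart.trans h) ^ m))
    (totProdStarRes_self k) (totProdStarRes_comp k)
    (fun c => by
      rw [polyUnit_trans_self]
      exact map_one _)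
    (totProdStarRes_laurentUnit k m)
    (fun {c c'} h => (ConnData.direct_isDPullback (c'.coords.poly 1) (c.coords.poly 1)
      (totRes (-k) h) (polyUnit (Chart.trans h)) hm (hf h)).congr (totProdRes_eq k h).symm)

/-- The exponential module on `L ×_X L^∨`. -/
def expMod : DMod (TotProd s n t k) :=
  ConnData.dmod (B := fun c => c.R[X][X])
    (fun c => ConnData.exponential ((c.coords.poly 1).poly 1)
      (-(Polynomial.X * Polynomial.C Polynomial.X)))
    (fun h => totProdRes k h) (fun _ => 1)
    (TotProd s n t k).res_self (TotProd s n t k).res_res (fun _ => rfl)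
    (fun h h' => by rw [Units.val_one, map_one, one_mul, Units.val_one])
    (fun {c c'} h => ConnData.exponential_isDPullback _ _ _ (totProdRes_pairing k h))

/-- The pairing is a global function, so its exponential module is a globally trivial line bundle
with potential -ty, and all transition functions are 1. -/
theorem isInverseImage_pairing_expMod :
    IsInverseImage (pairing s n t k) (DMod.const (Chart s n t) ℂ[X] ExpModule) (expMod s n t k) := by
  obtain ⟨e, -⟩ := exists_expEquiv
  let p : ∀ c : Chart s n t, ℂ[X] →ₐ[ℂ] c.R[X][X] := fun c =>
    polyLift (Algebra.ofId ℂ c.R[X][X]) (Polynomial.X * polyConst (Polynomial.X : c.R[X]))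
  have hp : ∀ c : Chart s n t, p c (-Polynomial.X) =
      (-(Polynomial.X * Polynomial.C Polynomial.X) : c.R[X][X]) := fun c =>
    (map_neg (p c) _).trans (congrArg Neg.neg (polyLift_X (Algebra.ofId ℂ c.R[X][X]) _))
  refine ⟨fun c : Chart s n t => (ConnData.res (ConnData.exponential ((c.coords.poly 1).poly 1)
      (-(Polynomial.X * Polynomial.C Polynomial.X)))
      (ConnData.exponential (coordsPoint.poly 1) (-Polynomial.X : ℂ[X]))
      (p c) 1).comp e.toAddEquiv.toAddMonoidHom, fun c => ?_, fun {c c'} h x => ?_⟩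
  · exact IsDPullback.comp_equiv (ConnData.exponential_isDPullback (coordsPoint.poly 1)
      ((c.coords.poly 1).poly 1) (p c) (hp c)) e
  · have hnat : ∀ a, p c a = totProdRes k h (p c' a) := fun a =>
      (pairing s n t k).naturality h a
    have key : ∀ a : ℂ[X], p c a * ((1 : (c.R[X][X])ˣ) : c.R[X][X]) =
        totProdRes k h (p c' a * ((1 : (c'.R[X][X])ˣ) : c'.R[X][X])) *
          ((1 : (c.R[X][X])ˣ) : c.R[X][X]) := fun a => by
      rw [Units.val_one, Units.val_one, mul_one, mul_one, mul_one, hnat]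
    exact key _

theorem isInverseImage_proj₁ : IsInverseImage (proj₁ s n t k) (directMod s n t k hm)
    (prodMod s n t k hm (fun _ => 0) (fun _ => map_zero _)) := by
  refine ⟨fun c => ConnData.res (ConnData.direct (c.coords.poly 1) γ 0)
    (ConnData.direct c.coords γ 0) (laurentRes polyConst (1 ^ k)) (laurentUnit (1 ^ m)),
    fun c => ?_, fun {c c'} h x => ?_⟩
  · have e : polyRes polyConst (1 ^ k) =
        polyLift (polyConst.comp polyConst) (Polynomial.X : c.R[X][X]) :=
      polyHom_ext (fun r => (polyRes_C _ _ r).trans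
        (polyLift_const (polyConst.comp polyConst) (Polynomial.X : c.R[X][X]) r).symm)
        ((polyRes_X _ _).trans (Eq.trans (by simp) (polyLift_X _ _).symm))
    exact (ConnData.direct_isDPullback c.coords (c.coords.poly 1) polyConst 1 hm
      (map_zero _)).congr e
  · have hun : (laurentUnit (1 ^ m) : (c.R[X][T;T⁻¹])ˣ) = 1 := by rw [one_zpow]; exact map_one _
    have hun' : (laurentUnit (1 ^ m) : (c'.R[X][T;T⁻¹])ˣ) = 1 := by rw [one_zpow]; exact map_one _
    have key : ∀ b : c'.R[T;T⁻¹], laurentRes polyConst (1 ^ k)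
        (laurentRes (Chart.res h) (Chart.trans h ^ k) b *
          LaurentPolynomial.C ((Chart.trans h ^ m : c.Rˣ) : c.R)) *
          (laurentUnit (1 ^ m) : (c.R[X][T;T⁻¹])ˣ) =
        totProdStarRes k h (laurentRes polyConst (1 ^ k) b *
          (laurentUnit (1 ^ m) : (c'.R[X][T;T⁻¹])ˣ)) *
          LaurentPolynomial.C ((polyUnit (Chart.trans h) ^ m : (c.R[X])ˣ) : c.R[X]) := by
      intro b
      rw [hun, hun', Units.val_one, Units.val_one, mul_one, mul_one, map_mul, laurentRes_C,
        totProdStarRes, laurentRes_laurentRes, laurentRes_laurentRes]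
      congr 1
      · have h1 : (polyConst : c.R →ₐ[ℂ] c.R[X]).comp (Chart.res h) =
            (totRes (-k) h).comp polyConst := AlgHom.ext fun r => (polyLift_const _ _ r).symm
        have h2 : Units.map ((polyConst : c.R →ₐ[ℂ] c.R[X]) : c.R →* c.R[X]) (Chart.trans h ^ k) *
            1 ^ k = Units.map (totRes (-k) h : c'.R[X] →* c.R[X]) (1 ^ k) *
              polyUnit (Chart.trans h) ^ k := by
          rw [one_zpow, one_zpow, map_one, one_mul, mul_one, map_zpow]
        rw [h1, h2]
      · rw [polyUnit, ← map_zpow]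
        rfl
    exact key _

/-- Tensoring with a trivial line bundle changes only the connection, whose form is the sum of the
two forms. Here this adds the differential of the potential. -/
theorem isTensor_expMod (f : ∀ c : Chart s n t, c.R[X][T;T⁻¹])
    (hf : ∀ {c c' : Chart s n t} (h : c ≤ c'), totProdStarRes k h (f c') = f c)
    (hf' : ∀ c, f c = toLaurentHom (-(Polynomial.X * Polynomial.C Polynomial.X))) :
    IsTensor (prodMod s n t k hm (fun _ => 0) (fun _ => map_zero _)) (expMod s n t k)
      (prodMod s n t k hm f hf) := by
  let P : ∀ c : Chart s n t, ConnData c.R[X][X] c.R[X][T;T⁻¹] := fun c =>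
    ConnData.direct (c.coords.poly 1) γ 0
  let Q : ∀ c : Chart s n t, ConnData c.R[X][X] c.R[X][T;T⁻¹] := fun c =>
    ConnData.direct (c.coords.poly 1) γ (f c)
  let K : ∀ c : Chart s n t, ConnData c.R[X][X] c.R[X][X] := fun c =>
    ConnData.exponential ((c.coords.poly 1).poly 1) (-(Polynomial.X * Polynomial.C Polynomial.X))
  let g : ∀ c, (P c).Mod ≃ₗ[c.R[X][X]] (Q c).Mod := fun c =>
    { (P c).val.trans (Q c).val.symm with map_smul' := fun _ _ => rfl }
  let e : ∀ c, (K c).Mod ≃ₗ[c.R[X][X]] c.R[X][X] := fun c =>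
    { (K c).val with map_smul' := fun _ _ => rfl }
  let τ : ∀ c, (P c).Mod →ₗ[c.R[X][X]] (K c).Mod →ₗ[c.R[X][X]] (Q c).Mod := fun c =>
    LinearMap.mk₂ _ (fun p x => e c x • g c p) (fun p p' x => by rw [map_add, smul_add])
      (fun a p x => by rw [map_smul, smul_comm]) (fun p x x' => by rw [map_add, add_smul])
      (fun a p x => by rw [map_smul, smul_assoc])
  have hτ : ∀ c p x, (Q c).val (τ c p x) = toLaurentHom ((K c).val x) * (P c).val p :=
    fun c p x => rfl
  refine ⟨τ, fun c => isTensorProduct_of_equiv (τ c) (e c) (g c) fun _ _ => rfl,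
    fun c θ p x => ?_, fun {c c'} h p x => ?_⟩
  · have key : ∀ (θ : VF c.R[X][X]) (p : (P c).Mod) (x : (K c).Mod), DiffOp.ofVF θ • τ c p x =
        τ c (DiffOp.ofVF θ • p) x + τ c p (DiffOp.ofVF θ • x) := by
      intro θ p x
      obtain ⟨θ₁, hθ₁⟩ := (Q c).rel.exists_related θ
      have hθ₁' : VFRelated toLaurentHom θ θ₁ := hθ₁
      apply (Q c).val.injective
      rw [(Q c).val_ofVF_smul hθ₁, map_add, hτ, hτ, hτ, (P c).val_ofVF_smul hθ₁,
        (K c).val_ofVF_smul (η := θ) (θ := θ) (fun _ => rfl), map_add,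
        map_mul toLaurentHom, ← hθ₁', Derivation.leibniz]
      have h1 : (Q c).form θ₁ = (P c).form θ₁ + toLaurentHom ((K c).form θ) := by
        simp only [ConnData.form]
        change γ • (θ₁ _ * _) + θ₁ (f c) = γ • (θ₁ _ * _) + θ₁ 0 +
          toLaurentHom ((0 : ℂ) • _ + θ (-(Polynomial.X * Polynomial.C Polynomial.X)))
        rw [zero_smul, zero_add, ← hθ₁', hf', map_zero, add_zero]
        rfl
      rw [h1]
      simp only [smul_eq_mul]
      ring
    exact key θ p x
  · have key : ∀ (p : (P c').Mod) (x : (K c').Mod),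
        totProdStarRes k h (toLaurentHom ((K c').val x) * (P c').val p) *
          (laurentUnit (polyUnit (Chart.trans h) ^ m) : (c.R[X][T;T⁻¹])ˣ) =
        toLaurentHom (totProdRes k h ((K c').val x) * ((1 : (c.R[X][X])ˣ) : c.R[X][X])) *
          (totProdStarRes k h ((P c').val p) *
          (laurentUnit (polyUnit (Chart.trans h) ^ m) : (c.R[X][T;T⁻¹])ˣ)) := by
      intro p x
      rw [Units.val_one, mul_one, map_mul, totProdStarRes_toLaurentHom, mul_assoc]
    exact key p x

end

theorem toLaurentHom_pairing (c : Chart s n t) :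
    toLaurentHom (-(Polynomial.X * Polynomial.C Polynomial.X) : c.R[X][X]) =
      -(LaurentPolynomial.T 1 * LaurentPolynomial.C Polynomial.X) := by
  rw [map_neg, map_mul, toLaurentHom_X, toLaurentHom_C]

theorem isFourierLaplace_directMod {k ℓ : ℤ} {β : ℂ} (hβ : (k : ℂ) * β = ℓ) :
    IsFourierLaplace k (directMod s n t k (isOBeta_cast hβ)) (fourierMod s n t hβ) := by
  refine ⟨_, _, prodMod s n t k (isOBeta_cast hβ)
      (fun c => -(LaurentPolynomial.T 1 * LaurentPolynomial.C Polynomial.X)) (fun {c c'} h => ?_),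
    isInverseImage_proj₁ s n t k _, isInverseImage_pairing_expMod s n t k,
    isTensor_expMod s n t k _ _ _ (fun c => (toLaurentHom_pairing c).symm), ?_⟩
  · rw [← toLaurentHom_pairing, ← toLaurentHom_pairing, totProdStarRes_toLaurentHom,
      totProdRes_pairing]
  · refine ⟨fun c m h => fourierConn_eq_zero c.coords β m h, fun c => fourierMap c.coords β,
      fun c => fourierMap_surjective c.coords β, fun c φ => fourierMap_eq_zero_iff c.coords β φ,
      fun c a φ => fourierMap_smul c.coords β a φ,
      fun c η θ h φ φ' hφ => ofVF_smul_fourierMap c.coords β h hφ,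
      fun {c c'} h φ φ' hφ => ladderRes_fourierMap c'.coords c.coords β (Chart.res h)
        (Chart.trans h) k ℓ (totProdRes_eq k h) hφ⟩

end Charts
end

noncomputable section

/-! ## Coordinates on smooth algebras -/

section Smooth

variable {A : Type} [CommRing A] [Algebra ℂ A] {n : ℕ}

/-- A differential killed by all vector fields vanishes. -/
theorem kaehler_eq_zero_of_coords [Algebra.Smooth ℂ A] (F : Coords A n) {ω : Ω[A⁄ℂ]}
    (h : ∀ i, (F.d i).liftKaehlerDifferential ω = 0) : ω = 0 := by
  -- Differentials form a finite projective module on a smooth algebra and embed into a free one.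
  -- Each component of the embedding corresponds to a vector field, hence to a combination of the
  -- coordinate fields.
  obtain ⟨m, f, g, -, hg, -⟩ := Module.Finite.exists_comp_eq_id_of_projective A Ω[A⁄ℂ]
  refine hg (Eq.trans (funext fun l => ?_) (map_zero g).symm)
  let η : VF A := ((LinearMap.proj l).comp g).compDer (KaehlerDifferential.D ℂ A)
  have hη : η.liftKaehlerDifferential = (LinearMap.proj l).comp g :=
    Derivation.liftKaehlerDifferential_unique _ _ (by
      rw [Derivation.liftKaehlerDifferential_comp])
  have h1 : ∀ ω, η.liftKaehlerDifferential ω =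
      ∑ i, η (F.x i) * (F.d i).liftKaehlerDifferential ω := by
    intro ω
    have e : η.liftKaehlerDifferential = ∑ i, η (F.x i) • (F.d i).liftKaehlerDifferential :=
      Derivation.liftKaehlerDifferential_unique _ _ (by
        refine Derivation.ext fun a => ?_
        rw [Derivation.liftKaehlerDifferential_comp]
        change η a = (∑ i, η (F.x i) • (F.d i).liftKaehlerDifferential) (KaehlerDifferential.D ℂ A a)
        rw [LinearMap.sum_apply, F.apply_eq_sum η a]
        refine Finset.sum_congr rfl fun i _ => ?_
        rw [LinearMap.smul_apply, Derivation.liftKaehlerDifferential_comp_D, smul_eq_mul])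
    rw [e, LinearMap.sum_apply]
    rfl
  have h2 : g ω l = η.liftKaehlerDifferential ω := by rw [hη]; rfl
  rw [h2, h1, Finset.sum_eq_zero fun i _ => by rw [h i, mul_zero]]
  rfl

/-- Coordinates restrict to étale neighbourhoods. -/
theorem Coords.exists_related_of_etale [Algebra.Smooth ℂ A] (F : Coords A n) {B : Type} [CommRing B]
    [Algebra ℂ B] (φ : A →ₐ[ℂ] B) (hφ : φ.toRingHom.Etale) :
    ∃ F' : Coords B n, Coords.Related φ F F' := by
  let : Algebra A B := φ.toRingHom.toAlgebra
  have : IsScalarTower ℂ A B := .of_algebraMap_eq fun z => (φ.commutes z).symm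
  have : Algebra.Etale A B := hφ
  have hsm : ∀ (a : A) (b : B), a • b = φ a * b := fun a b => rfl
  -- derivations of `A` extend to `B`
  have hext : ∀ η : VF A, ∃ θ : VF B, VFRelated φ η θ := by
    intro η
    let η' : Derivation ℂ A B := (Algebra.linearMap A B).compDer η
    let g : Ω[B⁄ℂ] →ₗ[B] B := (TensorProduct.AlgebraTensorModule.lift
      ((LinearMap.lsmul B (Ω[A⁄ℂ] →ₗ[A] B)).flip η'.liftKaehlerDifferential)).comp
        (KaehlerDifferential.tensorKaehlerEquivOfFormallyEtale ℂ A B).symm.toLinearMap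
    refine ⟨g.compDer (KaehlerDifferential.D ℂ B), fun a => ?_⟩
    change TensorProduct.AlgebraTensorModule.lift _
      ((KaehlerDifferential.tensorKaehlerEquivOfFormallyEtale ℂ A B).symm
        (KaehlerDifferential.D ℂ B (algebraMap A B a))) = _
    rw [KaehlerDifferential.tensorKaehlerEquivOfFormallyEtale_symm_D_algebraMap]
    change (1 : B) • η'.liftKaehlerDifferential (KaehlerDifferential.D ℂ A a) = _
    rw [one_smul, Derivation.liftKaehlerDifferential_comp_D]
    rfl
  choose d hd using fun i => hext (F.d i)
  obtain ⟨m, f, g, -, -, hfg⟩ := Module.Finite.exists_comp_eq_id_of_projective A Ω[A⁄ℂ]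
  refine ⟨⟨fun i => φ (F.x i), d, fun i j => ?_, fun θ hθ => ?_⟩, fun _ => rfl, hd⟩
  · rw [hd, F.dual]
    split <;> simp
  · have hA : ∀ a, θ (φ a) = 0 := by
      let D : Derivation ℂ A B := θ.compAlgebraMap A
      have hD : ∀ a, D a = θ (φ a) := fun a => rfl
      have hsum : ∀ ω : Ω[A⁄ℂ], D.liftKaehlerDifferential ω =
          ∑ l, φ (g ω l) * D.liftKaehlerDifferential (f (Pi.single l 1)) := by
        intro ω
        conv_lhs => rw [← LinearMap.id_apply (R := A) ω, ← hfg]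
        have : g ω = ∑ l, g ω l • (Pi.single l 1 : Fin m → A) := by
          refine (pi_eq_sum_univ' (g ω)).trans (Finset.sum_congr rfl fun l _ => ?_)
          congr 1
        rw [LinearMap.comp_apply]
        conv_lhs => rw [this, map_sum, map_sum]
        refine Finset.sum_congr rfl fun l _ => ?_
        rw [map_smul, map_smul, hsm]
      let η : Fin m → VF A := fun l =>
        ((LinearMap.proj l).comp g).compDer (KaehlerDifferential.D ℂ A)
      have hDη : ∀ a, D a = ∑ l, φ (η l a) * D.liftKaehlerDifferential (f (Pi.single l 1)) := by
        intro a
        rw [← D.liftKaehlerDifferential_comp_D, hsum]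
        rfl
      have hDi : ∀ a, D a = ∑ i, φ (F.d i a) * D (F.x i) := by
        intro a
        simp only [hDη (F.x _), Finset.mul_sum]
        rw [Finset.sum_comm, hDη]
        refine Finset.sum_congr rfl fun l _ => ?_
        rw [F.apply_eq_sum (η l) a, map_sum, Finset.sum_mul]
        refine Finset.sum_congr rfl fun i _ => ?_
        rw [map_mul]
        ring
      intro a
      rw [← hD, hDi, Finset.sum_eq_zero fun i _ => by rw [hD, hθ, mul_zero]]
    -- For an étale map the differentials of `B` are generated by those of `A`, on which θ has just
    -- been shown to vanish.
    have h0 : θ.liftKaehlerDifferential = 0 := by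
      refine LinearMap.ext fun ω => ?_
      obtain ⟨y, rfl⟩ := (KaehlerDifferential.tensorKaehlerEquivOfFormallyEtale ℂ A B).surjective ω
      induction y using TensorProduct.induction_on with
      | zero => simp
      | add x y hx hy => rw [map_add, map_add, hx, hy]; simp
      | tmul b ω =>
        have hω : ω ∈ Submodule.span A (Set.range (KaehlerDifferential.D ℂ A)) :=
          KaehlerDifferential.span_range_derivation ℂ A ▸ Submodule.mem_top
        rw [KaehlerDifferential.tensorKaehlerEquivOfFormallyEtale_apply,
          KaehlerDifferential.mapBaseChange_tmul, map_smul]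
        induction hω using Submodule.span_induction with
        | mem ω hω =>
          obtain ⟨a, rfl⟩ := hω
          rw [KaehlerDifferential.map_D, Derivation.liftKaehlerDifferential_comp_D]
          rw [show θ (algebraMap A B a) = 0 from hA a, smul_zero]
          rfl
        | zero => simp
        | add x y _ _ hx hy => rw [map_add, map_add, smul_add, hx, hy]; simp
        | smul a x _ hx =>
          rw [map_smul, LinearMap.map_smul_of_tower, smul_comm, hx]
          simp
    refine Derivation.ext fun b => ?_
    rw [← θ.liftKaehlerDifferential_comp_D, h0]
    rfl

/-- On a smooth variety over `ℂ`, the functions killed by all vector fields are constant. -/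
theorem Coords.exists_eq_algebraMap [Algebra.Smooth ℂ A] [IsDomain A] (F : Coords A n) {f : A}
    (h : ∀ i, F.d i f = 0) : ∃ z : ℂ, f = algebraMap ℂ A z := by
  have hdf : KaehlerDifferential.D ℂ A f = 0 := kaehler_eq_zero_of_coords F fun i => by
    rw [Derivation.liftKaehlerDifferential_comp_D, h]
  by_cases hf : Transcendental ℂ f
  -- A transcendental f would have nonzero differential. In characteristic zero the function field
  -- is formally smooth over ℂ(f), hence over ℂ[f], so df remains nonzero in it.
  · exfalso
    let K := FractionRing A
    let E := FractionRing ℂ[X]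
    let ψ : ℂ[X] →ₐ[ℂ] K := Polynomial.aeval (algebraMap A K f)
    have hψ : Function.Injective ψ := by
      have : Transcendental ℂ (algebraMap A K f) :=
        (transcendental_algebraMap_iff (IsFractionRing.injective A K)).mpr hf
      exact transcendental_iff_injective.mp this
    let : Algebra ℂ[X] K := ψ.toRingHom.toAlgebra
    have : IsScalarTower ℂ ℂ[X] K := .of_algebraMap_eq fun z => (ψ.commutes z).symm
    let : Algebra E K := (IsFractionRing.lift (K := E) (show Function.Injective ψ.toRingHom from hψ)).toAlgebra
    have : IsScalarTower ℂ[X] E K := .of_algebraMap_eq fun p =>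
      (IsFractionRing.lift_algebraMap (K := E) (show Function.Injective ψ.toRingHom from hψ) p).symm
    have : IsScalarTower ℂ E K := .to₁₃₄ ℂ ℂ[X] E K
    have : Algebra.EssFiniteType A K := .of_isLocalization K (nonZeroDivisors A)
    have : Algebra.EssFiniteType ℂ K := .comp ℂ A K
    have : Algebra.EssFiniteType E K := .of_comp ℂ E K
    have : CharZero E := charZero_of_injective_algebraMap (algebraMap ℂ E).injective
    have : Algebra.FormallySmooth E K := .of_perfectField
    have : Algebra.FormallySmooth ℂ[X] E := .of_isLocalization (nonZeroDivisors ℂ[X])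
    have : Algebra.FormallySmooth ℂ[X] K := .comp ℂ[X] E K
    have hinj : Function.Injective (KaehlerDifferential.mapBaseChange ℂ ℂ[X] K) := by
      rw [injective_iff_map_eq_zero]
      intro x hx
      obtain ⟨x, rfl⟩ := (Algebra.H1Cotangent.exact_δ_mapBaseChange ℂ ℂ[X] K x).mp hx
      rw [Subsingleton.elim x 0, map_zero]
    have h0 : KaehlerDifferential.mapBaseChange ℂ ℂ[X] K
        (1 ⊗ₜ KaehlerDifferential.D ℂ ℂ[X] Polynomial.X) = 0 := by
      rw [KaehlerDifferential.mapBaseChange_tmul, KaehlerDifferential.map_D, one_smul]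
      have e : algebraMap ℂ[X] K Polynomial.X = algebraMap A K f := Polynomial.aeval_X _
      rw [e, ← KaehlerDifferential.map_D ℂ ℂ A K, hdf, map_zero]
    have h1 := hinj (h0.trans (map_zero _).symm)
    let ev : TensorProduct ℂ[X] K Ω[ℂ[X]⁄ℂ] ≃ₗ[K] K :=
      (TensorProduct.AlgebraTensorModule.congr (LinearEquiv.refl K K)
        (KaehlerDifferential.polynomialEquiv ℂ)).trans (TensorProduct.AlgebraTensorModule.rid ℂ[X] K K)
    have h2 := congrArg ev h1
    simp [ev] at h2
  -- An algebraic f in a domain is a constant, because ℂ is algebraically closed.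
  · rw [Transcendental, not_not] at hf
    obtain ⟨z, hz⟩ := minpoly.mem_range_of_degree_eq_one ℂ f
      (IsAlgClosed.degree_eq_one_of_irreducible ℂ (minpoly.irreducible hf.isIntegral))
    exact ⟨z, hz.symm⟩

end Smooth
end

noncomputable section

/-! ## Charts of a smooth variety -/

section Geometry

variable {X : Scheme.{0}} {s : X ⟶ Spec (.of ℂ)} {n : ℕ}

theorem smooth_sectionsAlgebra [AlgebraicGeometry.Smooth s] {V : X.Opens} (hV : IsAffineOpen V) :
    letI := sectionsAlgebra s V
    Algebra.Smooth ℂ Γ(X, V) := by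
  have h1 : (s.appLE ⊤ V le_top).hom.Smooth := s.smooth_appLE (isAffineOpen_top _) hV le_top
  have h2 : (Scheme.ΓSpecIso (.of ℂ)).inv.hom.Smooth :=
    RingHom.Smooth.of_bijective
      (ConcreteCategory.bijective_of_isIso (Scheme.ΓSpecIso (.of ℂ)).inv)
  exact h2.comp h1

theorem etale_map {V V' : X.Opens} (hV : IsAffineOpen V) (hV' : IsAffineOpen V') (h : V ≤ V') :
    (X.presheaf.map (homOfLE h).op).hom.Etale := by
  have := (𝟙 X : X ⟶ X).etale_appLE hV' hV h
  rwa [show (𝟙 X : X ⟶ X).appLE V' V h = X.presheaf.map (homOfLE h).op by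
    simp only [Scheme.Hom.appLE, Scheme.Hom.id_app]
    exact Category.id_comp _] at this

theorem HasCoordinates.of_le [AlgebraicGeometry.Smooth s] {V V' : X.Opens} (hV : IsAffineOpen V)
    (hV' : IsAffineOpen V') (h : V ≤ V') (hc : HasCoordinates s n V') : HasCoordinates s n V := by
  obtain ⟨x, d, hxd⟩ := hc
  let : Algebra ℂ Γ(X, V') := sectionsAlgebra s V'
  let : Algebra ℂ Γ(X, V) := sectionsAlgebra s V
  have : Algebra.Smooth ℂ Γ(X, V') := smooth_sectionsAlgebra hV'
  let φ : Γ(X, V') →ₐ[ℂ] Γ(X, V) :=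
    { toRingHom := (X.presheaf.map (homOfLE h).op).hom
      commutes' := fun z => sectionsAlgebra_map s h z }
  obtain ⟨F, -⟩ := (Coords.ofBasis x d hxd).exists_related_of_etale φ (etale_map hV hV' h)
  exact ⟨F.x, F.basis, fun i j => by rw [F.basis_apply, F.dual]⟩

variable {ℱ : X.Modules} {t : LineBundleTrivialization ℱ}

theorem Chart.exists_related [AlgebraicGeometry.Smooth s] {c c' : Chart s n t} (h : c ≤ c') :
    ∃ F : Coords c.R n, Coords.Related (Chart.res h) c'.coords F := by
  have : Algebra.Smooth ℂ c'.R := smooth_sectionsAlgebra c'.affine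
  exact c'.coords.exists_related_of_etale (Chart.res h) (etale_map c.affine c'.affine h)

theorem Chart.exists_eq_algebraMap [AlgebraicGeometry.Smooth s] [IsIntegral X] (c : Chart s n t)
    {f : c.R} (hf : ∀ i, c.coords.d i f = 0) : ∃ z : ℂ, f = algebraMap ℂ c.R z := by
  have : Algebra.Smooth ℂ c.R := smooth_sectionsAlgebra c.affine
  by_cases hc : Nonempty c.W
  · have : IsDomain c.R := IsIntegral.component_integral c.W
    exact c.coords.exists_eq_algebraMap hf
  · have hbot : c.W = ⊥ := by
      refine Opens.ext ?_
      rw [Opens.coe_bot, Set.eq_empty_iff_forall_notMem]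
      exact fun x hx => hc ⟨⟨x, hx⟩⟩
    have : Subsingleton c.R := by
      change Subsingleton Γ(X, c.W)
      rw [hbot]
      infer_instance
    exact ⟨0, Subsingleton.elim _ _⟩

/-- Irreducibility makes two nonempty opens meet. Any affine open in the intersection inherits the
trivialization and, by étale restriction, the coordinates, so it is again a chart. -/
theorem Chart.exists_le_le [AlgebraicGeometry.Smooth s] [IsIntegral X] (c c' : Chart s n t)
    (hc : Nontrivial c.R) (hc' : Nontrivial c'.R) : ∃ d : Chart s n t, d ≤ c ∧ d ≤ c' ∧
      Nontrivial d.R := by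
  have hne : ∀ c : Chart s n t, Nontrivial c.R → (c.W : Set X).Nonempty := by
    intro c hc
    by_contra hne
    have hbot : c.W = ⊥ := by
      refine Opens.ext ?_
      rw [Opens.coe_bot]
      exact Set.not_nonempty_iff_eq_empty.mp hne
    have : Subsingleton Γ(X, c.W) := by
      rw [hbot]
      infer_instance
    exact not_subsingleton c.R this
  obtain ⟨x, hx, hx'⟩ := nonempty_preirreducible_inter c.W.2 c'.W.2 (hne c hc) (hne c' hc')
  obtain ⟨W, hW, hxW, hle⟩ := exists_isAffineOpen_mem_and_subset (U := c.W ⊓ c'.W) ⟨hx, hx'⟩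
  have h1 : W ≤ c.W := fun y hy => (hle hy).1
  have h2 : W ≤ c'.W := fun y hy => (hle hy).2
  refine ⟨⟨c.i, W, hW, h1.trans c.le, c.coord.of_le hW c.affine h1⟩, h1, h2, ?_⟩
  have : Nonempty W := ⟨⟨x, hxW⟩⟩
  have : IsDomain Γ(X, W) := IsIntegral.component_integral W
  exact (inferInstance : Nontrivial Γ(X, W))

end Geometry
end

noncomputable section

/-! ## Restriction of duality frames -/

theorem IsBaseChangeAlong.exists_lift {A' A : Type} [CommRing A'] [Algebra ℂ A'] [CommRing A]
    [Algebra ℂ A] {φ : A' →ₐ[ℂ] A} {M' M Q : Type} [AddCommGroup M'] [Module A' M'] [AddCommGroup M]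
    [Module A M] [AddCommGroup Q] [Module A Q] {r : M' →+ M}
    {hr : ∀ (a : A') (m : M'), r (a • m) = φ a • r m} (h : IsBaseChangeAlong φ r hr) (ψ : M' →+ Q)
    (hψ : ∀ (a : A') (m : M'), ψ (a • m) = φ a • ψ m) :
    ∃ g : M →ₗ[A] Q, ∀ m, g (r m) = ψ m := by
  let : Algebra A' A := φ.toRingHom.toAlgebra
  let : Module A' M := Module.compHom M φ.toRingHom
  let : Module A' Q := Module.compHom Q φ.toRingHom
  have : IsScalarTower A' A M := ⟨fun a c m => mul_smul (φ a) c m⟩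
  have : IsScalarTower A' A Q := ⟨fun a c m => mul_smul (φ a) c m⟩
  have h' : IsBaseChange A
    ({ toFun := r, map_add' := r.map_add, map_smul' := hr } : M' →ₗ[A'] M) := h
  let ψ' : M' →ₗ[A'] Q := { toFun := ψ, map_add' := ψ.map_add, map_smul' := hψ }
  exact ⟨h'.lift ψ', fun m => h'.lift_eq ψ' m⟩

theorem seqIdeal_map {D D' : Type} [Ring D] [Ring D'] (σ : D' →+* D) {P' : ℕ → D'} {P : ℕ → D}
    (h : ∀ i, P i = σ (P' i)) {k : ℕ} {Q : D'} (hQ : Q ∈ seqIdeal P' k) : σ Q ∈ seqIdeal P k := by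
  let J : Submodule D' D' :=
    { carrier := {Q | σ Q ∈ seqIdeal P k}
      add_mem' := fun {x y} hx hy => by
        change σ (x + y) ∈ seqIdeal P k
        rw [map_add]
        exact Submodule.add_mem _ hx hy
      zero_mem' := by
        change σ 0 ∈ seqIdeal P k
        rw [map_zero]
        exact Submodule.zero_mem _
      smul_mem' := fun c x hx => by
        change σ (c * x) ∈ seqIdeal P k
        rw [map_mul]
        exact Submodule.smul_mem _ _ hx }
  have : seqIdeal P' k ≤ J := seqIdeal_le fun i hi => by
    change σ (P' i) ∈ seqIdeal P k
    rw [← h]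
    exact mem_seqIdeal_of_lt P hi
  exact this hQ

section

variable {A' A : Type} [CommRing A'] [Algebra ℂ A'] [CommRing A] [Algebra ℂ A] {φ : A' →ₐ[ℂ] A}
  {n : ℕ} {F' : Coords A' (n + 1)} {F : Coords A (n + 1)} (h : Coords.Related φ F' F)
include h

/-- The inverse image of a cyclic module with Euler relations is cyclic with the restricted
relations. To see that there are no further relations, construct a map from the inverse image back
to the quotient 𝒟/I. -/
theorem RegularSeq.IsGen.restrict {a : ℂ} {nzd' : ∀ b, F'.x 0 * b = 0 → b = 0}
    (nzd : ∀ b, F.x 0 * b = 0 → b = 0) {M' M : Type} [AddCommGroup M'] [Module A' M']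
    [Module (DiffOp A') M'] [DCompatible A' M'] [AddCommGroup M] [Module A M] [Module (DiffOp A) M]
    [DCompatible A M] {r : M' →+ M} (hr : IsDPullback φ r) {u : M'}
    (hu : (F'.eulerSeq a nzd').IsGen u) : (F.eulerSeq a nzd).IsGen (r u) := by
  set I := seqIdeal (F.eulerSeq a nzd).P (n + 1) with hI
  have hP : ∀ i, (F.eulerSeq a nzd).P i = h.map ((F'.eulerSeq a nzd').P i) := fun i =>
    h.map_eulerP a i
  have hsemi : ∀ (P : DiffOp A') (m : M'), r (P • m) = h.map P • r m := h.map_smul hr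
  have hkill : I ≤ LinearMap.ker (LinearMap.toSpanSingleton (DiffOp A) M (r u)) := by
    refine seqIdeal_le fun i hi => ?_
    rw [LinearMap.mem_ker, LinearMap.toSpanSingleton_apply, hP, ← hsemi,
      (hu.ann _).mpr (mem_seqIdeal_of_lt _ hi), map_zero]
  refine ⟨fun m => ?_, fun Q => ⟨fun hQ => ?_, fun hQ => hkill hQ⟩⟩
  · have hm : m ∈ Submodule.span A (Set.range r) := hr.baseChange.span ▸ Submodule.mem_top
    induction hm using Submodule.span_induction with
    | mem m hm =>
      obtain ⟨m', rfl⟩ := hm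
      obtain ⟨Q, rfl⟩ := hu.gen m'
      exact ⟨h.map Q, (hsemi Q u).symm⟩
    | zero => exact ⟨0, zero_smul _ _⟩
    | add x y _ _ hx hy =>
      obtain ⟨P, rfl⟩ := hx
      obtain ⟨Q, rfl⟩ := hy
      exact ⟨P + Q, add_smul _ _ _⟩
    | smul c x _ hx =>
      obtain ⟨P, rfl⟩ := hx
      exact ⟨DiffOp.ofFun c * P, by rw [mul_smul, DCompatible.ofFun_smul]⟩
  · let : Module A (DiffOp A ⧸ I) := Module.compHom _ (DiffOp.ofFun (A := A)).toRingHom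
    have hA : ∀ (c : A) (x : DiffOp A ⧸ I), DiffOp.ofFun c • x = c • x := fun _ _ => rfl
    choose q hq using hu.gen
    have hqq : ∀ {P P' : DiffOp A'}, P • u = P' • u →
        (Submodule.Quotient.mk (h.map P) : DiffOp A ⧸ I) = Submodule.Quotient.mk (h.map P') := by
      intro P P' e
      rw [Submodule.Quotient.eq, ← map_sub]
      refine seqIdeal_map h.map hP ((hu.ann _).mp ?_)
      rw [sub_smul, e, sub_self]
    -- Sending Pu to the class of the restricted operator is well defined on the larger chart; base
    -- change then extends it linearly over functions.
    let ψ : M' →+ (DiffOp A ⧸ I) := AddMonoidHom.mk'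
      (fun m => Submodule.Quotient.mk (h.map (q m))) (fun m m' => by
        rw [← Submodule.Quotient.mk_add, ← map_add]
        exact hqq (by rw [hq, add_smul, hq, hq]))
    have hψ : ∀ P : DiffOp A', ψ (P • u) = Submodule.Quotient.mk (h.map P) := fun P => hqq (hq _)
    obtain ⟨g, hg⟩ := hr.baseChange.exists_lift ψ (fun c m => by
      obtain ⟨P, rfl⟩ := hu.gen m
      rw [← DCompatible.ofFun_smul, ← mul_smul, hψ, hψ, map_mul, Coords.Related.map_ofFun]
      rfl)
    -- The auxiliary `P'` absorbs coordinate fields of `P`, which are restrictions of fields on the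
    -- larger chart. With `P' = 1` this reads off the class of `P` from its action on the generator.
    have key : ∀ (P : DiffOp A) (P' : DiffOp A'), g (P • r (P' • u)) =
        Submodule.Quotient.mk (P * h.map P') := by
      intro P
      induction P using F.op_induction with
      | hf c =>
        intro P'
        rw [DCompatible.ofFun_smul, map_smul, hg, hψ]
        rfl
      | ha P Q hP hQ =>
        intro P'
        rw [add_smul, map_add, hP, hQ, add_mul]
        rfl
      | hm P i hP =>
        intro P'
        rw [mul_smul, ← h.map_d i, ← hsemi, ← mul_smul, hP, map_mul, mul_assoc]
    have h1 := key Q 1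
    rw [one_smul, hQ, map_zero, map_one, mul_one] at h1
    exact (Submodule.Quotient.mk_eq_zero I).mp h1.symm

/-- The restriction of a frame. -/
theorem DualityFrame.exists_related (nzd : ∀ b, F.x 0 * b = 0 → b = 0) {M' M N' N : Type}
    [AddCommGroup M'] [Module A' M'] [Module (DiffOp A') M'] [DCompatible A' M']
    [AddCommGroup M] [Module A M] [Module (DiffOp A) M] [DCompatible A M]
    [AddCommGroup N'] [Module A' N'] [Module (DiffOp A') N'] [DCompatible A' N']
    [AddCommGroup N] [Module A N] [Module (DiffOp A) N] [DCompatible A N]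
    {r : M' →+ M} (hr : IsDPullback φ r) {r' : N' →+ N} (hr' : IsDPullback φ r')
    (G : DualityFrame A' n M' N') (hF : G.F = F') :
    ∃ G₁ : DualityFrame A n M N, DualityFrame.Related φ r r' G G₁ := by
  subst hF
  exact ⟨⟨F, G.a, nzd, r G.u, r' G.v, G.hu.restrict h nzd hr, G.hv.restrict h nzd hr'⟩,
    ⟨h, rfl, rfl, rfl⟩⟩

end
end

noncomputable section

/-! ## Generators of graded modules -/

theorem RegularSeq.isGen_of_injective {D : Type} [Ring D] {N : ℕ} {S : RegularSeq D N} {M : Type}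
    [AddCommGroup M] [Module D M] {u : M} (hgen : ∀ m, ∃ Q : D, Q • u = m)
    (hP : ∀ i < N, S.P i • u = 0) (h : ∀ Q : D, Q • u = 0 → Q ∈ seqIdeal S.P N) : S.IsGen u := by
  refine ⟨hgen, fun Q => ⟨h Q, fun hQ => ?_⟩⟩
  have : seqIdeal S.P N ≤ LinearMap.ker (LinearMap.toSpanSingleton D M u) :=
    seqIdeal_le fun i hi => by
      rw [LinearMap.mem_ker, LinearMap.toSpanSingleton_apply, hP i hi]
  exact this hQ

theorem Coords.forall_eulerP_smul {A : Type} [CommRing A] [Algebra ℂ A] {n : ℕ}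
    (F : Coords A (n + 1)) {a : ℂ} {E : Type} [AddCommGroup E] [Module (DiffOp A) E] {e : E} :
    (∀ i < n + 1, F.eulerP a i • e = 0) ↔
      (∀ i : Fin n, DiffOp.ofVF (F.d i.succ) • e = 0) ∧
      DiffOp.ofFun (F.x 0) • DiffOp.ofVF (F.d 0) • e = algebraMap ℂ (DiffOp A) a • e := by
  have hself : F.eulerP a n • e = 0 ↔
      DiffOp.ofFun (F.x 0) • DiffOp.ofVF (F.d 0) • e = algebraMap ℂ (DiffOp A) a • e := by
    rw [eulerP_self, euler, sub_smul, mul_smul, sub_eq_zero]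
  rw [← hself]
  constructor
  · intro h
    refine ⟨fun i => ?_, h n (Nat.lt_succ_self n)⟩
    have := h i (Nat.lt_succ_of_lt i.2)
    rwa [F.eulerP_of_lt a i.2] at this
  · rintro ⟨h1, h2⟩ i hi
    rcases Nat.lt_succ_iff_lt_or_eq.mp hi with hi | rfl
    · rw [F.eulerP_of_lt a hi]
      exact h1 ⟨i, hi⟩
    · exact h2

section Ladders

variable {R : Type} [CommRing R] [Algebra ℂ R] {n : ℕ} (F : Coords R n)

/-- The operators `y^j` and `∂_y^{-j}`. -/
def ladderOp : ℤ → DiffOp R[X]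
  | Int.ofNat m => DiffOp.ofFun Polynomial.X ^ m
  | Int.negSucc m => DiffOp.ofVF (polyVF 0 1) ^ (m + 1)

theorem poly_x_zero : (F.poly 1).x 0 = Polynomial.X := by simp [Coords.poly]

theorem poly_d_zero : (F.poly 1).d 0 = polyVF 0 1 := by simp [Coords.poly]

theorem poly_d_succ (i : Fin n) : (F.poly 1).d i.succ = polyVF (F.d i) 0 := by simp [Coords.poly]

theorem poly_x_zero_nzd (b : R[X]) (h : (F.poly 1).x 0 * b = 0) : b = 0 := by
  rw [poly_x_zero] at h
  refine Polynomial.ext fun i => ?_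
  have h := congrArg (fun p => Polynomial.coeff p (i + 1)) h
  rwa [Polynomial.coeff_X_mul, Polynomial.coeff_zero] at h

section Span

variable {E : Type} [AddCommGroup E] [Module (DiffOp R[X]) E] {a : ℂ} {e : E}
  (h0 : DiffOp.ofFun (Polynomial.X : R[X]) • DiffOp.ofVF (polyVF (0 : VF R) 1) • e =
    algebraMap ℂ (DiffOp R[X]) a • e)

theorem dY_mul_y : DiffOp.ofVF (polyVF (0 : VF R) 1) * DiffOp.ofFun Polynomial.X =
    DiffOp.ofFun Polynomial.X * DiffOp.ofVF (polyVF (0 : VF R) 1) + 1 := by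
  rw [DiffOp.ofVF_mul_ofFun, polyVF_X, map_one]

include h0

theorem y_smul_dY_pow (m : ℕ) :
    DiffOp.ofFun (Polynomial.X : R[X]) • DiffOp.ofVF (polyVF (0 : VF R) 1) ^ (m + 1) • e =
      algebraMap ℂ (DiffOp R[X]) (a - m) • DiffOp.ofVF (polyVF (0 : VF R) 1) ^ m • e := by
  induction m with
  | zero => simpa using h0
  | succ m ih =>
    have e1 : DiffOp.ofFun (Polynomial.X : R[X]) * DiffOp.ofVF (polyVF (0 : VF R) 1) =
        DiffOp.ofVF (polyVF (0 : VF R) 1) * DiffOp.ofFun Polynomial.X - 1 := by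
      rw [dY_mul_y, add_sub_cancel_right]
    rw [pow_succ' _ (m + 1), mul_smul, ← mul_smul (DiffOp.ofFun (Polynomial.X : R[X])), e1, sub_smul,
      mul_smul, ih, ← mul_smul, ← Algebra.commutes, mul_smul, ← mul_smul _ (_ ^ m),
      ← pow_succ', one_smul]
    rw [Nat.cast_succ, ← sub_sub, map_sub _ _ (1 : ℂ), map_one, sub_smul, one_smul]

theorem dY_smul_y_pow (m : ℕ) :
    DiffOp.ofVF (polyVF (0 : VF R) 1) • DiffOp.ofFun (Polynomial.X : R[X]) ^ (m + 1) • e =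
      algebraMap ℂ (DiffOp R[X]) (a + m + 1) • DiffOp.ofFun (Polynomial.X : R[X]) ^ m • e := by
  induction m with
  | zero =>
    rw [zero_add, pow_one, pow_zero, one_smul, ← mul_smul, dY_mul_y, add_smul, mul_smul, h0,
      one_smul, Nat.cast_zero, add_zero, map_add, map_one, add_smul, one_smul]
  | succ m ih =>
    rw [pow_succ' _ (m + 1), mul_smul, ← mul_smul, dY_mul_y, add_smul, mul_smul, ih, ← mul_smul,
      ← Algebra.commutes, mul_smul, ← mul_smul _ (_ ^ m),
      ← pow_succ', one_smul]
    rw [Nat.cast_succ, ← add_assoc, map_add _ (a + (m : ℂ) + 1) (1 : ℂ), map_one, add_smul, one_smul]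

variable [Module R E] (hC : ∀ (r : R) (x : E), r • x = DiffOp.ofFun (Polynomial.C r) • x)
  (h1 : ∀ i, DiffOp.ofVF (polyVF (F.d i) 0) • e = 0)
include hC h1

/-- The module generated by `e` is spanned by `y^j e` and `∂_y^j e`. -/
theorem smul_mem_span_ladderOp (Q : DiffOp R[X]) :
    Q • e ∈ Submodule.span R (Set.range fun j => (ladderOp j : DiffOp R[X]) • e) := by
  set V := Submodule.span R (Set.range fun j => (ladderOp j : DiffOp R[X]) • e)
  have hz : ∀ j, (ladderOp j : DiffOp R[X]) • e ∈ V := fun j => Submodule.subset_span ⟨j, rfl⟩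
  have hℂ : ∀ (z : ℂ) x, x ∈ V → algebraMap ℂ (DiffOp R[X]) z • x ∈ V := by
    intro z x hx
    have : algebraMap ℂ (DiffOp R[X]) z • x = algebraMap ℂ R z • x := by
      rw [hC, ← AlgHom.commutes (DiffOp.ofFun (A := R[X]))]
      rfl
    rw [this]
    exact V.smul_mem _ hx
  have hY : ∀ x ∈ V, DiffOp.ofFun (Polynomial.X : R[X]) • x ∈ V := by
    intro x hx
    induction hx using Submodule.span_induction with
    | mem x hx =>
      obtain ⟨j, rfl⟩ := hx
      rcases j with m | m
      · have := hz (Int.ofNat (m + 1))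
        change DiffOp.ofFun (Polynomial.X : R[X]) • DiffOp.ofFun (Polynomial.X : R[X]) ^ m • e ∈ V
        rwa [← mul_smul, ← pow_succ']
      · change DiffOp.ofFun (Polynomial.X : R[X]) • DiffOp.ofVF (polyVF (0 : VF R) 1) ^ (m + 1) • e ∈ V
        rw [y_smul_dY_pow h0]
        refine hℂ _ _ ?_
        rcases m with - | m
        · have := hz 0
          change DiffOp.ofFun (Polynomial.X : R[X]) ^ 0 • e ∈ V at this
          rwa [pow_zero] at this ⊢
        · exact hz (Int.negSucc m)
    | zero => rw [smul_zero]; exact V.zero_mem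
    | add x y _ _ hx hy => rw [smul_add]; exact V.add_mem hx hy
    | smul r x _ hx =>
      rw [hC, ← mul_smul, ← map_mul, mul_comm, map_mul, mul_smul, ← hC]
      exact V.smul_mem _ hx
  have hD : ∀ x ∈ V, DiffOp.ofVF (polyVF (0 : VF R) 1) • x ∈ V := by
    intro x hx
    induction hx using Submodule.span_induction with
    | mem x hx =>
      obtain ⟨j, rfl⟩ := hx
      rcases j with m | m
      · change DiffOp.ofVF (polyVF (0 : VF R) 1) • DiffOp.ofFun (Polynomial.X : R[X]) ^ m • e ∈ V
        rcases m with - | m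
        · have := hz (Int.negSucc 0)
          change DiffOp.ofVF (polyVF (0 : VF R) 1) ^ (0 + 1) • e ∈ V at this
          rw [zero_add, pow_one] at this
          rwa [pow_zero, one_smul]
        · rw [dY_smul_y_pow h0]
          exact hℂ _ _ (hz (Int.ofNat m))
      · have := hz (Int.negSucc (m + 1))
        change DiffOp.ofVF (polyVF (0 : VF R) 1) • DiffOp.ofVF (polyVF (0 : VF R) 1) ^ (m + 1) • e ∈ V
        rwa [← mul_smul, ← pow_succ']
    | zero => rw [smul_zero]; exact V.zero_mem
    | add x y _ _ hx hy => rw [smul_add]; exact V.add_mem hx hy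
    | smul r x _ hx =>
      rw [hC, ← mul_smul, DiffOp.ofVF_mul_ofFun, polyVF_C, Derivation.coe_zero, Pi.zero_apply,
        map_zero, map_zero, add_zero, mul_smul, ← hC]
      exact V.smul_mem _ hx
  have hcomm : ∀ i j, Commute (DiffOp.ofVF (polyVF (F.d i) 0)) (ladderOp j : DiffOp R[X]) := by
    intro i j
    rcases j with m | m
    · refine Commute.pow_right ?_ m
      rw [Commute, SemiconjBy, DiffOp.ofVF_mul_ofFun, polyVF_X, map_zero, add_zero]
    · refine Commute.pow_right ?_ (m + 1)
      have := DiffOp.ofVF_commute (F.poly 1) i.succ 0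
      rwa [poly_d_zero, poly_d_succ] at this
  have hB : ∀ i, ∀ x ∈ V, DiffOp.ofVF (polyVF (F.d i) 0) • x ∈ V := by
    intro i x hx
    induction hx using Submodule.span_induction with
    | mem x hx =>
      obtain ⟨j, rfl⟩ := hx
      rw [← mul_smul, (hcomm i j).eq, mul_smul, h1, smul_zero]
      exact V.zero_mem
    | zero => rw [smul_zero]; exact V.zero_mem
    | add x y _ _ hx hy => rw [smul_add]; exact V.add_mem hx hy
    | smul r x hxV hx =>
      rw [hC, ← mul_smul, DiffOp.ofVF_mul_ofFun, polyVF_C, add_smul, mul_smul, ← hC, ← hC]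
      exact V.add_mem (V.smul_mem _ hx) (V.smul_mem _ hxV)
  have hfun : ∀ (p : R[X]), ∀ x ∈ V, DiffOp.ofFun p • x ∈ V := by
    intro p
    induction p using Polynomial.induction_on with
    | C r =>
      intro x hx
      rw [← hC]
      exact V.smul_mem _ hx
    | add p q hp hq =>
      intro x hx
      rw [map_add, add_smul]
      exact V.add_mem (hp x hx) (hq x hx)
    | monomial m r h =>
      intro x hx
      rw [pow_succ, ← mul_assoc, map_mul, mul_smul]
      exact h _ (hY x hx)
  have hall : ∀ Q : DiffOp R[X], ∀ x ∈ V, Q • x ∈ V := by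
    intro Q
    induction Q using (F.poly 1).op_induction with
    | hf p => exact hfun p
    | ha P Q hP hQ =>
      intro x hx
      rw [add_smul]
      exact V.add_mem (hP x hx) (hQ x hx)
    | hm P i hP =>
      intro x hx
      rw [mul_smul]
      refine hP _ ?_
      refine Fin.cases ?_ (fun i => ?_) i
      · rw [poly_d_zero]
        exact hD x hx
      · rw [poly_d_succ]
        exact hB i x hx
  refine hall Q e ?_
  have := hz 0
  change DiffOp.ofFun (Polynomial.X : R[X]) ^ 0 • e ∈ V at this
  rwa [pow_zero, one_smul] at this

end Span

/-- The generator of a module with an `R`-basis on which `y` and `∂_y` act as shift operators. -/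
theorem isGen_of_ladder {M : Type} [AddCommGroup M] [Module (DiffOp R[X]) M] [Module R M]
    (hC : ∀ (r : R) (x : M), r • x = DiffOp.ofFun (Polynomial.C r) • x) (B : Module.Basis ℤ R M)
    (p q : ℤ → ℂ)
    (hX : ∀ j, DiffOp.ofFun (Polynomial.X : R[X]) • B j = algebraMap ℂ (DiffOp R[X]) (p j) • B (j + 1))
    (hd : ∀ j, DiffOp.ofVF (polyVF (0 : VF R) 1) • B j = algebraMap ℂ (DiffOp R[X]) (q j) • B (j - 1))
    (hbase : ∀ i, DiffOp.ofVF (polyVF (F.d i) 0) • B 0 = 0)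
    (hp : ∀ j, 0 ≤ j → p j ≠ 0) (hq : ∀ j ≤ 0, q j ≠ 0) {a : ℂ} (ha : a = q 0 * p (-1)) :
    ((F.poly 1).eulerSeq a (poly_x_zero_nzd F)).IsGen (B 0) := by
  have hℂ : ∀ (z : ℂ) (Q : DiffOp R[X]) (x : M), Q • algebraMap ℂ (DiffOp R[X]) z • x =
      algebraMap ℂ (DiffOp R[X]) z • Q • x := fun z Q x => by
    rw [← mul_smul, ← Algebra.commutes, mul_smul]
  have hℂR : ∀ (z : ℂ) (x : M), algebraMap ℂ (DiffOp R[X]) z • x = algebraMap ℂ R z • x := by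
    intro z x
    rw [hC, ← AlgHom.commutes (DiffOp.ofFun (A := R[X]))]
    rfl
  -- Multiplication by y moves up from index 0 and ∂_y moves down, always with nonzero coefficients.
  -- Every basis element is therefore reached from `B 0`.
  have hop : ∀ j, ∃ z : ℂ, z ≠ 0 ∧
      (ladderOp j : DiffOp R[X]) • B 0 = algebraMap ℂ (DiffOp R[X]) z • B j := by
    rintro (m | m)
    · change ∃ z : ℂ, z ≠ 0 ∧ DiffOp.ofFun (Polynomial.X : R[X]) ^ m • B 0 = _
      induction m with
      | zero => exact ⟨1, one_ne_zero, by rw [pow_zero, one_smul, map_one, one_smul]; rfl⟩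
      | succ m ih =>
        obtain ⟨z, hz, e⟩ := ih
        refine ⟨z * p m, mul_ne_zero hz (hp m (by simp)), ?_⟩
        rw [pow_succ', mul_smul, e, hℂ, map_mul, mul_smul]
        exact congrArg _ (hX m)
    · change ∃ z : ℂ, z ≠ 0 ∧ DiffOp.ofVF (polyVF (0 : VF R) 1) ^ (m + 1) • B 0 = _
      induction m with
      | zero =>
        refine ⟨q 0, hq 0 le_rfl, ?_⟩
        rw [zero_add, pow_one, hd]
        rfl
      | succ m ih =>
        obtain ⟨z, hz, e⟩ := ih
        refine ⟨z * q (Int.negSucc m), mul_ne_zero hz (hq _ (Int.negSucc_lt_zero m).le), ?_⟩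
        rw [pow_succ', mul_smul, e, hℂ, map_mul, mul_smul]
        exact congrArg _ (hd _)
  choose z hz hzB using hop
  have hE : (∀ i : Fin n, DiffOp.ofVF ((F.poly 1).d i.succ) • B 0 = 0) ∧
      DiffOp.ofFun ((F.poly 1).x 0) • DiffOp.ofVF ((F.poly 1).d 0) • B 0 =
        algebraMap ℂ (DiffOp R[X]) a • B 0 := by
    refine ⟨fun i => by rw [poly_d_succ, hbase], ?_⟩
    rw [poly_x_zero, poly_d_zero, hd, hℂ, hX, ha, map_mul, mul_smul]
    rfl
  have hP := (F.poly 1).forall_eulerP_smul.mpr hE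
  refine RegularSeq.isGen_of_injective (fun m => ?_) hP fun Q hQ => ?_
  · have hm : m ∈ Submodule.span R (Set.range B) := B.span_eq ▸ Submodule.mem_top
    induction hm using Submodule.span_induction with
    | mem m hm =>
      obtain ⟨j, rfl⟩ := hm
      refine ⟨algebraMap ℂ (DiffOp R[X]) (z j)⁻¹ * ladderOp j, ?_⟩
      rw [mul_smul, hzB, ← mul_smul, ← map_mul, inv_mul_cancel₀ (hz j), map_one, one_smul]
    | zero => exact ⟨0, zero_smul _ _⟩
    | add x y _ _ hx hy =>
      obtain ⟨P, rfl⟩ := hx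
      obtain ⟨Q, rfl⟩ := hy
      exact ⟨P + Q, add_smul _ _ _⟩
    | smul r x _ hx =>
      obtain ⟨P, rfl⟩ := hx
      exact ⟨DiffOp.ofFun (Polynomial.C r) * P, by rw [mul_smul, hC]⟩
  -- There are no further relations: 𝒟/I is spanned over `R` by y^j and ∂_y^j applied to its
  -- generator, and these go to nonzero multiples of distinct basis elements.
  · set I := seqIdeal ((F.poly 1).eulerP a) (n + 1)
    change Q ∈ I
    let : Module R (DiffOp R[X] ⧸ I) :=
      Module.compHom _ ((DiffOp.ofFun (A := R[X])).toRingHom.comp Polynomial.C)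
    let e : DiffOp R[X] ⧸ I := Submodule.Quotient.mk 1
    have he : ∀ P : DiffOp R[X], P • e = Submodule.Quotient.mk P := fun P => by
      rw [← Submodule.Quotient.mk_smul, smul_eq_mul, mul_one]
    have hPe := (F.poly 1).forall_eulerP_smul.mp (fun i hi => by
      rw [he]
      exact (Submodule.Quotient.mk_eq_zero I).mpr (mem_seqIdeal_of_lt ((F.poly 1).eulerP a) hi) :
        ∀ i < n + 1, (F.poly 1).eulerP a i • e = 0)
    rw [poly_x_zero, poly_d_zero] at hPe
    have hspan := smul_mem_span_ladderOp F hPe.2 (fun _ _ => rfl)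
      (fun i => by rw [← poly_d_succ]; exact hPe.1 i) Q
    obtain ⟨c, hc⟩ := Finsupp.mem_span_range_iff_exists_finsupp.mp hspan
    have hkill : I ≤ LinearMap.ker (LinearMap.toSpanSingleton (DiffOp R[X]) M (B 0)) :=
      seqIdeal_le fun i hi => by
        rw [LinearMap.mem_ker, LinearMap.toSpanSingleton_apply, hP i hi]
    let lam : (DiffOp R[X] ⧸ I) →ₗ[DiffOp R[X]] M := Submodule.liftQ I _ hkill
    have hlam : ∀ P : DiffOp R[X], lam (P • e) = P • B 0 := fun P => by
      rw [he]
      rfl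
    have h2 : ∑ j ∈ c.support, (c j * algebraMap ℂ R (z j)) • B j = 0 := by
      rw [← hQ, ← hlam, ← hc, Finsupp.sum, map_sum]
      refine Finset.sum_congr rfl fun j _ => ?_
      change _ = lam (DiffOp.ofFun (Polynomial.C (c j)) • (ladderOp j : DiffOp R[X]) • e)
      rw [map_smul, hlam, hzB, hℂR, ← hC, mul_smul]
    have h3 : ∀ j, c j = 0 := by
      intro j
      by_contra hj
      have := linearIndependent_iff'.mp B.linearIndependent c.support _ h2 j
        (Finsupp.mem_support_iff.mpr hj)
      refine hj ?_
      have h4 := congrArg (fun y => y * algebraMap ℂ R (z j)⁻¹) this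
      simpa [mul_assoc, ← map_mul, mul_inv_cancel₀ (hz j)] using h4
    have h5 : c = 0 := Finsupp.ext h3
    rw [h5, Finsupp.sum_zero_index, he] at hc
    exact (Submodule.Quotient.mk_eq_zero I).mp hc.symm

end Ladders

/-- The endomorphisms of a graded module with constant functions `ℂ` are scalars. -/
theorem exists_scalar_of_graded {A : Type} [CommRing A] [Algebra ℂ A] {R : Type} [CommRing R]
    [Algebra ℂ R] {n : ℕ} (F : Coords R n) (hconst : ∀ r, (∀ i, F.d i r = 0) → ∃ z, r = algebraMap ℂ R z)
    {N : Type} [AddCommGroup N] [Module (DiffOp A) N] [Module R N] (B : Module.Basis ℤ R N)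
    (hℂ : ∀ (z : ℂ) (x : N), algebraMap ℂ (DiffOp A) z • x = algebraMap ℂ R z • x)
    (ε : DiffOp A) (δ : Fin n → DiffOp A) (lam : ℤ → ℂ) (hlam : Function.Injective lam)
    (hε : ∀ j (r : R), ε • r • B j = algebraMap ℂ R (lam j) • r • B j)
    (hδ : ∀ i j (r : R), δ i • r • B j = F.d i r • B j)
    {j₀ : ℤ} (hgen : ∀ x : N, ∃ Q : DiffOp A, Q • B j₀ = x) (f : N →ₗ[DiffOp A] N) :
    ∃ z : ℂ, ∀ x, f x = algebraMap ℂ (DiffOp A) z • x := by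
  have hsum : ∀ x : N, x = ∑ j ∈ (B.repr x).support, B.repr x j • B j := fun x =>
    (B.linearCombination_repr x).symm
  have hreprε : ∀ x j, B.repr (ε • x) j = algebraMap ℂ R (lam j) * B.repr x j := by
    intro x j
    conv_lhs => rw [hsum x, Finset.smul_sum, Finset.sum_congr rfl fun i _ => hε i _]
    simp only [map_sum, map_smul, Module.Basis.repr_self, Finsupp.coe_finsetSum, Finset.sum_apply,
      Finsupp.coe_smul, Pi.smul_apply, Finsupp.single_apply, smul_eq_mul, mul_ite, mul_one, mul_zero]
    rw [Finset.sum_ite_eq' (B.repr x).support j]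
    split
    · rfl
    · next h => rw [Finsupp.notMem_support_iff.mp h, mul_zero]
  have hreprδ : ∀ i x j, B.repr (δ i • x) j = F.d i (B.repr x j) := by
    intro i x j
    conv_lhs => rw [hsum x, Finset.smul_sum, Finset.sum_congr rfl fun l _ => hδ i l _]
    simp only [map_sum, map_smul, Module.Basis.repr_self, Finsupp.coe_finsetSum, Finset.sum_apply,
      Finsupp.coe_smul, Pi.smul_apply, Finsupp.single_apply, smul_eq_mul, mul_ite, mul_one, mul_zero]
    rw [Finset.sum_ite_eq' (B.repr x).support j]
    split
    · rfl
    · next h => rw [Finsupp.notMem_support_iff.mp h, map_zero]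
  -- An endomorphism preserves eigenvectors of the Euler operator `ε`, whose eigenvalues at
  -- different indices differ. So the image of `B j₀` is a function times `B j₀`.
  have h1 : ∀ j, j ≠ j₀ → B.repr (f (B j₀)) j = 0 := by
    intro j hj
    have e := hε j₀ 1
    rw [one_smul] at e
    have e2 : ε • f (B j₀) = algebraMap ℂ (DiffOp A) (lam j₀) • f (B j₀) := by
      rw [← map_smul, e, ← hℂ, map_smul]
    have e3 := congrArg (fun y => B.repr y j) e2
    simp only [hreprε, hℂ, map_smul, Finsupp.coe_smul, Pi.smul_apply, smul_eq_mul] at e3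
    rw [← sub_eq_zero, ← sub_mul, ← map_sub] at e3
    have hne : lam j - lam j₀ ≠ 0 := sub_ne_zero.mpr fun h => hj (hlam h)
    have e4 := congrArg (algebraMap ℂ R (lam j - lam j₀)⁻¹ * ·) e3
    rwa [← mul_assoc, ← map_mul, inv_mul_cancel₀ hne, map_one, one_mul, mul_zero] at e4
  -- The base fields kill `B j₀`, hence also its image, so this function is killed by all base
  -- fields and is a constant.
  obtain ⟨z, hz⟩ := hconst (B.repr (f (B j₀)) j₀) fun i => by
    have e := hδ i j₀ 1
    rw [one_smul, Derivation.map_one_eq_zero, zero_smul] at e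
    rw [← hreprδ, ← map_smul, e, map_zero, map_zero, Finsupp.zero_apply]
  have h2 : f (B j₀) = algebraMap ℂ (DiffOp A) z • B j₀ := by
    refine B.repr.injective (Finsupp.ext fun j => ?_)
    rw [hℂ, map_smul, Module.Basis.repr_self, Finsupp.smul_single, smul_eq_mul, mul_one,
      Finsupp.single_apply]
    split
    · next h => rw [← h, hz]
    · next h => exact h1 j (Ne.symm h)
  refine ⟨z, fun x => ?_⟩
  obtain ⟨Q, rfl⟩ := hgen x
  rw [map_smul, h2, ← mul_smul, ← mul_smul, Algebra.commutes]
end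

noncomputable section

/-! ## Frames for the modules of the theorem -/

section Frames

variable {R : Type} [CommRing R] [Algebra ℂ R] {n : ℕ} (F : Coords R n)

theorem laurent_x_zero : (F.laurent 1).x 0 = LaurentPolynomial.T 1 := by simp [Coords.laurent]

theorem laurent_d_zero : (F.laurent 1).d 0 = laurentVF 0 1 := by simp [Coords.laurent]

theorem laurent_d_succ (i : Fin n) : (F.laurent 1).d i.succ = laurentVF (F.d i) 0 := by
  simp [Coords.laurent]

theorem laurent_x_zero_nzd (g : Rˣ) (b : R[T;T⁻¹]) (h : (F.laurent g).x 0 * b = 0) : b = 0 := by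
  have hu : (F.laurent g).x 0 = ((laurentUnit g * laurentT : (R[T;T⁻¹])ˣ) : R[T;T⁻¹]) := rfl
  rw [hu] at h
  exact (Units.mul_right_eq_zero _).mp h

theorem poly_unit_x_zero_nzd (g : Rˣ) (b : R[X]) (h : (F.poly g).x 0 * b = 0) : b = 0 := by
  have hu : (F.poly g).x 0 = ((polyUnit g : (R[X])ˣ) : R[X]) * Polynomial.X := rfl
  rw [hu, mul_assoc] at h
  exact poly_x_zero_nzd F b (by rw [poly_x_zero]; exact (Units.mul_right_eq_zero _).mp h)

variable (γ : ℂ)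

theorem star_form (θ : VF R[T;T⁻¹]) : (ConnData.star F γ 0).form θ =
    γ • (θ (LaurentPolynomial.T 1) * LaurentPolynomial.T (-1)) := by
  change γ • (θ (LaurentPolynomial.T 1) * LaurentPolynomial.T (-1)) + θ 0 = _
  rw [map_zero, add_zero]

theorem star_val_ofVF_smul (θ : VF R[T;T⁻¹]) (x : (ConnData.star F γ 0).Mod) :
    (ConnData.star F γ 0).val (DiffOp.ofVF θ • x) = θ ((ConnData.star F γ 0).val x) +
      γ • (θ (LaurentPolynomial.T 1) * LaurentPolynomial.T (-1)) * (ConnData.star F γ 0).val x := by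
  rw [← star_form F γ θ]
  exact (ConnData.star F γ 0).val_ofVF_smul (fun _ => rfl) x

theorem star_val_ofFun_smul (a : R[T;T⁻¹]) (x : (ConnData.star F γ 0).Mod) :
    (ConnData.star F γ 0).val (DiffOp.ofFun a • x) = a * (ConnData.star F γ 0).val x := by
  rw [DCompatible.ofFun_smul, ConnData.val_smul]
  rfl

theorem laurent_euler_val (r : R) (j : ℤ) : LaurentPolynomial.T 1 *
    (laurentVF 0 1 (LaurentPolynomial.C r * LaurentPolynomial.T j) +
      γ • (laurentVF (0 : VF R) 1 (LaurentPolynomial.T 1) * LaurentPolynomial.T (-1)) *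
        (LaurentPolynomial.C r * LaurentPolynomial.T j)) =
    LaurentPolynomial.C (algebraMap ℂ R (j + γ)) *
      (LaurentPolynomial.C r * LaurentPolynomial.T j) := by
  have hT : (LaurentPolynomial.T 1 : R[T;T⁻¹]) * LaurentPolynomial.T (-1) = 1 := laurentT.val_inv
  rw [laurentVF_C_mul_T, laurentVF_T]
  simp only [Derivation.coe_zero, Pi.zero_apply, map_zero, zero_mul, zero_add, one_mul,
    Algebra.smul_def, LaurentPolynomial.algebraMap_apply, map_add, sub_eq_add_neg,
    LaurentPolynomial.T_add]
  linear_combination (LaurentPolynomial.C (algebraMap ℂ R j) + LaurentPolynomial.C (algebraMap ℂ R γ))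
    * LaurentPolynomial.C r * LaurentPolynomial.T j * hT

/-- On the punctured bundle T is invertible, so modulo the relations ∂_T is the function aT⁻¹ and
every operator is a function. A function that kills the generator is zero. -/
theorem isGen_star {a : ℂ} (ha : a = γ) :
    ((F.laurent 1).eulerSeq a (laurent_x_zero_nzd F 1)).IsGen
      ((ConnData.star F γ 0).val.symm 1) := by
  subst ha
  have hP : ∀ i < n + 1, (F.laurent 1).eulerP a i • (ConnData.star F a 0).val.symm 1 = 0 := by
    refine (F.laurent 1).forall_eulerP_smul.mpr ⟨fun i => ?_, ?_⟩
    · apply (ConnData.star F a 0).val.injective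
      rw [star_val_ofVF_smul, AddEquiv.apply_symm_apply, laurent_d_succ, laurentVF_T]
      simp
    · apply (ConnData.star F a 0).val.injective
      have := laurent_euler_val a (1 : R) 0
      rw [map_one, LaurentPolynomial.T_zero, mul_one, Int.cast_zero, zero_add] at this
      rw [star_val_ofFun_smul, star_val_ofVF_smul, AddEquiv.apply_symm_apply, laurent_x_zero,
        laurent_d_zero, this, ← AlgHom.commutes (DiffOp.ofFun (A := R[T;T⁻¹])),
        star_val_ofFun_smul, AddEquiv.apply_symm_apply]
      rfl
  have hval : ∀ b : R[T;T⁻¹], DiffOp.ofFun b • (ConnData.star F a 0).val.symm 1 =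
      (ConnData.star F a 0).val.symm b := fun b => by
    apply (ConnData.star F a 0).val.injective
    rw [star_val_ofFun_smul, AddEquiv.apply_symm_apply, mul_one, AddEquiv.apply_symm_apply]
  refine RegularSeq.isGen_of_injective (fun m => ⟨DiffOp.ofFun ((ConnData.star F a 0).val m), ?_⟩) hP
    fun Q hQ => ?_
  · rw [hval, AddEquiv.symm_apply_apply]
  · change Q ∈ seqIdeal ((F.laurent 1).eulerP a) (n + 1)
    obtain ⟨b, hb⟩ := (F.laurent 1).exists_sub_ofFun_mem
      (J := seqIdeal ((F.laurent 1).eulerP a) (n + 1)) (fun i => by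
        refine Fin.cases ?_ (fun i => ?_) i
        · refine ⟨LaurentPolynomial.T (-1) * algebraMap ℂ _ a, ?_⟩
          have h1 := mem_seqIdeal_of_lt ((F.laurent 1).eulerP a) (Nat.lt_succ_self n)
          have h2 := Submodule.smul_mem _ (DiffOp.ofFun (LaurentPolynomial.T (-1) : R[T;T⁻¹])) h1
          rw [Coords.eulerP_self, Coords.euler, laurent_x_zero, smul_eq_mul, mul_sub, ← mul_assoc,
            ← map_mul, show (LaurentPolynomial.T (-1) : R[T;T⁻¹]) * LaurentPolynomial.T 1 = 1 from
              laurentT.inv_val, map_one, one_mul,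
            ← AlgHom.commutes (DiffOp.ofFun (A := R[T;T⁻¹])), ← map_mul] at h2
          exact h2
        · refine ⟨0, ?_⟩
          have h1 := mem_seqIdeal_of_lt ((F.laurent 1).eulerP a) (Nat.lt_succ_of_lt i.2)
          rw [Coords.eulerP_of_lt _ _ i.2] at h1
          rw [map_zero, sub_zero]
          exact h1) Q
    have hkill : ∀ P ∈ seqIdeal ((F.laurent 1).eulerP a) (n + 1),
        P • (ConnData.star F a 0).val.symm 1 = 0 := by
      have : seqIdeal ((F.laurent 1).eulerP a) (n + 1) ≤ LinearMap.ker
          (LinearMap.toSpanSingleton (DiffOp R[T;T⁻¹]) _ ((ConnData.star F a 0).val.symm 1)) :=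
        seqIdeal_le fun i hi => by
          rw [LinearMap.mem_ker, LinearMap.toSpanSingleton_apply, hP i hi]
      exact fun P hP => this hP
    have h3 := hkill _ hb
    rw [sub_smul, hQ, hval, zero_sub, neg_eq_zero] at h3
    have h4 : b = 0 := (ConnData.star F a 0).val.symm.map_eq_zero_iff.mp h3
    rwa [h4, map_zero, sub_zero] at hb

theorem star_exists_scalar (hconst : ∀ r, (∀ i, F.d i r = 0) → ∃ z, r = algebraMap ℂ R z)
    (f : (ConnData.star F γ 0).Mod →ₗ[DiffOp R[T;T⁻¹]] (ConnData.star F γ 0).Mod) :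
    ∃ z : ℂ, ∀ x, f x = algebraMap ℂ (DiffOp R[T;T⁻¹]) z • x := by
  let : Module R (ConnData.star F γ 0).Mod := (inferInstance : Module R R[T;T⁻¹])
  let B : Module.Basis ℤ R (ConnData.star F γ 0).Mod := laurentBasis R
  have hB : ∀ (r : R) j, (ConnData.star F γ 0).val (r • B j) =
      LaurentPolynomial.C r * LaurentPolynomial.T j := fun r j =>
    LaurentPolynomial.smul_eq_C_mul r (LaurentPolynomial.T j)
  have hr : ∀ (r : R) x, (ConnData.star F γ 0).val (r • x) =
      LaurentPolynomial.C r * (ConnData.star F γ 0).val x := fun r x =>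
    LaurentPolynomial.smul_eq_C_mul r ((ConnData.star F γ 0).val x)
  refine exists_scalar_of_graded F hconst B (fun z x => ?_)
    (DiffOp.ofFun (LaurentPolynomial.T 1) * DiffOp.ofVF (laurentVF 0 1))
    (fun i => DiffOp.ofVF (laurentVF (F.d i) 0)) (fun j => j + γ)
    (fun i j h => Int.cast_injective (add_right_cancel h)) (fun j r => ?_) (fun i j r => ?_)
    (j₀ := 0) (fun x => ⟨DiffOp.ofFun ((ConnData.star F γ 0).val x), ?_⟩) f
  · apply (ConnData.star F γ 0).val.injective
    rw [hr, ← AlgHom.commutes (DiffOp.ofFun (A := R[T;T⁻¹])), star_val_ofFun_smul,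
      LaurentPolynomial.algebraMap_apply]
  · apply (ConnData.star F γ 0).val.injective
    rw [mul_smul, star_val_ofFun_smul, star_val_ofVF_smul, hr (algebraMap ℂ R _), hB,
      laurent_euler_val]
  · apply (ConnData.star F γ 0).val.injective
    rw [star_val_ofVF_smul, hB, hB, laurentVF_T, laurentVF_C_mul_T]
    simp
  · apply (ConnData.star F γ 0).val.injective
    rw [star_val_ofFun_smul]
    change _ * LaurentPolynomial.T 0 = _
    rw [LaurentPolynomial.T_zero, mul_one]

/-- Multiplication by y reaches all higher powers from T^{-m₀}. Lower powers are reached by ∂_y,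
with coefficients γ - m₀ - i, which `hγ` keeps nonzero. -/
theorem isGen_direct (m₀ : ℕ) (hγ : ∀ i : ℕ, γ - m₀ - i ≠ 0) {a : ℂ} (ha : a = γ - m₀) :
    ((F.poly 1).eulerSeq a (poly_x_zero_nzd F)).IsGen
      ((ConnData.direct F γ 0).val.symm (LaurentPolynomial.T (-m₀))) := by
  let : Module R (ConnData.direct F γ 0).Mod := (inferInstance : Module R R[T;T⁻¹])
  let B : Module.Basis ℤ R (ConnData.direct F γ 0).Mod :=
    (laurentBasis R).reindex (Equiv.addRight (m₀ : ℤ))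
  have hB : ∀ j, (ConnData.direct F γ 0).val (B j) = LaurentPolynomial.T (j - m₀) := fun j => by
    change (laurentBasis R).reindex (Equiv.addRight (m₀ : ℤ)) j = _
    rw [Module.Basis.reindex_apply, laurentBasis_apply]
    rfl
  have hfun : ∀ (b : R[X]) x, (ConnData.direct F γ 0).val (DiffOp.ofFun b • x) =
      toLaurentHom b * (ConnData.direct F γ 0).val x := fun b x => by
    rw [DCompatible.ofFun_smul, ConnData.val_smul]
    rfl
  have hvf : ∀ {η : VF R[X]} {θ : VF R[T;T⁻¹]}, VFRelated toLaurentHom η θ → ∀ x,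
      (ConnData.direct F γ 0).val (DiffOp.ofVF η • x) = θ ((ConnData.direct F γ 0).val x) +
        γ • (θ (LaurentPolynomial.T 1) * LaurentPolynomial.T (-1)) *
          (ConnData.direct F γ 0).val x := by
    intro η θ h x
    rw [← star_form F γ θ]
    exact (ConnData.direct F γ 0).val_ofVF_smul h x
  have hr : ∀ (r : R) x, (ConnData.direct F γ 0).val (r • x) =
      LaurentPolynomial.C r * (ConnData.direct F γ 0).val x := fun r x =>
    LaurentPolynomial.smul_eq_C_mul r ((ConnData.direct F γ 0).val x)
  have hz : ∀ (z : ℂ) x, (ConnData.direct F γ 0).val (algebraMap ℂ (DiffOp R[X]) z • x) =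
      LaurentPolynomial.C (algebraMap ℂ R z) * (ConnData.direct F γ 0).val x := fun z x => by
    rw [← AlgHom.commutes (DiffOp.ofFun (A := R[X])), hfun, AlgHom.commutes,
      LaurentPolynomial.algebraMap_apply]
  have hu : (ConnData.direct F γ 0).val.symm (LaurentPolynomial.T (-m₀)) = B 0 := by
    apply (ConnData.direct F γ 0).val.injective
    rw [AddEquiv.apply_symm_apply, hB, zero_sub]
  rw [hu]
  refine isGen_of_ladder F (fun r x => ?_) B (fun _ => 1) (fun j => j - m₀ + γ) (fun j => ?_)
    (fun j => ?_) (fun i => ?_) (fun _ _ => one_ne_zero) (fun j hj => ?_) (by rw [ha]; push_cast; ring)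
  · apply (ConnData.direct F γ 0).val.injective
    rw [hr, hfun, toLaurentHom_C]
  · apply (ConnData.direct F γ 0).val.injective
    rw [hfun, toLaurentHom_X, hB, map_one, one_smul, hB, ← LaurentPolynomial.T_add]
    congr 1
    ring
  · apply (ConnData.direct F γ 0).val.injective
    rw [hvf (θ := laurentVF 0 1) (vfRelated_poly (fun r => by simp) (by simp)), hz, hB, hB]
    have h1 := laurent_euler_val γ (1 : R) (j - m₀)
    rw [map_one, one_mul] at h1
    have h2 := congrArg (fun y => LaurentPolynomial.T (-1) * y) h1
    simp only [← mul_assoc] at h2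
    rw [show (LaurentPolynomial.T (-1) : R[T;T⁻¹]) * LaurentPolynomial.T 1 = 1 from
      laurentT.inv_val, one_mul] at h2
    rw [h2, mul_comm (LaurentPolynomial.T (-1)), mul_assoc, ← LaurentPolynomial.T_add]
    push_cast
    congr 2
    ring
  · apply (ConnData.direct F γ 0).val.injective
    rw [hvf (θ := laurentVF (F.d i) 0) (vfRelated_poly (fun r => by simp) (by simp)), hB,
      laurentVF_T, map_zero]
    have h1 := laurentVF_C_mul_T (F.d i) 0 (1 : R) (0 - m₀)
    rw [map_one, one_mul] at h1
    rw [h1]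
    simp
  · obtain ⟨i, hi⟩ := Int.eq_ofNat_of_zero_le (neg_nonneg.mpr hj)
    have := hγ i
    have hj' : j = -(i : ℤ) := by rw [← hi, neg_neg]
    rw [hj']
    push_cast
    intro h
    exact this (by linear_combination h)

variable (β : ℂ)

theorem Ladder.algebraMap_smul_elt (z : ℂ) (j : ℤ) (r : R) :
    algebraMap ℂ (DiffOp R[X]) z • Ladder.elt F β j r = Ladder.elt F β j (algebraMap ℂ R z * r) := by
  rw [← AlgHom.commutes (DiffOp.ofFun (A := R[X])), DCompatible.ofFun_smul]
  exact Ladder.C_smul_elt F β j _ r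

/-- Here ∂_y always moves e_j to -e_{j+1}, while y lowers the index with coefficients -β - m₀ - i
when started from e_{1-m₀}. The basis is reindexed backwards, so that y raises the index as in
`isGen_of_ladder`. -/
theorem isGen_ladder (m₀ : ℕ) (hβ : ∀ i : ℕ, -β - m₀ - i ≠ 0) {a : ℂ} (ha : a = β + m₀ - 1) :
    ((F.poly 1).eulerSeq a (poly_x_zero_nzd F)).IsGen (Ladder.elt F β (1 - m₀) 1) := by
  let B : Module.Basis ℤ R (Ladder F β) :=
    (Ladder.basis F β).reindex (Equiv.subLeft (1 - m₀ : ℤ))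
  have hB : ∀ j, B j = Ladder.elt F β (1 - m₀ - j) 1 := fun j => by
    have hs : (Equiv.subLeft (1 - m₀ : ℤ)).symm j = 1 - m₀ - j :=
      (Equiv.symm_apply_eq _).mpr (sub_sub_cancel _ _).symm
    rw [Module.Basis.reindex_apply, Ladder.basis_apply, hs]
  have hu : Ladder.elt F β (1 - m₀) 1 = B 0 := by rw [hB, sub_zero]
  rw [hu]
  refine isGen_of_ladder F (fun r x => ?_) B (fun j => -β - m₀ - j) (fun _ => -1) (fun j => ?_)
    (fun j => ?_) (fun i => ?_) (fun j hj => ?_) (fun _ _ => neg_ne_zero.mpr one_ne_zero)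
    (by rw [ha]; push_cast; ring)
  · rw [DCompatible.ofFun_smul, Ladder.C_smul]
  · rw [DCompatible.ofFun_smul, hB, hB, Ladder.X_smul_elt, Ladder.algebraMap_smul_elt, mul_one,
      mul_one, sub_sub _ j 1]
    congr 2
    push_cast
    ring
  · rw [hB, hB, Ladder.ofVF_smul_elt_one, polyVF_X, one_smul, Ladder.algebraMap_smul_elt, mul_one,
      map_neg (algebraMap ℂ R), map_one (algebraMap ℂ R), map_neg, sub_sub_eq_add_sub,
      add_sub_right_comm]
  · rw [hB, Ladder.ofVF_smul_elt_one, polyVF_X, zero_smul, neg_zero]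
  · obtain ⟨i, rfl⟩ := Int.eq_ofNat_of_zero_le hj
    exact_mod_cast hβ i

/-- The Euler operator y∂_y acts on e_j with eigenvalue β - j, so the eigenvalues are distinct and
the grading argument applies. -/
theorem ladder_exists_scalar (m₀ : ℕ) (hβ : ∀ i : ℕ, -β - m₀ - i ≠ 0)
    (hconst : ∀ r, (∀ i, F.d i r = 0) → ∃ z, r = algebraMap ℂ R z)
    (f : Ladder F β →ₗ[DiffOp R[X]] Ladder F β) :
    ∃ z : ℂ, ∀ x, f x = algebraMap ℂ (DiffOp R[X]) z • x := by
  have hB : ∀ (r : R) j, r • Ladder.basis F β j = Ladder.elt F β j r := fun r j => by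
    rw [Ladder.basis_apply, ← Ladder.elt_eq_smul]
  refine exists_scalar_of_graded F hconst (Ladder.basis F β) (fun z x => ?_)
    (DiffOp.ofFun Polynomial.X * DiffOp.ofVF (polyVF 0 1))
    (fun i => DiffOp.ofVF (polyVF (F.d i) 0)) (fun j => β - j)
    (fun i j h => Int.cast_injective (sub_right_injective h)) (fun j r => ?_) (fun i j r => ?_)
    (j₀ := 1 - m₀) (fun x => ?_) f
  · rw [← AlgHom.commutes (DiffOp.ofFun (A := R[X])), DCompatible.ofFun_smul]
    exact Ladder.C_smul F β _ x
  · rw [hB, mul_smul, Ladder.ofVF_smul_elt, polyVF_X, one_smul, polyVF_C, Derivation.coe_zero,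
      Pi.zero_apply, map_zero, zero_smul, zero_sub, smul_neg, DCompatible.ofFun_smul,
      Ladder.X_smul_elt, add_sub_cancel_right, ← map_smul, smul_eq_mul, ← map_neg, ← neg_mul,
      ← map_neg]
    congr 3
    push_cast
    ring
  · rw [hB, hB, Ladder.ofVF_smul_elt, polyVF_X, zero_smul, sub_zero, polyVF_C, Ladder.C_smul_elt,
      mul_one]
  · rw [Ladder.basis_apply]
    exact (isGen_ladder F β m₀ hβ rfl).gen x

end Frames
end

/-! ### Holonomic duals of the models and the conclusion -/

noncomputable section

theorem DMod.Iso.isGen {I : Type} [Preorder I] {Y : Charted I} {M M' : DMod Y} (i : M.Iso M')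
    {c : I} {N : ℕ} {S : RegularSeq (DiffOp (Y.A c)) N} {u : M.M c} (hu : S.IsGen u) :
    S.IsGen (i.app c u) where
  gen x := by
    obtain ⟨Q, hQ⟩ := hu.gen ((i.app c).symm x)
    exact ⟨Q, by rw [← map_smul, hQ, LinearEquiv.apply_symm_apply]⟩
  ann Q := by
    rw [← map_smul, LinearEquiv.map_eq_zero_iff]
    exact hu.ann Q

/-- The direct image under an open embedding depends only on the isomorphism class. -/
theorem IsOpenDirectImage.of_iso {I : Type} [Preorder I] {Y Z : Charted I} {j : Y.Hom Z}
    {M M' : DMod Y} {N : DMod Z} (h : IsOpenDirectImage j M N) (i : M.Iso M') :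
    IsOpenDirectImage j M' N := by
  obtain ⟨e, h₁, h₂, h₃⟩ := h
  refine ⟨fun c => (e c).trans (i.app c).toAddEquiv, fun c a x => ?_, fun c η θ hθ x => ?_,
    fun {c c'} hc x => ?_⟩
  · change i.app c (e c (a • x)) = j.app c a • i.app c (e c x)
    rw [h₁, ← DCompatible.ofFun_smul, map_smul, DCompatible.ofFun_smul]
  · change i.app c (e c (_ • x)) = _ • i.app c (e c x)
    rw [h₂ c η θ hθ, map_smul]
  · change i.app c (e c (N.res hc x)) = M'.res hc (i.app c' (e c' x))
    rw [h₃, i.naturality]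

section

variable {X : Scheme.{0}} {s : X ⟶ Spec (.of ℂ)} {n : ℕ} {ℱ : X.Modules}
  {t : LineBundleTrivialization ℱ}

theorem Chart.nontrivial_of_tot {k : ℤ} {M : DMod (Tot s n t k)} {c : Chart s n t}
    (h : Nontrivial (M.M c)) : Nontrivial c.R := by
  by_contra hc
  have : Subsingleton c.R := not_nontrivial_iff_subsingleton.mp hc
  have : Subsingleton ((Tot s n t k).A c) := (inferInstance : Subsingleton c.R[X])
  exact not_subsingleton (M.M c) (Module.subsingleton ((Tot s n t k).A c) (M.M c))

theorem Chart.nontrivial_of_totStar {k : ℤ} {M : DMod (TotStar s n t k)} {c : Chart s n t}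
    (h : Nontrivial (M.M c)) : Nontrivial c.R := by
  by_contra hc
  have : Subsingleton c.R := not_nontrivial_iff_subsingleton.mp hc
  have : Subsingleton ((TotStar s n t k).A c) :=
    (LaurentPolynomial.C (R := c.R)).codomain_trivial
  exact not_subsingleton (M.M c) (Module.subsingleton ((TotStar s n t k).A c) (M.M c))

/-- The function 1 generates both modules, with exponents γ and -(γ+1), which is exactly the
relation that formal adjoints impose in a frame. -/
theorem isHolonomicDual_star [AlgebraicGeometry.Smooth s] [IsIntegral X] {k m m' : ℤ} {γ γ' : ℂ}
    (hm : (m : ℂ) = k * γ) (hm' : (m' : ℂ) = k * γ') (hγ : γ' = -(γ + 1))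
    {M : DMod (TotStar s n t k)} (i : (starMod s n t k hm).Iso M) :
    IsHolonomicDual (n + 1) M (starMod s n t k hm') := by
  refine isHolonomicDual_of_frames M (starMod s n t k hm')
    (fun c => ⟨c.coords.laurent 1, γ, laurent_x_zero_nzd c.coords 1,
      i.app c ((ConnData.star c.coords γ 0).val.symm 1),
      (ConnData.star c.coords γ' 0).val.symm 1,
      i.isGen (isGen_star c.coords γ rfl),
      isGen_star c.coords γ' hγ.symm⟩)
    (fun {c c'} h => ?_) (fun c f => ?_) (fun c c' hc hc' => ?_)
  · obtain ⟨F, hF⟩ := Chart.exists_related h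
    exact DualityFrame.exists_related (A' := (TotStar s n t k).A c') (A := (TotStar s n t k).A c)
      (φ := (TotStar s n t k).res h) (hF.laurent (Chart.trans h ^ k)) (laurent_x_zero_nzd F _)
      (M.isPullback h) ((starMod s n t k hm').isPullback h) _ rfl
  · exact star_exists_scalar c.coords γ' (fun r hr => c.exists_eq_algebraMap hr) f
  · obtain ⟨d, h, h', hd⟩ := Chart.exists_le_le c c' (Chart.nontrivial_of_totStar hc)
      (Chart.nontrivial_of_totStar hc')
    exact ⟨d, h, h', (inferInstance : Nontrivial d.R[T;T⁻¹])⟩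

/-- The generators T^{-m₀} and e_{1-m₀} have Euler eigenvalues a = -β - m₀ and β + m₀ - 1 = -(a+1),
so they form a duality frame over every chart. -/
theorem isHolonomicDual_direct [AlgebraicGeometry.Smooth s] [IsIntegral X] {k ℓ : ℤ} {β : ℂ}
    (hβ : (k : ℂ) * β = ℓ) (hm : (ℓ : ℂ) = ((-k : ℤ) : ℂ) * -β) :
    IsHolonomicDual (n + 1) (directMod s n t (-k) hm) (fourierMod s n t hβ) := by
  -- With m₀ > |β| no -β - m₀ - i can vanish, since otherwise |β| = m₀ + i. This one bound makes
  -- both generators work, whether or not β is an integer.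
  obtain ⟨m₀, hm₀⟩ := exists_nat_gt ‖β‖
  have hne : ∀ i : ℕ, -β - m₀ - i ≠ 0 := fun i h => by
    have hb : β = -((m₀ + i : ℕ) : ℂ) := by
      push_cast
      linear_combination -h
    rw [hb, norm_neg, Complex.norm_natCast] at hm₀
    exact absurd (Nat.cast_lt.mp hm₀) (by omega)
  refine isHolonomicDual_of_frames (directMod s n t (-k) hm) (fourierMod s n t hβ)
    (fun c => ⟨c.coords.poly 1, -β - m₀, poly_x_zero_nzd c.coords,
      (ConnData.direct c.coords (-β) 0).val.symm (LaurentPolynomial.T (-m₀)),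
      Ladder.elt c.coords β (1 - m₀) 1,
      isGen_direct c.coords (-β) m₀ hne rfl,
      isGen_ladder c.coords β m₀ hne (by ring)⟩)
    (fun {c c'} h => ?_) (fun c f => ?_) (fun c c' hc hc' => ?_)
  · obtain ⟨F, hF⟩ := Chart.exists_related h
    exact DualityFrame.exists_related (A' := (Tot s n t (-k)).A c') (A := (Tot s n t (-k)).A c)
      (φ := (Tot s n t (-k)).res h) (hF.poly (Chart.trans h ^ (-k))) (poly_unit_x_zero_nzd F _)
      ((directMod s n t (-k) hm).isPullback h) ((fourierMod s n t hβ).isPullback h) _ rfl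
  · exact ladder_exists_scalar c.coords β m₀ hne (fun r hr => c.exists_eq_algebraMap hr) f
  · obtain ⟨d, h, h', hd⟩ := Chart.exists_le_le c c' (Chart.nontrivial_of_tot hc)
      (Chart.nontrivial_of_tot hc')
    have := (Ladder.basis d.coords β).ne_zero 0
    exact ⟨d, h, h', ⟨_, _, this⟩⟩

end

end

theorem proposition3p6 {X : Scheme.{0}} (s : X ⟶ Spec (.of ℂ)) [IsIntegral X]
    [LocallyOfFiniteType s] [QuasiCompact s] (n : ℕ) [SmoothOfRelativeDimension n s]
    (ℱ : X.Modules) (t : LineBundleTrivialization ℱ) (k : ℤ) (β : ℂ) (ℓ : ℤ) (hβ : (k : ℂ) * β = ℓ) :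
    (∃ M : DMod (TotStar s n t k), IsOBeta k β ℓ M) ∧
    (∃ M' : DMod (TotStar s n t (-k)), IsOBeta (-k) (-β) ℓ M') ∧
    ∀ (M : DMod (TotStar s n t k)) (M' : DMod (TotStar s n t (-k))),
      IsOBeta k β ℓ M → IsOBeta (-k) (-β) ℓ M' →
      ∃ (P : DMod (Tot s n t k)) (N N' : DMod (Tot s n t (-k))),
        IsOpenDirectImage (jHom s n t k) M P ∧
        IsFourierLaplace k P N ∧
        IsOpenProperDirectImage (n + 1) (jHom s n t (-k)) M' N' ∧
        Nonempty (N.Iso N') := by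
  have : AlgebraicGeometry.Smooth s := SmoothOfRelativeDimension.smooth n s
  have hβ' : ((-k : ℤ) : ℂ) * -β = ℓ := by
    push_cast
    linear_combination hβ
  refine ⟨⟨_, isOBeta_starMod hβ⟩, ⟨_, isOBeta_starMod hβ'⟩, fun M M' hM hM' => ?_⟩
  obtain ⟨i⟩ := IsOBeta.exists_iso hβ hM
  obtain ⟨i'⟩ := IsOBeta.exists_iso hβ' hM'
  -- The ladder module serves as both sides, so the final isomorphism is the identity. The
  -- intermediate dual of 𝒪^{-β} is the model with exponent -β and transition exponent ℓ, since
  -- -(-(-β+1)+1) = -β.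
  exact ⟨_, _, fourierMod s n t hβ, (isOpenDirectImage_directMod s n t k _).of_iso i,
    isFourierLaplace_directMod hβ,
    ⟨_, _, isHolonomicDual_star _ hβ'.symm (by ring) i', isOpenDirectImage_directMod s n t (-k) _,
      isHolonomicDual_direct hβ hβ'.symm⟩,
    ⟨⟨fun c => LinearEquiv.refl _ _, fun _ _ => rfl⟩⟩⟩
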